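/- Let $E\to M$ be a smooth real vector bundle of finite rank over a smooth manifold (finite-dimensional, Hausdorff, second countable, without boundary). Write $\langle (X,\varepsilon),(e,\theta)\rangle=\varepsilon(e)+\theta(X)$ for the duality between $TM\oplus E^*$ and $E\oplus T^*M$. A \emph{linear generalised complex structure} on $E$ is a smooth vector bundle endomorphism $\mathcal J$ of $TE\oplus T^*E\to E$ over $\mathrm{id}_E$ that satisfies $\mathcal J^2=-1$, is orthogonal for the canonical symmetric pairing, has vanishing Nijenhuis tensor with respect to the Courant--Dorfman bracket $[\![(X,\theta),(Y,\omega)]\!]=([X,Y],\mathcal L_X\omega-\iota_Y\mathbf d\theta)$, and is a morphism of double vector bundles, i.e. is also a vector bundle morphism for the structure $TE\oplus T^*E\to TM\oplus E^*$, over some vector bundle morphism $j\colon TM\oplus E^*\to TM\oplus E^*$ (its side morphism). A \emph{Dorfman connection} is an $\mathbb R$-bilinear map $\Delta\colon\Gamma(TM\oplus E^*)\times\Gamma(E\oplus T^*M)\to\Gamma(E\oplus T^*M)$ with $\Delta_\nu(f\tau)=f\Delta_\nu\tau+\mathrm{pr}_{TM}(\nu)(f)\,\tau$, $\Delta_{f\nu}\tau=f\Delta_\nu\tau+\langle\nu,\tau\rangle(0,\mathbf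 df)$ and $\Delta_\nu(0,\mathbf df)=(0,\mathbf d(\mathrm{pr}_{TM}(\nu)(f)))$. Its dull bracket on $\Gamma(TM\oplus E^*)$ is given by $\langle[\![\nu_1,\nu_2]\!]_\Delta,\tau\rangle=\mathrm{pr}_{TM}(\nu_1)\langle\nu_2,\tau\rangle-\langle\nu_2,\Delta_{\nu_1}\tau\rangle$, and $\Delta$ is skew-symmetric if this bracket is. For $e\in\Gamma(E)$, $(e,\theta)^\uparrow$ denotes the section $e'\mapsto(\frac{d}{dt}|_{t=0}(e'+te),(Tq_E)^t\theta)$ of $TE\oplus T^*E\to E$, and the horizontal lift $\sigma^\Delta$ is given by $\sigma^\Delta(X,\varepsilon)(e(m))=(T_me\,X(m),\mathbf d\ell_\varepsilon(e(m)))-(\Delta_{(X,\varepsilon)}(e,0))^\uparrow(e(m))$, where $\ell_\varepsilon(e')=\langle\varepsilon,e'\rangle$. Given $j$, two skew-symmetric Dorfman connections $\Delta_1,\Delta_2$ are \emph{$j$-equivalent} if $\Psi_{12}$, defined by $[\![\nu_1,\nu_2]\!]_{\Delta_2}=[\![\nu_1,\nu_2]\!]_{\Delta_1}+(0,\Psi_{12}(\nu_1,\nu_2))$,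 satisfies $\Psi_{12}(\nu_1,\nu_2)=\Psi_{12}(j\nu_1,j\nu_2)$ for all $\nu_1,\nu_2$. \textbf{Theorem.} There is a bijection from the set of linear generalised complex structures $\mathcal J$ on $E$ to the set of pairs $(j,[\Delta])$ consisting of \begin{enumerate} \item a smooth vector bundle morphism $j\colon TM\oplus E^*\to TM\oplus E^*$ over $\mathrm{id}_M$ with $j^2=-\mathrm{id}$, and \item a $j$-equivalence class $[\Delta]$ of skew-symmetric Dorfman connections such that the bracket $\mathbb A(\nu_1,\nu_2)=\tfrac12\bigl([\![\nu_1,\nu_2]\!]_\Delta-[\![j\nu_1,j\nu_2]\!]_\Delta\bigr)$ (which depends only on the class) and the anchor $\rho(\nu)=\tfrac12\bigl(\mathrm{pr}_{TM}\nu\otimes1-\mathrm{pr}_{TM}(j\nu)\otimes i\bigr)\in T_{\mathbb C}M$ make $(TM\oplus E^*,j)$ a complex Lie algebroid: $\rho$ is a morphism of complex vector bundles, $\mathbb A$ is a $\mathbb C$-bilinear Lie bracket, and $\mathbb A(\nu_1,f\nu_2)=\rho(\nu_1)(f)\nu_2+f\mathbb A(\nu_1,\nu_2)$ for all $f\in C^\infty(M,\mathbb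 C)$, where $j$ is the multiplication by $i$. \end{enumerate} If $\mathcal J$ corresponds to $(j,[\Delta])$, then $j$ is the side morphism of $\mathcal J$, $\mathcal J(\tau^\uparrow)=(-j^t\tau)^\uparrow$ for all $\tau\in\Gamma(E\oplus T^*M)$, and a skew-symmetric Dorfman connection $\Delta'$ lies in $[\Delta]$ if and only if it is adapted to $\mathcal J$, i.e. $\mathcal J(\sigma^{\Delta'}(\nu))=\sigma^{\Delta'}(j\nu)$ for all $\nu\in\Gamma(TM\oplus E^*)$. -/

import Mathlib

open Bundle Manifold ContDiff

noncomputable section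

namespace LinGC

/-! ### Vector bundles, bundle morphisms and sections -/

section Bundles

variable {EM : Type*} [NormedAddCommGroup EM] [NormedSpace ℝ EM]
  {H : Type*} [TopologicalSpace H] (I : ModelWithCorners ℝ EM H)
  {M : Type*} [TopologicalSpace M] [ChartedSpace H M]
  (F : Type*) [NormedAddCommGroup F] [NormedSpace ℝ F]
  (V : M → Type*) [TopologicalSpace (TotalSpace F V)]
  [∀ x, AddCommGroup (V x)] [∀ x, Module ℝ (V x)] [∀ x, TopologicalSpace (V x)]
  [FiberBundle F V] [VectorBundle ℝ F V]

/-- A smooth vector bundle endomorphism of `V → M` over the identity of `M`. -/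
structure BundleEnd where
  /-- the linear maps in the fibres -/
  app : ∀ x, V x →ₗ[ℝ] V x
  /-- the induced map of total spaces is smooth -/
  contMDiff_app : ContMDiff (I.prod 𝓘(ℝ, F)) (I.prod 𝓘(ℝ, F)) ∞
    (fun v : TotalSpace F V => (⟨v.1, app v.1 v.2⟩ : TotalSpace F V))

variable {I F V}

/-- The action of a bundle endomorphism on smooth sections. -/
def BundleEnd.onSections (j : BundleEnd I F V) (s : Cₛ^∞⟮I; F, V⟯) : Cₛ^∞⟮I; F, V⟯ where
  toFun x := j.app x (s x)
  contMDiff_toFun := j.contMDiff_app.comp s.contMDiff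

/-- Multiplication of a smooth section by a smooth function. -/
def fsmul (f : C^∞⟮I, M; ℝ⟯) (s : Cₛ^∞⟮I; F, V⟯) : Cₛ^∞⟮I; F, V⟯ where
  toFun x := f x • s x
  contMDiff_toFun := f.contMDiff.smul_section s.contMDiff

/-- For a bundle endomorphism `j` (with `j ^ 2 = -1`), the product of the section `s` with the
complex-valued function `f`, where `j` is the multiplication by the imaginary unit. -/
def csmul (j : BundleEnd I F V) (f : C^∞⟮I, M; 𝓘(ℝ, ℂ), ℂ⟯) (s : Cₛ^∞⟮I; F, V⟯) :
    Cₛ^∞⟮I; F, V⟯ :=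
  fsmul ⟨fun x => (f x).re, Complex.reCLM.contMDiff.comp f.contMDiff⟩ s +
    fsmul ⟨fun x => (f x).im, Complex.imCLM.contMDiff.comp f.contMDiff⟩ (j.onSections s)

end Bundles

/-! ### Complex Lie algebroids -/

section ComplexLieAlgebroid

variable {EM : Type*} [NormedAddCommGroup EM] [NormedSpace ℝ EM]
  {H : Type*} [TopologicalSpace H] (I : ModelWithCorners ℝ EM H)
  {M : Type*} [TopologicalSpace M] [ChartedSpace H M] [IsManifold I ∞ M]

/-- The fibres of the complexified tangent bundle `T_ℂ M = TM ⊕ i TM`: the pair `(u, v)` stands for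
`u + i v`. -/
abbrev ComplexTangent (x : M) : Type _ := TangentSpace I x × TangentSpace I x

variable {I}

/-- The derivative `w(f)` of a complex-valued function in a complex tangent direction. -/
def complexDeriv (f : M → ℂ) (x : M) (w : ComplexTangent I x) : ℂ :=
  mvfderiv I f x w.1 + Complex.I * mvfderiv I f x w.2

variable {F : Type*} [NormedAddCommGroup F] [NormedSpace ℝ F]
  {V : M → Type*} [TopologicalSpace (TotalSpace F V)]
  [∀ x, AddCommGroup (V x)] [∀ x, Module ℝ (V x)] [∀ x, TopologicalSpace (V x)]
  [FiberBundle F V] [VectorBundle ℝ F V]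

/-- `(V, j)` with the anchor `ρ : V → T_ℂ M` and the bracket `br` on `Γ(V)` is a complex Lie
algebroid: `j` is a complex structure in the fibres, `ρ` is a morphism of complex vector bundles,
`br` is a `ℂ`-bilinear Lie bracket and `ρ` anchors `br`. -/
structure IsComplexLieAlgebroid (j : BundleEnd I F V) (ρ : ∀ x, V x →ₗ[ℝ] ComplexTangent I x)
    (br : Cₛ^∞⟮I; F, V⟯ → Cₛ^∞⟮I; F, V⟯ → Cₛ^∞⟮I; F, V⟯) : Prop where
  complex_structure : ∀ x (v : V x), j.app x (j.app x v) = -v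
  anchor_smooth : ContMDiff (I.prod 𝓘(ℝ, F)) (I.prod 𝓘(ℝ, EM × EM)) ∞
    (fun v : TotalSpace F V => (⟨v.1, ρ v.1 v.2⟩ : TotalSpace (EM × EM) (ComplexTangent I)))
  anchor_complex : ∀ x (v : V x), ρ x (j.app x v) = (-(ρ x v).2, (ρ x v).1)
  add_left : ∀ q₁ q₂ q₃, br (q₁ + q₂) q₃ = br q₁ q₃ + br q₂ q₃
  add_right : ∀ q₁ q₂ q₃, br q₁ (q₂ + q₃) = br q₁ q₂ + br q₁ q₃
  smul_left : ∀ (c : ℂ) (q₁ q₂),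
    br (csmul j (ContMDiffMap.const c) q₁) q₂ = csmul j (ContMDiffMap.const c) (br q₁ q₂)
  smul_right : ∀ (c : ℂ) (q₁ q₂),
    br q₁ (csmul j (ContMDiffMap.const c) q₂) = csmul j (ContMDiffMap.const c) (br q₁ q₂)
  alternating : ∀ q, br q q = 0
  jacobi : ∀ q₁ q₂ q₃, br q₁ (br q₂ q₃) + br q₂ (br q₃ q₁) + br q₃ (br q₁ q₂) = 0
  leibniz : ∀ (f : C^∞⟮I, M; 𝓘(ℝ, ℂ), ℂ⟯) (q₁ q₂) (x),
    br q₁ (csmul j f q₂) x =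
      (complexDeriv f x (ρ x (q₁ x))).re • q₂ x +
        (complexDeriv f x (ρ x (q₁ x))).im • j.app x (q₂ x) + csmul j f (br q₁ q₂) x

end ComplexLieAlgebroid

/-! ### The standard Courant algebroid and generalised complex structures -/

section Courant

variable {EN : Type*} [NormedAddCommGroup EN] [NormedSpace ℝ EN]
  {H : Type*} [TopologicalSpace H] (I : ModelWithCorners ℝ EN H)
  {N : Type*} [TopologicalSpace N] [ChartedSpace H N]

/-- The fibres of the generalised tangent bundle `TN ⊕ T*N`. -/
abbrev GenTangent (p : N) : Type _ := TangentSpace I p × (TangentSpace I p →L[ℝ] ℝ)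

variable {I}

/-- The symmetric pairing `⟨(v, θ), (w, ω)⟩ = θ(w) + ω(v)`. -/
def genPairing {p : N} (a b : GenTangent I p) : ℝ := a.2 b.1 + b.2 a.1

variable (I) in
/-- The one-form `η`, read in the preferred chart at `p`. -/
def oneFormInChart (η : ∀ q : N, TangentSpace I q →L[ℝ] ℝ) (p : N) (y : EN) : EN →L[ℝ] ℝ :=
  (η ((extChartAt I p).symm y)).comp
    (mfderivWithin 𝓘(ℝ, EN) I (extChartAt I p).symm (Set.range I) y)

variable (I) in
/-- The exterior derivative `dη(u, v)` at `p` of a one-form `η`, computed in the preferred chart at `p`,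
through which `T_p N` is the model space. -/
def extDerivOneForm (η : ∀ q : N, TangentSpace I q →L[ℝ] ℝ) (p : N) :
    TangentSpace I p →L[ℝ] TangentSpace I p →L[ℝ] ℝ :=
  letI D : EN →L[ℝ] EN →L[ℝ] ℝ :=
    fderivWithin ℝ (oneFormInChart I η p) (Set.range I) (extChartAt I p p)
  (D - D.flip : EN →L[ℝ] EN →L[ℝ] ℝ)

variable (I) in
/-- The Lie derivative `L_X η = d(η(X)) + ι_X dη` of a one-form. -/
def lieDerivOneForm (X : ∀ q : N, TangentSpace I q) (η : ∀ q : N, TangentSpace I q →L[ℝ] ℝ)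
    (p : N) : TangentSpace I p →L[ℝ] ℝ :=
  mvfderiv I (fun q => η q (X q)) p + extDerivOneForm I η p (X p)

variable (I) in
/-- The Courant-Dorfman bracket `⟦(X, θ), (Y, ω)⟧ = ([X, Y], L_X ω - ι_Y dθ)`. -/
def courantBracket (e₁ e₂ : ∀ q : N, GenTangent I q) (p : N) : GenTangent I p :=
  (VectorField.mlieBracket I (fun q => (e₁ q).1) (fun q => (e₂ q).1) p,
    lieDerivOneForm I (fun q => (e₁ q).1) (fun q => (e₂ q).2) p -
      extDerivOneForm I (fun q => (e₁ q).2) p (e₂ p).1)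

variable [IsManifold I ∞ N]

/-- A generalised complex structure on the manifold `N`: an orthogonal endomorphism of `TN ⊕ T*N`
with square `-1` and vanishing Nijenhuis tensor. -/
structure IsGeneralizedComplex (J : BundleEnd I (EN × (EN →L[ℝ] ℝ)) (GenTangent I (N := N))) :
    Prop where
  sq : ∀ p (a : GenTangent I p), J.app p (J.app p a) = -a
  orthogonal : ∀ p (a b : GenTangent I p), genPairing (J.app p a) (J.app p b) = genPairing a b
  nijenhuis : ∀ (e₁ e₂ : Cₛ^∞⟮I; EN × (EN →L[ℝ] ℝ), GenTangent I (N := N)⟯) (p : N),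
    courantBracket I e₁ e₂ p - courantBracket I (J.onSections e₁) (J.onSections e₂) p +
      J.app p (courantBracket I (J.onSections e₁) e₂ p + courantBracket I e₁ (J.onSections e₂) p)
      = 0

end Courant

/-! ### The double vector bundle `TE ⊕ T*E` -/

section DoubleVectorBundle

variable {EM : Type*} [NormedAddCommGroup EM] [NormedSpace ℝ EM]
  {H : Type*} [TopologicalSpace H] (I : ModelWithCorners ℝ EM H)
  {M : Type*} [TopologicalSpace M] [ChartedSpace H M] [IsManifold I ∞ M]
  (F : Type*) [NormedAddCommGroup F] [NormedSpace ℝ F]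
  (E : M → Type*) [TopologicalSpace (TotalSpace F E)]
  [∀ x, AddCommGroup (E x)] [∀ x, Module ℝ (E x)] [∀ x, TopologicalSpace (E x)]
  [FiberBundle F E] [VectorBundle ℝ F E] [ContMDiffVectorBundle ∞ F E I]

/-- The fibres of `TM ⊕ E*`. -/
abbrev Side (x : M) : Type _ := TangentSpace I x × (E x →L[ℝ] ℝ)

/-- The fibres of `E ⊕ T*M`. -/
abbrev Core (x : M) : Type _ := E x × (TangentSpace I x →L[ℝ] ℝ)

/-- Smooth sections of `TM ⊕ E*`. -/
abbrev SideSection : Type _ := Cₛ^∞⟮I; EM × (F →L[ℝ] ℝ), Side I E⟯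

/-- Smooth sections of `E ⊕ T*M`. -/
abbrev CoreSection : Type _ := Cₛ^∞⟮I; F × (EM →L[ℝ] ℝ), Core I E⟯

/-- Smooth endomorphisms of `TM ⊕ E*`. -/
abbrev SideEnd : Type _ := BundleEnd I (EM × (F →L[ℝ] ℝ)) (Side I E)

/-- The tangent space of the manifold `E` at `p`. -/
abbrev TE (p : TotalSpace F E) : Type _ := TangentSpace (I.prod 𝓘(ℝ, F)) p

/-- The fibres of `TE ⊕ T*E → E`. -/
abbrev GTE (p : TotalSpace F E) : Type _ := GenTangent (I.prod 𝓘(ℝ, F)) p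

/-- Smooth endomorphisms of `TE ⊕ T*E → E`. -/
abbrev GTEEnd : Type _ :=
  BundleEnd (I.prod 𝓘(ℝ, F)) ((EM × F) × (EM × F →L[ℝ] ℝ)) (GTE I F E)

variable {I F E}

/-- The duality between `TM ⊕ E*` and `E ⊕ T*M`. -/
def pairing {x : M} (ν : Side I E x) (τ : Core I E x) : ℝ := ν.2 τ.1 + τ.2 ν.1

variable (I) in
/-- The derivative of the bundle projection `q_E : E → M`. -/
def Tproj (p : TotalSpace F E) : TE I F E p →L[ℝ] TangentSpace I p.1 :=
  mfderiv (I.prod 𝓘(ℝ, F)) I (TotalSpace.proj : TotalSpace F E → M) p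

variable (I) in
/-- The vertical lift `d/dt|_{t = 0} (p + t e)` of `e ∈ E_x` to the point `p ∈ E_x`. -/
def vlift (p : TotalSpace F E) (e : E p.1) : TE I F E p :=
  mfderiv 𝓘(ℝ, ℝ) (I.prod 𝓘(ℝ, F)) (fun t : ℝ => (⟨p.1, p.2 + t • e⟩ : TotalSpace F E)) 0 (1 : ℝ)

/-- The side projection `Φ_E = Tq_E ⊕ r_E : TE ⊕ T*E → TM ⊕ E*` sends `a` to `ν`. The projection
`r_E : T*E → E*` restricts a covector to the vertical vectors. -/
def ProjectsTo {p : TotalSpace F E} (a : GTE I F E p) (ν : Side I E p.1) : Prop :=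
  Tproj I p a.1 = ν.1 ∧ ∀ e : E p.1, a.2 (vlift I p e) = ν.2 e

/-! The operations of the Whitney sum `E ×_M E`, whose tangent bundle is `TE ×_{TM} TE`. -/

variable (F E) in
/-- The total space of the Whitney sum `E ×_M E`. -/
abbrev Whitney : Type _ := TotalSpace (F × F) (fun x => E x × E x)

variable (F E) in
/-- The first projection `E ×_M E → E`. -/
def Whitney.fst (w : Whitney F E) : TotalSpace F E := ⟨w.1, w.2.1⟩

variable (F E) in
/-- The second projection `E ×_M E → E`. -/
def Whitney.snd (w : Whitney F E) : TotalSpace F E := ⟨w.1, w.2.2⟩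

variable (F E) in
/-- The addition `E ×_M E → E`. -/
def Whitney.add (w : Whitney F E) : TotalSpace F E := ⟨w.1, w.2.1 + w.2.2⟩

variable (F E) in
/-- The multiplication `E → E` by the real number `r` in the fibres. -/
def homothety (r : ℝ) (p : TotalSpace F E) : TotalSpace F E := ⟨p.1, r • p.2⟩

/-- `c` is the sum of `a` and `b` in the vector bundle `TE ⊕ T*E → TM ⊕ E*`. On `TE → TM` the
addition is the derivative of the addition of `E`; on `T*E → E*` the sum `c` of two covectors `a`,
`b` is defined by `c (T(+) u) = a (T pr₁ u) + b (T pr₂ u)` for all `u ∈ T(E ×_M E)`. -/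
def IsSideSum (w : Whitney F E) (a : GTE I F E (w.fst F E)) (b : GTE I F E (w.snd F E))
    (c : GTE I F E (w.add F E)) : Prop :=
  (∃ u : TangentSpace (I.prod 𝓘(ℝ, F × F)) w,
    mfderiv (I.prod 𝓘(ℝ, F × F)) (I.prod 𝓘(ℝ, F)) (Whitney.fst F E) w u = a.1 ∧
    mfderiv (I.prod 𝓘(ℝ, F × F)) (I.prod 𝓘(ℝ, F)) (Whitney.snd F E) w u = b.1 ∧
    mfderiv (I.prod 𝓘(ℝ, F × F)) (I.prod 𝓘(ℝ, F)) (Whitney.add F E) w u = c.1) ∧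
  ∀ u : TangentSpace (I.prod 𝓘(ℝ, F × F)) w,
    c.2 (mfderiv (I.prod 𝓘(ℝ, F × F)) (I.prod 𝓘(ℝ, F)) (Whitney.add F E) w u) =
      a.2 (mfderiv (I.prod 𝓘(ℝ, F × F)) (I.prod 𝓘(ℝ, F)) (Whitney.fst F E) w u) +
      b.2 (mfderiv (I.prod 𝓘(ℝ, F × F)) (I.prod 𝓘(ℝ, F)) (Whitney.snd F E) w u)

/-- `c` is the product of `r` and `a` in the vector bundle `TE ⊕ T*E → TM ⊕ E*`. On `TE → TM` the
multiplication is the derivative of that of `E`; the multiple `c` of a covector `a` is the covector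
with the same projection to `E*` and with `c (T(r·) v) = r a(v)` for all `v ∈ TE`. -/
def IsSideSMul (r : ℝ) (p : TotalSpace F E) (a : GTE I F E p) (c : GTE I F E (homothety F E r p)) :
    Prop :=
  mfderiv (I.prod 𝓘(ℝ, F)) (I.prod 𝓘(ℝ, F)) (homothety F E r) p a.1 = c.1 ∧
  (∀ v : TE I F E p,
    c.2 (mfderiv (I.prod 𝓘(ℝ, F)) (I.prod 𝓘(ℝ, F)) (homothety F E r) p v) = r * a.2 v) ∧
  ∀ e : E p.1, c.2 (vlift I (homothety F E r p) e) = a.2 (vlift I p e)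

/-- The endomorphism `J` of the vector bundle `TE ⊕ T*E → E` is a morphism of double vector bundles
over `j`, that is, it is also a morphism of vector bundles over `j` for the second vector bundle
structure `TE ⊕ T*E → TM ⊕ E*`. -/
structure IsDoubleMorphism (J : GTEEnd I F E) (j : SideEnd I F E) : Prop where
  covers : ∀ (p : TotalSpace F E) (a : GTE I F E p) (ν : Side I E p.1),
    ProjectsTo a ν → ProjectsTo (J.app p a) (j.app p.1 ν)
  add : ∀ (w : Whitney F E) (a : GTE I F E (w.fst F E)) (b : GTE I F E (w.snd F E))
    (c : GTE I F E (w.add F E)), IsSideSum w a b c →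
      IsSideSum w (J.app (w.fst F E) a) (J.app (w.snd F E) b) (J.app (w.add F E) c)
  smul : ∀ (r : ℝ) (p : TotalSpace F E) (a : GTE I F E p) (c : GTE I F E (homothety F E r p)),
    IsSideSMul r p a c → IsSideSMul r p (J.app p a) (J.app (homothety F E r p) c)

variable (I F E) in
/-- A linear generalised complex structure on the vector bundle `E`. -/
structure LinearGCS where
  /-- the endomorphism of `TE ⊕ T*E` -/
  J : GTEEnd I F E
  isGeneralizedComplex : IsGeneralizedComplex J
  isLinear : ∃ j : SideEnd I F E, IsDoubleMorphism J j

/-! ### Dorfman connections and dull brackets -/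

/-- The section `(e, 0)` of `E ⊕ T*M`. -/
def coreInl (e : Cₛ^∞⟮I; F, E⟯) : CoreSection I F E where
  toFun x := (e x, 0)
  contMDiff_toFun x := by
    have h1 := (contMDiffAt_section x).1 (e.contMDiff x)
    have h2 := (contMDiffAt_section (IB := I) (n := ∞) x).1
      (contMDiff_zeroSection (IB := I) (n := ∞) ℝ
        (fun x : M => TangentSpace I x →L[ℝ] ℝ) (F := EM →L[ℝ] ℝ) x)
    exact (contMDiffAt_section x).2 (h1.prodMk_space h2)

variable (F E) in
/-- The section `(0, df)` of `E ⊕ T*M`. -/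
def coreD (f : C^∞⟮I, M; ℝ⟯) : CoreSection I F E where
  toFun x := (0, mvfderiv I f x)
  contMDiff_toFun x := by
    have h1 := (contMDiffAt_section (IB := I) (n := ∞) x).1
      (contMDiff_zeroSection (IB := I) (n := ∞) ℝ E (F := F) x)
    have h2 : ContMDiffAt I (I.prod 𝓘(ℝ, EM →L[ℝ] ℝ)) ∞
        (fun y => (⟨y, mvfderiv I f y⟩ : TotalSpace (EM →L[ℝ] ℝ)
          (fun x : M => TangentSpace I x →L[ℝ] ℝ))) x := by
      rw [contMDiffAt_hom_bundle]
      refine ⟨contMDiffAt_id, ?_⟩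
      have := (f.contMDiff x).mfderiv_const (m := ∞) (by simp)
      refine this.congr_of_eventuallyEq (.of_forall fun y => ?_)
      ext v
      simp [inTangentCoordinates, ContinuousLinearMap.inCoordinates, mvfderiv]
      rfl
    exact (contMDiffAt_section x).2 (h1.prodMk_space ((contMDiffAt_section x).1 h2))

variable (I F E) in
/-- A Dorfman `TM ⊕ E*`-connection on `E ⊕ T*M`. -/
structure DorfmanConnection where
  /-- the `ℝ`-bilinear map `(ν, τ) ↦ Δ_ν τ` -/
  toFun : SideSection I F E →ₗ[ℝ] CoreSection I F E →ₗ[ℝ] CoreSection I F E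
  leibniz : ∀ (f : C^∞⟮I, M; ℝ⟯) (ν : SideSection I F E) (τ : CoreSection I F E) (x : M),
    toFun ν (fsmul f τ) x = f x • toFun ν τ x + mvfderiv I f x (ν x).1 • τ x
  smul_left : ∀ (f : C^∞⟮I, M; ℝ⟯) (ν : SideSection I F E) (τ : CoreSection I F E) (x : M),
    toFun (fsmul f ν) τ x = f x • toFun ν τ x + pairing (ν x) (τ x) • coreD F E f x
  exact_form : ∀ (f : C^∞⟮I, M; ℝ⟯) (ν : SideSection I F E) (x : M),
    toFun ν (coreD F E f) x = (0, mvfderiv I (fun y => mvfderiv I f y (ν y).1) x)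

/-- `B` is the value at `(ν₁, ν₂)` of the dual of `Δ` in the sense of derivations:
`⟨B, τ⟩ = pr_TM(ν₁) ⟨ν₂, τ⟩ - ⟨ν₂, Δ_{ν₁} τ⟩` for all `τ`. -/
def DorfmanConnection.IsDualValue (Δ : DorfmanConnection I F E) (ν₁ ν₂ B : SideSection I F E) :
    Prop :=
  ∀ (τ : CoreSection I F E) (x : M), pairing (B x) (τ x) =
    mvfderiv I (fun y => pairing (ν₂ y) (τ y)) x (ν₁ x).1 - pairing (ν₂ x) (Δ.toFun ν₁ τ x)

/-- The dull bracket of `Δ`: the section `⟦ν₁, ν₂⟧_Δ` of `TM ⊕ E*` that is the value at `(ν₁, ν₂)` of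
the dual of `Δ`. It exists and is unique since the right-hand side of `IsDualValue` is
`C^∞(M)`-linear in `τ` and the pairing of `TM ⊕ E*` with `E ⊕ T*M` is non-degenerate. -/
def DorfmanConnection.dullBracket (Δ : DorfmanConnection I F E) (ν₁ ν₂ : SideSection I F E) :
    SideSection I F E :=
  Classical.epsilon (Δ.IsDualValue ν₁ ν₂)

variable (I F E) in
/-- Skew-symmetric Dorfman connections. -/
structure SkewDorfman extends DorfmanConnection I F E where
  skew : ∀ ν₁ ν₂, toDorfmanConnection.dullBracket ν₁ ν₂ = -toDorfmanConnection.dullBracket ν₂ ν₁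

/-- `Ψ` is the change of splittings from `Δ₁` to `Δ₂`:
`⟦ν₁, ν₂⟧_{Δ₂} = ⟦ν₁, ν₂⟧_{Δ₁} + (0, Ψ(ν₁, ν₂))`. -/
def IsChangeOfSplittings (Δ₁ Δ₂ : DorfmanConnection I F E)
    (Ψ : SideSection I F E → SideSection I F E → ∀ x, E x →L[ℝ] ℝ) : Prop :=
  ∀ (ν₁ ν₂ : SideSection I F E) (x : M),
    Δ₂.dullBracket ν₁ ν₂ x = Δ₁.dullBracket ν₁ ν₂ x + (0, Ψ ν₁ ν₂ x)

/-- The `j`-equivalence of skew-symmetric Dorfman connections: the change of splittings is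
invariant under `j`. -/
def jSetoid (j : SideEnd I F E) : Setoid (SkewDorfman I F E) where
  r Δ₁ Δ₂ := ∃ Ψ, IsChangeOfSplittings Δ₁.toDorfmanConnection Δ₂.toDorfmanConnection Ψ ∧
    ∀ ν₁ ν₂ x, Ψ ν₁ ν₂ x = Ψ (j.onSections ν₁) (j.onSections ν₂) x
  iseqv :=
    { refl := fun Δ => ⟨fun _ _ _ => 0, fun ν₁ ν₂ x => by simp [← Prod.zero_eq_mk],
        fun _ _ _ => rfl⟩
      symm := fun {Δ₁ Δ₂} ⟨Ψ, h, hj⟩ => ⟨fun ν₁ ν₂ x => -Ψ ν₁ ν₂ x, fun ν₁ ν₂ x => by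
        rw [h, add_assoc, Prod.mk_add_mk]; simp [← Prod.zero_eq_mk],
        fun ν₁ ν₂ x => by simp only [hj ν₁ ν₂ x]⟩
      trans := fun {Δ₁ Δ₂ Δ₃} ⟨Ψ, h, hj⟩ ⟨Ψ', h', hj'⟩ =>
        ⟨fun ν₁ ν₂ x => Ψ ν₁ ν₂ x + Ψ' ν₁ ν₂ x, fun ν₁ ν₂ x => by
          rw [h', h, add_assoc]; simp,
          fun ν₁ ν₂ x => by simp only [hj ν₁ ν₂ x, hj' ν₁ ν₂ x]⟩ }

/-- The bracket `𝔸(ν₁, ν₂) = ½ (⟦ν₁, ν₂⟧_Δ - ⟦j ν₁, j ν₂⟧_Δ)`. -/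
def bracketA (j : SideEnd I F E) (Δ : SkewDorfman I F E) (ν₁ ν₂ : SideSection I F E) :
    SideSection I F E :=
  (1 / 2 : ℝ) • (Δ.dullBracket ν₁ ν₂ - Δ.dullBracket (j.onSections ν₁) (j.onSections ν₂))

/-- The bracket `𝔸` only depends on the `j`-equivalence class of the Dorfman connection. -/
def bracketAClass (j : SideEnd I F E) (c : Quotient (jSetoid j)) :
    SideSection I F E → SideSection I F E → SideSection I F E :=
  Quotient.lift (bracketA j) (by
    rintro Δ₁ Δ₂ ⟨Ψ, h, hj⟩
    funext ν₁ ν₂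
    ext1 x
    simp only [bracketA, ContMDiffSection.coe_smul, ContMDiffSection.coe_sub, Pi.smul_apply,
      Pi.sub_apply]
    rw [h ν₁ ν₂ x, h (j.onSections ν₁) (j.onSections ν₂) x, ← hj, add_sub_add_right_eq_sub]) c

/-- The complex anchor `ρ(ν) = pr_{T_ℂ M} (½ (ν ⊗ 1 - j ν ⊗ i))`. -/
def complexAnchor (j : SideEnd I F E) (x : M) : Side I E x →ₗ[ℝ] ComplexTangent I x where
  toFun ν := ((1 / 2 : ℝ) • ν.1, -((1 / 2 : ℝ) • (j.app x ν).1))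
  map_add' _ _ := by simp [add_comm]
  map_smul' r _ := by simp [smul_comm r]

variable (I F E) in
/-- A complex structure `j` in the fibres of `TM ⊕ E*` together with a `j`-equivalence class of
skew-symmetric Dorfman connections whose bracket `𝔸` makes `TM ⊕ E*` a complex Lie algebroid. -/
structure DorfmanDatum where
  /-- the complex structure in the fibres -/
  j : SideEnd I F E
  sq : ∀ x (ν : Side I E x), j.app x (j.app x ν) = -ν
  /-- the `j`-equivalence class -/
  cls : Quotient (jSetoid j)
  isComplexLieAlgebroid : IsComplexLieAlgebroid j (complexAnchor j) (bracketAClass j cls)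

/-! ### Core sections, horizontal lifts and adapted Dorfman connections -/

/-- The core element `(e, θ)^↑ = (d/dt|_{t = 0} (p + t e), (T_p q_E)^t θ)` at `p ∈ E_x`. -/
def coreLift (p : TotalSpace F E) (τ : Core I E p.1) : GTE I F E p :=
  (vlift I p τ.1, τ.2.comp (Tproj I p))

/-- The value at `e(m)` of the horizontal lift of `ν = (X, ε)` with respect to `Δ`, written with a
section `e` of `E`: `σ(ν)(e(m)) = (T_m e X(m), dℓ_ε(e(m))) - Δ_ν(e, 0)^↑(e(m))`. -/
def horizontalLift (Δ : SkewDorfman I F E) (ν : SideSection I F E) (e : Cₛ^∞⟮I; F, E⟯) (m : M) :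
    GTE I F E ⟨m, e m⟩ :=
  (mfderiv I (I.prod 𝓘(ℝ, F)) (fun x => (⟨x, e x⟩ : TotalSpace F E)) m (ν m).1,
    mvfderiv (I.prod 𝓘(ℝ, F)) (fun p : TotalSpace F E => (ν p.1).2 p.2) ⟨m, e m⟩) -
    coreLift ⟨m, e m⟩ (Δ.toFun ν (coreInl e) m)

/-- `Δ` is adapted to `J` with side morphism `j`: `J(σ(ν)) = σ(j ν)` for all sections `ν`. -/
def IsAdapted (J : GTEEnd I F E) (j : SideEnd I F E) (Δ : SkewDorfman I F E) : Prop :=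
  ∀ (ν : SideSection I F E) (e : Cₛ^∞⟮I; F, E⟯) (m : M),
    J.app ⟨m, e m⟩ (horizontalLift Δ ν e m) = horizontalLift Δ (j.onSections ν) e m

/-- The core morphism of `J` is `-j^t`: `J(τ^↑) = τ'^↑` whenever `τ' = -j^t τ`, that is,
`⟨ν, τ'⟩ = -⟨j ν, τ⟩` for all `ν`. -/
def HasCoreNegTranspose (J : GTEEnd I F E) (j : SideEnd I F E) : Prop :=
  ∀ (p : TotalSpace F E) (τ τ' : Core I E p.1),
    (∀ ν : Side I E p.1, pairing ν τ' = -pairing (j.app p.1 ν) τ) →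
      J.app p (coreLift p τ) = coreLift p τ'

end DoubleVectorBundle
end LinGC

/-! A splitting turns every structure on `TE ⊕ T*E` into data on `M`. A skew-symmetric Dorfman
connection `Δ` has horizontal lifts `σ(ν)`, and each fibre of `TE ⊕ T*E → E` is the direct sum of
the lifts of `TM ⊕ E*` and the core elements `τ^↑` of `E ⊕ T*M`. Skew-symmetry makes the lifts
isotropic, the core is isotropic, and the two are paired by the duality (`genPairing_lift`). The
Courant-Dorfman bracket becomes `[σ(ν₁), σ(ν₂)] = σ(⟦ν₁, ν₂⟧) - (R(ν₁, ν₂)(e, 0))^↑`, `[σ(ν), τ^↑] =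
(Δ_ν τ)^↑` and `[τ^↑, τ'^↑] = 0`, where `R` is the curvature of `Δ` and `e` a section through the
point (`courantBracket_hlift_hlift`, `courantBracket_hlift_core`, `courantBracket_core_core`). These
formulas are checked in coordinates.

Let `J` be linear over `j`. Then `j² = -1`, and orthogonality forces the core morphism `-jᵗ`
(`app_coreLift`). For any `Δ` the difference `J ∘ σ - σ ∘ j` is a core-valued tensor `φ`, and
correcting the lift by `½ φ ∘ j` gives an adapted connection (`IsDoubleMorphism.exists_isAdapted`).
The change of splittings between two connections is the pairing of their lifts (`dullBracket_snd`),
so the adapted connections form exactly one `j`-equivalence class (`IsAdapted.jSetoid_iff`).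
Conversely `j` and `Δ` define an endomorphism by `σ(ν) ↦ σ(j ν)` and `τ^↑ ↦ (-jᵗ τ)^↑` (`liftEnd`),
and every `J` to which `Δ` is adapted has this form (`eq_liftEnd`).

It remains to match the integrability conditions. The Nijenhuis expression of `J` is tensorial, so
lifts and core sections suffice. Two core sections give zero; a lift and a core section give the
dual of the Nijenhuis expression of `j` for the dull bracket; two lifts give that expression itself
and a combination of four curvatures, which is dual to a combination of four Jacobiators
(`nijenhuisExpr_eq_zero_iff`). Pure algebra shows that both vanish if and only if `𝔸` is complex
linear and satisfies the Jacobi identity (`complexBracket_integrable_iff`). The other axioms of a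
complex Lie algebroid are automatic (`isComplexLieAlgebroid_iff`).

Some skew-symmetric Dorfman connection exists because the axioms are affine: the flat connections of
the charts can be averaged with a partition of unity (`nonempty_skewDorfman`). -/

namespace LinGC

open Filter Topology

set_option linter.unusedSectionVars false
set_option linter.unusedSimpArgs false
set_option synthInstance.maxHeartbeats 400000

/-! ### Sections in coordinates, and global sections with prescribed local form. -/

section Reading

variable {EM : Type*} [NormedAddCommGroup EM] [NormedSpace ℝ EM]
  {H : Type*} [TopologicalSpace H] (I : ModelWithCorners ℝ EM H)
  {M : Type*} [TopologicalSpace M] [ChartedSpace H M]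
  (F : Type*) [NormedAddCommGroup F] [NormedSpace ℝ F]
  {V : M → Type*} [TopologicalSpace (TotalSpace F V)]
  [∀ x, AddCommGroup (V x)] [∀ x, Module ℝ (V x)] [∀ x, TopologicalSpace (V x)]
  [FiberBundle F V] [VectorBundle ℝ F V]

variable (V) in
/-- The fibre coordinates at `x` in the preferred trivialization at `x₀`. -/
abbrev fibreCoord (x₀ x : M) : V x →L[ℝ] F :=
  (trivializationAt F V x₀).continuousLinearMapAt ℝ x

/-- A section read in the preferred chart and trivialization at `x₀`. -/
def reading (x₀ : M) (s : ∀ x, V x) (y : EM) : F :=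
  fibreCoord F V x₀ ((extChartAt I x₀).symm y) (s ((extChartAt I x₀).symm y))

variable (V) in
/-- The domain of the coordinates at `x₀`. -/
def coordDomain (x₀ : M) : Set EM :=
  (extChartAt I x₀).target ∩ (extChartAt I x₀).symm ⁻¹' (trivializationAt F V x₀).baseSet

variable {I F}

theorem isOpen_coordDomain [I.Boundaryless] (x₀ : M) : IsOpen (coordDomain I F V x₀) :=
  (continuousOn_extChartAt_symm x₀).isOpen_inter_preimage (isOpen_extChartAt_target x₀)
    (trivializationAt F V x₀).open_baseSet

theorem mem_coordDomain_self (x₀ : M) : extChartAt I x₀ x₀ ∈ coordDomain I F V x₀ :=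
  ⟨mem_extChartAt_target x₀, by simp [mem_baseSet_trivializationAt]⟩

theorem coordDomain_mem_nhds [I.Boundaryless] (x₀ : M) :
    coordDomain I F V x₀ ∈ 𝓝 (extChartAt I x₀ x₀) :=
  (isOpen_coordDomain x₀).mem_nhds (mem_coordDomain_self x₀)

theorem reading_add (x₀ : M) (s t : ∀ x, V x) :
    reading I F x₀ (fun x => s x + t x) = reading I F x₀ s + reading I F x₀ t := by
  funext y; simp only [reading, map_add, Pi.add_apply]

theorem contDiffOn_reading [IsManifold I ∞ M] [ContMDiffVectorBundle ∞ F V I] [I.Boundaryless]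
    (x₀ : M) {s : ∀ x, V x}
    (hs : ContMDiff I (I.prod 𝓘(ℝ, F)) ∞ (fun x => (⟨x, s x⟩ : TotalSpace F V))) :
    ContDiffOn ℝ ∞ (reading I F x₀ s) (coordDomain I F V x₀) := by
  have h1 : ContMDiffOn I 𝓘(ℝ, F) ∞ (fun x => (trivializationAt F V x₀ ⟨x, s x⟩).2)
      (trivializationAt F V x₀).baseSet :=
    ((trivializationAt F V x₀).contMDiffOn_section_baseSet_iff (n := ∞) (IB := I)).1
      hs.contMDiffOn
  have h2 : ContMDiffOn 𝓘(ℝ, EM) I ∞ (extChartAt I x₀).symm (extChartAt I x₀).target :=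
    contMDiffOn_extChartAt_symm x₀
  have h3 : ContMDiffOn 𝓘(ℝ, EM) 𝓘(ℝ, F) ∞ _ (coordDomain I F V x₀) :=
    h1.comp (h2.mono Set.inter_subset_left) (fun y hy => hy.2)
  rw [contMDiffOn_iff_contDiffOn] at h3
  refine h3.congr fun y hy => ?_
  simp only [reading, Function.comp_def, fibreCoord]
  rw [Trivialization.continuousLinearMapAt_apply_of_mem ℝ _ hy.2]

/-- Only the centre of the coordinates is needed, since every point is the centre of its own chart
and trivialization. -/
theorem contMDiffAt_section_of_reading [I.Boundaryless] [IsManifold I ∞ M] {x₀ : M} {s : ∀ x, V x}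
    (hs : ContDiffAt ℝ ∞ (reading I F x₀ s) (extChartAt I x₀ x₀)) :
    ContMDiffAt I (I.prod 𝓘(ℝ, F)) ∞ (fun x => (⟨x, s x⟩ : TotalSpace F V)) x₀ := by
  rw [Bundle.contMDiffAt_section]
  have h1 : ContMDiffAt I 𝓘(ℝ, F) ∞ (reading I F x₀ s ∘ extChartAt I x₀) x₀ :=
    hs.contMDiffAt.comp x₀ (contMDiffAt_extChartAt)
  refine h1.congr_of_eventuallyEq ?_
  filter_upwards [extChartAt_source_mem_nhds (I := I) x₀,
    (trivializationAt F V x₀).open_baseSet.mem_nhds (mem_baseSet_trivializationAt F V x₀)]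
    with x hx hx'
  simp only [Function.comp_def, reading, fibreCoord]
  rw [(extChartAt I x₀).left_inv hx, Trivialization.continuousLinearMapAt_apply_of_mem ℝ _ hx']

/-- The derivative of a function, read in a chart. -/
theorem mvfderiv_eq_fderiv [I.Boundaryless] [IsManifold I ∞ M] {G : Type*} [NormedAddCommGroup G]
    [NormedSpace ℝ G] {g : M → G} {x₀ x : M} (hx : x ∈ (chartAt H x₀).source)
    (hg : MDifferentiableAt I 𝓘(ℝ, G) g x) (v : TangentSpace I x) :
    mvfderiv I g x v = fderiv ℝ (g ∘ (extChartAt I x₀).symm) (extChartAt I x₀ x)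
      (fibreCoord EM (TangentSpace I) x₀ x v) := by
  have hx' : x ∈ (extChartAt I x₀).source := by rwa [extChartAt_source]
  rw [fibreCoord, TangentBundle.continuousLinearMapAt_trivializationAt hx]
  have hsymm : MDifferentiableAt 𝓘(ℝ, EM) I (extChartAt I x₀).symm (extChartAt I x₀ x) := by
    have := mdifferentiableWithinAt_extChartAt_symm (I := I) ((extChartAt I x₀).map_source hx')
    rwa [I.range_eq_univ, mdifferentiableWithinAt_univ] at this
  have hg' : MDifferentiableAt I 𝓘(ℝ, G) g ((extChartAt I x₀).symm (extChartAt I x₀ x)) := by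
    rwa [(extChartAt I x₀).left_inv hx']
  have h1 : MDifferentiableAt 𝓘(ℝ, EM) 𝓘(ℝ, G) (g ∘ (extChartAt I x₀).symm) (extChartAt I x₀ x) :=
    hg'.comp _ hsymm
  have h2 := mfderiv_comp x h1 (mdifferentiableAt_extChartAt (I := I) hx)
  have h3 : (g ∘ (extChartAt I x₀).symm) ∘ extChartAt I x₀ =ᶠ[𝓝 x] g := by
    filter_upwards [(isOpen_extChartAt_source (I := I) x₀).mem_nhds hx'] with z hz
    simp only [Function.comp_apply, (extChartAt I x₀).left_inv hz]
  rw [h3.mfderiv_eq, mfderiv_eq_fderiv] at h2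
  exact congrArg (fun L => L v) h2

/-- Smooth bump functions near a point. -/
theorem exists_bump [FiniteDimensional ℝ EM] [T2Space M] [IsManifold I ∞ M] {x₀ : M} {U : Set M}
    (hU : U ∈ 𝓝 x₀) :
    ∃ χ : C^∞⟮I, M; ℝ⟯, tsupport χ ⊆ U ∧ (∀ᶠ x in 𝓝 x₀, χ x = 1) := by
  obtain ⟨f, hf⟩ := (SmoothBumpFunction.nhds_basis_tsupport (I := I) x₀).mem_iff.1 hU
  exact ⟨⟨f, f.contMDiff⟩, hf.2, f.eventuallyEq_one⟩

/-- Global sections that are constant in the coordinates near a given point. -/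
theorem exists_constSection [FiniteDimensional ℝ EM] [T2Space M] [IsManifold I ∞ M]
    [ContMDiffVectorBundle ∞ F V I] (x₀ : M) :
    ∃ c : F →ₗ[ℝ] Cₛ^∞⟮I; F, V⟯, ∀ᶠ x in 𝓝 x₀, x ∈ (trivializationAt F V x₀).baseSet ∧
      ∀ v, c v x = (trivializationAt F V x₀).symmL ℝ x v := by
  set e := trivializationAt F V x₀
  have hU : e.baseSet ∈ 𝓝 x₀ := e.open_baseSet.mem_nhds (mem_baseSet_trivializationAt F V x₀)
  obtain ⟨χ, hχ, hχ1⟩ := exists_bump (I := I) hU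
  -- The cut-off `χ` is supported in the base set, so the local frame extends by zero; near `x₀` it
  -- is unchanged.
  have hsm : ∀ v, ContMDiff I (I.prod 𝓘(ℝ, F)) ∞
      (fun x => (⟨x, ((χ : M → ℝ) • fun x => e.symmL ℝ x v) x⟩ : TotalSpace F V)) := by
    intro v
    refine ContMDiffOn.smul_section_of_tsupport (u := e.baseSet) (V := V)
      (χ.contMDiff.contMDiffOn) e.open_baseSet hχ ?_
    rw [e.contMDiffOn_section_baseSet_iff]
    refine (contMDiffOn_const (c := v)).congr fun x hx => ?_
    rw [e.symmL_apply hx, e.apply_mk_symm hx]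
  refine ⟨{ toFun := fun v => ⟨_, hsm v⟩, map_add' := ?_, map_smul' := ?_ }, ?_⟩
  · intro v w; ext x; simp
  · intro r v; ext x; simp [smul_comm r]
  · filter_upwards [hU, hχ1] with x hx hx1
    refine ⟨hx, fun v => ?_⟩
    change χ x • e.symmL ℝ x v = _
    rw [hx1, one_smul]

/-- A global section through a given vector. -/
theorem exists_section_eq [FiniteDimensional ℝ EM] [T2Space M] [IsManifold I ∞ M]
    [ContMDiffVectorBundle ∞ F V I] (x₀ : M) (v : V x₀) :
    ∃ s : Cₛ^∞⟮I; F, V⟯, s x₀ = v := by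
  obtain ⟨c, hc⟩ := exists_constSection (I := I) (F := F) (V := V) x₀
  obtain ⟨h1, h2⟩ := hc.self_of_nhds
  exact ⟨c (fibreCoord F V x₀ x₀ v), by
    rw [h2, Trivialization.symmL_continuousLinearMapAt _ h1]⟩

end Reading

/-! ### The Courant-Dorfman bracket in coordinates. -/

section ModelBracket

variable {W : Type*} [NormedAddCommGroup W] [NormedSpace ℝ W]

/-- The symmetric pairing on `W ⊕ W*`. -/
def modelPairing (a b : W × (W →L[ℝ] ℝ)) : ℝ := a.2 b.1 + b.2 a.1

/-- The one-form `z ↦ ⟨D z, b⟩`. -/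
def pairForm (D : W →L[ℝ] W × (W →L[ℝ] ℝ)) (b : W × (W →L[ℝ] ℝ)) : W →L[ℝ] ℝ :=
  ((ContinuousLinearMap.snd ℝ W (W →L[ℝ] ℝ)).comp D).flip b.1 +
    b.2.comp ((ContinuousLinearMap.fst ℝ W (W →L[ℝ] ℝ)).comp D)

@[simp]
theorem pairForm_apply (D : W →L[ℝ] W × (W →L[ℝ] ℝ)) (b : W × (W →L[ℝ] ℝ)) (z : W) :
    pairForm D b z = modelPairing (D z) b := by
  simp [pairForm, modelPairing]

/-- The Courant-Dorfman bracket in coordinates. -/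
def modelBracket (a b : W → W × (W →L[ℝ] ℝ)) (y : W) : W × (W →L[ℝ] ℝ) :=
  fderiv ℝ b y (a y).1 - fderiv ℝ a y (b y).1 + (0, pairForm (fderiv ℝ a y) (b y))

/-- The right-hand side is `d(ω(X)) + ι_X dω - ι_Y dθ` as the definitions of `lieDerivOneForm` and
`extDerivOneForm` produce it. The two terms that differentiate `ω` along `z` cancel, which leaves
the compact form of `modelBracket`. -/
theorem modelBracket_snd_apply (a b : W → W × (W →L[ℝ] ℝ)) (y z : W) :
    (modelBracket a b y).2 z =
      (b y).2 (fderiv ℝ a y z).1 + (fderiv ℝ b y z).2 (a y).1 +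
        ((fderiv ℝ b y (a y).1).2 z - (fderiv ℝ b y z).2 (a y).1) -
        ((fderiv ℝ a y (b y).1).2 z - (fderiv ℝ a y z).2 (b y).1) := by
  change ((fderiv ℝ b y (a y).1).2 - (fderiv ℝ a y (b y).1).2) z +
    pairForm (fderiv ℝ a y) (b y) z = _
  rw [pairForm_apply]
  simp only [modelPairing, sub_apply]
  ring

end ModelBracket

section Courant

variable {EN : Type*} [NormedAddCommGroup EN] [NormedSpace ℝ EN]
  {H : Type*} [TopologicalSpace H] {I : ModelWithCorners ℝ EN H} [I.Boundaryless]
  {N : Type*} [TopologicalSpace N] [ChartedSpace H N] [IsManifold I ∞ N]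

theorem fibreCoord_tangent {p q : N} (hq : q ∈ (chartAt H p).source) :
    fibreCoord EN (TangentSpace I) p q = mfderiv I 𝓘(ℝ, EN) (extChartAt I p) q :=
  TangentBundle.continuousLinearMapAt_trivializationAt hq

theorem fibreCoord_tangent_self (p : N) (v : TangentSpace I p) :
    fibreCoord EN (TangentSpace I) p p v = v := by
  rw [fibreCoord_tangent (mem_chart_source H p), mfderiv_extChartAt_self]; rfl

theorem symmL_tangent_self (p : N) (v : EN) :
    (trivializationAt EN (TangentSpace I) p).symmL ℝ p v = (v : TangentSpace I p) := by
  have h := Trivialization.symmL_continuousLinearMapAt (R := ℝ)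
    (trivializationAt EN (TangentSpace I) p) (mem_baseSet_trivializationAt EN (TangentSpace I) p)
    (v : TangentSpace I p)
  have h2 := fibreCoord_tangent_self (I := I) p (v : TangentSpace I p)
  simp only [fibreCoord] at h2
  rw [h2] at h
  exact h

theorem fibreCoord_gen {p q : N} (hq : q ∈ (chartAt H p).source) (a : GenTangent I q) :
    fibreCoord (EN × (EN →L[ℝ] ℝ)) (GenTangent I) p q a =
      (fibreCoord EN (TangentSpace I) p q a.1,
        a.2.comp ((trivializationAt EN (TangentSpace I) p).symmL ℝ q)) := by
  have h1 : q ∈ (trivializationAt EN (TangentSpace I) p).baseSet := hq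
  have h2 : q ∈ (trivializationAt (EN × (EN →L[ℝ] ℝ)) (GenTangent I) p).baseSet :=
    ⟨h1, h1, Set.mem_univ _⟩
  simp only [fibreCoord]
  rw [Trivialization.continuousLinearMapAt_apply_of_mem ℝ _ h2,
    Trivialization.continuousLinearMapAt_apply_of_mem ℝ _ h1]
  refine Prod.ext rfl ?_
  ext v
  exact Trivialization.continuousLinearMapAt_apply_of_mem ℝ
    (trivializationAt ℝ (fun _ : N => ℝ) p) (Set.mem_univ q) _

/-- Over the centre of its chart the trivialization is the identity of the model space. This allows
a fibre at `p` to be compared directly with the model space throughout. -/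
theorem fibreCoord_gen_self {p : N} (a : GenTangent I p) :
    fibreCoord (EN × (EN →L[ℝ] ℝ)) (GenTangent I) p p a = a := by
  rw [fibreCoord_gen (mem_chart_source H p), fibreCoord_tangent_self]
  refine Prod.ext rfl ?_
  ext v
  exact congrArg a.2 (symmL_tangent_self p v)

theorem symmL_tangent_eq {p : N} {y : EN} (hy : y ∈ (extChartAt I p).target) :
    (trivializationAt EN (TangentSpace I) p).symmL ℝ ((extChartAt I p).symm y) =
      mfderivWithin 𝓘(ℝ, EN) I (extChartAt I p).symm (Set.range I) y := by
  have hs : (extChartAt I p).symm y ∈ (chartAt H p).source := by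
    rw [← extChartAt_source (I := I)]; exact (extChartAt I p).map_target hy
  rw [TangentBundle.symmL_trivializationAt hs, (extChartAt I p).right_inv hy]

/-- The pulled back vector field and `oneFormInChart` are what the Lie bracket and the exterior
derivative differentiate, so the bracket can be computed from readings alone. -/
theorem reading_gen {p : N} {y : EN} (hy : y ∈ (extChartAt I p).target)
    (e : ∀ q, GenTangent I q) :
    reading I (EN × (EN →L[ℝ] ℝ)) p e y =
      (VectorField.mpullbackWithin 𝓘(ℝ, EN) I (extChartAt I p).symm (fun q => (e q).1)
        (Set.range I) y, oneFormInChart I (fun q => (e q).2) p y) := by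
  have hs : (extChartAt I p).symm y ∈ (chartAt H p).source := by
    rw [← extChartAt_source (I := I)]; exact (extChartAt I p).map_target hy
  rw [reading, fibreCoord_gen hs, fibreCoord_tangent hs, symmL_tangent_eq hy]
  refine Prod.ext ?_ rfl
  change _ = (mfderivWithin 𝓘(ℝ, EN) I (extChartAt I p).symm (Set.range I) y).inverse _
  rw [ContinuousLinearMap.inverse_eq
    (mfderivWithin_extChartAt_symm_comp_mfderiv_extChartAt hy)
    (mfderiv_extChartAt_comp_mfderivWithin_extChartAt_symm hy)]
  rfl

/-- The Courant-Dorfman bracket, computed in the preferred chart. -/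
theorem courantBracket_eq_modelBracket {p : N} (e₁ e₂ : ∀ q, GenTangent I q)
    (h₁ : DifferentiableAt ℝ (reading I (EN × (EN →L[ℝ] ℝ)) p e₁) (extChartAt I p p))
    (h₂ : DifferentiableAt ℝ (reading I (EN × (EN →L[ℝ] ℝ)) p e₂) (extChartAt I p p))
    (hf : MDifferentiableAt I 𝓘(ℝ, ℝ) (fun q => (e₂ q).2 (e₁ q).1) p) :
    courantBracket I e₁ e₂ p =
      modelBracket (reading I (EN × (EN →L[ℝ] ℝ)) p e₁) (reading I (EN × (EN →L[ℝ] ℝ)) p e₂)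
        (extChartAt I p p) := by
  set y₀ := extChartAt I p p with hy₀
  set a := reading I (EN × (EN →L[ℝ] ℝ)) p e₁ with ha
  set b := reading I (EN × (EN →L[ℝ] ℝ)) p e₂ with hb
  have htn : (extChartAt I p).target ∈ 𝓝 y₀ := extChartAt_target_mem_nhds p
  have hr : ∀ e : ∀ q, GenTangent I q, ∀ᶠ y in 𝓝 y₀, reading I (EN × (EN →L[ℝ] ℝ)) p e y =
      (VectorField.mpullbackWithin 𝓘(ℝ, EN) I (extChartAt I p).symm (fun q => (e q).1)
        (Set.range I) y, oneFormInChart I (fun q => (e q).2) p y) := fun e => by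
    filter_upwards [htn] with y hy using reading_gen hy e
  have hv : ∀ e : ∀ q, GenTangent I q, (VectorField.mpullbackWithin 𝓘(ℝ, EN) I
      (extChartAt I p).symm (fun q => (e q).1) (Set.range I) : EN → EN) =ᶠ[𝓝 y₀]
        fun y => (reading I (EN × (EN →L[ℝ] ℝ)) p e y).1 := fun e => by
    filter_upwards [hr e] with y hy; rw [hy]
  have hw : ∀ e : ∀ q, GenTangent I q, oneFormInChart I (fun q => (e q).2) p =ᶠ[𝓝 y₀]
      fun y => (reading I (EN × (EN →L[ℝ] ℝ)) p e y).2 := fun e => by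
    filter_upwards [hr e] with y hy; rw [hy]
  have hval : ∀ e : ∀ q, GenTangent I q, reading I (EN × (EN →L[ℝ] ℝ)) p e y₀ = e p := fun e => by
    have : (extChartAt I p).symm y₀ = p := extChartAt_to_inv p
    rw [reading, this, fibreCoord_gen_self]
  have hd1 : ∀ {f : EN → EN × (EN →L[ℝ] ℝ)}, DifferentiableAt ℝ f y₀ →
      fderiv ℝ (fun y => (f y).1) y₀ = (ContinuousLinearMap.fst ℝ _ _).comp (fderiv ℝ f y₀) :=
    fun hf => (hf.hasFDerivAt.fst).fderiv
  have hd2 : ∀ {f : EN → EN × (EN →L[ℝ] ℝ)}, DifferentiableAt ℝ f y₀ →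
      fderiv ℝ (fun y => (f y).2) y₀ = (ContinuousLinearMap.snd ℝ _ _).comp (fderiv ℝ f y₀) :=
    fun hf => (hf.hasFDerivAt.snd).fderiv
  have hext : ∀ (e : ∀ q, GenTangent I q),
      DifferentiableAt ℝ (reading I (EN × (EN →L[ℝ] ℝ)) p e) y₀ → ∀ u v : EN,
      (extDerivOneForm I (fun q => (e q).2) p : EN →L[ℝ] EN →L[ℝ] ℝ) u v =
        (fderiv ℝ (reading I (EN × (EN →L[ℝ] ℝ)) p e) y₀ u).2 v -
        (fderiv ℝ (reading I (EN × (EN →L[ℝ] ℝ)) p e) y₀ v).2 u := by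
    intro e he u v
    have : fderivWithin ℝ (oneFormInChart I (fun q => (e q).2) p) (Set.range I) y₀ =
        (ContinuousLinearMap.snd ℝ _ _).comp
          (fderiv ℝ (reading I (EN × (EN →L[ℝ] ℝ)) p e) y₀) := by
      rw [I.range_eq_univ, fderivWithin_univ, (hw e).fderiv_eq, hd2 he]
    change (fderivWithin ℝ (oneFormInChart I (fun q => (e q).2) p) (Set.range I) y₀ -
      (fderivWithin ℝ (oneFormInChart I (fun q => (e q).2) p) (Set.range I) y₀).flip) u v = _
    rw [this]; rfl
  refine Prod.ext ?_ ?_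
  · change VectorField.mlieBracketWithin I _ _ _ p = _
    -- At the centre the derivative of the chart is the identity, so transporting the bracket back
    -- changes nothing.
    rw [VectorField.mlieBracketWithin_apply, mfderiv_extChartAt_self]
    change (ContinuousLinearMap.id ℝ EN).inverse _ = _
    rw [ContinuousLinearMap.inverse_id, Set.preimage_univ, Set.univ_inter, I.range_eq_univ]
    rw [I.range_eq_univ] at hv
    have := VectorField.lieBracketWithin_univ (𝕜 := ℝ) (E := EN) (V :=
      VectorField.mpullbackWithin 𝓘(ℝ, EN) I (extChartAt I p).symm (fun q => (e₁ q).1) Set.univ)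
      (W := VectorField.mpullbackWithin 𝓘(ℝ, EN) I (extChartAt I p).symm (fun q => (e₂ q).1)
        Set.univ)
    have h3 := congrFun this y₀
    refine h3.trans ?_
    have h4 := (hv e₁).lieBracket_vectorField_eq (hv e₂) (𝕜 := ℝ)
    refine h4.trans ?_
    simp only [VectorField.lieBracket, modelBracket]
    rw [hd1 h₁, hd1 h₂]
    simp [a, b]
  · ext z
    change mvfderiv I (fun q => (e₂ q).2 (e₁ q).1) p z +
      (extDerivOneForm I (fun q => (e₂ q).2) p : EN →L[ℝ] EN →L[ℝ] ℝ) (e₁ p).1 z -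
      (extDerivOneForm I (fun q => (e₁ q).2) p : EN →L[ℝ] EN →L[ℝ] ℝ) (e₂ p).1 z = _
    have hm := mvfderiv_eq_fderiv (mem_chart_source H p) hf z
    rw [fibreCoord_tangent_self] at hm
    refine (congrArg₂ (· - ·) (congrArg₂ (· + ·) hm (hext e₂ h₂ (e₁ p).1 z))
      (hext e₁ h₁ (e₂ p).1 z)).trans ?_
    -- The natural pairing of forms with vectors is the same in every trivialization.
    have hfe : (fun q => (e₂ q).2 (e₁ q).1) ∘ (extChartAt I p).symm =ᶠ[𝓝 y₀]
        fun y => (b y).2 (a y).1 := by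
      filter_upwards [htn] with y hy
      have hs : (extChartAt I p).symm y ∈ (chartAt H p).source := by
        rw [← extChartAt_source (I := I)]; exact (extChartAt I p).map_target hy
      simp only [ha, hb, reading, fibreCoord_gen hs, Function.comp_apply,
        ContinuousLinearMap.comp_apply]
      rw [Trivialization.symmL_continuousLinearMapAt _ hs]
    have h5 := (h₂.hasFDerivAt.snd.clm_apply h₁.hasFDerivAt.fst).fderiv
    have h6 := congrArg (fun L : EN →L[ℝ] ℝ => L z) (hfe.fderiv_eq.trans h5)
    have ea : (e₁ p).1 = (a y₀).1 := congrArg Prod.fst (hval e₁).symm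
    have eb : (e₂ p).1 = (b y₀).1 := congrArg Prod.fst (hval e₂).symm
    rw [ea, eb]
    refine (congrArg₂ (· - ·) (congrArg₂ (· + ·) h6 rfl) rfl).trans ?_
    exact (modelBracket_snd_apply a b y₀ z).symm

end Courant

/-! ### Bundle endomorphisms in coordinates. -/

section EndReading

theorem reading_extChartAt {EM : Type*} [NormedAddCommGroup EM] [NormedSpace ℝ EM]
    {H : Type*} [TopologicalSpace H] {I : ModelWithCorners ℝ EM H}
    {M : Type*} [TopologicalSpace M] [ChartedSpace H M]
    {F : Type*} [NormedAddCommGroup F] [NormedSpace ℝ F]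
    {V : M → Type*} [TopologicalSpace (TotalSpace F V)]
    [∀ x, AddCommGroup (V x)] [∀ x, Module ℝ (V x)] [∀ x, TopologicalSpace (V x)]
    [FiberBundle F V] [VectorBundle ℝ F V] {x₀ x : M} (hx : x ∈ (extChartAt I x₀).source)
    (s : ∀ x, V x) : reading I F x₀ s (extChartAt I x₀ x) = fibreCoord F V x₀ x (s x) := by
  rw [reading, (extChartAt I x₀).left_inv hx]

variable {EM : Type*} [NormedAddCommGroup EM] [NormedSpace ℝ EM]
  {H : Type*} [TopologicalSpace H] {I : ModelWithCorners ℝ EM H} [I.Boundaryless]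
  {M : Type*} [TopologicalSpace M] [ChartedSpace H M] [IsManifold I ∞ M]
  {F : Type*} [NormedAddCommGroup F] [NormedSpace ℝ F] [FiniteDimensional ℝ F]
  {V : M → Type*} [TopologicalSpace (TotalSpace F V)]
  [∀ x, AddCommGroup (V x)] [∀ x, Module ℝ (V x)] [∀ x, TopologicalSpace (V x)]
  [FiberBundle F V] [VectorBundle ℝ F V] [ContMDiffVectorBundle ∞ F V I]

/-- A bundle endomorphism in the coordinates at `x₀`. -/
def BundleEnd.reading (j : BundleEnd I F V) (x₀ : M) (y : EM) : F →L[ℝ] F :=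
  LinearMap.toContinuousLinearMap
    (((fibreCoord F V x₀ ((extChartAt I x₀).symm y) : V _ →L[ℝ] F) : V _ →ₗ[ℝ] F) ∘ₗ
      j.app ((extChartAt I x₀).symm y) ∘ₗ
      (((trivializationAt F V x₀).symmL ℝ ((extChartAt I x₀).symm y) : F →L[ℝ] V _) :
        F →ₗ[ℝ] V _))

theorem BundleEnd.reading_apply (j : BundleEnd I F V) (x₀ : M) (y : EM) (w : F) :
    j.reading x₀ y w = fibreCoord F V x₀ ((extChartAt I x₀).symm y)
      (j.app _ ((trivializationAt F V x₀).symmL ℝ ((extChartAt I x₀).symm y) w)) := rfl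

theorem BundleEnd.reading_onSections (j : BundleEnd I F V) {x₀ : M} {y : EM}
    (hy : y ∈ coordDomain I F V x₀) (s : Cₛ^∞⟮I; F, V⟯) :
    LinGC.reading I F x₀ (j.onSections s) y = j.reading x₀ y (LinGC.reading I F x₀ s y) := by
  rw [BundleEnd.reading_apply, LinGC.reading, LinGC.reading,
    Trivialization.symmL_continuousLinearMapAt _ hy.2]
  rfl

theorem BundleEnd.reading_self (j : BundleEnd I F V) (x₀ : M) (v : V x₀) :
    j.reading x₀ (extChartAt I x₀ x₀) (fibreCoord F V x₀ x₀ v) =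
      fibreCoord F V x₀ x₀ (j.app x₀ v) := by
  rw [BundleEnd.reading_apply, extChartAt_to_inv x₀,
    Trivialization.symmL_continuousLinearMapAt _ (mem_baseSet_trivializationAt F V x₀)]

/-- In finite dimension a family of linear maps is smooth as soon as its values on fixed vectors
are. These values read the images of the local frame sections. -/
theorem BundleEnd.contDiffOn_reading (j : BundleEnd I F V) (x₀ : M) :
    ContDiffOn ℝ ∞ (j.reading x₀) (coordDomain I F V x₀) := by
  rw [contDiffOn_clm_apply]
  intro w
  set e := trivializationAt F V x₀
  have h1 : ContMDiffOn I (I.prod 𝓘(ℝ, F)) ∞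
      (fun x => (⟨x, e.symmL ℝ x w⟩ : TotalSpace F V)) e.baseSet := by
    rw [e.contMDiffOn_section_baseSet_iff]
    refine (contMDiffOn_const (c := w)).congr fun x hx => ?_
    rw [e.symmL_apply hx, e.apply_mk_symm hx]
  have h2 : ContMDiffOn I (I.prod 𝓘(ℝ, F)) ∞
      (fun x => (⟨x, j.app x (e.symmL ℝ x w)⟩ : TotalSpace F V)) e.baseSet :=
    j.contMDiff_app.comp_contMDiffOn h1
  rw [e.contMDiffOn_section_baseSet_iff] at h2
  have h3 : ContMDiffOn 𝓘(ℝ, EM) 𝓘(ℝ, F) ∞ _ (coordDomain I F V x₀) :=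
    h2.comp ((contMDiffOn_extChartAt_symm x₀).mono Set.inter_subset_left) (fun y hy => hy.2)
  rw [contMDiffOn_iff_contDiffOn] at h3
  refine h3.congr fun y hy => ?_
  rw [BundleEnd.reading_apply, fibreCoord, Trivialization.continuousLinearMapAt_apply_of_mem ℝ _ hy.2]
  rfl

end EndReading

/-! ### Tensoriality of the Nijenhuis expression. -/

section ModelNijenhuis

variable {W : Type*} [NormedAddCommGroup W] [NormedSpace ℝ W]

theorem pairForm_add (D D' : W →L[ℝ] W × (W →L[ℝ] ℝ)) (b : W × (W →L[ℝ] ℝ)) :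
    pairForm (D + D') b = pairForm D b + pairForm D' b := by
  ext z; simp [modelPairing]; ring

/-- The Nijenhuis tensor in coordinates. -/
def modelNijenhuis (J : W → (W × (W →L[ℝ] ℝ)) →L[ℝ] (W × (W →L[ℝ] ℝ)))
    (a b : W → W × (W →L[ℝ] ℝ)) (y : W) : W × (W →L[ℝ] ℝ) :=
  modelBracket a b y - modelBracket (fun y => J y (a y)) (fun y => J y (b y)) y +
    J y (modelBracket (fun y => J y (a y)) b y + modelBracket a (fun y => J y (b y)) y)

/-- The value of the Nijenhuis tensor on two vectors, in coordinates. -/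
def modelNijenhuisAt (D : W →L[ℝ] (W × (W →L[ℝ] ℝ)) →L[ℝ] (W × (W →L[ℝ] ℝ)))
    (J : (W × (W →L[ℝ] ℝ)) →L[ℝ] (W × (W →L[ℝ] ℝ))) (u v : W × (W →L[ℝ] ℝ)) :
    W × (W →L[ℝ] ℝ) :=
  - (D (J u).1 v - D (J v).1 u + (0, pairForm (D.flip u) (J v))) +
    J (D u.1 v - D v.1 u + (0, pairForm (D.flip u) v))

/-- The product rule splits each derivative of `J a` into a part with `DJ` and a part with `Da`. The
parts with `Da` and `Db` cancel because `J² = -1` and `J` is skew for the pairing, and only values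
of `a` and `b` survive. -/
theorem modelNijenhuis_eq {J : W → (W × (W →L[ℝ] ℝ)) →L[ℝ] (W × (W →L[ℝ] ℝ))}
    {a b : W → W × (W →L[ℝ] ℝ)} {y : W} (hJ : DifferentiableAt ℝ J y)
    (ha : DifferentiableAt ℝ a y) (hb : DifferentiableAt ℝ b y)
    (hsq : ∀ u, J y (J y u) = -u)
    (horth : ∀ u v, modelPairing (J y u) (J y v) = modelPairing u v) :
    modelNijenhuis J a b y = modelNijenhuisAt (fderiv ℝ J y) (J y) (a y) (b y) := by
  have hd : ∀ {c : W → W × (W →L[ℝ] ℝ)}, DifferentiableAt ℝ c y →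
      fderiv ℝ (fun y => J y (c y)) y = (fderiv ℝ J y).flip (c y) + (J y).comp (fderiv ℝ c y) :=
    fun hc => by rw [(hJ.hasFDerivAt.clm_apply hc.hasFDerivAt).fderiv, add_comm]
  have hskew : ∀ u v, modelPairing (J y u) v = - modelPairing u (J y v) := by
    intro u v
    have h := horth u (J y v)
    rw [hsq] at h
    rw [← h]
    simp [modelPairing]
    ring
  -- Orthogonality and skewness dispose of the non-skew term of the bracket, the one-form `⟨D ·,
  -- b⟩`.
  have p1 : ∀ D v, pairForm ((J y).comp D) (J y v) = pairForm D v := by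
    intro D v; ext z; simp [horth]
  have p2 : ∀ D v, pairForm ((J y).comp D) v = - pairForm D (J y v) := by
    intro D v; ext z; simp [hskew]
  have i0 : ∀ θ θ' : W →L[ℝ] ℝ, ((0, θ + θ') : W × (W →L[ℝ] ℝ)) = (0, θ) + (0, θ') := by
    intro θ θ'; simp
  have i1 : ∀ θ : W →L[ℝ] ℝ, ((0, -θ) : W × (W →L[ℝ] ℝ)) = -(0, θ) := by
    intro θ; simp
  simp only [modelNijenhuis, modelNijenhuisAt, modelBracket, hd ha, hd hb, pairForm_add, p1, p2,
    i0, i1, add_apply, ContinuousLinearMap.comp_apply, ContinuousLinearMap.flip_apply,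
    map_add, map_sub, map_neg, hsq]
  abel

theorem modelNijenhuisAt_add_left
    (D : W →L[ℝ] (W × (W →L[ℝ] ℝ)) →L[ℝ] (W × (W →L[ℝ] ℝ)))
    (J : (W × (W →L[ℝ] ℝ)) →L[ℝ] (W × (W →L[ℝ] ℝ))) (u u' v : W × (W →L[ℝ] ℝ)) :
    modelNijenhuisAt D J (u + u') v = modelNijenhuisAt D J u v + modelNijenhuisAt D J u' v := by
  have i0 : ∀ θ θ' : W →L[ℝ] ℝ, ((0, θ + θ') : W × (W →L[ℝ] ℝ)) = (0, θ) + (0, θ') := by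
    intro θ θ'; simp
  simp only [modelNijenhuisAt, map_add, Prod.fst_add, pairForm_add, i0, add_apply, map_sub]
  abel

theorem modelNijenhuisAt_add_right
    (D : W →L[ℝ] (W × (W →L[ℝ] ℝ)) →L[ℝ] (W × (W →L[ℝ] ℝ)))
    (J : (W × (W →L[ℝ] ℝ)) →L[ℝ] (W × (W →L[ℝ] ℝ))) (u v v' : W × (W →L[ℝ] ℝ)) :
    modelNijenhuisAt D J u (v + v') = modelNijenhuisAt D J u v + modelNijenhuisAt D J u v' := by
  have i0 : ∀ θ θ' : W →L[ℝ] ℝ, ((0, θ + θ') : W × (W →L[ℝ] ℝ)) = (0, θ) + (0, θ') := by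
    intro θ θ'; simp
  have p : ∀ D' w w', pairForm D' (w + w') = pairForm (W := W) D' w + pairForm D' w' := by
    intro D' w w'; ext z; simp [modelPairing]; ring
  simp only [modelNijenhuisAt, map_add, Prod.fst_add, p, i0, add_apply, map_sub]
  abel

end ModelNijenhuis

section Nijenhuis

variable {EN : Type*} [NormedAddCommGroup EN] [NormedSpace ℝ EN]
  {H : Type*} [TopologicalSpace H] {I : ModelWithCorners ℝ EN H} [I.Boundaryless]
  {N : Type*} [TopologicalSpace N] [ChartedSpace H N] [IsManifold I ∞ N]

theorem genPairing_fibreCoord {p q : N} (hq : q ∈ (chartAt H p).source) (a b : GenTangent I q) :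
    modelPairing (fibreCoord (EN × (EN →L[ℝ] ℝ)) (GenTangent I) p q a)
      (fibreCoord (EN × (EN →L[ℝ] ℝ)) (GenTangent I) p q b) = genPairing a b := by
  have h : ∀ v, (trivializationAt EN (TangentSpace I) p).symmL ℝ q
      (fibreCoord EN (TangentSpace I) p q v) = v :=
    Trivialization.symmL_continuousLinearMapAt _ hq
  rw [fibreCoord_gen hq, fibreCoord_gen hq]
  simp only [modelPairing, genPairing, ContinuousLinearMap.comp_apply, h]

theorem reading_gen_self {p : N} (e : ∀ q, GenTangent I q) :
    reading I (EN × (EN →L[ℝ] ℝ)) p e (extChartAt I p p) = e p := by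
  have : (extChartAt I p).symm (extChartAt I p p) = p := extChartAt_to_inv p
  rw [reading, this, fibreCoord_gen_self]

theorem contDiffAt_reading_gen (e : Cₛ^∞⟮I; EN × (EN →L[ℝ] ℝ), GenTangent I (N := N)⟯) (p : N) :
    ContDiffAt ℝ ∞ (reading I (EN × (EN →L[ℝ] ℝ)) p e) (extChartAt I p p) :=
  (contDiffOn_reading p e.contMDiff).contDiffAt (coordDomain_mem_nhds p)

theorem courantBracket_section (e₁ e₂ : Cₛ^∞⟮I; EN × (EN →L[ℝ] ℝ), GenTangent I (N := N)⟯)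
    (p : N) : courantBracket I e₁ e₂ p =
      modelBracket (reading I (EN × (EN →L[ℝ] ℝ)) p e₁) (reading I (EN × (EN →L[ℝ] ℝ)) p e₂)
        (extChartAt I p p) := by
  have h1 := contDiffAt_reading_gen e₁ p
  have h2 := contDiffAt_reading_gen e₂ p
  refine courantBracket_eq_modelBracket _ _ (h1.differentiableAt (by simp))
    (h2.differentiableAt (by simp)) ?_
  have h3 : ContDiffAt ℝ ∞ (fun y => (reading I (EN × (EN →L[ℝ] ℝ)) p e₂ y).2
      (reading I (EN × (EN →L[ℝ] ℝ)) p e₁ y).1) (extChartAt I p p) :=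
    (contDiffAt_snd.comp _ h2).clm_apply (contDiffAt_fst.comp _ h1)
  have h4 : ContMDiffAt I 𝓘(ℝ, ℝ) ∞ _ p := h3.contMDiffAt.comp p (contMDiffAt_extChartAt)
  refine (h4.mdifferentiableAt (by simp)).congr_of_eventuallyEq ?_
  filter_upwards [extChartAt_source_mem_nhds (I := I) p] with q hq
  have hs : q ∈ (chartAt H p).source := by rwa [← extChartAt_source (I := I)]
  simp only [Function.comp_apply, reading_extChartAt hq, fibreCoord_gen hs,
    ContinuousLinearMap.comp_apply]
  rw [Trivialization.symmL_continuousLinearMapAt _ hs]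

/-- The Nijenhuis expression on two sections. -/
def nijenhuisExpr (J : BundleEnd I (EN × (EN →L[ℝ] ℝ)) (GenTangent I (N := N)))
    (e₁ e₂ : Cₛ^∞⟮I; EN × (EN →L[ℝ] ℝ), GenTangent I (N := N)⟯) (p : N) : GenTangent I p :=
  courantBracket I e₁ e₂ p - courantBracket I (J.onSections e₁) (J.onSections e₂) p +
    J.app p (courantBracket I (J.onSections e₁) e₂ p + courantBracket I e₁ (J.onSections e₂) p)

theorem BundleEnd.reading_gen_self (J : BundleEnd I (EN × (EN →L[ℝ] ℝ)) (GenTangent I (N := N)))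
    [FiniteDimensional ℝ EN] (p : N) (a : GenTangent I p) :
    J.reading p (extChartAt I p p) a = J.app p a := by
  have h := J.reading_self p a
  rwa [fibreCoord_gen_self, fibreCoord_gen_self] at h

/-- The Nijenhuis expression of an orthogonal almost complex structure is tensorial. -/
theorem nijenhuisExpr_tensorial [FiniteDimensional ℝ EN]
    (J : BundleEnd I (EN × (EN →L[ℝ] ℝ)) (GenTangent I (N := N)))
    (hsq : ∀ p (a : GenTangent I p), J.app p (J.app p a) = -a)
    (horth : ∀ p (a b : GenTangent I p), genPairing (J.app p a) (J.app p b) = genPairing a b)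
    (p : N) :
    ∃ T : GenTangent I p → GenTangent I p → GenTangent I p,
      (∀ u u' v, T (u + u') v = T u v + T u' v) ∧ (∀ u v v', T u (v + v') = T u v + T u v') ∧
      ∀ e₁ e₂, nijenhuisExpr J e₁ e₂ p = T (e₁ p) (e₂ p) := by
  set y₀ := extChartAt I p p with hy₀
  refine ⟨modelNijenhuisAt (W := EN) (fderiv ℝ (J.reading p) y₀) (J.reading p y₀),
    modelNijenhuisAt_add_left (W := EN) _ _, modelNijenhuisAt_add_right (W := EN) _ _, fun e₁ e₂ => ?_⟩
  have hJd : DifferentiableAt ℝ (J.reading p) y₀ :=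
    ((J.contDiffOn_reading p).contDiffAt (coordDomain_mem_nhds p)).differentiableAt (by simp)
  have hd : ∀ e : Cₛ^∞⟮I; EN × (EN →L[ℝ] ℝ), GenTangent I (N := N)⟯,
      DifferentiableAt ℝ (reading I (EN × (EN →L[ℝ] ℝ)) p e) y₀ := fun e =>
    (contDiffAt_reading_gen e p).differentiableAt (by simp)
  have key := modelNijenhuis_eq hJd (hd e₁) (hd e₂)
    (fun u => by
      have h1 := J.reading_gen_self p (u : GenTangent I p)
      have h2 := J.reading_gen_self p (J.app p u)
      exact (congrArg (J.reading p y₀) h1).trans (h2.trans (hsq p u)))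
    (fun u v => by
      have h1 := J.reading_gen_self p (u : GenTangent I p)
      have h2 := J.reading_gen_self p (v : GenTangent I p)
      exact (congrArg₂ modelPairing h1 h2).trans (horth p u v))
  have ev : ∀ e : Cₛ^∞⟮I; EN × (EN →L[ℝ] ℝ), GenTangent I (N := N)⟯,
      reading I (EN × (EN →L[ℝ] ℝ)) p (J.onSections e) =ᶠ[𝓝 y₀]
        fun y => J.reading p y (reading I (EN × (EN →L[ℝ] ℝ)) p e y) := fun e => by
    filter_upwards [coordDomain_mem_nhds (I := I) (F := EN × (EN →L[ℝ] ℝ))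
      (V := GenTangent I (N := N)) p] with y hy using
      BundleEnd.reading_onSections (I := I) (V := GenTangent I (N := N)) J hy e
  have hcongr : ∀ {a a' b b' : EN → EN × (EN →L[ℝ] ℝ)}, a =ᶠ[𝓝 y₀] a' → b =ᶠ[𝓝 y₀] b' →
      modelBracket a b y₀ = modelBracket a' b' y₀ := fun h h' => by
    simp only [modelBracket, h.fderiv_eq, h'.fderiv_eq, h.eq_of_nhds, h'.eq_of_nhds]
  have v1 := (reading_gen_self (I := I) (p := p) e₁)
  have v2 := (reading_gen_self (I := I) (p := p) e₂)
  rw [← hy₀] at v1 v2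
  refine Eq.trans ?_ (key.trans (congrArg₂ _ v1 v2))
  rw [nijenhuisExpr, ← J.reading_gen_self p, courantBracket_section, courantBracket_section,
    courantBracket_section, courantBracket_section]
  rw [← hy₀, modelNijenhuis, hcongr (ev e₁) (ev e₂), hcongr (ev e₁) (EventuallyEq.refl _ _),
    hcongr (EventuallyEq.refl _ _) (ev e₂)]
  rfl

end Nijenhuis

/-! ### Coordinates on the total space of `E`. -/

section TotalSpaceCoords

variable {EM : Type*} [NormedAddCommGroup EM] [NormedSpace ℝ EM]
  {H : Type*} [TopologicalSpace H] {I : ModelWithCorners ℝ EM H} [I.Boundaryless]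
  {M : Type*} [TopologicalSpace M] [ChartedSpace H M] [IsManifold I ∞ M]
  {F : Type*} [NormedAddCommGroup F] [NormedSpace ℝ F]
  {E : M → Type*} [TopologicalSpace (TotalSpace F E)]
  [∀ x, AddCommGroup (E x)] [∀ x, Module ℝ (E x)] [∀ x, TopologicalSpace (E x)]
  [FiberBundle F E] [VectorBundle ℝ F E] [ContMDiffVectorBundle ∞ F E I]

variable (F E) in
/-- The points of `M` in the domain of the coordinates at `x₀`. -/
def coordSource (x₀ : M) : Set M := (chartAt H x₀).source ∩ (trivializationAt F E x₀).baseSet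

theorem isOpen_coordSource (x₀ : M) : IsOpen (coordSource (H := H) F E x₀) :=
  (chartAt H x₀).open_source.inter (trivializationAt F E x₀).open_baseSet

theorem mem_coordSource_self (x₀ : M) : x₀ ∈ coordSource (H := H) F E x₀ :=
  ⟨mem_chart_source H x₀, mem_baseSet_trivializationAt F E x₀⟩

theorem coordSource_mem_nhds (x₀ : M) : coordSource (H := H) F E x₀ ∈ 𝓝 x₀ :=
  (isOpen_coordSource x₀).mem_nhds (mem_coordSource_self x₀)

theorem mem_chart_totalSpace {p q : TotalSpace F E} (hq : q.1 ∈ coordSource (H := H) F E p.1) :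
    q ∈ (chartAt (ModelProd H F) p).source := by
  rw [FiberBundle.chartedSpace_chartAt]
  simp only [mfld_simps]
  exact ⟨(Trivialization.mem_source _).2 hq.2, by rw [Trivialization.coe_fst' _ hq.2]; exact hq.1⟩

theorem extChartAt_totalSpace {p q : TotalSpace F E} (hq : q.1 ∈ coordSource (H := H) F E p.1) :
    extChartAt (I.prod 𝓘(ℝ, F)) p q = (extChartAt I p.1 q.1, fibreCoord F E p.1 q.1 q.2) := by
  rw [FiberBundle.extChartAt, fibreCoord, Trivialization.continuousLinearMapAt_apply_of_mem ℝ _ hq.2]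
  change (extChartAt I p.1 (trivializationAt F E p.1 q).1, (trivializationAt F E p.1 q).2) = _
  rw [Trivialization.coe_fst' _ hq.2]

theorem extChartAt_totalSpace_symm {p : TotalSpace F E} {y : EM} (hy : y ∈ coordDomain I F E p.1)
    (f : F) : (extChartAt (I.prod 𝓘(ℝ, F)) p).symm (y, f) =
      ⟨(extChartAt I p.1).symm y,
        (trivializationAt F E p.1).symmL ℝ ((extChartAt I p.1).symm y) f⟩ := by
  rw [FiberBundle.extChartAt]
  change (trivializationAt F E p.1).toOpenPartialHomeomorph.symm
    ((extChartAt I p.1).symm y, f) = _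
  rw [← Trivialization.mk_symm _ hy.2, Trivialization.symmL_apply _ hy.2]

theorem eventually_coordSource {p q : TotalSpace F E}
    (hq : q.1 ∈ coordSource (H := H) F E p.1) :
    ∀ᶠ r : TotalSpace F E in 𝓝 q, r.1 ∈ coordSource (H := H) F E p.1 :=
  (FiberBundle.continuous_proj F E).continuousAt.preimage_mem_nhds
    ((isOpen_coordSource p.1).mem_nhds hq)

variable (I) in
/-- The coordinates of tangent vectors to the total space. -/
abbrev tangentCoord (p q : TotalSpace F E) : TE I F E q →L[ℝ] EM × F :=
  fibreCoord (EM × F) (TangentSpace (I.prod 𝓘(ℝ, F))) p q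

theorem hasMFDerivAt_extChartAt_totalSpace {p q : TotalSpace F E}
    (hq : q.1 ∈ coordSource (H := H) F E p.1) :
    HasMFDerivAt (I.prod 𝓘(ℝ, F)) 𝓘(ℝ, EM × F) (extChartAt (I.prod 𝓘(ℝ, F)) p) q
      (tangentCoord I p q) := by
  rw [tangentCoord, fibreCoord_tangent (mem_chart_totalSpace hq)]
  exact (mdifferentiableAt_extChartAt (mem_chart_totalSpace hq)).hasMFDerivAt

theorem hasMFDerivAt_extChartAt_base {x₀ x : M} (hx : x ∈ (chartAt H x₀).source) :
    HasMFDerivAt I 𝓘(ℝ, EM) (extChartAt I x₀) x (fibreCoord EM (TangentSpace I) x₀ x) := by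
  rw [fibreCoord_tangent hx]
  exact (mdifferentiableAt_extChartAt hx).hasMFDerivAt

/-- The map `E → M` followed by the base chart is also the chart of `E` followed by the first
projection. The two factorisations have the same derivative. -/
theorem tangentCoord_fst {p q : TotalSpace F E} (hq : q.1 ∈ coordSource (H := H) F E p.1)
    (v : TE I F E q) :
    (tangentCoord I p q v).1 = fibreCoord EM (TangentSpace I) p.1 q.1 (Tproj I q v) := by
  have h1 : HasMFDerivAt (I.prod 𝓘(ℝ, F)) I (TotalSpace.proj : TotalSpace F E → M) q
      (Tproj I q) :=
    ((contMDiff_proj E (n := ∞)).mdifferentiable (by simp) q).hasMFDerivAt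
  have h2 := (hasMFDerivAt_extChartAt_base (I := I) hq.1).comp q h1
  have h3 := ((ContinuousLinearMap.fst ℝ EM F).hasMFDerivAt
    (x := extChartAt (I.prod 𝓘(ℝ, F)) p q)).comp q (hasMFDerivAt_extChartAt_totalSpace hq)
  have h4 := h3.congr_of_eventuallyEq (f₁ := extChartAt I p.1 ∘ TotalSpace.proj) (by
    filter_upwards [eventually_coordSource hq] with r hr
    simp only [Function.comp_apply, extChartAt_totalSpace hr]
    rfl)
  exact congrArg (fun L => L v) (hasMFDerivAt_unique h4 h2)

theorem mdifferentiableAt_line (q : TotalSpace F E) (e : E q.1) :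
    MDifferentiableAt 𝓘(ℝ, ℝ) (I.prod 𝓘(ℝ, F))
      (fun t : ℝ => (⟨q.1, q.2 + t • e⟩ : TotalSpace F E)) 0 := by
  have : ContMDiffAt 𝓘(ℝ, ℝ) (I.prod 𝓘(ℝ, F)) ∞
      (fun t : ℝ => (⟨q.1, q.2 + t • e⟩ : TotalSpace F E)) 0 := by
    rw [Bundle.contMDiffAt_totalSpace]
    refine ⟨contMDiffAt_const, ?_⟩
    have h : ContDiff ℝ ∞ (fun t : ℝ => fibreCoord F E q.1 q.1 q.2 +
      t • fibreCoord F E q.1 q.1 e) := by fun_prop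
    refine h.contMDiff.contMDiffAt.congr_of_eventuallyEq (.of_forall fun t => ?_)
    simp only
    rw [← Trivialization.continuousLinearMapAt_apply_of_mem ℝ _
      (mem_baseSet_trivializationAt F E q.1)]
    simp only [map_add, map_smul, fibreCoord]
  exact this.mdifferentiableAt (by simp)

/-- The curve that defines the vertical lift is an affine line over a fixed base point in
coordinates. -/
theorem tangentCoord_vlift {p q : TotalSpace F E} (hq : q.1 ∈ coordSource (H := H) F E p.1)
    (e : E q.1) : tangentCoord I p q (vlift I q e) = (0, fibreCoord F E p.1 q.1 e) := by
  set c : ℝ → TotalSpace F E := fun t => ⟨q.1, q.2 + t • e⟩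
  have hc0 : c 0 = q := by simp [c]
  have h1 := (mdifferentiableAt_line (I := I) q e).hasMFDerivAt
  have h2 : HasMFDerivAt (I.prod 𝓘(ℝ, F)) 𝓘(ℝ, EM × F) (extChartAt (I.prod 𝓘(ℝ, F)) p) (c 0)
      (tangentCoord I p q) := by rw [hc0]; exact hasMFDerivAt_extChartAt_totalSpace hq
  have h3 := h2.comp (0 : ℝ) h1
  have h4 : HasFDerivAt (fun t : ℝ => (extChartAt I p.1 q.1,
      fibreCoord F E p.1 q.1 q.2 + t • fibreCoord F E p.1 q.1 e))
      ((0 : ℝ →L[ℝ] EM).prod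
        ((ContinuousLinearMap.id ℝ ℝ).smulRight (fibreCoord F E p.1 q.1 e))) 0 := by
    refine (hasFDerivAt_const _ _).prodMk ?_
    exact ((hasFDerivAt_id (0 : ℝ)).smul_const (fibreCoord F E p.1 q.1 e)).const_add _
  have h5 := h4.hasMFDerivAt.congr_of_eventuallyEq
    (f₁ := extChartAt (I.prod 𝓘(ℝ, F)) p ∘ c) (.of_forall fun t => by
    rw [Function.comp_apply, extChartAt_totalSpace (p := p) (q := c t) hq, map_add, map_smul])
  have h6 := congrArg (fun L : ℝ →L[ℝ] EM × F => L 1) (hasMFDerivAt_unique h3 h5)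
  refine h6.trans ?_
  simp

theorem tangentCoord_section {p : TotalSpace F E} {e : ∀ x, E x} {x : M}
    (hx : x ∈ coordSource (H := H) F E p.1)
    (he : MDifferentiableAt I (I.prod 𝓘(ℝ, F)) (fun x => (⟨x, e x⟩ : TotalSpace F E)) x)
    (X : TangentSpace I x) :
    tangentCoord I p ⟨x, e x⟩
      (mfderiv I (I.prod 𝓘(ℝ, F)) (fun x => (⟨x, e x⟩ : TotalSpace F E)) x X) =
      (fibreCoord EM (TangentSpace I) p.1 x X,
        fderiv ℝ (reading I F p.1 e) (extChartAt I p.1 x)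
          (fibreCoord EM (TangentSpace I) p.1 x X)) := by
  have h2 := hasMFDerivAt_extChartAt_totalSpace (I := I) (p := p) (q := ⟨x, e x⟩) hx
  have h3 := h2.comp x he.hasMFDerivAt
  have ht := hasMFDerivAt_extChartAt_base (I := I) hx.1
  have hev : extChartAt (I.prod 𝓘(ℝ, F)) p ∘ (fun x => (⟨x, e x⟩ : TotalSpace F E)) =ᶠ[𝓝 x]
      fun x => (extChartAt I p.1 x, fibreCoord F E p.1 x (e x)) := by
    filter_upwards [(isOpen_coordSource p.1).mem_nhds hx] with z hz
    rw [Function.comp_apply, extChartAt_totalSpace (p := p) (q := ⟨z, e z⟩) hz]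
  have h4 := h3.congr_of_eventuallyEq hev.symm
  have h5 := ((ContinuousLinearMap.snd ℝ EM F).hasMFDerivAt
    (x := (extChartAt I p.1 x, fibreCoord F E p.1 x (e x)))).comp x h4
  have h6 := ((ContinuousLinearMap.fst ℝ EM F).hasMFDerivAt
    (x := (extChartAt I p.1 x, fibreCoord F E p.1 x (e x)))).comp x h4
  have hf := congrArg (fun L => L X) (hasMFDerivAt_unique h6 ht)
  have hm := mvfderiv_eq_fderiv (I := I) (g := fun x => fibreCoord F E p.1 x (e x)) hx.1
    h5.mdifferentiableAt X
  have hs := congrArg (fun L => L X) h5.mfderiv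
  refine Prod.ext hf ?_
  refine hs.symm.trans (hm.trans ?_)
  rfl

end TotalSpaceCoords

/-! ### Coordinates of `TM ⊕ E*`, `E ⊕ T*M` and the side projection. -/

section SideCore

variable {EM : Type*} [NormedAddCommGroup EM] [NormedSpace ℝ EM]
  {H : Type*} [TopologicalSpace H] {I : ModelWithCorners ℝ EM H} [I.Boundaryless]
  {M : Type*} [TopologicalSpace M] [ChartedSpace H M] [IsManifold I ∞ M]
  {F : Type*} [NormedAddCommGroup F] [NormedSpace ℝ F]
  {E : M → Type*} [TopologicalSpace (TotalSpace F E)]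
  [∀ x, AddCommGroup (E x)] [∀ x, Module ℝ (E x)] [∀ x, TopologicalSpace (E x)]
  [FiberBundle F E] [VectorBundle ℝ F E] [ContMDiffVectorBundle ∞ F E I]

theorem coordSource_subset_side {x₀ x : M} (hx : x ∈ coordSource (H := H) F E x₀) :
    x ∈ (trivializationAt (EM × (F →L[ℝ] ℝ)) (Side I E) x₀).baseSet :=
  ⟨hx.1, hx.2, Set.mem_univ _⟩

theorem coordSource_subset_core {x₀ x : M} (hx : x ∈ coordSource (H := H) F E x₀) :
    x ∈ (trivializationAt (F × (EM →L[ℝ] ℝ)) (Core I E) x₀).baseSet :=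
  ⟨hx.2, hx.1, Set.mem_univ _⟩

variable (I F E) in
/-- The coordinates of `TM ⊕ E*`. -/
abbrev sideCoord (x₀ x : M) : Side I E x →L[ℝ] EM × (F →L[ℝ] ℝ) :=
  fibreCoord (EM × (F →L[ℝ] ℝ)) (Side I E) x₀ x

variable (I F E) in
/-- The coordinates of `E ⊕ T*M`. -/
abbrev coreCoord (x₀ x : M) : Core I E x →L[ℝ] F × (EM →L[ℝ] ℝ) :=
  fibreCoord (F × (EM →L[ℝ] ℝ)) (Core I E) x₀ x

variable (I F E) in
/-- The coordinates of `TE ⊕ T*E`. -/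
abbrev genCoord (p q : TotalSpace F E) : GTE I F E q →L[ℝ] (EM × F) × (EM × F →L[ℝ] ℝ) :=
  fibreCoord ((EM × F) × (EM × F →L[ℝ] ℝ)) (GTE I F E) p q

theorem sideCoord_apply {x₀ x : M} (hx : x ∈ coordSource (H := H) F E x₀) (ν : Side I E x) :
    sideCoord I F E x₀ x ν = (fibreCoord EM (TangentSpace I) x₀ x ν.1,
      ν.2.comp ((trivializationAt F E x₀).symmL ℝ x)) := by
  simp only [fibreCoord]
  rw [Trivialization.continuousLinearMapAt_apply_of_mem ℝ _ (coordSource_subset_side hx),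
    Trivialization.continuousLinearMapAt_apply_of_mem ℝ _ (show x ∈ (trivializationAt EM
      (TangentSpace I) x₀).baseSet from hx.1)]
  refine Prod.ext rfl ?_
  ext v
  exact Trivialization.continuousLinearMapAt_apply_of_mem ℝ
    (trivializationAt ℝ (fun _ : M => ℝ) x₀) (Set.mem_univ x) _

theorem coreCoord_apply {x₀ x : M} (hx : x ∈ coordSource (H := H) F E x₀) (τ : Core I E x) :
    coreCoord I F E x₀ x τ = (fibreCoord F E x₀ x τ.1,
      τ.2.comp ((trivializationAt EM (TangentSpace I) x₀).symmL ℝ x)) := by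
  simp only [fibreCoord]
  rw [Trivialization.continuousLinearMapAt_apply_of_mem ℝ _ (coordSource_subset_core hx),
    Trivialization.continuousLinearMapAt_apply_of_mem ℝ _ hx.2]
  refine Prod.ext rfl ?_
  ext v
  exact Trivialization.continuousLinearMapAt_apply_of_mem ℝ
    (trivializationAt ℝ (fun _ : M => ℝ) x₀) (Set.mem_univ x) _

theorem fibreCoord_injective {F' : Type*} [NormedAddCommGroup F'] [NormedSpace ℝ F']
    {V : M → Type*} [TopologicalSpace (TotalSpace F' V)]
    [∀ x, AddCommGroup (V x)] [∀ x, Module ℝ (V x)] [∀ x, TopologicalSpace (V x)]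
    [FiberBundle F' V] [VectorBundle ℝ F' V] {x₀ x : M}
    (hx : x ∈ (trivializationAt F' V x₀).baseSet) : Function.Injective (fibreCoord F' V x₀ x) :=
  Function.LeftInverse.injective (g := (trivializationAt F' V x₀).symmL ℝ x)
    (Trivialization.symmL_continuousLinearMapAt _ hx)

theorem sideCoord_injective {x₀ x : M} (hx : x ∈ coordSource (H := H) F E x₀) :
    Function.Injective (sideCoord I F E x₀ x) :=
  fibreCoord_injective (V := Side I E) (coordSource_subset_side hx)

theorem coreCoord_injective {x₀ x : M} (hx : x ∈ coordSource (H := H) F E x₀) :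
    Function.Injective (coreCoord I F E x₀ x) :=
  fibreCoord_injective (V := Core I E) (coordSource_subset_core hx)

/-- The duality between side and core in coordinates. -/
def modelDuality {W G : Type*} [NormedAddCommGroup W] [NormedSpace ℝ W] [NormedAddCommGroup G]
    [NormedSpace ℝ G] (ν : W × (G →L[ℝ] ℝ)) (τ : G × (W →L[ℝ] ℝ)) : ℝ := ν.2 τ.1 + τ.2 ν.1

theorem symmL_fibreCoord_tangent {x₀ x : M} (hx : x ∈ coordSource (H := H) F E x₀)
    (v : TangentSpace I x) : (trivializationAt EM (TangentSpace I) x₀).symmL ℝ x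
      (fibreCoord EM (TangentSpace I) x₀ x v) = v :=
  Trivialization.symmL_continuousLinearMapAt _ hx.1 v

theorem fibreCoord_symmL_tangent {x₀ x : M} (hx : x ∈ coordSource (H := H) F E x₀)
    (z : EM) : fibreCoord EM (TangentSpace I) x₀ x
      ((trivializationAt EM (TangentSpace I) x₀).symmL ℝ x z) = z :=
  Trivialization.continuousLinearMapAt_symmL (trivializationAt EM (TangentSpace I) x₀) hx.1 z

theorem symmL_fibreCoord {x₀ x : M} (hx : x ∈ coordSource (H := H) F E x₀)
    (v : E x) : (trivializationAt F E x₀).symmL ℝ x (fibreCoord F E x₀ x v) = v :=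
  Trivialization.symmL_continuousLinearMapAt _ hx.2 v

theorem fibreCoord_symmL {x₀ x : M} (hx : x ∈ coordSource (H := H) F E x₀)
    (f : F) : fibreCoord F E x₀ x ((trivializationAt F E x₀).symmL ℝ x f) = f :=
  Trivialization.continuousLinearMapAt_symmL _ hx.2 f

theorem modelDuality_coord {x₀ x : M} (hx : x ∈ coordSource (H := H) F E x₀) (ν : Side I E x)
    (τ : Core I E x) :
    modelDuality (sideCoord I F E x₀ x ν) (coreCoord I F E x₀ x τ) = pairing ν τ := by
  rw [sideCoord_apply hx, coreCoord_apply hx]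
  simp only [modelDuality, pairing, ContinuousLinearMap.comp_apply, symmL_fibreCoord hx,
    symmL_fibreCoord_tangent hx]

/-- The side projection `TE ⊕ T*E → TM ⊕ E*`, as a linear map in the fibres over `E`. -/
def sideProj (p : TotalSpace F E) : GTE I F E p →ₗ[ℝ] Side I E p.1 where
  toFun a := (Tproj I p a.1, (a.2.comp ((trivializationAt (EM × F)
    (TangentSpace (I.prod 𝓘(ℝ, F))) p).symmL ℝ p)).comp
      ((ContinuousLinearMap.inr ℝ EM F).comp (fibreCoord F E p.1 p.1)))
  map_add' a b := by ext <;> simp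
  map_smul' r a := by ext <;> simp

theorem symmL_tangentCoord {p q : TotalSpace F E} (hq : q.1 ∈ coordSource (H := H) F E p.1)
    (v : TE I F E q) : (trivializationAt (EM × F) (TangentSpace (I.prod 𝓘(ℝ, F))) p).symmL ℝ q
      (tangentCoord I p q v) = v :=
  Trivialization.symmL_continuousLinearMapAt (R := ℝ)
    (trivializationAt (EM × F) (TangentSpace (I.prod 𝓘(ℝ, F))) p) (mem_chart_totalSpace hq) v

theorem tangentCoord_symmL {p q : TotalSpace F E} (hq : q.1 ∈ coordSource (H := H) F E p.1)
    (z : EM × F) : tangentCoord I p q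
      ((trivializationAt (EM × F) (TangentSpace (I.prod 𝓘(ℝ, F))) p).symmL ℝ q z) = z :=
  Trivialization.continuousLinearMapAt_symmL (R := ℝ)
    (trivializationAt (EM × F) (TangentSpace (I.prod 𝓘(ℝ, F))) p) (mem_chart_totalSpace hq) z

/-- The covector part of `sideProj` is written in coordinates to make it a continuous functional of
`e`; this identifies it with the restriction to vertical vectors. -/
theorem sideProj_snd_apply (p : TotalSpace F E) (a : GTE I F E p) (e : E p.1) :
    (sideProj p a).2 e = a.2 (vlift I p e) := by
  change a.2 ((trivializationAt (EM × F) (TangentSpace (I.prod 𝓘(ℝ, F))) p).symmL ℝ p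
    (0, fibreCoord F E p.1 p.1 e)) = _
  rw [← tangentCoord_vlift (I := I) (mem_coordSource_self (H := H) p.1),
    symmL_tangentCoord (I := I) (mem_coordSource_self (H := H) p.1)]

theorem projectsTo_iff {p : TotalSpace F E} {a : GTE I F E p} {ν : Side I E p.1} :
    ProjectsTo a ν ↔ sideProj p a = ν := by
  constructor
  · rintro ⟨h1, h2⟩
    refine Prod.ext h1 ?_
    ext e
    rw [sideProj_snd_apply, h2]
  · rintro rfl
    exact ⟨rfl, fun e => (sideProj_snd_apply p a e).symm⟩

theorem genCoord_apply {p q : TotalSpace F E} (hq : q.1 ∈ coordSource (H := H) F E p.1)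
    (a : GTE I F E q) : genCoord I F E p q a = (tangentCoord I p q a.1,
      a.2.comp ((trivializationAt (EM × F) (TangentSpace (I.prod 𝓘(ℝ, F))) p).symmL ℝ q)) :=
  fibreCoord_gen (mem_chart_totalSpace hq) a

theorem genCoord_injective {p q : TotalSpace F E} (hq : q.1 ∈ coordSource (H := H) F E p.1) :
    Function.Injective (genCoord I F E p q) :=
  fibreCoord_injective (V := GTE I F E)
    ⟨mem_chart_totalSpace hq, mem_chart_totalSpace hq, Set.mem_univ _⟩

/-- The side projection in coordinates. -/
def modelSide {W G : Type*} [NormedAddCommGroup W] [NormedSpace ℝ W] [NormedAddCommGroup G]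
    [NormedSpace ℝ G] (a : (W × G) × (W × G →L[ℝ] ℝ)) : W × (G →L[ℝ] ℝ) :=
  (a.1.1, a.2.comp (ContinuousLinearMap.inr ℝ W G))

/-- The core inclusion in coordinates. -/
def modelCore {W G : Type*} [NormedAddCommGroup W] [NormedSpace ℝ W] [NormedAddCommGroup G]
    [NormedSpace ℝ G] (τ : G × (W →L[ℝ] ℝ)) : (W × G) × (W × G →L[ℝ] ℝ) :=
  ((0, τ.1), τ.2.comp (ContinuousLinearMap.fst ℝ W G))

/-- The flat horizontal inclusion in coordinates. -/
def modelHor {W G : Type*} [NormedAddCommGroup W] [NormedSpace ℝ W] [NormedAddCommGroup G]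
    [NormedSpace ℝ G] (ν : W × (G →L[ℝ] ℝ)) : (W × G) × (W × G →L[ℝ] ℝ) :=
  ((ν.1, 0), ν.2.comp (ContinuousLinearMap.snd ℝ W G))

theorem vlift_eq_symmL {p q : TotalSpace F E} (hq : q.1 ∈ coordSource (H := H) F E p.1)
    (e : E q.1) : vlift I q e =
      (trivializationAt (EM × F) (TangentSpace (I.prod 𝓘(ℝ, F))) p).symmL ℝ q
        (0, fibreCoord F E p.1 q.1 e) := by
  rw [← tangentCoord_vlift (I := I) hq, symmL_tangentCoord (I := I) hq]

theorem sideCoord_sideProj {p q : TotalSpace F E} (hq : q.1 ∈ coordSource (H := H) F E p.1)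
    (a : GTE I F E q) :
    sideCoord I F E p.1 q.1 (sideProj q a) = modelSide (genCoord I F E p q a) := by
  rw [sideCoord_apply hq, genCoord_apply hq]
  refine Prod.ext (tangentCoord_fst hq a.1).symm ?_
  ext f
  change (sideProj q a).2 _ = _
  rw [sideProj_snd_apply, vlift_eq_symmL (I := I) hq]
  exact congrArg (fun w => a.2 ((trivializationAt (EM × F)
    (TangentSpace (I.prod 𝓘(ℝ, F))) p).symmL ℝ q (0, w))) (fibreCoord_symmL (H := H) hq f)

/-- A core element has vertical vector part and basic covector part, and neither depends on the
fibre coordinate of `q`. -/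
theorem genCoord_coreLift {p q : TotalSpace F E} (hq : q.1 ∈ coordSource (H := H) F E p.1)
    (τ : Core I E q.1) :
    genCoord I F E p q (coreLift q τ) = modelCore (coreCoord I F E p.1 q.1 τ) := by
  rw [coreCoord_apply hq, genCoord_apply hq]
  refine Prod.ext (tangentCoord_vlift hq τ.1) ?_
  refine ContinuousLinearMap.ext fun z => ?_
  refine congrArg τ.2 ?_
  have h := tangentCoord_fst (I := I) hq
    ((trivializationAt (EM × F) (TangentSpace (I.prod 𝓘(ℝ, F))) p).symmL ℝ q z)
  rw [tangentCoord_symmL (I := I) hq] at h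
  exact (symmL_fibreCoord_tangent (I := I) hq _).symm.trans
    (congrArg ((trivializationAt EM (TangentSpace I) p.1).symmL ℝ q.1) h.symm)

variable (I F E) in
theorem symm_mem_coordSource {x₀ : M} {y : EM} (hy : y ∈ coordDomain I F E x₀) :
    (extChartAt I x₀).symm y ∈ coordSource (H := H) F E x₀ := by
  refine ⟨?_, hy.2⟩
  rw [← extChartAt_source (I := I)]
  exact (extChartAt I x₀).map_target hy.1

theorem mem_extChartAt_source_of_coordSource {x₀ x : M} (hx : x ∈ coordSource (H := H) F E x₀) :
    x ∈ (extChartAt I x₀).source := by rw [extChartAt_source]; exact hx.1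

theorem extChartAt_mem_coordDomain {x₀ x : M} (hx : x ∈ coordSource (H := H) F E x₀) :
    extChartAt I x₀ x ∈ coordDomain I F E x₀ := by
  have h := mem_extChartAt_source_of_coordSource (I := I) hx
  refine ⟨(extChartAt I x₀).map_source h, ?_⟩
  rw [Set.mem_preimage, (extChartAt I x₀).left_inv h]
  exact hx.2

/-- `TM` is trivialized over the chart domain, and duals and sums over the same sets as their
ingredients, so `E`, the side and the core share one coordinate domain. -/
theorem coordDomain_side_core (x₀ : M) :
    coordDomain I F E x₀ = coordDomain I (EM × (F →L[ℝ] ℝ)) (Side I E) x₀ ∧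
    coordDomain I F E x₀ = coordDomain I (F × (EM →L[ℝ] ℝ)) (Core I E) x₀ := by
  constructor
  · ext y
    exact ⟨fun hy => ⟨hy.1, coordSource_subset_side (symm_mem_coordSource I F E hy)⟩,
      fun hy => ⟨hy.1, hy.2.2.1⟩⟩
  · ext y
    exact ⟨fun hy => ⟨hy.1, coordSource_subset_core (symm_mem_coordSource I F E hy)⟩,
      fun hy => ⟨hy.1, hy.2.1⟩⟩

theorem contDiffOn_reading_side (x₀ : M) (ν : SideSection I F E) :
    ContDiffOn ℝ ∞ (reading I (EM × (F →L[ℝ] ℝ)) x₀ ν) (coordDomain I F E x₀) := by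
  rw [(coordDomain_side_core x₀).1]; exact contDiffOn_reading x₀ ν.contMDiff

theorem contDiffOn_reading_core (x₀ : M) (τ : CoreSection I F E) :
    ContDiffOn ℝ ∞ (reading I (F × (EM →L[ℝ] ℝ)) x₀ τ) (coordDomain I F E x₀) := by
  rw [(coordDomain_side_core x₀).2]; exact contDiffOn_reading x₀ τ.contMDiff

theorem contDiffAt_reading_side {x₀ x : M} (hx : x ∈ coordSource (H := H) F E x₀)
    (ν : SideSection I F E) :
    ContDiffAt ℝ ∞ (reading I (EM × (F →L[ℝ] ℝ)) x₀ ν) (extChartAt I x₀ x) :=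
  (contDiffOn_reading_side x₀ ν).contDiffAt
    ((isOpen_coordDomain x₀).mem_nhds (extChartAt_mem_coordDomain hx))

theorem contDiffAt_reading_core {x₀ x : M} (hx : x ∈ coordSource (H := H) F E x₀)
    (τ : CoreSection I F E) :
    ContDiffAt ℝ ∞ (reading I (F × (EM →L[ℝ] ℝ)) x₀ τ) (extChartAt I x₀ x) :=
  (contDiffOn_reading_core x₀ τ).contDiffAt
    ((isOpen_coordDomain x₀).mem_nhds (extChartAt_mem_coordDomain hx))

/-- The linear function `ℓ_ε` on `E` of a section `(X, ε)`, in coordinates. -/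
theorem mvfderiv_linear {p q : TotalSpace F E} (hq : q.1 ∈ coordSource (H := H) F E p.1)
    (ν : SideSection I F E) (v : TE I F E q) :
    mvfderiv (I.prod 𝓘(ℝ, F)) (fun r : TotalSpace F E => (ν r.1).2 r.2) q v =
      (fderiv ℝ (reading I (EM × (F →L[ℝ] ℝ)) p.1 ν) (extChartAt I p.1 q.1)
        (tangentCoord I p q v).1).2 (fibreCoord F E p.1 q.1 q.2) +
      (sideCoord I F E p.1 q.1 (ν q.1)).2 (tangentCoord I p q v).2 := by
  set y := extChartAt I p.1 q.1
  set f := fibreCoord F E p.1 q.1 q.2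
  set a := reading I (EM × (F →L[ℝ] ℝ)) p.1 ν
  have ha : ContDiffAt ℝ ∞ a y := contDiffAt_reading_side hq ν
  have hg : ∀ r : TotalSpace F E, r.1 ∈ coordSource (H := H) F E p.1 →
      (ν r.1).2 r.2 = (a (extChartAt I p.1 r.1)).2 (fibreCoord F E p.1 r.1 r.2) := by
    intro r hr
    have h1 : a (extChartAt I p.1 r.1) = sideCoord I F E p.1 r.1 (ν r.1) :=
      reading_extChartAt (mem_extChartAt_source_of_coordSource hr) ν
    rw [h1, sideCoord_apply hr]
    exact congrArg (ν r.1).2 (symmL_fibreCoord (H := H) hr r.2).symm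
  -- In coordinates `ℓ_ε` is `(y, f) ↦ ε(y) f`; the product rule gives one term along the base and
  -- one along the fibre.
  have hL : HasFDerivAt (fun z : EM × F => (a z.1).2 z.2)
      ((a y).2.comp (ContinuousLinearMap.snd ℝ EM F) +
        (((ContinuousLinearMap.snd ℝ EM (F →L[ℝ] ℝ)).comp (fderiv ℝ a y)).comp
          (ContinuousLinearMap.fst ℝ EM F)).flip f) (y, f) := by
    have h1 : HasFDerivAt (fun z : EM × F => (a z.1).2)
      (((ContinuousLinearMap.snd ℝ EM (F →L[ℝ] ℝ)).comp (fderiv ℝ a y)).comp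
        (ContinuousLinearMap.fst ℝ EM F)) (y, f) :=
      HasFDerivAt.comp (y, f) (g := fun z => (a z).2)
        ((ha.differentiableAt (by simp)).hasFDerivAt.snd) hasFDerivAt_fst
    exact h1.clm_apply hasFDerivAt_snd
  have hE : extChartAt (I.prod 𝓘(ℝ, F)) p q = (y, f) := extChartAt_totalSpace hq
  have h2 := (hE ▸ hL.hasMFDerivAt : HasMFDerivAt 𝓘(ℝ, EM × F) 𝓘(ℝ, ℝ) _
    (extChartAt (I.prod 𝓘(ℝ, F)) p q) _).comp q (hasMFDerivAt_extChartAt_totalSpace hq)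
  have h3 := h2.congr_of_eventuallyEq (f₁ := fun r : TotalSpace F E => (ν r.1).2 r.2) (by
    filter_upwards [eventually_coordSource hq] with r hr
    rw [hg r hr, Function.comp_apply, extChartAt_totalSpace hr])
  have h4 := congrArg (fun L => L v) h3.mfderiv
  refine h4.trans ?_
  have hay : a y = sideCoord I F E p.1 q.1 (ν q.1) :=
    reading_extChartAt (mem_extChartAt_source_of_coordSource hq) ν
  rw [← hay]
  change (a y).2 (tangentCoord I p q v).2 + (fderiv ℝ a y (tangentCoord I p q v).1).2 f = _
  ring

end SideCore

/-! ### Tensorial maps on sections are pointwise. -/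

section Tensorial

variable {EM : Type*} [NormedAddCommGroup EM] [NormedSpace ℝ EM] [FiniteDimensional ℝ EM]
  {H : Type*} [TopologicalSpace H] {I : ModelWithCorners ℝ EM H}
  {M : Type*} [TopologicalSpace M] [T2Space M] [ChartedSpace H M] [IsManifold I ∞ M]
  {F : Type*} [NormedAddCommGroup F] [NormedSpace ℝ F] [FiniteDimensional ℝ F]
  {V : M → Type*} [TopologicalSpace (TotalSpace F V)]
  [∀ x, AddCommGroup (V x)] [∀ x, Module ℝ (V x)] [∀ x, TopologicalSpace (V x)]
  [FiberBundle F V] [VectorBundle ℝ F V] [ContMDiffVectorBundle ∞ F V I]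

@[simp]
theorem fsmul_apply (f : C^∞⟮I, M; ℝ⟯) (s : Cₛ^∞⟮I; F, V⟯) (x : M) : fsmul f s x = f x • s x := rfl

@[simp]
theorem BundleEnd.onSections_apply (j : BundleEnd I F V) (s : Cₛ^∞⟮I; F, V⟯) (x : M) :
    j.onSections s x = j.app x (s x) := rfl

@[simp]
theorem BundleEnd.onSections_add (j : BundleEnd I F V) (s t : Cₛ^∞⟮I; F, V⟯) :
    j.onSections (s + t) = j.onSections s + j.onSections t := by
  ext x; simp

@[simp]
theorem BundleEnd.onSections_smul (j : BundleEnd I F V) (r : ℝ) (s : Cₛ^∞⟮I; F, V⟯) :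
    j.onSections (r • s) = r • j.onSections s := by
  ext x; simp

theorem contMDiffOn_fibreCoord (x₀ : M) (s : Cₛ^∞⟮I; F, V⟯) :
    ContMDiffOn I 𝓘(ℝ, F) ∞ (fun x => fibreCoord F V x₀ x (s x))
      (trivializationAt F V x₀).baseSet := by
  refine (((trivializationAt F V x₀).contMDiffOn_section_baseSet_iff (n := ∞) (IB := I)).1
    s.contMDiff.contMDiffOn).congr fun x hx => ?_
  rw [fibreCoord, Trivialization.continuousLinearMapAt_apply_of_mem ℝ _ hx]

/-- Near a given point every section is a combination of finitely many given global sections. -/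
theorem exists_decomposition (x₀ : M) :
    ∃ c : F →ₗ[ℝ] Cₛ^∞⟮I; F, V⟯, (∀ᶠ x in 𝓝 x₀, x ∈ (trivializationAt F V x₀).baseSet ∧
      ∀ v, c v x = (trivializationAt F V x₀).symmL ℝ x v) ∧
    ∃ χ : C^∞⟮I, M; ℝ⟯, (∀ᶠ x in 𝓝 x₀, χ x = 1) ∧ ∀ (s : Cₛ^∞⟮I; F, V⟯) {n : ℕ}
      (b : Module.Basis (Fin n) ℝ F), ∃ g : Fin n → C^∞⟮I, M; ℝ⟯,
      (∀ i x, g i x = χ x * b.repr (fibreCoord F V x₀ x (s x)) i) ∧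
      fsmul χ s = ∑ i, fsmul (g i) (c (b i)) := by
  obtain ⟨c, hc⟩ := exists_constSection (I := I) (F := F) (V := V) x₀
  obtain ⟨χ, hχ, hχ1⟩ := exists_bump (I := I) hc
  refine ⟨c, hc, χ, hχ1, fun s n b => ?_⟩
  have hbase : tsupport χ ⊆ (trivializationAt F V x₀).baseSet := fun x hx => (hχ hx).1
  have hg : ∀ i, ContMDiff I 𝓘(ℝ, ℝ) ∞
      (fun x => χ x * b.repr (fibreCoord F V x₀ x (s x)) i) := by
    intro i
    refine contMDiff_of_tsupport fun x hx => ?_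
    have hx' : x ∈ tsupport χ := closure_mono (Function.support_mul_subset_left _ _) hx
    have h1 : ContMDiffAt I 𝓘(ℝ, F) ∞ (fun x => fibreCoord F V x₀ x (s x)) x :=
      (contMDiffOn_fibreCoord x₀ s).contMDiffAt
        ((trivializationAt F V x₀).open_baseSet.mem_nhds (hbase hx'))
    have h2 : ContMDiff 𝓘(ℝ, F) 𝓘(ℝ, ℝ) ∞ (fun v => b.repr v i) :=
      (LinearMap.toContinuousLinearMap (b.coord i)).contDiff.contMDiff
    exact (χ.contMDiff x).mul (h2.contMDiffAt.comp x h1)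
  refine ⟨fun i => ⟨_, hg i⟩, fun i x => rfl, ?_⟩
  ext x
  have hsum : (∑ i, fsmul (⟨_, hg i⟩ : C^∞⟮I, M; ℝ⟯) (c (b i)) : Cₛ^∞⟮I; F, V⟯) x =
      ∑ i, (χ x * b.repr (fibreCoord F V x₀ x (s x)) i) • c (b i) x := by
    have := map_sum (ContMDiffSection.coeAddHom I F ∞ V)
      (fun i => fsmul (⟨_, hg i⟩ : C^∞⟮I, M; ℝ⟯) (c (b i))) Finset.univ
    have h2 := congrFun this x
    rw [Finset.sum_apply] at h2
    exact h2
  rw [hsum, fsmul_apply]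
  by_cases hx : x ∈ tsupport χ
  · have h := hχ hx
    simp only [h.2, mul_smul, ← map_smul, ← Finset.smul_sum, ← map_sum]
    rw [b.sum_repr]
    simp only [map_smul, Trivialization.symmL_continuousLinearMapAt _ h.1]
  · have : χ x = 0 := image_eq_zero_of_notMem_tsupport hx
    simp [this]

/-- `C^∞`-linear maps on sections are pointwise. -/
theorem eq_of_section_eq {A : Type*} [AddCommGroup A] [Module ℝ A] {x₀ : M}
    {L : Cₛ^∞⟮I; F, V⟯ → A} (hadd : ∀ s t, L (s + t) = L s + L t)
    (hsmul : ∀ f s, L (fsmul f s) = f x₀ • L s) {s t : Cₛ^∞⟮I; F, V⟯} (h : s x₀ = t x₀) :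
    L s = L t := by
  obtain ⟨c, hc, χ, hχ, hdec⟩ := exists_decomposition (I := I) (F := F) (V := V) x₀
  let L' : Cₛ^∞⟮I; F, V⟯ →+ A := AddMonoidHom.mk' L hadd
  -- Multiplying by `χ`, which is `1` at `x₀`, does not change `L s`; the frame decomposition then
  -- expresses `L s` through `s x₀` alone.
  have key : ∀ s, L s = ∑ i, (Module.finBasis ℝ F).repr (fibreCoord F V x₀ x₀ (s x₀)) i •
      L (c (Module.finBasis ℝ F i)) := by
    intro s
    obtain ⟨g, hg, hs⟩ := hdec s (Module.finBasis ℝ F)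
    have h1 : L (fsmul χ s) = L s := by rw [hsmul, hχ.self_of_nhds, one_smul]
    rw [← h1, hs]
    change L' _ = _
    rw [map_sum]
    refine Finset.sum_congr rfl fun i _ => ?_
    change L _ = _
    rw [hsmul, hg, hχ.self_of_nhds, one_mul]
  rw [key s, key t, h]

/-- `L` factors through evaluation at `x₀`: a vector is extended to any section, and
`eq_of_section_eq` makes the choice irrelevant. Real homogeneity is the case of constant functions.
-/
theorem exists_pointwise {A : Type*} [AddCommGroup A] [Module ℝ A] (x₀ : M)
    {L : Cₛ^∞⟮I; F, V⟯ → A} (hadd : ∀ s t, L (s + t) = L s + L t)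
    (hsmul : ∀ f s, L (fsmul f s) = f x₀ • L s) :
    ∃ B : V x₀ →ₗ[ℝ] A, ∀ s, B (s x₀) = L s := by
  choose S hS using fun v : V x₀ => exists_section_eq (I := I) (F := F) (V := V) x₀ v
  have h := fun {s t} => eq_of_section_eq (s := s) (t := t) hadd hsmul
  refine ⟨{ toFun := fun v => L (S v), map_add' := ?_, map_smul' := ?_ }, fun s => h (hS _)⟩
  · intro v w
    rw [← hadd]; exact h (by simp [hS])
  · intro r v
    have := hsmul (ContMDiffMap.const r) (S v)
    refine Eq.trans (h ?_) this
    simp only [hS, fsmul_apply]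
    rfl

end Tensorial

/-! ### The duality between side and core. -/

section Duality

variable {EM : Type*} [NormedAddCommGroup EM] [NormedSpace ℝ EM] [FiniteDimensional ℝ EM]
  {H : Type*} [TopologicalSpace H] {I : ModelWithCorners ℝ EM H} [I.Boundaryless]
  {M : Type*} [TopologicalSpace M] [T2Space M] [ChartedSpace H M] [IsManifold I ∞ M]
  {F : Type*} [NormedAddCommGroup F] [NormedSpace ℝ F] [FiniteDimensional ℝ F]
  {E : M → Type*} [TopologicalSpace (TotalSpace F E)]
  [∀ x, AddCommGroup (E x)] [∀ x, Module ℝ (E x)] [∀ x, TopologicalSpace (E x)]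
  [FiberBundle F E] [VectorBundle ℝ F E] [ContMDiffVectorBundle ∞ F E I]

theorem pairing_add_left {x : M} (ν ν' : Side I E x) (τ : Core I E x) :
    pairing (ν + ν') τ = pairing ν τ + pairing ν' τ := by
  simp [pairing]; ring

theorem pairing_add_right {x : M} (ν : Side I E x) (τ τ' : Core I E x) :
    pairing ν (τ + τ') = pairing ν τ + pairing ν τ' := by
  simp [pairing]; ring

theorem pairing_smul_left {x : M} (r : ℝ) (ν : Side I E x) (τ : Core I E x) :
    pairing (r • ν) τ = r * pairing ν τ := by
  simp [pairing]; ring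

theorem pairing_smul_right {x : M} (r : ℝ) (ν : Side I E x) (τ : Core I E x) :
    pairing ν (r • τ) = r * pairing ν τ := by
  simp [pairing]; ring

theorem pairing_neg_left {x : M} (ν : Side I E x) (τ : Core I E x) :
    pairing (-ν) τ = -pairing ν τ := by
  simp [pairing]; ring

theorem pairing_neg_right {x : M} (ν : Side I E x) (τ : Core I E x) :
    pairing ν (-τ) = -pairing ν τ := by
  simp [pairing]; ring

theorem pairing_sub_left {x : M} (ν ν' : Side I E x) (τ : Core I E x) :
    pairing (ν - ν') τ = pairing ν τ - pairing ν' τ := by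
  simp [pairing]; ring

theorem pairing_sub_right {x : M} (ν : Side I E x) (τ τ' : Core I E x) :
    pairing ν (τ - τ') = pairing ν τ - pairing ν τ' := by
  simp [pairing]; ring

theorem exists_coreCoord {x₀ x : M} (hx : x ∈ coordSource (H := H) F E x₀)
    (t : F × (EM →L[ℝ] ℝ)) : ∃ τ : Core I E x, coreCoord I F E x₀ x τ = t :=
  ⟨_, Trivialization.continuousLinearMapAt_symmL (R := ℝ)
    (trivializationAt (F × (EM →L[ℝ] ℝ)) (Core I E) x₀) (coordSource_subset_core hx) t⟩

theorem exists_sideCoord {x₀ x : M} (hx : x ∈ coordSource (H := H) F E x₀)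
    (t : EM × (F →L[ℝ] ℝ)) : ∃ ν : Side I E x, sideCoord I F E x₀ x ν = t :=
  ⟨_, Trivialization.continuousLinearMapAt_symmL (R := ℝ)
    (trivializationAt (EM × (F →L[ℝ] ℝ)) (Side I E) x₀) (coordSource_subset_side hx) t⟩

theorem modelDuality_ext_left {W G : Type*} [NormedAddCommGroup W] [NormedSpace ℝ W]
    [NormedAddCommGroup G] [NormedSpace ℝ G] {ν ν' : W × (G →L[ℝ] ℝ)}
    (h : ∀ τ, modelDuality ν τ = modelDuality ν' τ) : ν = ν' := by
  refine Prod.ext ?_ ?_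
  · refine (SeparatingDual.eq_iff_forall_dual_eq (R := ℝ)).2 fun θ => ?_
    simpa [modelDuality] using h (0, θ)
  · ext f
    simpa [modelDuality] using h (f, 0)

theorem modelDuality_ext_right {W G : Type*} [NormedAddCommGroup W] [NormedSpace ℝ W]
    [NormedAddCommGroup G] [NormedSpace ℝ G] {τ τ' : G × (W →L[ℝ] ℝ)}
    (h : ∀ ν, modelDuality ν τ = modelDuality ν τ') : τ = τ' := by
  refine Prod.ext ?_ ?_
  · refine (SeparatingDual.eq_iff_forall_dual_eq (R := ℝ)).2 fun θ => ?_
    simpa [modelDuality] using h (0, θ)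
  · ext f
    simpa [modelDuality] using h (f, 0)

/-- Non-degeneracy is inherited from the model. The pairing does not mention the model fibre `F`,
which is therefore an explicit argument. -/
theorem pairing_ext_left (F : Type*) [NormedAddCommGroup F] [NormedSpace ℝ F] [FiniteDimensional ℝ F]
    [TopologicalSpace (TotalSpace F E)] [FiberBundle F E] [VectorBundle ℝ F E]
    [ContMDiffVectorBundle ∞ F E I] {x : M} {ν ν' : Side I E x}
    (h : ∀ τ, pairing ν τ = pairing ν' τ) :
    ν = ν' := by
  have hx := mem_coordSource_self (H := H) (F := F) (E := E) x
  refine sideCoord_injective hx (modelDuality_ext_left fun t => ?_)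
  obtain ⟨τ, rfl⟩ := exists_coreCoord (I := I) hx t
  rw [modelDuality_coord hx, modelDuality_coord hx, h]

theorem pairing_ext_right (F : Type*) [NormedAddCommGroup F] [NormedSpace ℝ F] [FiniteDimensional ℝ F]
    [TopologicalSpace (TotalSpace F E)] [FiberBundle F E] [VectorBundle ℝ F E]
    [ContMDiffVectorBundle ∞ F E I] {x : M} {τ τ' : Core I E x}
    (h : ∀ ν, pairing ν τ = pairing ν τ') :
    τ = τ' := by
  have hx := mem_coordSource_self (H := H) (F := F) (E := E) x
  refine coreCoord_injective hx (modelDuality_ext_right fun t => ?_)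
  obtain ⟨ν, rfl⟩ := exists_sideCoord (I := I) hx t
  rw [modelDuality_coord hx, modelDuality_coord hx, h]

theorem contMDiff_pairing (ν : SideSection I F E) (τ : CoreSection I F E) :
    ContMDiff I 𝓘(ℝ, ℝ) ∞ (fun x => pairing (ν x) (τ x)) := by
  intro x₀
  have h1 := contDiffAt_reading_side (mem_coordSource_self (H := H) (F := F) (E := E) x₀) ν
  have h2 := contDiffAt_reading_core (mem_coordSource_self (H := H) (F := F) (E := E) x₀) τ
  have h3 : ContDiffAt ℝ ∞ (fun y => modelDuality (reading I (EM × (F →L[ℝ] ℝ)) x₀ ν y)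
      (reading I (F × (EM →L[ℝ] ℝ)) x₀ τ y)) (extChartAt I x₀ x₀) :=
    ((contDiffAt_snd.comp _ h1).clm_apply (contDiffAt_fst.comp _ h2)).add
      ((contDiffAt_snd.comp _ h2).clm_apply (contDiffAt_fst.comp _ h1))
  have h4 : ContMDiffAt I 𝓘(ℝ, ℝ) ∞ _ x₀ := h3.contMDiffAt.comp x₀ (contMDiffAt_extChartAt)
  refine h4.congr_of_eventuallyEq ?_
  filter_upwards [coordSource_mem_nhds (H := H) (F := F) (E := E) x₀] with x hx
  have hs := mem_extChartAt_source_of_coordSource (I := I) hx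
  rw [Function.comp_apply, reading_extChartAt hs, reading_extChartAt hs, modelDuality_coord hx]

/-- The smooth function `⟨ν, τ⟩`. -/
def pairingMap (ν : SideSection I F E) (τ : CoreSection I F E) : C^∞⟮I, M; ℝ⟯ :=
  ⟨fun x => pairing (ν x) (τ x), contMDiff_pairing ν τ⟩

end Duality

section ModelDuality

variable {W G : Type*} [NormedAddCommGroup W] [NormedSpace ℝ W] [FiniteDimensional ℝ W]
  [NormedAddCommGroup G] [NormedSpace ℝ G] [FiniteDimensional ℝ G]

/-- The restriction of `ℓ` to `W` is the covector, and its restriction to the dual of `G` is an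
evaluation, since `G` is its own bidual. -/
theorem exists_modelDuality_eq (ℓ : W × (G →L[ℝ] ℝ) →ₗ[ℝ] ℝ) :
    ∃ τ : G × (W →L[ℝ] ℝ), ∀ ν, modelDuality ν τ = ℓ ν := by
  refine ⟨((Module.evalEquiv ℝ G).symm (ℓ ∘ₗ LinearMap.inr ℝ W (G →L[ℝ] ℝ) ∘ₗ
    (LinearMap.toContinuousLinearMap : (G →ₗ[ℝ] ℝ) ≃ₗ[ℝ] (G →L[ℝ] ℝ)).toLinearMap),
    LinearMap.toContinuousLinearMap (ℓ ∘ₗ LinearMap.inl ℝ W (G →L[ℝ] ℝ))), fun ν => ?_⟩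
  have h := Module.apply_evalEquiv_symm_apply ℝ G ν.2.toLinearMap
    (ℓ ∘ₗ LinearMap.inr ℝ W (G →L[ℝ] ℝ) ∘ₗ
      (LinearMap.toContinuousLinearMap : (G →ₗ[ℝ] ℝ) ≃ₗ[ℝ] (G →L[ℝ] ℝ)).toLinearMap)
  rw [ContinuousLinearMap.coe_coe] at h
  rw [modelDuality, h]
  simp only [LinearMap.comp_apply, LinearMap.coe_toContinuousLinearMap', LinearMap.inr_apply,
    LinearMap.inl_apply, LinearEquiv.coe_coe]
  rw [← map_add]
  congr 1
  ext <;> simp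

/-- Pairing with a basis of `W` and a dual basis of `G` recovers all coordinates of `f`. -/
theorem contDiffAt_of_modelDuality {Z : Type*} [NormedAddCommGroup Z] [NormedSpace ℝ Z]
    {f : Z → G × (W →L[ℝ] ℝ)} {z : Z}
    (h : ∀ ν, ContDiffAt ℝ ∞ (fun y => modelDuality ν (f y)) z) : ContDiffAt ℝ ∞ f z := by
  have h1 : ContDiffAt ℝ ∞ (fun y => (f y).1) z := by
    let b := Module.finBasis ℝ G
    have : (fun y => (f y).1) = fun y => ∑ i, b.repr (f y).1 i • b i := by
      funext y; rw [b.sum_repr]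
    rw [this]
    refine ContDiffAt.sum fun i _ => ContDiffAt.smul ?_ contDiffAt_const
    refine (h (0, LinearMap.toContinuousLinearMap (b.coord i))).congr_of_eventuallyEq
      (.of_forall fun y => ?_)
    simp [modelDuality]
  have h2 : ContDiffAt ℝ ∞ (fun y => (f y).2) z := by
    let b := Module.finBasis ℝ W
    have : (fun y => (f y).2) =
        fun y => ∑ i, (f y).2 (b i) • LinearMap.toContinuousLinearMap (b.coord i) := by
      funext y
      refine ContinuousLinearMap.ext fun w => ?_
      conv_lhs => rw [← b.sum_repr w, map_sum]
      simp [mul_comm]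
    rw [this]
    refine ContDiffAt.sum fun i _ => ?_
    have h3 : ContDiffAt ℝ ∞ (fun y => (f y).2 (b i)) z :=
      (h (b i, 0)).congr_of_eventuallyEq (.of_forall fun y => by simp [modelDuality])
    exact h3.smul contDiffAt_const
  exact h1.prodMk h2

theorem modelDuality_comm (ν : W × (G →L[ℝ] ℝ)) (τ : G × (W →L[ℝ] ℝ)) :
    modelDuality ν τ = modelDuality τ ν := add_comm _ _

end ModelDuality

section Duality

variable {EM : Type*} [NormedAddCommGroup EM] [NormedSpace ℝ EM] [FiniteDimensional ℝ EM]
  {H : Type*} [TopologicalSpace H] {I : ModelWithCorners ℝ EM H} [I.Boundaryless]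
  {M : Type*} [TopologicalSpace M] [T2Space M] [ChartedSpace H M] [IsManifold I ∞ M]
  {F : Type*} [NormedAddCommGroup F] [NormedSpace ℝ F] [FiniteDimensional ℝ F]
  {E : M → Type*} [TopologicalSpace (TotalSpace F E)]
  [∀ x, AddCommGroup (E x)] [∀ x, Module ℝ (E x)] [∀ x, TopologicalSpace (E x)]
  [FiberBundle F E] [VectorBundle ℝ F E] [ContMDiffVectorBundle ∞ F E I]

theorem contDiffAt_comp_symm {N G : Type*} [TopologicalSpace N] [ChartedSpace H N]
    [IsManifold I ∞ N] [NormedAddCommGroup G] [NormedSpace ℝ G] {f : N → G}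
    (hf : ContMDiff I 𝓘(ℝ, G) ∞ f) (x : N) :
    ContDiffAt ℝ ∞ (f ∘ (extChartAt I x).symm) (extChartAt I x x) := by
  rw [← contMDiffAt_iff_contDiffAt]
  exact hf.contMDiffAt.comp _ ((contMDiffOn_extChartAt_symm x).contMDiffAt
    (extChartAt_target_mem_nhds x))

/-- Tensoriality gives a functional on each fibre, which is represented by the perfect pairing.
Smoothness is tested on sections constant in coordinates. Smooth core sections are mostly obtained
from this statement. -/
theorem exists_coreSection (L : SideSection I F E → C^∞⟮I, M; ℝ⟯)
    (hadd : ∀ s t x, L (s + t) x = L s x + L t x) (hsmul : ∀ f s x, L (fsmul f s) x = f x * L s x) :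
    ∃ τ : CoreSection I F E, ∀ ν x, pairing (ν x) (τ x) = L ν x := by
  have hp : ∀ x, ∃ τ : Core I E x, ∀ ν : SideSection I F E, pairing (ν x) τ = L ν x := by
    intro x
    obtain ⟨B, hB⟩ := exists_pointwise (I := I) (V := Side I E) x (L := fun s => L s x)
      (fun s t => hadd s t x) (fun f s => hsmul f s x)
    have hx := mem_coordSource_self (H := H) (F := F) (E := E) x
    obtain ⟨t, ht⟩ := exists_modelDuality_eq (B ∘ₗ
      ((trivializationAt (EM × (F →L[ℝ] ℝ)) (Side I E) x).symmL ℝ x).toLinearMap)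
    obtain ⟨τ, rfl⟩ := exists_coreCoord (I := I) hx t
    refine ⟨τ, fun ν => ?_⟩
    rw [← modelDuality_coord hx, ht, ← hB]
    exact congrArg B (Trivialization.symmL_continuousLinearMapAt (R := ℝ)
      (trivializationAt (EM × (F →L[ℝ] ℝ)) (Side I E) x) (coordSource_subset_side hx) (ν x))
  choose τ hτ using hp
  refine ⟨⟨τ, fun x₀ => ?_⟩, fun ν x => hτ x ν⟩
  refine contMDiffAt_section_of_reading (V := Core I E) (contDiffAt_of_modelDuality fun ν => ?_)
  obtain ⟨c, hc⟩ := exists_constSection (I := I) (F := EM × (F →L[ℝ] ℝ)) (V := Side I E) x₀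
  refine (contDiffAt_comp_symm (L (c ν)).contMDiff x₀).congr_of_eventuallyEq ?_
  have hs : ContinuousAt (extChartAt I x₀).symm (extChartAt I x₀ x₀) :=
    continuousAt_extChartAt_symm x₀
  filter_upwards [hs.eventually (by rw [extChartAt_to_inv]; exact hc),
    coordDomain_mem_nhds (I := I) (F := F) (V := E) x₀] with y hy hy'
  have hx := symm_mem_coordSource I F E hy'
  have h1 : sideCoord I F E x₀ _ (c ν ((extChartAt I x₀).symm y)) = ν :=
    (congrArg _ (hy.2 ν)).trans (Trivialization.continuousLinearMapAt_symmL (R := ℝ)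
    (trivializationAt (EM × (F →L[ℝ] ℝ)) (Side I E) x₀) hy.1 ν)
  rw [Function.comp_apply]
  refine Eq.trans ?_ (hτ _ (c ν))
  rw [← modelDuality_coord hx, h1]
  rfl

/-- The same with side and core exchanged; this produces dull brackets. -/
theorem exists_sideSection (L : CoreSection I F E → C^∞⟮I, M; ℝ⟯)
    (hadd : ∀ s t x, L (s + t) x = L s x + L t x) (hsmul : ∀ f s x, L (fsmul f s) x = f x * L s x) :
    ∃ ν : SideSection I F E, ∀ τ x, pairing (ν x) (τ x) = L τ x := by
  have hp : ∀ x, ∃ ν : Side I E x, ∀ τ : CoreSection I F E, pairing ν (τ x) = L τ x := by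
    intro x
    obtain ⟨B, hB⟩ := exists_pointwise (I := I) (V := Core I E) x (L := fun s => L s x)
      (fun s t => hadd s t x) (fun f s => hsmul f s x)
    have hx := mem_coordSource_self (H := H) (F := F) (E := E) x
    obtain ⟨t, ht⟩ := exists_modelDuality_eq (B ∘ₗ
      ((trivializationAt (F × (EM →L[ℝ] ℝ)) (Core I E) x).symmL ℝ x).toLinearMap)
    obtain ⟨ν, rfl⟩ := exists_sideCoord (I := I) hx t
    refine ⟨ν, fun τ => ?_⟩
    rw [← modelDuality_coord hx, modelDuality_comm, ht, ← hB]
    exact congrArg B (Trivialization.symmL_continuousLinearMapAt (R := ℝ)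
      (trivializationAt (F × (EM →L[ℝ] ℝ)) (Core I E) x) (coordSource_subset_core hx) (τ x))
  choose ν hν using hp
  refine ⟨⟨ν, fun x₀ => ?_⟩, fun τ x => hν x τ⟩
  refine contMDiffAt_section_of_reading (V := Side I E) (contDiffAt_of_modelDuality fun τ => ?_)
  obtain ⟨c, hc⟩ := exists_constSection (I := I) (F := F × (EM →L[ℝ] ℝ)) (V := Core I E) x₀
  refine (contDiffAt_comp_symm (L (c τ)).contMDiff x₀).congr_of_eventuallyEq ?_
  have hs : ContinuousAt (extChartAt I x₀).symm (extChartAt I x₀ x₀) :=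
    continuousAt_extChartAt_symm x₀
  filter_upwards [hs.eventually (by rw [extChartAt_to_inv]; exact hc),
    coordDomain_mem_nhds (I := I) (F := F) (V := E) x₀] with y hy hy'
  have hx := symm_mem_coordSource I F E hy'
  have h1 : coreCoord I F E x₀ _ (c τ ((extChartAt I x₀).symm y)) = τ :=
    (congrArg _ (hy.2 τ)).trans (Trivialization.continuousLinearMapAt_symmL (R := ℝ)
    (trivializationAt (F × (EM →L[ℝ] ℝ)) (Core I E) x₀) hy.1 τ)
  rw [Function.comp_apply]
  refine Eq.trans ?_ (hν _ (c τ))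
  rw [← modelDuality_coord hx, h1, modelDuality_comm]
  rfl

end Duality

/-! ### Smoothness of fibrewise linear maps. -/

section FibrewiseLinear

variable {EM : Type*} [NormedAddCommGroup EM] [NormedSpace ℝ EM] [FiniteDimensional ℝ EM]
  {H : Type*} [TopologicalSpace H] {I : ModelWithCorners ℝ EM H}
  {M : Type*} [TopologicalSpace M] [T2Space M] [ChartedSpace H M] [IsManifold I ∞ M]
  {F : Type*} [NormedAddCommGroup F] [NormedSpace ℝ F] [FiniteDimensional ℝ F]
  {V : M → Type*} [TopologicalSpace (TotalSpace F V)]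
  [∀ x, AddCommGroup (V x)] [∀ x, Module ℝ (V x)] [∀ x, TopologicalSpace (V x)]
  [FiberBundle F V] [VectorBundle ℝ F V] [ContMDiffVectorBundle ∞ F V I]
  {F' : Type*} [NormedAddCommGroup F'] [NormedSpace ℝ F']
  {V' : M → Type*} [TopologicalSpace (TotalSpace F' V')]
  [∀ x, AddCommGroup (V' x)] [∀ x, Module ℝ (V' x)] [∀ x, TopologicalSpace (V' x)]
  [FiberBundle F' V'] [VectorBundle ℝ F' V'] [ContMDiffVectorBundle ∞ F' V' I]

/-- A fibrewise linear map is smooth if it maps sufficiently many smooth sections to smooth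
sections. -/
theorem contMDiff_of_sections (A : ∀ x, V x →ₗ[ℝ] V' x)
    (h : ∀ x₀ (v : V x₀), ∃ s : Cₛ^∞⟮I; F, V⟯, s x₀ = v ∧
      ContMDiffAt I (I.prod 𝓘(ℝ, F')) ∞ (fun x => (⟨x, A x (s x)⟩ : TotalSpace F' V')) x₀) :
    ContMDiff (I.prod 𝓘(ℝ, F)) (I.prod 𝓘(ℝ, F')) ∞
      (fun v : TotalSpace F V => (⟨v.1, A v.1 v.2⟩ : TotalSpace F' V')) := by
  intro v₀
  set x₀ := v₀.1
  have hb : x₀ ∈ (trivializationAt F V x₀).baseSet := mem_baseSet_trivializationAt F V x₀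
  have hb' : x₀ ∈ (trivializationAt F' V' x₀).baseSet := mem_baseSet_trivializationAt F' V' x₀
  let b := Module.finBasis ℝ F
  choose s hs hA using fun i => h x₀ ((trivializationAt F V x₀).symmL ℝ x₀ (b i))
  let β : Fin (Module.finrank ℝ F) → (F →L[ℝ] ℝ) := fun i =>
    LinearMap.toContinuousLinearMap (b.coord i)
  -- `S` is the matrix of the sections `s i` and `T` that of their images. Since `S x₀` is the
  -- identity, `S` is invertible near `x₀`, and there `A` reads as `T ∘ S⁻¹`, a smooth family.
  let S : M → F →L[ℝ] F := fun x => ∑ i, (β i).smulRight (fibreCoord F V x₀ x (s i x))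
  let T : M → F →L[ℝ] F' := fun x => ∑ i, (β i).smulRight (fibreCoord F' V' x₀ x (A x (s i x)))
  have hS : ContMDiffAt I 𝓘(ℝ, F →L[ℝ] F) ∞ S x₀ := by
    refine ContMDiffAt.sum fun i _ => ?_
    have h1 : ContMDiffAt I 𝓘(ℝ, F) ∞ (fun x => fibreCoord F V x₀ x (s i x)) x₀ :=
      (contMDiffOn_fibreCoord x₀ (s i)).contMDiffAt
        ((trivializationAt F V x₀).open_baseSet.mem_nhds hb)
    exact (((ContinuousLinearMap.smulRightL ℝ F F (β i)).contDiff (n := ∞)).contMDiff.contMDiffAt).comp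
      x₀ h1
  have hT : ContMDiffAt I 𝓘(ℝ, F →L[ℝ] F') ∞ T x₀ := by
    refine ContMDiffAt.sum fun i _ => ?_
    have h1 : ContMDiffAt I 𝓘(ℝ, F') ∞ (fun x => fibreCoord F' V' x₀ x (A x (s i x))) x₀ := by
      refine ((contMDiffAt_section x₀).1 (hA i)).congr_of_eventuallyEq ?_
      filter_upwards [(trivializationAt F' V' x₀).open_baseSet.mem_nhds hb'] with x hx
      rw [fibreCoord, Trivialization.continuousLinearMapAt_apply_of_mem ℝ _ hx]
    exact (((ContinuousLinearMap.smulRightL ℝ F F' (β i)).contDiff (n := ∞)).contMDiff.contMDiffAt).comp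
      x₀ h1
  have hS₀ : S x₀ = ContinuousLinearEquiv.refl ℝ F := by
    ext v
    have h2 : ∀ i, fibreCoord F V x₀ x₀ (s i x₀) = b i := fun i => by
      rw [hs]; exact Trivialization.continuousLinearMapAt_symmL _ hb _
    simp only [S, h2]
    simp only [_root_.sum_apply, ContinuousLinearMap.smulRight_apply]
    exact b.sum_repr v
  have hinv : ContDiffAt ℝ ∞ ContinuousLinearMap.inverse (S x₀) := by
    rw [hS₀]; exact contDiffAt_map_inverse _
  have hSi : ContMDiffAt I 𝓘(ℝ, F →L[ℝ] F) ∞ (fun x => (S x).inverse) x₀ :=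
    hinv.contMDiffAt.comp x₀ hS
  have hunit : ∀ᶠ x in 𝓝 x₀, ∃ u : F ≃L[ℝ] F, S x = u := by
    have h3 := hS.continuousAt.preimage_mem_nhds
      (ContinuousLinearEquiv.nhds (ContinuousLinearEquiv.refl ℝ F) |> (hS₀ ▸ ·))
    filter_upwards [h3] with x hx
    obtain ⟨u, hu⟩ := hx
    exact ⟨u, hu.symm⟩
  have hproj : ContMDiffAt (I.prod 𝓘(ℝ, F)) I ∞ (TotalSpace.proj : TotalSpace F V → M) v₀ :=
    (contMDiff_proj V) v₀
  rw [Bundle.contMDiffAt_totalSpace]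
  refine ⟨hproj, ?_⟩
  have hv : ContMDiffAt (I.prod 𝓘(ℝ, F)) 𝓘(ℝ, F) ∞
      (fun v : TotalSpace F V => (trivializationAt F V x₀ v).2) v₀ :=
    ((Bundle.contMDiffAt_totalSpace).1 (contMDiffAt_id (x := v₀))).2
  have hTv := (hT.comp v₀ hproj).clm_apply ((hSi.comp v₀ hproj).clm_apply hv)
  refine hTv.congr_of_eventuallyEq ?_
  have hev : ∀ {P : M → Prop}, (∀ᶠ x in 𝓝 x₀, P x) → ∀ᶠ v : TotalSpace F V in 𝓝 v₀, P v.1 :=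
    fun hP => (FiberBundle.continuous_proj F V).continuousAt.eventually hP
  filter_upwards [hev ((trivializationAt F V x₀).open_baseSet.mem_nhds hb),
    hev ((trivializationAt F' V' x₀).open_baseSet.mem_nhds hb'), hev hunit] with v hv1 hv2 hv3
  obtain ⟨u, hu⟩ := hv3
  simp only [Function.comp_apply]
  change _ = T v.1 ((S v.1).inverse (trivializationAt F V x₀ v).2)
  rw [hu, ContinuousLinearMap.inverse_equiv]
  -- In coordinates `T = A ∘ S`, by linearity of `A` in the fibre.
  have key : ∀ w, T v.1 w = fibreCoord F' V' x₀ v.1 (A v.1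
      ((trivializationAt F V x₀).symmL ℝ v.1 (S v.1 w))) := by
    intro w
    simp only [T, S]
    simp only [_root_.sum_apply, ContinuousLinearMap.smulRight_apply, map_sum, map_smul]
    refine Finset.sum_congr rfl fun i _ => ?_
    rw [Trivialization.symmL_continuousLinearMapAt _ hv1]
  rw [key, hu]
  change _ = fibreCoord F' V' x₀ v.1 (A v.1 ((trivializationAt F V x₀).symmL ℝ v.1
    (u (u.symm (trivializationAt F V x₀ v).2))))
  rw [u.apply_symm_apply, ← Trivialization.continuousLinearMapAt_apply_of_mem ℝ _ hv2]
  have : (trivializationAt F V x₀ v).2 = fibreCoord F V x₀ v.1 v.2 :=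
    (Trivialization.continuousLinearMapAt_apply_of_mem ℝ _ hv1 v.2).symm
  rw [this, Trivialization.symmL_continuousLinearMapAt _ hv1]

end FibrewiseLinear

/-! ### Derivatives along sections and the dull bracket. -/

section ModelDorfman

variable {W G : Type*} [NormedAddCommGroup W] [NormedSpace ℝ W]
  [NormedAddCommGroup G] [NormedSpace ℝ G]

/-- The one-form `z ↦ ⟨D z, t⟩`. -/
def dualForm (D : W →L[ℝ] W × (G →L[ℝ] ℝ)) (t : G × (W →L[ℝ] ℝ)) : W →L[ℝ] ℝ :=
  ((ContinuousLinearMap.snd ℝ W (G →L[ℝ] ℝ)).comp D).flip t.1 +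
    t.2.comp ((ContinuousLinearMap.fst ℝ W (G →L[ℝ] ℝ)).comp D)

@[simp]
theorem dualForm_apply (D : W →L[ℝ] W × (G →L[ℝ] ℝ)) (t : G × (W →L[ℝ] ℝ)) (z : W) :
    dualForm D t z = modelDuality (D z) t := rfl

/-- The flat Dorfman connection in coordinates. -/
def modelDorfman (a : W → W × (G →L[ℝ] ℝ)) (b : W → G × (W →L[ℝ] ℝ)) (y : W) : G × (W →L[ℝ] ℝ) :=
  fderiv ℝ b y (a y).1 + (0, dualForm (fderiv ℝ a y) (b y))

end ModelDorfman

section DerivMap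

variable {EM : Type*} [NormedAddCommGroup EM] [NormedSpace ℝ EM] [FiniteDimensional ℝ EM]
  {H : Type*} [TopologicalSpace H] {I : ModelWithCorners ℝ EM H} [I.Boundaryless]
  {M : Type*} [TopologicalSpace M] [T2Space M] [ChartedSpace H M] [IsManifold I ∞ M]
  {F : Type*} [NormedAddCommGroup F] [NormedSpace ℝ F] [FiniteDimensional ℝ F]
  {E : M → Type*} [TopologicalSpace (TotalSpace F E)]
  [∀ x, AddCommGroup (E x)] [∀ x, Module ℝ (E x)] [∀ x, TopologicalSpace (E x)]
  [FiberBundle F E] [VectorBundle ℝ F E] [ContMDiffVectorBundle ∞ F E I]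

@[simp]
theorem pairingMap_apply (ν : SideSection I F E) (τ : CoreSection I F E) (x : M) :
    pairingMap ν τ x = pairing (ν x) (τ x) := rfl

theorem pairing_coreD (ν : SideSection I F E) (f : C^∞⟮I, M; ℝ⟯) (x : M) :
    pairing (ν x) (coreD F E f x) = mvfderiv I f x (ν x).1 := by
  change (ν x).2 0 + mvfderiv I f x (ν x).1 = _
  rw [map_zero, zero_add]

/-- The derivative of a function along a section of `TM ⊕ E*`. -/
def derivMap (ν : SideSection I F E) (f : C^∞⟮I, M; ℝ⟯) : C^∞⟮I, M; ℝ⟯ :=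
  -- As a pairing with `df` this function is smooth without further argument.
  pairingMap ν (coreD F E f)

theorem derivMap_apply (ν : SideSection I F E) (f : C^∞⟮I, M; ℝ⟯) (x : M) :
    derivMap ν f x = mvfderiv I f x (ν x).1 := pairing_coreD ν f x

theorem mdifferentiableAt_smooth {G : Type*} [NormedAddCommGroup G] [NormedSpace ℝ G]
    (f : C^∞⟮I, M; 𝓘(ℝ, G), G⟯) (x : M) :
    MDifferentiableAt I 𝓘(ℝ, G) f x := f.contMDiff.mdifferentiable (by simp) x

theorem derivMap_mul (ν : SideSection I F E) (f g : C^∞⟮I, M; ℝ⟯) (x : M) :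
    derivMap ν (f * g) x = f x * derivMap ν g x + g x * derivMap ν f x := by
  simp only [derivMap_apply]
  have h := mvfderiv_mul (mdifferentiableAt_smooth f x) (mdifferentiableAt_smooth g x)
  exact congrArg (fun L => L (ν x).1) h

theorem derivMap_add (ν : SideSection I F E) (f g : C^∞⟮I, M; ℝ⟯) (x : M) :
    derivMap ν (f + g) x = derivMap ν f x + derivMap ν g x := by
  simp only [derivMap_apply]
  have h := mvfderiv_add (mdifferentiableAt_smooth f x) (mdifferentiableAt_smooth g x)
  exact congrArg (fun L => L (ν x).1) h

theorem derivMap_sub (ν : SideSection I F E) (f g : C^∞⟮I, M; ℝ⟯) (x : M) :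
    derivMap ν (f - g) x = derivMap ν f x - derivMap ν g x := by
  simp only [derivMap_apply]
  have h := mvfderiv_sub (mdifferentiableAt_smooth f x) (mdifferentiableAt_smooth g x)
  exact congrArg (fun L => L (ν x).1) h

theorem derivMap_neg (ν : SideSection I F E) (f : C^∞⟮I, M; ℝ⟯) (x : M) :
    derivMap ν (-f) x = -derivMap ν f x := by
  simp only [derivMap_apply]
  have h := mvfderiv_neg (I := I) (g := f) (x := x)
  exact congrArg (fun L => L (ν x).1) h

namespace DorfmanConnection

variable (Δ : DorfmanConnection I F E)

theorem exact_form_eq (f : C^∞⟮I, M; ℝ⟯) (ν : SideSection I F E) :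
    Δ.toFun ν (coreD F E f) = coreD F E (derivMap ν f) := by
  ext1 x
  rw [Δ.exact_form]
  have : (fun y => mvfderiv I f y (ν y).1) = derivMap ν f := funext fun y => (derivMap_apply ν f y).symm
  rw [this]
  rfl

/-- The choice in `dullBracket` is made from a nonempty set: in `ν₁⟨ν₂, τ⟩ - ⟨ν₂, Δ_{ν₁} τ⟩` the two
terms with the derivative of `f` cancel when `τ` is replaced by `f τ`, so the expression is
represented by a side section. -/
theorem isDualValue_dullBracket (ν₁ ν₂ : SideSection I F E) :
    Δ.IsDualValue ν₁ ν₂ (Δ.dullBracket ν₁ ν₂) := by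
  refine Classical.epsilon_spec (p := Δ.IsDualValue ν₁ ν₂) ?_
  obtain ⟨B, hB⟩ := exists_sideSection (I := I) (F := F) (E := E)
    (fun τ => derivMap ν₁ (pairingMap ν₂ τ) - pairingMap ν₂ (Δ.toFun ν₁ τ)) (by
      intro s t x
      have h : pairingMap ν₂ (s + t) = pairingMap ν₂ s + pairingMap ν₂ t := by
        ext x; exact pairing_add_right _ _ _
      rw [h, map_add]
      change derivMap ν₁ _ x - pairing (ν₂ x) (_ + _) = (derivMap ν₁ _ x - _) + (derivMap ν₁ _ x - _)
      rw [derivMap_add, pairing_add_right, pairingMap_apply, pairingMap_apply]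
      ring) (by
      intro f s x
      have h : pairingMap ν₂ (fsmul f s) = f * pairingMap ν₂ s := by
        ext x; exact pairing_smul_right _ _ _
      rw [h]
      change derivMap ν₁ _ x - pairing (ν₂ x) (Δ.toFun ν₁ (fsmul f s) x) =
        f x * (derivMap ν₁ _ x - pairing (ν₂ x) (Δ.toFun ν₁ s x))
      rw [derivMap_mul, Δ.leibniz, pairing_add_right, pairing_smul_right, pairing_smul_right,
        derivMap_apply ν₁ f, pairingMap_apply]
      ring)
  refine ⟨B, fun τ x => ?_⟩
  rw [hB]
  change derivMap ν₁ _ x - _ = _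
  rw [derivMap_apply]
  rfl

theorem pairing_dullBracket (ν₁ ν₂ : SideSection I F E) (τ : CoreSection I F E) (x : M) :
    pairing (Δ.dullBracket ν₁ ν₂ x) (τ x) =
      derivMap ν₁ (pairingMap ν₂ τ) x - pairing (ν₂ x) (Δ.toFun ν₁ τ x) := by
  rw [Δ.isDualValue_dullBracket ν₁ ν₂ τ x, derivMap_apply]
  rfl

end DorfmanConnection

theorem sideSection_ext {ν ν' : SideSection I F E}
    (h : ∀ (τ : CoreSection I F E) x, pairing (ν x) (τ x) = pairing (ν' x) (τ x)) : ν = ν' := by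
  ext1 x
  refine pairing_ext_left F fun t => ?_
  obtain ⟨τ, rfl⟩ := exists_section_eq (I := I) (F := F × (EM →L[ℝ] ℝ)) (V := Core I E) x t
  exact h τ x

theorem pairingMap_add_left (ν ν' : SideSection I F E) (τ : CoreSection I F E) :
    pairingMap (ν + ν') τ = pairingMap ν τ + pairingMap ν' τ := by
  ext x; exact pairing_add_left _ _ _

theorem pairingMap_fsmul_left (f : C^∞⟮I, M; ℝ⟯) (ν : SideSection I F E) (τ : CoreSection I F E) :
    pairingMap (fsmul f ν) τ = f * pairingMap ν τ := by
  ext x; exact pairing_smul_left _ _ _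

namespace DorfmanConnection

variable (Δ : DorfmanConnection I F E)

theorem dullBracket_add_left (ν₁ ν₁' ν₂ : SideSection I F E) :
    Δ.dullBracket (ν₁ + ν₁') ν₂ = Δ.dullBracket ν₁ ν₂ + Δ.dullBracket ν₁' ν₂ := by
  refine sideSection_ext fun τ x => ?_
  rw [ContMDiffSection.coe_add, Pi.add_apply, pairing_add_left]
  simp only [pairing_dullBracket, derivMap, pairingMap_add_left, map_add, LinearMap.add_apply]
  rw [ContMDiffSection.coe_add, Pi.add_apply, pairing_add_right, ContMDiffMap.coe_add, Pi.add_apply]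
  ring

theorem dullBracket_add_right (ν₁ ν₂ ν₂' : SideSection I F E) :
    Δ.dullBracket ν₁ (ν₂ + ν₂') = Δ.dullBracket ν₁ ν₂ + Δ.dullBracket ν₁ ν₂' := by
  refine sideSection_ext fun τ x => ?_
  rw [ContMDiffSection.coe_add, Pi.add_apply, pairing_add_left]
  simp only [pairing_dullBracket, pairingMap_add_left, derivMap_add]
  rw [ContMDiffSection.coe_add, Pi.add_apply, pairing_add_left]
  ring

theorem dullBracket_fsmul_right (f : C^∞⟮I, M; ℝ⟯) (ν₁ ν₂ : SideSection I F E) :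
    Δ.dullBracket ν₁ (fsmul f ν₂) = fsmul (derivMap ν₁ f) ν₂ + fsmul f (Δ.dullBracket ν₁ ν₂) := by
  refine sideSection_ext fun τ x => ?_
  rw [ContMDiffSection.coe_add, Pi.add_apply, pairing_add_left]
  simp only [fsmul_apply, pairing_smul_left]
  simp only [pairing_dullBracket, pairingMap_fsmul_left, derivMap_mul, fsmul_apply,
    pairing_smul_left, pairingMap_apply]
  ring

end DorfmanConnection

end DerivMap

/-! ### Local form of a Dorfman connection. -/

section Model

variable {W G : Type*} [NormedAddCommGroup W] [NormedSpace ℝ W]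
  [NormedAddCommGroup G] [NormedSpace ℝ G]

theorem contDiffAt_sum_smulRight {T T' Z : Type*} [NormedAddCommGroup T] [NormedSpace ℝ T]
    [NormedAddCommGroup T'] [NormedSpace ℝ T'] [NormedAddCommGroup Z] [NormedSpace ℝ Z]
    {ι : Type*} (s : Finset ι) (β : ι → T →L[ℝ] ℝ) {f : ι → Z → T'} {z : Z}
    (hf : ∀ i, ContDiffAt ℝ ∞ (f i) z) :
    ContDiffAt ℝ ∞ (fun y => ∑ i ∈ s, (β i).smulRight (f i y)) z :=
  ContDiffAt.sum fun i _ =>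
    ((ContinuousLinearMap.smulRightL ℝ T T' (β i)).contDiff (n := ∞)).contDiffAt.comp z (hf i)

theorem fderiv_clm_comp {T T' Z : Type*} [NormedAddCommGroup T] [NormedSpace ℝ T]
    [NormedAddCommGroup T'] [NormedSpace ℝ T'] [NormedAddCommGroup Z] [NormedSpace ℝ Z]
    (L : T →L[ℝ] T') {f : Z → T} {z : Z} (hf : DifferentiableAt ℝ f z) :
    fderiv ℝ (L ∘ f) z = L.comp (fderiv ℝ f z) :=
  (L.hasFDerivAt.comp z hf.hasFDerivAt).fderiv

/-- The linear map `f ↦ (0, ⟨D ·, (f, 0)⟩)`. -/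
def coreForm : (W →L[ℝ] W × (G →L[ℝ] ℝ)) →L[ℝ] (G →L[ℝ] G × (W →L[ℝ] ℝ)) :=
  ((ContinuousLinearMap.compL ℝ G (W →L[ℝ] ℝ) (G × (W →L[ℝ] ℝ)))
    (ContinuousLinearMap.inr ℝ G (W →L[ℝ] ℝ))).comp
    (((ContinuousLinearMap.flipₗᵢ ℝ W G ℝ).toContinuousLinearEquiv.toContinuousLinearMap).comp
      (ContinuousLinearMap.compL ℝ W (W × (G →L[ℝ] ℝ)) (G →L[ℝ] ℝ)
        (ContinuousLinearMap.snd ℝ W (G →L[ℝ] ℝ))))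

theorem coreForm_apply (D : W →L[ℝ] W × (G →L[ℝ] ℝ)) (g : G) :
    coreForm D g = (0, dualForm D (g, 0)) := by
  refine Prod.ext rfl (ContinuousLinearMap.ext fun z => ?_)
  simp [coreForm, modelDuality]

theorem dualForm_split (D : W →L[ℝ] W × (G →L[ℝ] ℝ)) (t : G × (W →L[ℝ] ℝ)) :
    ((0 : G), dualForm D t) = (0, dualForm D (t.1, 0)) + (0, dualForm D (0, t.2)) := by
  refine Prod.ext (by simp) (ContinuousLinearMap.ext fun z => ?_)
  simp [modelDuality]

theorem contDiffAt_clm_fderiv_sub_comp {S T T' : Type*} [NormedAddCommGroup S] [NormedSpace ℝ S]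
    [NormedAddCommGroup T] [NormedSpace ℝ T] [NormedAddCommGroup T'] [NormedSpace ℝ T']
    (P : (W →L[ℝ] S) →L[ℝ] (G →L[ℝ] T')) (L : G →L[ℝ] T) {a : W → S} {Γ : W → T →L[ℝ] T'} {y : W}
    (ha : ContDiffAt ℝ ∞ a y) (hΓ : ContDiffAt ℝ ∞ Γ y) :
    ContDiffAt ℝ ∞ (fun y => P (fderiv ℝ a y) - (Γ y).comp L) y :=
  (P.contDiff.contDiffAt.comp y (ha.fderiv_right (m := ∞) (by simp))).sub
    (hΓ.clm_comp contDiffAt_const)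

/-- Once `Γ` is prescribed on covectors, the connection differs from the flat one only by a map on
the `G`-component. With this sign that map is the core part of the horizontal lift. -/
theorem modelDorfman_sub_eq (a : W → W × (G →L[ℝ] ℝ)) (b : W → G × (W →L[ℝ] ℝ)) (y : W)
    (Γ : (G × (W →L[ℝ] ℝ)) →L[ℝ] (G × (W →L[ℝ] ℝ)))
    (h : ∀ θ : W →L[ℝ] ℝ, Γ (0, θ) = (0, dualForm (fderiv ℝ a y) (0, θ))) :
    fderiv ℝ b y (a y).1 + Γ (b y) = modelDorfman a b y -
      (coreForm (fderiv ℝ a y) - Γ.comp (ContinuousLinearMap.inl ℝ G (W →L[ℝ] ℝ))) (b y).1 := by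
  have ht : b y = ((b y).1, 0) + (0, (b y).2) := by simp
  have hGt : Γ (b y) = Γ ((b y).1, 0) + Γ (0, (b y).2) := by rw [← map_add, ← ht]
  rw [modelDorfman, dualForm_split, hGt, h]
  change _ = _ - (coreForm (fderiv ℝ a y) (b y).1 - Γ ((b y).1, 0))
  rw [coreForm_apply]
  abel

end Model

section LocalForm

variable {EM : Type*} [NormedAddCommGroup EM] [NormedSpace ℝ EM] [FiniteDimensional ℝ EM]
  {H : Type*} [TopologicalSpace H] {I : ModelWithCorners ℝ EM H} [I.Boundaryless]
  {M : Type*} [TopologicalSpace M] [T2Space M] [ChartedSpace H M] [IsManifold I ∞ M]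
  {F : Type*} [NormedAddCommGroup F] [NormedSpace ℝ F] [FiniteDimensional ℝ F]
  {E : M → Type*} [TopologicalSpace (TotalSpace F E)]
  [∀ x, AddCommGroup (E x)] [∀ x, Module ℝ (E x)] [∀ x, TopologicalSpace (E x)]
  [FiberBundle F E] [VectorBundle ℝ F E] [ContMDiffVectorBundle ∞ F E I]

/-- A section of `TM ⊕ E*` in coordinates. -/
abbrev sideReading (x₀ : M) (ν : SideSection I F E) : EM → EM × (F →L[ℝ] ℝ) :=
  reading I (EM × (F →L[ℝ] ℝ)) x₀ ν

/-- A section of `E ⊕ T*M` in coordinates. -/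
abbrev coreReading (x₀ : M) (τ : CoreSection I F E) : EM → F × (EM →L[ℝ] ℝ) :=
  reading I (F × (EM →L[ℝ] ℝ)) x₀ τ

theorem eventually_symm {x₀ : M} {P : M → Prop} (h : ∀ᶠ x in 𝓝 x₀, P x) :
    ∀ᶠ y in 𝓝 (extChartAt I x₀ x₀), P ((extChartAt I x₀).symm y) :=
  (continuousAt_extChartAt_symm x₀).eventually (by rwa [extChartAt_to_inv])

theorem contDiffAt_sideReading (x₀ : M) (ν : SideSection I F E) :
    ContDiffAt ℝ ∞ (sideReading x₀ ν) (extChartAt I x₀ x₀) :=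
  contDiffAt_reading_side (mem_coordSource_self x₀) ν

theorem contDiffAt_coreReading (x₀ : M) (τ : CoreSection I F E) :
    ContDiffAt ℝ ∞ (coreReading x₀ τ) (extChartAt I x₀ x₀) :=
  contDiffAt_reading_core (mem_coordSource_self x₀) τ

theorem contDiffAt_of_coordDomain {G : Type*} [NormedAddCommGroup G] [NormedSpace ℝ G] {x₀ : M}
    {f : EM → G} (hf : ContDiffOn ℝ ∞ f (coordDomain I F E x₀)) {y : EM}
    (hy : y ∈ coordDomain I F E x₀) : ContDiffAt ℝ ∞ f y :=
  hf.contDiffAt ((isOpen_coordDomain x₀).mem_nhds hy)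

theorem modelDuality_reading {x₀ : M} {y : EM} (hy : y ∈ coordDomain I F E x₀)
    (ν : SideSection I F E) (τ : CoreSection I F E) :
    modelDuality (sideReading x₀ ν y) (coreReading x₀ τ y) =
      pairing (ν ((extChartAt I x₀).symm y)) (τ ((extChartAt I x₀).symm y)) :=
  modelDuality_coord (symm_mem_coordSource I F E hy) _ _

theorem mvfderiv_symm {x₀ : M} {y : EM} (hy : y ∈ coordDomain I F E x₀) {G : Type*}
    [NormedAddCommGroup G] [NormedSpace ℝ G] (f : C^∞⟮I, M; 𝓘(ℝ, G), G⟯)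
    (v : TangentSpace I ((extChartAt I x₀).symm y)) :
    mvfderiv I f ((extChartAt I x₀).symm y) v = fderiv ℝ (f ∘ (extChartAt I x₀).symm) y
      (fibreCoord EM (TangentSpace I) x₀ ((extChartAt I x₀).symm y) v) := by
  have hx := symm_mem_coordSource I F E hy
  rw [mvfderiv_eq_fderiv (I := I) hx.1 (mdifferentiableAt_smooth f _),
    (extChartAt I x₀).right_inv hy.1]

theorem derivMap_symm {x₀ : M} {y : EM} (hy : y ∈ coordDomain I F E x₀) (ν : SideSection I F E)
    (f : C^∞⟮I, M; ℝ⟯) : derivMap ν f ((extChartAt I x₀).symm y) =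
      fderiv ℝ (f ∘ (extChartAt I x₀).symm) y (sideReading x₀ ν y).1 := by
  have hx := symm_mem_coordSource I F E hy
  rw [derivMap_apply, mvfderiv_symm hy]
  refine congrArg _ ?_
  exact (congrArg Prod.fst (sideCoord_apply hx (ν _))).symm

theorem coreReading_coreD {x₀ : M} {y : EM} (hy : y ∈ coordDomain I F E x₀)
    (f : C^∞⟮I, M; ℝ⟯) : coreReading x₀ (coreD F E f) y =
      (0, fderiv ℝ (f ∘ (extChartAt I x₀).symm) y) := by
  have hx := symm_mem_coordSource I F E hy
  refine (coreCoord_apply hx _).trans (Prod.ext (map_zero _) ?_)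
  refine ContinuousLinearMap.ext fun z => ?_
  refine (mvfderiv_symm hy f _).trans (congrArg _ ?_)
  exact fibreCoord_symmL_tangent hx z

theorem coreReading_sum {ι : Type*} (s : Finset ι) (τ : ι → CoreSection I F E) (x₀ : M) (y : EM) :
    coreReading x₀ (∑ i ∈ s, τ i) y = ∑ i ∈ s, coreReading x₀ (τ i) y := by
  let L : CoreSection I F E →+ F × (EM →L[ℝ] ℝ) :=
    AddMonoidHom.mk' (fun τ => coreReading x₀ τ y) fun _ _ => map_add _ _ _
  exact map_sum L τ s

namespace DorfmanConnection

variable (Δ : DorfmanConnection I F E)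

theorem toFun_sum (ν : SideSection I F E) {ι : Type*} (s : Finset ι) (τ : ι → CoreSection I F E) :
    Δ.toFun ν (∑ i ∈ s, τ i) = ∑ i ∈ s, Δ.toFun ν (τ i) := by
  let L : CoreSection I F E →+ CoreSection I F E :=
    AddMonoidHom.mk' (Δ.toFun ν) (Δ.toFun ν).map_add
  exact map_sum L τ s

/-- `Δ_ν` is a derivation of sections over the vector field of `ν`, hence the directional derivative
plus a term of order zero, given by its values on a local frame. -/
theorem exists_christoffel (ν : SideSection I F E) (x₀ : M) :
    ∃ G : EM → (F × (EM →L[ℝ] ℝ)) →L[ℝ] (F × (EM →L[ℝ] ℝ)),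
      ContDiffAt ℝ ∞ G (extChartAt I x₀ x₀) ∧
      ∀ᶠ y in 𝓝 (extChartAt I x₀ x₀), ∀ τ, coreReading x₀ (Δ.toFun ν τ) y =
        fderiv ℝ (coreReading x₀ τ) y (sideReading x₀ ν y).1 + G y (coreReading x₀ τ y) := by
  obtain ⟨c, hc, χ, hχ, hdec⟩ :=
    exists_decomposition (I := I) (F := F × (EM →L[ℝ] ℝ)) (V := Core I E) x₀
  let b := Module.finBasis ℝ (F × (EM →L[ℝ] ℝ))
  let β : Fin _ → ((F × (EM →L[ℝ] ℝ)) →L[ℝ] ℝ) := fun i =>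
    LinearMap.toContinuousLinearMap (b.coord i)
  refine ⟨fun y => ∑ i, (β i).smulRight (coreReading x₀ (Δ.toFun ν (c (b i))) y), ?_, ?_⟩
  · exact contDiffAt_sum_smulRight _ β fun i => contDiffAt_coreReading x₀ _
  filter_upwards [eventually_symm (I := I) hc,
    eventually_symm (I := I) (eventually_eventually_nhds.2 hχ),
    coordDomain_mem_nhds (I := I) (F := F) (V := E) x₀,
    eventually_eventually_nhds.2 (eventually_symm (I := I) hχ)] with y hcy hχy hy hχy' τ
  set x := (extChartAt I x₀).symm y with hxy
  obtain ⟨g, hg, hgs⟩ := hdec τ b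
  have hχx : χ x = 1 := hχy.self_of_nhds
  -- `χ` is constant near `x`, so passing from `τ` to `χ τ` changes neither the value nor the
  -- derivative.
  have hdχ : mvfderiv I χ x (ν x).1 = 0 := by
    have h1 : (χ : M → ℝ) =ᶠ[𝓝 x] fun _ => (1 : ℝ) := hχy
    have h2 : mvfderiv I χ x = mvfderiv I (fun _ => (1 : ℝ)) x := h1.mfderiv_eq
    rw [h2, mvfderiv_const]; rfl
  have h1 : Δ.toFun ν (fsmul χ τ) x = Δ.toFun ν τ x := by
    rw [Δ.leibniz, hχx, hdχ, one_smul, zero_smul, add_zero]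
  have h2 : coreReading x₀ (Δ.toFun ν τ) y =
      ∑ i, coreReading x₀ (Δ.toFun ν (fsmul (g i) (c (b i)))) y := by
    rw [← coreReading_sum, ← toFun_sum, ← hgs]
    exact congrArg (coreCoord I F E x₀ x) h1.symm
  rw [h2]
  have hD : DifferentiableAt ℝ (coreReading x₀ τ) y :=
    (contDiffAt_of_coordDomain (contDiffOn_reading_core x₀ τ) hy).differentiableAt (by simp)
  -- The coefficient `g i` is a coordinate of `τ` near `x`; the Leibniz rule separates its value
  -- from its derivative.
  have h3 : ∀ i, coreReading x₀ (Δ.toFun ν (fsmul (g i) (c (b i)))) y =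
      β i (coreReading x₀ τ y) • coreReading x₀ (Δ.toFun ν (c (b i))) y +
      β i (fderiv ℝ (coreReading x₀ τ) y (sideReading x₀ ν y).1) • b i := by
    intro i
    have e1 : g i x = β i (coreReading x₀ τ y) := by rw [hg, hχx, one_mul]; rfl
    have e2 : mvfderiv I (g i) x (ν x).1 =
        β i (fderiv ℝ (coreReading x₀ τ) y (sideReading x₀ ν y).1) := by
      have h4 := derivMap_symm hy ν (g i)
      rw [derivMap_apply] at h4
      rw [h4]
      have h5 : (g i) ∘ (extChartAt I x₀).symm =ᶠ[𝓝 y] β i ∘ coreReading x₀ τ := by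
        filter_upwards [hχy'] with z hz
        rw [Function.comp_apply, hg, hz, one_mul]; rfl
      rw [h5.fderiv_eq, fderiv_clm_comp _ hD]
      rfl
    have e3 : coreCoord I F E x₀ x (c (b i) x) = b i :=
      (congrArg _ (hcy.2 (b i))).trans (Trivialization.continuousLinearMapAt_symmL (R := ℝ)
        (trivializationAt (F × (EM →L[ℝ] ℝ)) (Core I E) x₀) hcy.1 (b i))
    refine (congrArg (coreCoord I F E x₀ x) (Δ.leibniz (g i) ν (c (b i)) x)).trans ?_
    rw [map_add, map_smul, map_smul, e3, e1, e2]
    rfl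
  simp only [h3, Finset.sum_add_distrib]
  rw [add_comm]
  refine congrArg₂ _ (b.sum_repr _) ?_
  simp only [_root_.sum_apply, ContinuousLinearMap.smulRight_apply]

/-- The axiom on exact forms is applied to functions that are linear in the chart: their
differentials are constant covectors `θ`, and `d(ν f)` is the derivative of `θ` applied to the
vector part of `ν`. -/
theorem christoffel_exact (ν : SideSection I F E) (x₀ : M)
    {G : EM → (F × (EM →L[ℝ] ℝ)) →L[ℝ] (F × (EM →L[ℝ] ℝ))}
    (hG : ∀ᶠ y in 𝓝 (extChartAt I x₀ x₀), ∀ τ, coreReading x₀ (Δ.toFun ν τ) y =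
        fderiv ℝ (coreReading x₀ τ) y (sideReading x₀ ν y).1 + G y (coreReading x₀ τ y)) :
    ∀ᶠ y in 𝓝 (extChartAt I x₀ x₀), ∀ θ : EM →L[ℝ] ℝ,
      G y (0, θ) = (0, dualForm (fderiv ℝ (sideReading x₀ ν) y) (0, θ)) := by
  obtain ⟨χ, hχ, hχ1⟩ := exists_bump (I := I) ((chartAt H x₀).open_source.mem_nhds
    (mem_chart_source H x₀))
  have hf : ∀ θ : EM →L[ℝ] ℝ, ContMDiff I 𝓘(ℝ, ℝ) ∞ (fun x => χ x * θ (extChartAt I x₀ x)) := by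
    intro θ
    refine contMDiff_of_tsupport fun x hx => ?_
    have hx' : x ∈ tsupport χ := closure_mono (Function.support_mul_subset_left _ _) hx
    exact (χ.contMDiff x).mul (θ.contDiff.contMDiff.contMDiffAt.comp x
      (contMDiffAt_extChartAt' (hχ hx')))
  filter_upwards [hG, coordDomain_mem_nhds (I := I) (F := F) (V := E) x₀,
    eventually_eventually_nhds.2 (coordDomain_mem_nhds (I := I) (F := F) (V := E) x₀),
    eventually_eventually_nhds.2 (eventually_symm (I := I) hχ1)] with y hGy hy hy' hχy θ
  let f : C^∞⟮I, M; ℝ⟯ := ⟨_, hf θ⟩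
  have hfy : ∀ᶠ z in 𝓝 y, z ∈ coordDomain I F E x₀ ∧
      (f ∘ (extChartAt I x₀).symm) =ᶠ[𝓝 z] θ := by
    filter_upwards [hy', eventually_eventually_nhds.2 hχy, eventually_eventually_nhds.2 hy']
      with z hz hz1 hz2
    refine ⟨hz, ?_⟩
    filter_upwards [hz1, hz2] with w hw1 hw2
    change χ _ * θ _ = _
    rw [hw1, one_mul, (extChartAt I x₀).right_inv hw2.1]
  have hcf : coreReading x₀ (coreD F E f) =ᶠ[𝓝 y] fun _ => (0, θ) := by
    filter_upwards [hfy] with z hz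
    rw [coreReading_coreD hz.1, hz.2.fderiv_eq, ContinuousLinearMap.fderiv]
  have h1 := hGy (coreD F E f)
  rw [hcf.fderiv_eq, hcf.eq_of_nhds, Δ.exact_form_eq, coreReading_coreD hy] at h1
  have hD : DifferentiableAt ℝ (sideReading x₀ ν) y :=
    (contDiffAt_of_coordDomain (contDiffOn_reading_side x₀ ν) hy).differentiableAt (by simp)
  have h2 : (derivMap ν f) ∘ (extChartAt I x₀).symm =ᶠ[𝓝 y]
      (θ.comp (ContinuousLinearMap.fst ℝ EM (F →L[ℝ] ℝ))) ∘ sideReading x₀ ν := by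
    filter_upwards [hfy] with z hz
    rw [Function.comp_apply, derivMap_symm hz.1, hz.2.fderiv_eq, ContinuousLinearMap.fderiv]
    rfl
  rw [h2.fderiv_eq, fderiv_clm_comp _ hD] at h1
  simp only [fderiv_fun_const, Pi.zero_apply, zero_apply, zero_add] at h1
  rw [← h1]
  refine Prod.ext rfl (ContinuousLinearMap.ext fun z => ?_)
  simp [modelDuality]

/-- A Dorfman connection in coordinates. -/
theorem exists_localForm (ν : SideSection I F E) (x₀ : M) :
    ∃ K : EM → F →L[ℝ] (F × (EM →L[ℝ] ℝ)), ContDiffAt ℝ ∞ K (extChartAt I x₀ x₀) ∧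
      ∀ᶠ y in 𝓝 (extChartAt I x₀ x₀), ∀ τ, coreReading x₀ (Δ.toFun ν τ) y =
        modelDorfman (sideReading x₀ ν) (coreReading x₀ τ) y - K y (coreReading x₀ τ y).1 := by
  obtain ⟨G, hG, hGe⟩ := Δ.exists_christoffel ν x₀
  have hK := contDiffAt_clm_fderiv_sub_comp (W := EM) (G := F) (S := EM × (F →L[ℝ] ℝ))
    (T := F × (EM →L[ℝ] ℝ)) (T' := F × (EM →L[ℝ] ℝ)) coreForm
    (ContinuousLinearMap.inl ℝ F (EM →L[ℝ] ℝ)) (contDiffAt_sideReading x₀ ν) hG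
  refine ⟨_, hK, ?_⟩
  filter_upwards [hGe, Δ.christoffel_exact ν x₀ hGe] with y h1 h2 τ
  exact (h1 τ).trans (modelDorfman_sub_eq _ _ y (G y) h2)

end DorfmanConnection

end LocalForm

/-! ### Brackets of horizontal lifts and core fields in coordinates. -/

section ModelLift

variable {W G : Type*} [NormedAddCommGroup W] [NormedSpace ℝ W]
  [NormedAddCommGroup G] [NormedSpace ℝ G]

/-- `modelHor` as a continuous linear map. -/
def modelHorL : W × (G →L[ℝ] ℝ) →L[ℝ] (W × G) × (W × G →L[ℝ] ℝ) :=
  ((ContinuousLinearMap.inl ℝ W G).comp (ContinuousLinearMap.fst ℝ W (G →L[ℝ] ℝ))).prod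
    ((ContinuousLinearMap.compL ℝ (W × G) G ℝ).flip (ContinuousLinearMap.snd ℝ W G) ∘L
      ContinuousLinearMap.snd ℝ W (G →L[ℝ] ℝ))

/-- `modelCore` as a continuous linear map. -/
def modelCoreL : G × (W →L[ℝ] ℝ) →L[ℝ] (W × G) × (W × G →L[ℝ] ℝ) :=
  ((ContinuousLinearMap.inr ℝ W G).comp (ContinuousLinearMap.fst ℝ G (W →L[ℝ] ℝ))).prod
    ((ContinuousLinearMap.compL ℝ (W × G) W ℝ).flip (ContinuousLinearMap.fst ℝ W G) ∘L
      ContinuousLinearMap.snd ℝ G (W →L[ℝ] ℝ))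

theorem modelHorL_apply (ν : W × (G →L[ℝ] ℝ)) : modelHorL ν = modelHor ν := rfl

theorem modelCoreL_apply (τ : G × (W →L[ℝ] ℝ)) : modelCoreL τ = modelCore τ := rfl

theorem modelCore_add (τ τ' : G × (W →L[ℝ] ℝ)) :
    modelCore (τ + τ') = modelCore τ + modelCore τ' := map_add modelCoreL τ τ'

theorem modelCore_sub (τ τ' : G × (W →L[ℝ] ℝ)) :
    modelCore (τ - τ') = modelCore τ - modelCore τ' := map_sub modelCoreL τ τ'

theorem prod_dual_ext {A B : Type*} [NormedAddCommGroup A] [NormedSpace ℝ A]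
    {t t' : B × (A →L[ℝ] ℝ)} (h₁ : t.1 = t'.1) (h₂ : ∀ z, t.2 z = t'.2 z) : t = t' :=
  Prod.ext h₁ (ContinuousLinearMap.ext h₂)

/-- The horizontal lift in coordinates. -/
def liftField (a : W → W × (G →L[ℝ] ℝ)) (K : W → G →L[ℝ] G × (W →L[ℝ] ℝ)) (z : W × G) :
    (W × G) × (W × G →L[ℝ] ℝ) :=
  modelHor (a z.1) + modelCore (K z.1 z.2)

theorem hasFDerivAt_comp_fst {S : Type*} [NormedAddCommGroup S] [NormedSpace ℝ S] {f : W → S}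
    {y : W} (hf : DifferentiableAt ℝ f y) (g : G) : HasFDerivAt (fun z : W × G => f z.1)
      ((fderiv ℝ f y).comp (ContinuousLinearMap.fst ℝ W G)) (y, g) :=
  HasFDerivAt.comp (y, g) (g := f) hf.hasFDerivAt hasFDerivAt_fst

theorem hasFDerivAt_clm_comp {S S' Z : Type*} [NormedAddCommGroup S] [NormedSpace ℝ S]
    [NormedAddCommGroup S'] [NormedSpace ℝ S'] [NormedAddCommGroup Z] [NormedSpace ℝ Z]
    (L : S →L[ℝ] S') {f : Z → S} {f' : Z →L[ℝ] S} {z : Z} (hf : HasFDerivAt f f' z) :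
    HasFDerivAt (fun z => L (f z)) (L.comp f') z :=
  L.hasFDerivAt.comp z hf

theorem hasFDerivAt_clm_apply_const {S T Z : Type*} [NormedAddCommGroup S] [NormedSpace ℝ S]
    [NormedAddCommGroup T] [NormedSpace ℝ T] [NormedAddCommGroup Z] [NormedSpace ℝ Z]
    {f : Z → S →L[ℝ] T} {f' : Z →L[ℝ] S →L[ℝ] T} {z : Z} (hf : HasFDerivAt f f' z) (s : S) :
    HasFDerivAt (fun z => f z s) (f'.flip s) z :=
  ((ContinuousLinearMap.apply ℝ T s).hasFDerivAt.comp z hf)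

theorem hasFDerivAt_liftField {a : W → W × (G →L[ℝ] ℝ)} {K : W → G →L[ℝ] G × (W →L[ℝ] ℝ)} {y : W}
    {g : G} (ha : DifferentiableAt ℝ a y) (hK : DifferentiableAt ℝ K y) :
    HasFDerivAt (liftField a K) (modelHorL.comp ((fderiv ℝ a y).comp (ContinuousLinearMap.fst ℝ W G))
      + modelCoreL.comp ((K y).comp (ContinuousLinearMap.snd ℝ W G) +
        ((fderiv ℝ K y).comp (ContinuousLinearMap.fst ℝ W G)).flip g)) (y, g) := by
  have h1 := hasFDerivAt_comp_fst ha g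
  have h2 := hasFDerivAt_comp_fst (S := G →L[ℝ] G × (W →L[ℝ] ℝ)) hK g
  exact (hasFDerivAt_clm_comp modelHorL h1).add
    (hasFDerivAt_clm_comp modelCoreL (h2.clm_apply hasFDerivAt_snd))

theorem fderiv_liftField {a : W → W × (G →L[ℝ] ℝ)} {K : W → G →L[ℝ] G × (W →L[ℝ] ℝ)} {y : W} {g : G}
    (ha : DifferentiableAt ℝ a y) (hK : DifferentiableAt ℝ K y) (z : W × G) :
    fderiv ℝ (liftField a K) (y, g) z =
      modelHor (fderiv ℝ a y z.1) + modelCore (K y z.2 + fderiv ℝ K y z.1 g) := by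
  rw [(hasFDerivAt_liftField ha hK).fderiv]
  rfl

theorem fderiv_modelCore_comp {b : W → G × (W →L[ℝ] ℝ)} {y : W} {g : G}
    (hb : DifferentiableAt ℝ b y) (z : W × G) :
    fderiv ℝ (fun z : W × G => modelCore (b z.1)) (y, g) z = modelCore (fderiv ℝ b y z.1) := by
  have h2 : HasFDerivAt (fun z : W × G => modelCore (b z.1)) _ (y, g) :=
    hasFDerivAt_clm_comp modelCoreL (hasFDerivAt_comp_fst hb g)
  rw [h2.fderiv]
  rfl

/-- The dull bracket in coordinates. -/
def modelDull (a₁ a₂ : W → W × (G →L[ℝ] ℝ)) (K₁ : W → G →L[ℝ] G × (W →L[ℝ] ℝ)) (y : W) :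
    W × (G →L[ℝ] ℝ) :=
  fderiv ℝ a₂ y (a₁ y).1 - fderiv ℝ a₁ y (a₂ y).1 + (0, (a₂ y).2.comp
    ((ContinuousLinearMap.fst ℝ G (W →L[ℝ] ℝ)).comp (K₁ y)) +
    ((ContinuousLinearMap.snd ℝ G (W →L[ℝ] ℝ)).comp (K₁ y)).flip (a₂ y).1)

/-- The core component of the bracket of two horizontal lifts in coordinates. -/
def modelDefect (a₁ a₂ : W → W × (G →L[ℝ] ℝ)) (K₁ K₂ : W → G →L[ℝ] G × (W →L[ℝ] ℝ)) (y : W) (g : G) :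
    G × (W →L[ℝ] ℝ) :=
  fderiv ℝ K₂ y (a₁ y).1 g + K₂ y (K₁ y g).1 - (fderiv ℝ K₁ y (a₂ y).1 g + K₁ y (K₂ y g).1) +
    (0, dualForm (fderiv ℝ a₁ y) (K₂ y g) + (a₂ y).2.comp
      ((ContinuousLinearMap.fst ℝ G (W →L[ℝ] ℝ)).comp ((fderiv ℝ K₁ y).flip g)) +
      ((ContinuousLinearMap.snd ℝ G (W →L[ℝ] ℝ)).comp ((fderiv ℝ K₁ y).flip g)).flip (a₂ y).1)

-- The dull part involves only `K₁`: the asymmetry comes from the one-form `⟨Da ·, b⟩` in the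
-- Courant-Dorfman bracket, which differentiates the first argument and contributes `K₁` along the
-- fibre directions.
set_option maxHeartbeats 1000000 in
theorem modelBracket_liftField {a₁ a₂ : W → W × (G →L[ℝ] ℝ)}
    {K₁ K₂ : W → G →L[ℝ] G × (W →L[ℝ] ℝ)} {y : W} {g : G}
    (ha₁ : DifferentiableAt ℝ a₁ y) (hK₁ : DifferentiableAt ℝ K₁ y)
    (ha₂ : DifferentiableAt ℝ a₂ y) (hK₂ : DifferentiableAt ℝ K₂ y) :
    modelBracket (liftField a₁ K₁) (liftField a₂ K₂) (y, g) =
      modelHor (modelDull a₁ a₂ K₁ y) + modelCore (modelDefect a₁ a₂ K₁ K₂ y g) := by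
  simp only [modelBracket, fderiv_liftField ha₁ hK₁, fderiv_liftField ha₂ hK₂]
  refine prod_dual_ext (Prod.ext ?_ ?_) fun z => ?_
  · simp only [liftField, modelHor, modelCore, modelDefect, modelDull, modelDorfman, modelPairing,
      modelDuality, Prod.fst_add, Prod.snd_add, add_apply, Prod.fst_sub, Prod.snd_sub, sub_apply,
      ContinuousLinearMap.comp_apply, dualForm_apply, ContinuousLinearMap.flip_apply, zero_apply,
      ContinuousLinearMap.coe_fst', ContinuousLinearMap.coe_snd', zero_add, add_zero, sub_zero, sub_self, Prod.fst_zero,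
      Prod.snd_zero,
      ContinuousLinearMap.map_add, ContinuousLinearMap.map_zero]
  · simp only [liftField, modelHor, modelCore, modelDefect, modelDull, modelDorfman, modelPairing,
      modelDuality, Prod.fst_add, Prod.snd_add, add_apply, Prod.fst_sub, Prod.snd_sub, sub_apply,
      ContinuousLinearMap.comp_apply, dualForm_apply, ContinuousLinearMap.flip_apply, zero_apply,
      ContinuousLinearMap.coe_fst', ContinuousLinearMap.coe_snd', zero_add, add_zero, sub_zero, sub_self, Prod.fst_zero,
      Prod.snd_zero,
      ContinuousLinearMap.map_add, ContinuousLinearMap.map_zero]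
    abel
  · simp only [Prod.snd_add, Prod.snd_sub, add_apply, sub_apply, pairForm_apply,
      fderiv_liftField ha₁ hK₁]
    simp only [liftField, modelHor, modelCore, modelDefect, modelDull, modelDorfman, modelPairing,
      modelDuality, Prod.fst_add, Prod.snd_add, add_apply, Prod.fst_sub, Prod.snd_sub, sub_apply,
      ContinuousLinearMap.comp_apply, dualForm_apply, ContinuousLinearMap.flip_apply, zero_apply,
      ContinuousLinearMap.coe_fst', ContinuousLinearMap.coe_snd', zero_add, add_zero, sub_zero, sub_self, Prod.fst_zero,
      Prod.snd_zero,
      ContinuousLinearMap.map_add, ContinuousLinearMap.map_zero]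
    ring

/-- This is `[σ(ν), τ^↑] = (Δ_ν τ)^↑`: the right-hand side is the local form of `Δ_ν τ`. -/
theorem modelBracket_liftField_core {a : W → W × (G →L[ℝ] ℝ)}
    {K : W → G →L[ℝ] G × (W →L[ℝ] ℝ)} {b : W → G × (W →L[ℝ] ℝ)} {y : W} {g : G}
    (ha : DifferentiableAt ℝ a y) (hK : DifferentiableAt ℝ K y) (hb : DifferentiableAt ℝ b y) :
    modelBracket (liftField a K) (fun z => modelCore (b z.1)) (y, g) =
      modelCore (modelDorfman a b y - K y (b y).1) := by
  simp only [modelBracket, fderiv_liftField ha hK, fderiv_modelCore_comp hb]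
  refine prod_dual_ext (Prod.ext ?_ ?_) fun z => ?_
  · simp only [liftField, modelHor, modelCore, modelDefect, modelDull, modelDorfman, modelPairing,
      modelDuality, Prod.fst_add, Prod.snd_add, add_apply, Prod.fst_sub, Prod.snd_sub, sub_apply,
      ContinuousLinearMap.comp_apply, dualForm_apply, ContinuousLinearMap.flip_apply, zero_apply,
      ContinuousLinearMap.coe_fst', ContinuousLinearMap.coe_snd', zero_add, add_zero, sub_zero, sub_self, Prod.fst_zero,
      Prod.snd_zero,
      ContinuousLinearMap.map_add, ContinuousLinearMap.map_zero]
  · simp only [liftField, modelHor, modelCore, modelDefect, modelDull, modelDorfman, modelPairing,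
      modelDuality, Prod.fst_add, Prod.snd_add, add_apply, Prod.fst_sub, Prod.snd_sub, sub_apply,
      ContinuousLinearMap.comp_apply, dualForm_apply, ContinuousLinearMap.flip_apply, zero_apply,
      ContinuousLinearMap.coe_fst', ContinuousLinearMap.coe_snd', zero_add, add_zero, sub_zero, sub_self, Prod.fst_zero,
      Prod.snd_zero,
      ContinuousLinearMap.map_add, ContinuousLinearMap.map_zero]
  · simp only [Prod.snd_add, Prod.snd_sub, add_apply, sub_apply, pairForm_apply,
      fderiv_liftField ha hK]
    simp only [liftField, modelHor, modelCore, modelDefect, modelDull, modelDorfman, modelPairing,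
      modelDuality, Prod.fst_add, Prod.snd_add, add_apply, Prod.fst_sub, Prod.snd_sub, sub_apply,
      ContinuousLinearMap.comp_apply, dualForm_apply, ContinuousLinearMap.flip_apply, zero_apply,
      ContinuousLinearMap.coe_fst', ContinuousLinearMap.coe_snd', zero_add, add_zero, sub_zero, sub_self, Prod.fst_zero,
      Prod.snd_zero,
      ContinuousLinearMap.map_add, ContinuousLinearMap.map_zero]
    ring

/-- Core fields do not vary along the fibres, their vectors are vertical and their covectors kill
vertical vectors. -/
theorem modelBracket_core_core {b b' : W → G × (W →L[ℝ] ℝ)} {y : W} {g : G}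
    (hb : DifferentiableAt ℝ b y) (hb' : DifferentiableAt ℝ b' y) :
    modelBracket (fun z : W × G => modelCore (b z.1)) (fun z => modelCore (b' z.1)) (y, g) = 0 := by
  simp only [modelBracket, fderiv_modelCore_comp hb, fderiv_modelCore_comp hb']
  refine Prod.ext (Prod.ext ?_ ?_) (ContinuousLinearMap.ext fun z => ?_)
  · simp [modelCore]
  · simp [modelCore]
  · simp only [Prod.snd_add, Prod.snd_sub, add_apply, sub_apply, pairForm_apply,
      fderiv_modelCore_comp hb]
    simp [modelCore, modelPairing]

/-- Here `b` is the local form of `Δ_ν (e, 0)` for a section `e` with constant coordinates `g`. -/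
theorem fderiv_coreForm_sub {a : W → W × (G →L[ℝ] ℝ)} {K : W → G →L[ℝ] G × (W →L[ℝ] ℝ)} {y : W}
    {g : G} (ha : ContDiffAt ℝ ∞ a y) (hK : DifferentiableAt ℝ K y) {b : W → G × (W →L[ℝ] ℝ)}
    (hb : b =ᶠ[𝓝 y] fun y => (0, dualForm (fderiv ℝ a y) (g, 0)) - K y g) (w : W) :
    fderiv ℝ b y w = (0, dualForm (fderiv ℝ (fderiv ℝ a) y w) (g, 0)) - fderiv ℝ K y w g := by
  have hD : DifferentiableAt ℝ (fderiv ℝ a) y :=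
    (ha.fderiv_right (m := ∞) (by simp)).differentiableAt (by simp)
  have h1 := hasFDerivAt_clm_apply_const (S := G) (T := G × (W →L[ℝ] ℝ))
    (hasFDerivAt_clm_comp (S := W →L[ℝ] W × (G →L[ℝ] ℝ)) (S' := G →L[ℝ] G × (W →L[ℝ] ℝ)) coreForm
        hD.hasFDerivAt) g
  have h2 := hasFDerivAt_clm_apply_const (S := G) (T := G × (W →L[ℝ] ℝ)) hK.hasFDerivAt g
  have h3 : b =ᶠ[𝓝 y] fun y => coreForm (fderiv ℝ a y) g - K y g := by
    filter_upwards [hb] with z hz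
    rw [hz, coreForm_apply]
  rw [((h1.sub h2).congr_of_eventuallyEq h3).fderiv, ← coreForm_apply]
  rfl

/-- Two covariant derivatives of a constant core section, in coordinates. -/
theorem modelDorfman_modelDorfman {a₁ a₂ : W → W × (G →L[ℝ] ℝ)}
    {K₁ K₂ : W → G →L[ℝ] G × (W →L[ℝ] ℝ)} {y : W} {g : G}
    (ha₂ : ContDiffAt ℝ ∞ a₂ y) (hK₂ : DifferentiableAt ℝ K₂ y) {b : W → G × (W →L[ℝ] ℝ)}
    (hb : b =ᶠ[𝓝 y] fun y => (0, dualForm (fderiv ℝ a₂ y) (g, 0)) - K₂ y g) :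
    (modelDorfman a₁ b y - K₁ y (b y).1).1 =
        (K₁ y (K₂ y g).1).1 - (fderiv ℝ K₂ y (a₁ y).1 g).1 ∧
      ∀ z, (modelDorfman a₁ b y - K₁ y (b y).1).2 z =
        (fderiv ℝ (fderiv ℝ a₂) y (a₁ y).1 z).2 g + (fderiv ℝ a₂ y (fderiv ℝ a₁ y z).1).2 g -
          modelDuality (fderiv ℝ a₁ y z) (K₂ y g) - (fderiv ℝ K₂ y (a₁ y).1 g).2 z +
          (K₁ y (K₂ y g).1).2 z := by
  have hK : K₁ y (b y).1 = -K₁ y (K₂ y g).1 := by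
    rw [hb.eq_of_nhds, Prod.fst_sub, zero_sub, ContinuousLinearMap.map_neg]
  rw [hK, modelDorfman, fderiv_coreForm_sub ha₂ hK₂ hb, hb.eq_of_nhds]
  generalize K₁ y (K₂ y g).1 = u
  generalize fderiv ℝ K₂ y (a₁ y).1 g = v
  generalize K₂ y g = w
  constructor
  · simp only [Prod.fst_add, Prod.fst_sub, Prod.fst_neg]
    abel
  · intro z
    simp only [Prod.fst_sub, Prod.snd_add, Prod.snd_sub, Prod.snd_neg, add_apply, sub_apply,
      neg_apply, dualForm_apply, modelDuality, zero_apply, zero_sub, add_zero,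
      ContinuousLinearMap.map_neg]
    ring

theorem fderiv_modelDull_snd {a₁ a₂ : W → W × (G →L[ℝ] ℝ)} {K₁ : W → G →L[ℝ] G × (W →L[ℝ] ℝ)}
    {y : W} (ha₁ : ContDiffAt ℝ ∞ a₁ y) (ha₂ : ContDiffAt ℝ ∞ a₂ y) (hK₁ : DifferentiableAt ℝ K₁ y)
    (w : W) (g : G) :
    (fderiv ℝ (modelDull a₁ a₂ K₁) y w).2 g =
      (fderiv ℝ (fderiv ℝ a₂) y w (a₁ y).1).2 g + (fderiv ℝ a₂ y (fderiv ℝ a₁ y w).1).2 g -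
      ((fderiv ℝ (fderiv ℝ a₁) y w (a₂ y).1).2 g + (fderiv ℝ a₁ y (fderiv ℝ a₂ y w).1).2 g) +
      modelDuality (fderiv ℝ a₂ y w) (K₁ y g) + modelDuality (a₂ y) (fderiv ℝ K₁ y w g) := by
  have hd₁ := ha₁.differentiableAt (n := ∞) (by simp)
  have hd₂ := ha₂.differentiableAt (n := ∞) (by simp)
  have hD₁ : DifferentiableAt ℝ (fderiv ℝ a₁) y :=
    (ha₁.fderiv_right (m := ∞) (by simp)).differentiableAt (by simp)
  have hD₂ : DifferentiableAt ℝ (fderiv ℝ a₂) y :=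
    (ha₂.fderiv_right (m := ∞) (by simp)).differentiableAt (by simp)
  have e1 : HasFDerivAt (fun y => (fderiv ℝ a₂ y (a₁ y).1).2 g) _ y :=
    hasFDerivAt_clm_apply_const (hD₂.hasFDerivAt.clm_apply hd₁.hasFDerivAt.fst).snd g
  have e2 : HasFDerivAt (fun y => (fderiv ℝ a₁ y (a₂ y).1).2 g) _ y :=
    hasFDerivAt_clm_apply_const (hD₁.hasFDerivAt.clm_apply hd₂.hasFDerivAt.fst).snd g
  have e3 := hasFDerivAt_clm_apply_const (S := G) (T := G × (W →L[ℝ] ℝ)) hK₁.hasFDerivAt g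
  have e4 : HasFDerivAt (fun y => (a₂ y).2 (K₁ y g).1) _ y :=
    hd₂.hasFDerivAt.snd.clm_apply e3.fst
  have e5 : HasFDerivAt (fun y => (K₁ y g).2 (a₂ y).1) _ y :=
    e3.snd.clm_apply hd₂.hasFDerivAt.fst
  have hdiff : DifferentiableAt ℝ (modelDull a₁ a₂ K₁) y := by
    unfold modelDull
    have f1 := hD₂.clm_apply hd₁.fst
    have f2 := hD₁.clm_apply hd₂.fst
    have f3 : DifferentiableAt ℝ (fun y => (a₂ y).2.comp
      ((ContinuousLinearMap.fst ℝ G (W →L[ℝ] ℝ)).comp (K₁ y))) y :=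
      hd₂.snd.clm_comp ((differentiableAt_const _).clm_comp hK₁)
    have f4 : DifferentiableAt ℝ (fun y => ((ContinuousLinearMap.snd ℝ G (W →L[ℝ] ℝ)).comp
        (K₁ y)).flip (a₂ y).1) y := by
      have f5 : DifferentiableAt ℝ (fun y => (ContinuousLinearMap.snd ℝ G (W →L[ℝ] ℝ)).comp
        (K₁ y)) y := (differentiableAt_const _).clm_comp hK₁
      have f6 := hasFDerivAt_clm_comp (S := G →L[ℝ] W →L[ℝ] ℝ) (S' := W →L[ℝ] G →L[ℝ] ℝ)
        (ContinuousLinearMap.flipₗᵢ ℝ G W ℝ).toContinuousLinearEquiv.toContinuousLinearMap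
        f5.hasFDerivAt
      exact f6.differentiableAt.clm_apply hd₂.fst
    exact (f1.sub f2).add ((differentiableAt_const _).prodMk (f3.add f4))
  have key : HasFDerivAt (fun y => (modelDull a₁ a₂ K₁ y).2 g) _ y :=
    hasFDerivAt_clm_apply_const hdiff.hasFDerivAt.snd g
  have key' := ((e1.sub e2).add (e4.add e5))
  have := congrArg (fun L => L w) (key.unique (key'.congr_of_eventuallyEq
    (.of_forall fun y => by simp [modelDull])))
  simp only [sub_apply, add_apply, ContinuousLinearMap.comp_apply, zero_apply, map_zero, zero_add,
      ContinuousLinearMap.flip_apply, ContinuousLinearMap.coe_fst', ContinuousLinearMap.coe_snd',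
      Prod.snd_add] at this
  rw [this]
  simp only [modelDuality]
  ring

/-- The core component of the bracket of two horizontal lifts is the curvature. -/
theorem modelDefect_eq {a₁ a₂ : W → W × (G →L[ℝ] ℝ)} {K₁ K₂ : W → G →L[ℝ] G × (W →L[ℝ] ℝ)} {y : W}
    {g : G} (ha₁ : ContDiffAt ℝ ∞ a₁ y) (ha₂ : ContDiffAt ℝ ∞ a₂ y) (hK₁ : DifferentiableAt ℝ K₁ y)
    (hK₂ : DifferentiableAt ℝ K₂ y) {b₁ b₂ : W → G × (W →L[ℝ] ℝ)}
    (hb₁ : b₁ =ᶠ[𝓝 y] fun y => (0, dualForm (fderiv ℝ a₁ y) (g, 0)) - K₁ y g)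
    (hb₂ : b₂ =ᶠ[𝓝 y] fun y => (0, dualForm (fderiv ℝ a₂ y) (g, 0)) - K₂ y g) :
    modelDefect a₁ a₂ K₁ K₂ y g = (0, dualForm (fderiv ℝ (modelDull a₁ a₂ K₁) y) (g, 0)) -
      (modelDorfman a₁ b₂ y - K₁ y (b₂ y).1) + (modelDorfman a₂ b₁ y - K₂ y (b₁ y).1) := by
  obtain ⟨h₁, h₁'⟩ := modelDorfman_modelDorfman (a₁ := a₁) (K₁ := K₁) ha₂ hK₂ hb₂
  obtain ⟨h₂, h₂'⟩ := modelDorfman_modelDorfman (a₁ := a₂) (K₁ := K₂) ha₁ hK₁ hb₁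
  -- The derivative of the dull bracket and the iterated connections differentiate `a₁` and `a₂`
  -- twice in different orders; these terms cancel by symmetry.
  have hs : ∀ {a : W → W × (G →L[ℝ] ℝ)}, ContDiffAt ℝ ∞ a y → ∀ v w,
      fderiv ℝ (fderiv ℝ a) y v w = fderiv ℝ (fderiv ℝ a) y w v := fun ha v w =>
    (ha.isSymmSndFDerivAt (by simpa using ENat.LEInfty.out)).eq v w
  refine prod_dual_ext ?_ fun w => ?_
  · rw [Prod.fst_add, Prod.fst_sub, h₁, h₂]
    simp only [modelDefect, Prod.fst_add, Prod.fst_sub]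
    abel
  · rw [Prod.snd_add, Prod.snd_sub, add_apply, sub_apply, h₁', h₂', dualForm_apply]
    rw [show modelDuality (fderiv ℝ (modelDull a₁ a₂ K₁) y w) (g, (0 : W →L[ℝ] ℝ)) =
      (fderiv ℝ (modelDull a₁ a₂ K₁) y w).2 g by simp only [modelDuality, zero_apply, add_zero],
      fderiv_modelDull_snd ha₁ ha₂ hK₁, hs ha₁ w, hs ha₂ w]
    simp only [modelDefect, modelDuality, Prod.snd_add, Prod.snd_sub, add_apply, sub_apply,
      ContinuousLinearMap.comp_apply, dualForm_apply, ContinuousLinearMap.flip_apply,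
      ContinuousLinearMap.coe_fst', ContinuousLinearMap.coe_snd']
    ring

end ModelLift

/-! ### The horizontal lift as a linear splitting. -/

section HorizontalLift

variable {EM : Type*} [NormedAddCommGroup EM] [NormedSpace ℝ EM] [FiniteDimensional ℝ EM]
  {H : Type*} [TopologicalSpace H] {I : ModelWithCorners ℝ EM H} [I.Boundaryless]
  {M : Type*} [TopologicalSpace M] [T2Space M] [ChartedSpace H M] [IsManifold I ∞ M]
  {F : Type*} [NormedAddCommGroup F] [NormedSpace ℝ F] [FiniteDimensional ℝ F]
  {E : M → Type*} [TopologicalSpace (TotalSpace F E)]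
  [∀ x, AddCommGroup (E x)] [∀ x, Module ℝ (E x)] [∀ x, TopologicalSpace (E x)]
  [FiberBundle F E] [VectorBundle ℝ F E] [ContMDiffVectorBundle ∞ F E I]

/-- The coefficients of a Dorfman connection in coordinates. -/
def DorfmanConnection.localForm (Δ : DorfmanConnection I F E) (ν : SideSection I F E) (x₀ : M) :
    EM → F →L[ℝ] (F × (EM →L[ℝ] ℝ)) :=
  (Δ.exists_localForm ν x₀).choose

theorem DorfmanConnection.contDiffAt_localForm (Δ : DorfmanConnection I F E)
    (ν : SideSection I F E) (x₀ : M) :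
    ContDiffAt ℝ ∞ (Δ.localForm ν x₀) (extChartAt I x₀ x₀) :=
  (Δ.exists_localForm ν x₀).choose_spec.1

theorem DorfmanConnection.coreReading_toFun (Δ : DorfmanConnection I F E)
    (ν : SideSection I F E) (x₀ : M) : ∀ᶠ y in 𝓝 (extChartAt I x₀ x₀), ∀ τ,
      coreReading x₀ (Δ.toFun ν τ) y = modelDorfman (sideReading x₀ ν) (coreReading x₀ τ) y -
        Δ.localForm ν x₀ y (coreReading x₀ τ y).1 :=
  (Δ.exists_localForm ν x₀).choose_spec.2

theorem coreReading_coreInl {x₀ : M} {y : EM} (hy : y ∈ coordDomain I F E x₀)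
    (e : Cₛ^∞⟮I; F, E⟯) : coreReading x₀ (coreInl (I := I) e) y = (reading I F x₀ e y, 0) := by
  have hx := symm_mem_coordSource I F E hy
  refine (coreCoord_apply hx _).trans (Prod.ext rfl ?_)
  exact ContinuousLinearMap.zero_comp _

theorem eventually_extChartAt {x₀ : M} {P : EM → Prop}
    (h : ∀ᶠ y in 𝓝 (extChartAt I x₀ x₀), P y) : ∀ᶠ x in 𝓝 x₀, P (extChartAt I x₀ x) :=
  (continuousAt_extChartAt x₀).eventually h

theorem modelDorfman_inl {W G : Type*} [NormedAddCommGroup W] [NormedSpace ℝ W]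
    [NormedAddCommGroup G] [NormedSpace ℝ G] {a : W → W × (G →L[ℝ] ℝ)} {b : W → G × (W →L[ℝ] ℝ)}
    {e : W → G} {y : W} (he : DifferentiableAt ℝ e y) (hb : b =ᶠ[𝓝 y] fun y => (e y, 0)) :
    modelDorfman a b y = (fderiv ℝ e y (a y).1, dualForm (fderiv ℝ a y) (e y, 0)) := by
  have h : HasFDerivAt (fun y => (e y, (0 : W →L[ℝ] ℝ))) ((fderiv ℝ e y).prod 0) y :=
    he.hasFDerivAt.prodMk (hasFDerivAt_const _ _)
  rw [modelDorfman, (h.congr_of_eventuallyEq hb).fderiv, hb.eq_of_nhds]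
  refine Prod.ext (add_zero _) (zero_add _)

theorem contDiffAt_reading_section {x₀ : M} {y : EM} (hy : y ∈ coordDomain I F E x₀)
    (e : Cₛ^∞⟮I; F, E⟯) : ContDiffAt ℝ ∞ (reading I F x₀ e) y :=
  contDiffAt_of_coordDomain (contDiffOn_reading x₀ e.contMDiff) hy

/-- The derivative `u` of the section `e` occurs both in `Te X` and in `Δ_ν (e, 0)`, and the
derivative of `ν` both in `dℓ_ε` and in `Δ_ν (e, 0)`. Both cancel, so the lift depends on `e` only
through its value. -/
theorem model_horizontalLift {W G : Type*} [NormedAddCommGroup W] [NormedSpace ℝ W]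
    [NormedAddCommGroup G] [NormedSpace ℝ G] (D : W →L[ℝ] W × (G →L[ℝ] ℝ)) (ν : W × (G →L[ℝ] ℝ))
    (u g : G) (k : G × (W →L[ℝ] ℝ)) {θ : W × G →L[ℝ] ℝ} (hθ : ∀ z, θ z = (D z.1).2 g + ν.2 z.2) :
    ((ν.1, u), θ) - modelCore ((u, dualForm D (g, 0)) - k) = modelHor ν + modelCore k := by
  refine prod_dual_ext ?_ fun z => ?_
  · simp [modelHor, modelCore]
  · simp [modelHor, modelCore, hθ, modelDuality]

/-- The horizontal lift, in coordinates. -/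
theorem genCoord_horizontalLift (Δ : SkewDorfman I F E) (ν : SideSection I F E) (x₀ : M) :
    ∀ᶠ x in 𝓝 x₀, ∀ (p : TotalSpace F E), p.1 = x₀ → ∀ e : Cₛ^∞⟮I; F, E⟯,
      genCoord I F E p ⟨x, e x⟩ (horizontalLift Δ ν e x) =
        modelHor (sideCoord I F E x₀ x (ν x)) +
          modelCore (Δ.localForm ν x₀ (extChartAt I x₀ x) (fibreCoord F E x₀ x (e x))) := by
  filter_upwards [coordSource_mem_nhds (H := H) (F := F) (E := E) x₀,
    eventually_extChartAt (Δ.coreReading_toFun ν x₀)] with x hx hΔ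
  rintro p rfl e
  have hs := mem_extChartAt_source_of_coordSource (I := I) hx
  have hy := extChartAt_mem_coordDomain (I := I) hx
  set y := extChartAt I p.1 x with hydef
  have he := (contDiffAt_reading_section hy e).differentiableAt (by simp)
  have hinl : coreReading p.1 (coreInl (I := I) e) =ᶠ[𝓝 y] fun y => (reading I F p.1 e y, 0) := by
    filter_upwards [(isOpen_coordDomain p.1).mem_nhds hy] with z hz using coreReading_coreInl hz e
  have h1 := hΔ (coreInl e)
  rw [modelDorfman_inl he hinl, hinl.eq_of_nhds] at h1
  have h2 : coreCoord I F E p.1 x (Δ.toFun ν (coreInl e) x) = _ :=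
    (reading_extChartAt (V := Core I E) hs _).symm.trans h1
  have hν : sideReading p.1 ν y = sideCoord I F E p.1 x (ν x) := reading_extChartAt (V := Side I E) hs _
  have hee : reading I F p.1 e y = fibreCoord F E p.1 x (e x) := reading_extChartAt hs _
  rw [horizontalLift, map_sub, genCoord_coreLift (p := p) (q := ⟨x, e x⟩) hx, h2,
    genCoord_apply (p := p) (q := ⟨x, e x⟩) hx, hν, hee,
    tangentCoord_section hx (e.contMDiff.mdifferentiable (by simp) x)]
  have hν1 : fibreCoord EM (TangentSpace I) p.1 x (ν x).1 = (sideCoord I F E p.1 x (ν x)).1 :=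
    (congrArg Prod.fst (sideCoord_apply hx (ν x))).symm
  rw [hν1]
  refine model_horizontalLift (fderiv ℝ (sideReading p.1 ν) y) _ _ _ _ fun z => ?_
  have h3 := mvfderiv_linear (p := p) (q := ⟨x, e x⟩) hx ν
    ((trivializationAt (EM × F) (TangentSpace (I.prod 𝓘(ℝ, F))) p).symmL ℝ ⟨x, e x⟩ z)
  rw [tangentCoord_symmL (I := I) (p := p) (q := ⟨x, e x⟩) hx] at h3
  exact h3

theorem coreLift_add {p : TotalSpace F E} (τ τ' : Core I E p.1) :
    coreLift p (τ + τ') = coreLift p τ + coreLift p τ' := by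
  have hp := mem_coordSource_self (H := H) (F := F) (E := E) p.1
  apply genCoord_injective (I := I) hp
  rw [map_add, genCoord_coreLift hp, genCoord_coreLift hp, genCoord_coreLift hp, map_add,
    modelCore_add]

theorem coreLift_smul {p : TotalSpace F E} (r : ℝ) (τ : Core I E p.1) :
    coreLift p (r • τ) = r • coreLift p τ := by
  have hp := mem_coordSource_self (H := H) (F := F) (E := E) p.1
  apply genCoord_injective (I := I) hp
  rw [map_smul, genCoord_coreLift hp, genCoord_coreLift hp, map_smul]
  exact map_smul (modelCoreL (W := EM) (G := F)) r _

theorem sideReading_add (x₀ : M) (ν ν' : SideSection I F E) :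
    sideReading x₀ (ν + ν') = sideReading x₀ ν + sideReading x₀ ν' := reading_add x₀ ν ν'

theorem sideReading_fsmul (x₀ : M) (f : C^∞⟮I, M; ℝ⟯) (ν : SideSection I F E) (y : EM) :
    sideReading x₀ (fsmul f ν) y = (f ∘ (extChartAt I x₀).symm) y • sideReading x₀ ν y :=
  map_smul (sideCoord I F E x₀ _) _ _

theorem mvfderiv_linear_add (ν ν' : SideSection I F E) (q : TotalSpace F E) (v : TE I F E q) :
    mvfderiv (I.prod 𝓘(ℝ, F)) (fun r : TotalSpace F E => ((ν + ν') r.1).2 r.2) q v =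
      mvfderiv (I.prod 𝓘(ℝ, F)) (fun r : TotalSpace F E => (ν r.1).2 r.2) q v +
      mvfderiv (I.prod 𝓘(ℝ, F)) (fun r : TotalSpace F E => (ν' r.1).2 r.2) q v := by
  have hq := mem_coordSource_self (H := H) (F := F) (E := E) q.1
  have hd : ∀ ν : SideSection I F E,
      DifferentiableAt ℝ (sideReading q.1 ν) (extChartAt I q.1 q.1) := fun ν =>
    (contDiffAt_sideReading q.1 ν).differentiableAt (by simp)
  rw [mvfderiv_linear (p := q) hq, mvfderiv_linear (p := q) hq, mvfderiv_linear (p := q) hq]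
  have h := congrArg (fun g => fderiv ℝ g (extChartAt I q.1 q.1)) (sideReading_add q.1 ν ν')
  have h2 := h.trans (fderiv_add (hd ν) (hd ν'))
  have h3 : sideCoord I F E q.1 q.1 ((ν + ν') q.1) = sideCoord I F E q.1 q.1 (ν q.1) +
    sideCoord I F E q.1 q.1 (ν' q.1) := map_add _ _ _
  rw [h3]
  refine (congrArg (fun D : EM →L[ℝ] EM × (F →L[ℝ] ℝ) => (D (tangentCoord I q q v).1).2
    (fibreCoord F E q.1 q.1 q.2) + _) h2).trans ?_
  simp only [add_apply, Prod.snd_add]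
  ring

theorem mvfderiv_linear_fsmul (f : C^∞⟮I, M; ℝ⟯) (ν : SideSection I F E) (q : TotalSpace F E)
    (v : TE I F E q) :
    mvfderiv (I.prod 𝓘(ℝ, F)) (fun r : TotalSpace F E => (fsmul f ν r.1).2 r.2) q v =
      f q.1 * mvfderiv (I.prod 𝓘(ℝ, F)) (fun r : TotalSpace F E => (ν r.1).2 r.2) q v +
      (ν q.1).2 q.2 * mvfderiv I f q.1 (Tproj I q v) := by
  have hq := mem_coordSource_self (H := H) (F := F) (E := E) q.1
  have hd : DifferentiableAt ℝ (sideReading q.1 ν) (extChartAt I q.1 q.1) :=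
    (contDiffAt_sideReading q.1 ν).differentiableAt (by simp)
  have hf : DifferentiableAt ℝ (f ∘ (extChartAt I q.1).symm) (extChartAt I q.1 q.1) :=
    (contDiffAt_comp_symm f.contMDiff q.1).differentiableAt (by simp)
  rw [mvfderiv_linear (p := q) hq, mvfderiv_linear (p := q) hq]
  have h := congrArg (fun g => fderiv ℝ g (extChartAt I q.1 q.1)) (funext (sideReading_fsmul q.1 f ν))
  have h2 := h.trans (hf.hasFDerivAt.smul hd.hasFDerivAt).fderiv
  have h3 : sideCoord I F E q.1 q.1 (fsmul f ν q.1) = f q.1 • sideCoord I F E q.1 q.1 (ν q.1) :=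
    map_smul _ _ _
  rw [h3, mvfderiv_eq_fderiv (I := I) hq.1 (mdifferentiableAt_smooth f _), ← tangentCoord_fst hq]
  refine (congrArg (fun D : EM →L[ℝ] EM × (F →L[ℝ] ℝ) => (D (tangentCoord I q q v).1).2
    (fibreCoord F E q.1 q.1 q.2) + _) h2).trans ?_
  have h4 : (ν q.1).2 q.2 = (sideReading q.1 ν (extChartAt I q.1 q.1)).2
      (fibreCoord F E q.1 q.1 q.2) := by
    have h5 : sideReading q.1 ν (extChartAt I q.1 q.1) = sideCoord I F E q.1 q.1 (ν q.1) :=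
      reading_extChartAt (V := Side I E) (mem_extChartAt_source_of_coordSource hq) _
    rw [h5, sideCoord_apply hq]
    exact congrArg (ν q.1).2 (symmL_fibreCoord (H := H) hq q.2).symm
  have h6 : (f ∘ (extChartAt I q.1).symm) (extChartAt I q.1 q.1) = f q.1 := by
    rw [Function.comp_apply, extChartAt_to_inv]
  rw [h4, h6]
  simp only [add_apply, smul_apply, ContinuousLinearMap.smulRight_apply, Prod.snd_add, Prod.smul_snd,
    smul_eq_mul]
  ring

theorem horizontalLift_add (Δ : SkewDorfman I F E) (ν ν' : SideSection I F E) (e : Cₛ^∞⟮I; F, E⟯)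
    (m : M) : horizontalLift Δ (ν + ν') e m = horizontalLift Δ ν e m + horizontalLift Δ ν' e m := by
  have h : Δ.toFun (ν + ν') (coreInl e) m = Δ.toFun ν (coreInl e) m + Δ.toFun ν' (coreInl e) m := by
    rw [map_add]; rfl
  rw [horizontalLift, horizontalLift, horizontalLift, h, coreLift_add, sub_add_sub_comm]
  refine congrArg (· - _) (Prod.ext ?_ (ContinuousLinearMap.ext fun v => ?_))
  · exact map_add (mfderiv I (I.prod 𝓘(ℝ, F)) (fun x => (⟨x, e x⟩ : TotalSpace F E)) m) _ _
  · exact mvfderiv_linear_add ν ν' ⟨m, e m⟩ v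

/-- The summand `ℓ_ε q^* df` in the differential of `ℓ_{f ε}` is the core lift of the correction
`⟨ν, (e, 0)⟩ (0, df)` in the rule for `Δ_{f ν}`, and the two cancel. -/
theorem horizontalLift_fsmul (Δ : SkewDorfman I F E) (f : C^∞⟮I, M; ℝ⟯) (ν : SideSection I F E)
    (e : Cₛ^∞⟮I; F, E⟯) (m : M) :
    horizontalLift Δ (fsmul f ν) e m = f m • horizontalLift Δ ν e m := by
  have h0 : pairing (ν m) ((coreInl e : CoreSection I F E) m) = (ν m).2 (e m) := by
    change (ν m).2 (e m) + 0 = _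
    rw [add_zero]
  have h1 : Δ.toFun (fsmul f ν) (coreInl e) m =
      f m • Δ.toFun ν (coreInl e) m + (ν m).2 (e m) • coreD F E f m :=
    (Δ.smul_left f ν (coreInl e) m).trans (by rw [h0])
  rw [horizontalLift, horizontalLift, h1, coreLift_add, coreLift_smul, coreLift_smul, smul_sub]
  rw [← sub_sub, sub_right_comm]
  refine congrArg (· - _) ?_
  rw [sub_eq_iff_eq_add]
  refine Prod.ext ?_ (ContinuousLinearMap.ext fun v => ?_)
  · have h1 : (coreLift (I := I) (⟨m, e m⟩ : TotalSpace F E) (coreD F E f m)).1 = 0 := by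
      have hp := mem_coordSource_self (H := H) (F := F) (E := E) m
      change vlift I (⟨m, e m⟩ : TotalSpace F E) 0 = 0
      rw [vlift_eq_symmL (p := ⟨m, e m⟩) (q := ⟨m, e m⟩) hp, map_zero]
      exact map_zero _
    rw [Prod.fst_add, Prod.smul_fst, Prod.smul_fst, h1, smul_zero, add_zero]
    exact map_smul (mfderiv I (I.prod 𝓘(ℝ, F)) (fun x => (⟨x, e x⟩ : TotalSpace F E)) m) _ _
  · exact mvfderiv_linear_fsmul f ν ⟨m, e m⟩ v

/-- The two sides lie over the points `e m` and `e' m`; the equality is stated in the common model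
space. -/
theorem horizontalLift_congr (Δ : SkewDorfman I F E) (ν : SideSection I F E)
    {e e' : Cₛ^∞⟮I; F, E⟯} {m : M} (h : e m = e' m) :
    (horizontalLift Δ ν e m : (EM × F) × (EM × F →L[ℝ] ℝ)) = horizontalLift Δ ν e' m := by
  have h1 := (genCoord_horizontalLift Δ ν m).self_of_nhds
  have h2 := h1 ⟨m, e m⟩ rfl e
  have h3 := h1 ⟨m, e' m⟩ rfl e'
  have h4 : genCoord I F E ⟨m, e m⟩ ⟨m, e m⟩ (horizontalLift Δ ν e m) = horizontalLift Δ ν e m :=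
    fibreCoord_gen_self _
  have h5 : genCoord I F E ⟨m, e' m⟩ ⟨m, e' m⟩ (horizontalLift Δ ν e' m) = horizontalLift Δ ν e' m :=
    fibreCoord_gen_self _
  have h6 := congrArg (fun v => modelHor (sideCoord I F E m m (ν m)) +
    modelCore (Δ.localForm ν m (extChartAt I m m) (fibreCoord F E m m v))) h
  exact h4.symm.trans (h2.trans (h6.trans (h3.symm.trans h5)))

/-- Tensoriality in `ν` and independence of the section `e` together give a linear map over each
point of `E`. -/
theorem exists_hlift (Δ : SkewDorfman I F E) :
    ∃ B : ∀ p : TotalSpace F E, Side I E p.1 →ₗ[ℝ] GTE I F E p,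
      ∀ (ν : SideSection I F E) (e : Cₛ^∞⟮I; F, E⟯) (m : M),
        B ⟨m, e m⟩ (ν m) = horizontalLift Δ ν e m := by
  choose e he using fun p : TotalSpace F E => exists_section_eq (I := I) (F := F) (V := E) p.1 p.2
  have h : ∀ p : TotalSpace F E, ∃ B : Side I E p.1 →ₗ[ℝ] GTE I F E p, ∀ ν : SideSection I F E,
      B (ν p.1) = horizontalLift Δ ν (e p) p.1 := fun p =>
    exists_pointwise (I := I) (V := Side I E) (A := GTE I F E p) p.1
      (L := fun ν => horizontalLift Δ ν (e p) p.1) (fun s t => horizontalLift_add Δ s t _ _)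
      (fun f s => horizontalLift_fsmul Δ f s _ _)
  choose B hB using h
  refine ⟨B, fun ν e' m => ?_⟩
  exact (hB ⟨m, e' m⟩ ν).trans (horizontalLift_congr Δ ν (he ⟨m, e' m⟩))

/-- The horizontal lift as a linear splitting of the side projection. -/
def hlift (Δ : SkewDorfman I F E) (p : TotalSpace F E) : Side I E p.1 →ₗ[ℝ] GTE I F E p :=
  (exists_hlift Δ).choose p

theorem hlift_section (Δ : SkewDorfman I F E) (ν : SideSection I F E) (e : Cₛ^∞⟮I; F, E⟯) (m : M) :
    hlift Δ ⟨m, e m⟩ (ν m) = horizontalLift Δ ν e m := (exists_hlift Δ).choose_spec ν e m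

theorem genCoord_hlift (Δ : SkewDorfman I F E) (ν : SideSection I F E) (p : TotalSpace F E) :
    ∀ᶠ x in 𝓝 p.1, ∀ v : E x,
      genCoord I F E p ⟨x, v⟩ (hlift Δ ⟨x, v⟩ (ν x)) =
        modelHor (sideCoord I F E p.1 x (ν x)) +
          modelCore (Δ.localForm ν p.1 (extChartAt I p.1 x) (fibreCoord F E p.1 x v)) := by
  filter_upwards [genCoord_horizontalLift Δ ν p.1] with x hx v
  obtain ⟨e, rfl⟩ := exists_section_eq (I := I) (F := F) (V := E) x v
  rw [hlift_section]
  exact hx p rfl e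

theorem genCoord_hlift_self (Δ : SkewDorfman I F E) (ν : SideSection I F E) (p : TotalSpace F E) :
    genCoord I F E p p (hlift Δ p (ν p.1)) =
        modelHor (sideCoord I F E p.1 p.1 (ν p.1)) +
          modelCore (Δ.localForm ν p.1 (extChartAt I p.1 p.1) (fibreCoord F E p.1 p.1 p.2)) :=
  (genCoord_hlift Δ ν p).self_of_nhds p.2

theorem modelSide_modelHor {W G : Type*} [NormedAddCommGroup W] [NormedSpace ℝ W]
    [NormedAddCommGroup G] [NormedSpace ℝ G] (ν : W × (G →L[ℝ] ℝ)) (τ : G × (W →L[ℝ] ℝ)) :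
    modelSide (modelHor ν + modelCore τ) = ν := by
  refine prod_dual_ext ?_ fun z => ?_
  · simp [modelSide, modelHor, modelCore]
  · simp [modelSide, modelHor, modelCore]

theorem sideProj_hlift (Δ : SkewDorfman I F E) (p : TotalSpace F E) (ν : Side I E p.1) :
    sideProj p (hlift Δ p ν) = ν := by
  obtain ⟨s, rfl⟩ := exists_section_eq (I := I) (F := EM × (F →L[ℝ] ℝ)) (V := Side I E) p.1 ν
  have hp := mem_coordSource_self (H := H) (F := F) (E := E) p.1
  apply sideCoord_injective (F := F) hp
  rw [sideCoord_sideProj hp, genCoord_hlift_self, modelSide_modelHor]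

theorem eventually_totalSpace {p : TotalSpace F E} {P : M → Prop} (h : ∀ᶠ x in 𝓝 p.1, P x) :
    ∀ᶠ z in 𝓝 (extChartAt (I.prod 𝓘(ℝ, F)) p p), z.1 ∈ coordDomain I F E p.1 ∧
      P ((extChartAt I p.1).symm z.1) := by
  rw [extChartAt_totalSpace (mem_coordSource_self (H := H) p.1)]
  have hP : ∀ᶠ y in 𝓝 (extChartAt I p.1 p.1), y ∈ coordDomain I F E p.1 ∧
      P ((extChartAt I p.1).symm y) := by
    filter_upwards [coordDomain_mem_nhds (I := I) (F := F) (V := E) p.1,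
      eventually_symm (I := I) h] with y h1 h2 using ⟨h1, h2⟩
  have hc : ContinuousAt (Prod.fst : EM × F → EM) (extChartAt I p.1 p.1, fibreCoord F E p.1 p.1 p.2) :=
    continuousAt_fst
  exact hc.eventually hP

/-- A section of `TE ⊕ T*E` in coordinates. -/
abbrev genReading (p : TotalSpace F E) (s : ∀ q : TotalSpace F E, GTE I F E q) :
    EM × F → (EM × F) × (EM × F →L[ℝ] ℝ) :=
  reading (I.prod 𝓘(ℝ, F)) ((EM × F) × (EM × F →L[ℝ] ℝ)) p s

/-- Holds on a neighbourhood and not only at the centre, since brackets differentiate the lift. -/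
theorem genReading_hlift (Δ : SkewDorfman I F E) (ν : SideSection I F E) (p : TotalSpace F E) :
    genReading p (fun q => hlift Δ q (ν q.1)) =ᶠ[𝓝 (extChartAt (I.prod 𝓘(ℝ, F)) p p)]
      liftField (sideReading p.1 ν) (Δ.localForm ν p.1) := by
  filter_upwards [eventually_totalSpace (genCoord_hlift Δ ν p)] with z hz
  have hx := symm_mem_coordSource I F E hz.1
  have h1 : (extChartAt (I.prod 𝓘(ℝ, F)) p).symm z = _ :=
    extChartAt_totalSpace_symm (p := p) hz.1 z.2
  have h2 := hz.2 ((trivializationAt F E p.1).symmL ℝ ((extChartAt I p.1).symm z.1) z.2)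
  rw [genReading, reading, h1]
  refine h2.trans ?_
  rw [fibreCoord_symmL (H := H) hx, (extChartAt I p.1).right_inv hz.1.1]
  rfl

theorem genReading_coreLift (τ : CoreSection I F E) (p : TotalSpace F E) :
    genReading p (fun q => coreLift q (τ q.1)) =ᶠ[𝓝 (extChartAt (I.prod 𝓘(ℝ, F)) p p)]
      fun z => modelCore (coreReading p.1 τ z.1) := by
  filter_upwards [eventually_totalSpace (I := I) (p := p) (P := fun _ => True) (by simp)] with z hz
  have hx := symm_mem_coordSource I F E hz.1
  have h1 : (extChartAt (I.prod 𝓘(ℝ, F)) p).symm z = _ :=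
    extChartAt_totalSpace_symm (p := p) hz.1 z.2
  rw [genReading, reading, h1]
  exact genCoord_coreLift (p := p) (q := ⟨_, _⟩) hx _

end HorizontalLift

/-! ### The second vector bundle structure on `TE ⊕ T*E`. -/

section Fibrewise

variable {EM : Type*} [NormedAddCommGroup EM] [NormedSpace ℝ EM]
  {H : Type*} [TopologicalSpace H] {I : ModelWithCorners ℝ EM H} [I.Boundaryless]
  {M : Type*} [TopologicalSpace M] [ChartedSpace H M] [IsManifold I ∞ M]
  {F₁ : Type*} [NormedAddCommGroup F₁] [NormedSpace ℝ F₁]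
  {E₁ : M → Type*} [TopologicalSpace (TotalSpace F₁ E₁)]
  [∀ x, AddCommGroup (E₁ x)] [∀ x, Module ℝ (E₁ x)] [∀ x, TopologicalSpace (E₁ x)]
  [FiberBundle F₁ E₁] [VectorBundle ℝ F₁ E₁] [ContMDiffVectorBundle ∞ F₁ E₁ I]
  {F₂ : Type*} [NormedAddCommGroup F₂] [NormedSpace ℝ F₂]
  {E₂ : M → Type*} [TopologicalSpace (TotalSpace F₂ E₂)]
  [∀ x, AddCommGroup (E₂ x)] [∀ x, Module ℝ (E₂ x)] [∀ x, TopologicalSpace (E₂ x)]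
  [FiberBundle F₂ E₂] [VectorBundle ℝ F₂ E₂] [ContMDiffVectorBundle ∞ F₂ E₂ I]

/-- The derivative of a fibrewise map that is a constant linear map in coordinates. -/
theorem tangentCoord_mfderiv_fibrewise (φ : ∀ x, E₁ x → E₂ x) (L : F₁ →L[ℝ] F₂)
    (w : TotalSpace F₁ E₁)
    (hφ : ∀ x ∈ coordSource (H := H) F₁ E₁ w.1, x ∈ coordSource (H := H) F₂ E₂ w.1 → ∀ v,
      fibreCoord F₂ E₂ w.1 x (φ x v) = L (fibreCoord F₁ E₁ w.1 x v))
    (u : TangentSpace (I.prod 𝓘(ℝ, F₁)) w) :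
    tangentCoord I (⟨w.1, φ w.1 w.2⟩ : TotalSpace F₂ E₂) ⟨w.1, φ w.1 w.2⟩
      (mfderiv (I.prod 𝓘(ℝ, F₁)) (I.prod 𝓘(ℝ, F₂))
        (fun w : TotalSpace F₁ E₁ => (⟨w.1, φ w.1 w.2⟩ : TotalSpace F₂ E₂)) w u) =
      ((tangentCoord I w w u).1, L (tangentCoord I w w u).2) := by
  set Φ := fun w : TotalSpace F₁ E₁ => (⟨w.1, φ w.1 w.2⟩ : TotalSpace F₂ E₂) with hΦ
  have h1 := mem_coordSource_self (H := H) (F := F₁) (E := E₁) w.1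
  have h2 := mem_coordSource_self (H := H) (F := F₂) (E := E₂) w.1
  have hE := hasMFDerivAt_extChartAt_totalSpace (I := I) (p := w) (q := w) h1
  have ev : ∀ᶠ v : TotalSpace F₁ E₁ in 𝓝 w, v.1 ∈ coordSource (H := H) F₁ E₁ w.1 ∧
      v.1 ∈ coordSource (H := H) F₂ E₂ w.1 :=
    (FiberBundle.continuous_proj F₁ E₁).continuousAt.eventually
      ((coordSource_mem_nhds (H := H) (F := F₁) (E := E₁) w.1 |>
        (fun h => h : _ → ∀ᶠ x in 𝓝 w.1, x ∈ coordSource (H := H) F₁ E₁ w.1)).and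
        (coordSource_mem_nhds (H := H) (F := F₂) (E := E₂) w.1))
  have hL := (((ContinuousLinearMap.fst ℝ EM F₁).prod
    (L.comp (ContinuousLinearMap.snd ℝ EM F₁))).hasMFDerivAt
      (x := extChartAt (I.prod 𝓘(ℝ, F₁)) w w)).comp w hE
  -- Between charts the map is the identity on the base times `L` on the fibre, which is linear and
  -- thus its own derivative.
  have hcoord : extChartAt (I.prod 𝓘(ℝ, F₂)) (Φ w) ∘ Φ =ᶠ[𝓝 w]
      ((ContinuousLinearMap.fst ℝ EM F₁).prod (L.comp (ContinuousLinearMap.snd ℝ EM F₁))) ∘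
        extChartAt (I.prod 𝓘(ℝ, F₁)) w := by
    filter_upwards [ev] with v hv
    rw [Function.comp_apply, Function.comp_apply, extChartAt_totalSpace (p := Φ w) (q := Φ v) hv.2,
      extChartAt_totalSpace (p := w) (q := v) hv.1]
    exact Prod.ext rfl (hφ v.1 hv.1 hv.2 v.2)
  have hd : MDifferentiableAt (I.prod 𝓘(ℝ, F₁)) (I.prod 𝓘(ℝ, F₂)) Φ w := by
    have : ContMDiffAt (I.prod 𝓘(ℝ, F₁)) (I.prod 𝓘(ℝ, F₂)) ∞ Φ w := by
      rw [Bundle.contMDiffAt_totalSpace]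
      refine ⟨(contMDiff_proj E₁).contMDiffAt, ?_⟩
      have h3 : ContMDiffAt (I.prod 𝓘(ℝ, F₁)) 𝓘(ℝ, F₂) ∞ ((L.comp (ContinuousLinearMap.snd ℝ EM F₁)) ∘
          extChartAt (I.prod 𝓘(ℝ, F₁)) w) w :=
        (L.comp (ContinuousLinearMap.snd ℝ EM F₁)).contMDiff.contMDiffAt.comp w
          contMDiffAt_extChartAt
      refine h3.congr_of_eventuallyEq ?_
      filter_upwards [ev] with v hv
      rw [Function.comp_apply, extChartAt_totalSpace (p := w) (q := v) hv.1]
      refine Eq.trans ?_ (hφ v.1 hv.1 hv.2 v.2)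
      exact (Trivialization.continuousLinearMapAt_apply_of_mem ℝ _ hv.2.2 _).symm
    exact this.mdifferentiableAt (by simp)
  have h4 := (hasMFDerivAt_extChartAt_totalSpace (I := I) (p := Φ w) (q := Φ w) h2).comp w
    hd.hasMFDerivAt
  have h5 := hasMFDerivAt_unique h4 (hL.congr_of_eventuallyEq hcoord)
  exact congrArg (fun A => A u) h5

end Fibrewise

section SideSum

variable {EM : Type*} [NormedAddCommGroup EM] [NormedSpace ℝ EM] [FiniteDimensional ℝ EM]
  {H : Type*} [TopologicalSpace H] {I : ModelWithCorners ℝ EM H} [I.Boundaryless]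
  {M : Type*} [TopologicalSpace M] [T2Space M] [ChartedSpace H M] [IsManifold I ∞ M]
  {F : Type*} [NormedAddCommGroup F] [NormedSpace ℝ F] [FiniteDimensional ℝ F]
  {E : M → Type*} [TopologicalSpace (TotalSpace F E)]
  [∀ x, AddCommGroup (E x)] [∀ x, Module ℝ (E x)] [∀ x, TopologicalSpace (E x)]
  [FiberBundle F E] [VectorBundle ℝ F E] [ContMDiffVectorBundle ∞ F E I]

theorem fibreCoord_whitney {x₀ x : M} (hx : x ∈ coordSource (H := H) F E x₀) (v : E x × E x) :
    fibreCoord (F × F) (fun x => E x × E x) x₀ x v =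
      (fibreCoord F E x₀ x v.1, fibreCoord F E x₀ x v.2) := by
  simp only [fibreCoord]
  rw [Trivialization.continuousLinearMapAt_apply_of_mem ℝ _ (show x ∈ (trivializationAt (F × F)
      (fun x => E x × E x) x₀).baseSet from ⟨hx.2, hx.2⟩),
    Trivialization.continuousLinearMapAt_apply_of_mem ℝ _ hx.2,
    Trivialization.continuousLinearMapAt_apply_of_mem ℝ _ hx.2]
  rfl

/-- The core component of an element of `TE ⊕ T*E`, in coordinates. -/
def modelCorePart {W G : Type*} [NormedAddCommGroup W] [NormedSpace ℝ W] [NormedAddCommGroup G]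
    [NormedSpace ℝ G] (a : (W × G) × (W × G →L[ℝ] ℝ)) : G × (W →L[ℝ] ℝ) :=
  (a.1.2, a.2.comp (ContinuousLinearMap.inl ℝ W G))

theorem modelCorePart_apply {W G : Type*} [NormedAddCommGroup W] [NormedSpace ℝ W]
    [NormedAddCommGroup G] [NormedSpace ℝ G] (ν : W × (G →L[ℝ] ℝ)) (τ : G × (W →L[ℝ] ℝ)) :
    modelCorePart (modelHor ν + modelCore τ) = τ := by
  refine prod_dual_ext ?_ fun z => ?_
  · simp [modelCorePart, modelHor, modelCore]
  · simp [modelCorePart, modelHor, modelCore]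

/-- Addition in the side structure, in coordinates. -/
theorem model_sideSum {W G : Type*} [NormedAddCommGroup W] [NormedSpace ℝ W]
    [NormedAddCommGroup G] [NormedSpace ℝ G] (a b c : (W × G) × (W × G →L[ℝ] ℝ)) :
    ((∃ u : W × G × G, (u.1, u.2.1) = a.1 ∧ (u.1, u.2.2) = b.1 ∧ (u.1, u.2.1 + u.2.2) = c.1) ∧
      ∀ u : W × G × G, c.2 (u.1, u.2.1 + u.2.2) = a.2 (u.1, u.2.1) + b.2 (u.1, u.2.2)) ↔
    modelSide a = modelSide c ∧ modelSide b = modelSide c ∧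
      modelCorePart c = modelCorePart a + modelCorePart b := by
  have split : ∀ (θ : W × G →L[ℝ] ℝ) x g, θ (x, g) = θ (x, 0) + θ (0, g) := by
    intro θ x g; rw [← map_add]; simp
  constructor
  · rintro ⟨⟨u, h1, h2, h3⟩, h4⟩
    -- The three kinds of test vectors, vertical in either summand or along the base, give the two
    -- side conditions and the core condition.
    have ha := fun g => h4 (0, g, 0)
    have hb := fun g => h4 (0, 0, g)
    have hc := fun x => h4 (x, 0, 0)
    simp only [add_zero, zero_add, ← Prod.zero_eq_mk, map_zero] at ha hb hc
    refine ⟨prod_dual_ext ?_ fun z => ?_, prod_dual_ext ?_ fun z => ?_,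
      prod_dual_ext ?_ fun z => ?_⟩
    · simp [modelSide, ← h1, ← h3]
    · simp [modelSide, ha]
    · simp [modelSide, ← h2, ← h3]
    · simp [modelSide, hb]
    · simp [modelCorePart, ← h1, ← h2, ← h3]
    · simp [modelCorePart, hc]
  · rintro ⟨h1, h2, h3⟩
    have k1 := congrArg Prod.fst h1
    have k2 := congrArg Prod.fst h2
    have k3 := congrArg Prod.fst h3
    have l1 := fun z => congrArg (fun t => t.2 z) h1
    have l2 := fun z => congrArg (fun t => t.2 z) h2
    have l3 := fun z => congrArg (fun t => t.2 z) h3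
    simp only [modelSide, modelCorePart, Prod.fst_add, Prod.snd_add, add_apply,
      ContinuousLinearMap.comp_apply, ContinuousLinearMap.inr_apply,
      ContinuousLinearMap.inl_apply] at k1 k2 k3 l1 l2 l3
    refine ⟨⟨(c.1.1, a.1.2, b.1.2), Prod.ext k1.symm rfl, Prod.ext k2.symm rfl,
      Prod.ext rfl k3.symm⟩, fun u => ?_⟩
    rw [split, split a.2, split b.2, l1, l2, l3, ← zero_add (0 : W), ← Prod.mk_add_mk, map_add]
    simp only [zero_add]
    ring

variable (w : Whitney F E)

theorem tangentCoord_whitney_fst (u : TangentSpace (I.prod 𝓘(ℝ, F × F)) w) :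
    tangentCoord I (w.fst F E) (w.fst F E)
      (mfderiv (I.prod 𝓘(ℝ, F × F)) (I.prod 𝓘(ℝ, F)) (Whitney.fst F E) w u) =
      ((tangentCoord I w w u).1, (tangentCoord I w w u).2.1) :=
  tangentCoord_mfderiv_fibrewise (I := I) (E₁ := fun x => E x × E x) (fun _ v => v.1)
    (ContinuousLinearMap.fst ℝ F F) w (fun x _ hx v => by rw [fibreCoord_whitney hx]; rfl) u

theorem tangentCoord_whitney_snd (u : TangentSpace (I.prod 𝓘(ℝ, F × F)) w) :
    tangentCoord I (w.snd F E) (w.snd F E)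
      (mfderiv (I.prod 𝓘(ℝ, F × F)) (I.prod 𝓘(ℝ, F)) (Whitney.snd F E) w u) =
      ((tangentCoord I w w u).1, (tangentCoord I w w u).2.2) :=
  tangentCoord_mfderiv_fibrewise (I := I) (E₁ := fun x => E x × E x) (fun _ v => v.2)
    (ContinuousLinearMap.snd ℝ F F) w (fun x _ hx v => by rw [fibreCoord_whitney hx]; rfl) u

theorem tangentCoord_whitney_add (u : TangentSpace (I.prod 𝓘(ℝ, F × F)) w) :
    tangentCoord I (w.add F E) (w.add F E)
      (mfderiv (I.prod 𝓘(ℝ, F × F)) (I.prod 𝓘(ℝ, F)) (Whitney.add F E) w u) =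
      ((tangentCoord I w w u).1, (tangentCoord I w w u).2.1 + (tangentCoord I w w u).2.2) :=
  tangentCoord_mfderiv_fibrewise (I := I) (E₁ := fun x => E x × E x) (fun _ v => v.1 + v.2)
    (ContinuousLinearMap.fst ℝ F F + ContinuousLinearMap.snd ℝ F F) w
    (fun x _ hx v => by rw [fibreCoord_whitney hx, map_add]; rfl) u

theorem tangentCoord_homothety (r : ℝ) (p : TotalSpace F E) (u : TE I F E p) :
    tangentCoord I (homothety F E r p) (homothety F E r p)
      (mfderiv (I.prod 𝓘(ℝ, F)) (I.prod 𝓘(ℝ, F)) (homothety F E r) p u) =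
      ((tangentCoord I p p u).1, r • (tangentCoord I p p u).2) :=
  tangentCoord_mfderiv_fibrewise (I := I) (fun _ v => r • v)
    (r • ContinuousLinearMap.id ℝ F) p (fun x _ hx v => by rw [map_smul]; rfl) u

theorem tangentCoord_self (p : TotalSpace F E) (v : TE I F E p) : tangentCoord I p p v = v :=
  fibreCoord_tangent_self p v

/-- Addition in the side structure, in coordinates. -/
theorem isSideSum_iff (a : GTE I F E (w.fst F E)) (b : GTE I F E (w.snd F E))
    (c : GTE I F E (w.add F E)) : IsSideSum w a b c ↔
      modelSide (W := EM) (G := F) a = modelSide (W := EM) (G := F) c ∧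
      modelSide (W := EM) (G := F) b = modelSide (W := EM) (G := F) c ∧
      modelCorePart (W := EM) (G := F) c =
        modelCorePart (W := EM) (G := F) a + modelCorePart (W := EM) (G := F) b := by
  refine Iff.trans ?_ (model_sideSum (W := EM) (G := F) a b c)
  have h1 : ∀ u : TangentSpace (I.prod 𝓘(ℝ, F × F)) w,
      mfderiv (I.prod 𝓘(ℝ, F × F)) (I.prod 𝓘(ℝ, F)) (Whitney.fst F E) w u =
        (((u : EM × F × F).1, (u : EM × F × F).2.1) : EM × F) := fun u => by
    have h := tangentCoord_whitney_fst (I := I) w u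
    rw [tangentCoord_self, tangentCoord, fibreCoord_tangent_self] at h
    exact h
  have h2 : ∀ u : TangentSpace (I.prod 𝓘(ℝ, F × F)) w,
      mfderiv (I.prod 𝓘(ℝ, F × F)) (I.prod 𝓘(ℝ, F)) (Whitney.snd F E) w u =
        (((u : EM × F × F).1, (u : EM × F × F).2.2) : EM × F) := fun u => by
    have h := tangentCoord_whitney_snd (I := I) w u
    rw [tangentCoord_self, tangentCoord, fibreCoord_tangent_self] at h
    exact h
  have h3 : ∀ u : TangentSpace (I.prod 𝓘(ℝ, F × F)) w,
      mfderiv (I.prod 𝓘(ℝ, F × F)) (I.prod 𝓘(ℝ, F)) (Whitney.add F E) w u =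
        (((u : EM × F × F).1, (u : EM × F × F).2.1 + (u : EM × F × F).2.2) : EM × F) := fun u => by
    have h := tangentCoord_whitney_add (I := I) w u
    rw [tangentCoord_self, tangentCoord, fibreCoord_tangent_self] at h
    exact h
  refine and_congr (exists_congr fun u => ?_) (forall_congr' fun u => ?_)
  · exact and_congr (Eq.congr (h1 u) rfl) (and_congr (Eq.congr (h2 u) rfl) (Eq.congr (h3 u) rfl))
  · exact Eq.congr (congrArg c.2 (h3 u))
      (congrArg₂ (· + ·) (congrArg a.2 (h1 u)) (congrArg b.2 (h2 u)))

theorem model_sideSMul {W G : Type*} [NormedAddCommGroup W] [NormedSpace ℝ W]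
    [NormedAddCommGroup G] [NormedSpace ℝ G] (r : ℝ) (a c : (W × G) × (W × G →L[ℝ] ℝ)) :
    ((a.1.1, r • a.1.2) = c.1 ∧ (∀ v : W × G, c.2 (v.1, r • v.2) = r * a.2 v) ∧
      ∀ g, c.2 (0, g) = a.2 (0, g)) ↔
    modelSide c = modelSide a ∧ modelCorePart c = r • modelCorePart a := by
  have split : ∀ (θ : W × G →L[ℝ] ℝ) x g, θ (x, g) = θ (x, 0) + θ (0, g) := by
    intro θ x g; rw [← map_add]; simp
  constructor
  · rintro ⟨h1, h2, h3⟩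
    refine ⟨prod_dual_ext ?_ fun z => ?_, prod_dual_ext ?_ fun z => ?_⟩
    · simp [modelSide, ← h1]
    · simp [modelSide, h3]
    · simp [modelCorePart, ← h1]
    · have := h2 (z, 0)
      simp only [smul_zero] at this
      simp [modelCorePart, this]
  · rintro ⟨h1, h2⟩
    have k1 := congrArg Prod.fst h1
    have k2 := congrArg Prod.fst h2
    have l1 := fun z => congrArg (fun t => t.2 z) h1
    have l2 := fun z => congrArg (fun t => t.2 z) h2
    simp only [modelSide, modelCorePart, Prod.smul_fst, Prod.smul_snd, smul_apply,
      ContinuousLinearMap.comp_apply, ContinuousLinearMap.inr_apply, smul_eq_mul,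
      ContinuousLinearMap.inl_apply] at k1 k2 l1 l2
    refine ⟨Prod.ext k1.symm k2.symm, fun v => ?_, l1⟩
    have h5 : c.2 (0, r • v.2) = r * a.2 (0, v.2) := by
      rw [l1]
      have : ((0, r • v.2) : W × G) = r • (0, v.2) := by simp
      rw [this, map_smul, smul_eq_mul]
    rw [split, l2, h5, ← mul_add, ← split]

/-- Multiplication in the side structure, in coordinates. -/
theorem isSideSMul_iff (r : ℝ) (p : TotalSpace F E) (a : GTE I F E p)
    (c : GTE I F E (homothety F E r p)) : IsSideSMul r p a c ↔
      modelSide (W := EM) (G := F) c = modelSide (W := EM) (G := F) a ∧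
      modelCorePart (W := EM) (G := F) c = r • modelCorePart (W := EM) (G := F) a := by
  refine Iff.trans ?_ (model_sideSMul (W := EM) (G := F) r a c)
  have h1 : ∀ u : TE I F E p,
      mfderiv (I.prod 𝓘(ℝ, F)) (I.prod 𝓘(ℝ, F)) (homothety F E r) p u =
        (((u : EM × F).1, r • (u : EM × F).2) : EM × F) := fun u => by
    have h := tangentCoord_homothety (I := I) r p u
    rw [tangentCoord_self, tangentCoord_self] at h
    exact h
  have h2 : ∀ (q : TotalSpace F E) (e : E q.1),
      vlift I q e = ((0, fibreCoord F E q.1 q.1 e) : EM × F) := fun q e => by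
    have h := tangentCoord_vlift (I := I) (p := q) (mem_coordSource_self (H := H) q.1) e
    rw [tangentCoord_self] at h
    exact h
  have hp := mem_coordSource_self (H := H) (F := F) (E := E) p.1
  refine and_congr (Eq.congr (h1 a.1) rfl) (and_congr (forall_congr' fun u => ?_) ?_)
  · exact Eq.congr (congrArg c.2 (h1 u)) rfl
  · constructor
    · intro h g
      have h3 := h ((trivializationAt F E p.1).symmL ℝ p.1 g)
      have h4 := fibreCoord_symmL (H := H) hp g
      exact (congrArg c.2 ((h2 (homothety F E r p) _).trans (congrArg (Prod.mk (0 : EM)) h4))).symm.trans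
        (h3.trans (congrArg a.2 ((h2 p _).trans (congrArg (Prod.mk (0 : EM)) h4))))
    · intro h e
      exact (congrArg c.2 (h2 (homothety F E r p) e)).trans
        ((h _).trans (congrArg a.2 (h2 p e)).symm)

end SideSum

/-! ### The splitting into horizontal and core parts. -/

section ModelIso

variable {W G : Type*} [NormedAddCommGroup W] [NormedSpace ℝ W]
  [NormedAddCommGroup G] [NormedSpace ℝ G]

theorem fderiv_modelDuality {a : W → W × (G →L[ℝ] ℝ)} {b : W → G × (W →L[ℝ] ℝ)} {y : W}
    (ha : DifferentiableAt ℝ a y) (hb : DifferentiableAt ℝ b y) (v : W) :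
    fderiv ℝ (fun y => modelDuality (a y) (b y)) y v =
      modelDuality (fderiv ℝ a y v) (b y) + modelDuality (a y) (fderiv ℝ b y v) := by
  have h := (ha.hasFDerivAt.snd.clm_apply hb.hasFDerivAt.fst).add
    (hb.hasFDerivAt.snd.clm_apply ha.hasFDerivAt.fst)
  refine (congrArg (fun L => L v) h.fderiv).trans ?_
  simp only [modelDuality, add_apply, ContinuousLinearMap.comp_apply, ContinuousLinearMap.flip_apply,
    ContinuousLinearMap.coe_fst', ContinuousLinearMap.coe_snd']
  ring

/-- The duality that defines the dull bracket, for the local form of the connection; it identifies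
`modelDull` with the reading of `dullBracket`. -/
theorem modelDull_eq {a₁ a₂ : W → W × (G →L[ℝ] ℝ)} {K₁ : W → G →L[ℝ] G × (W →L[ℝ] ℝ)}
    {b : W → G × (W →L[ℝ] ℝ)} {y : W} (ha₂ : DifferentiableAt ℝ a₂ y)
    (hb : DifferentiableAt ℝ b y) :
    modelDuality (modelDull a₁ a₂ K₁ y) (b y) =
      fderiv ℝ (fun y => modelDuality (a₂ y) (b y)) y (a₁ y).1 -
        modelDuality (a₂ y) (modelDorfman a₁ b y - K₁ y (b y).1) := by
  rw [fderiv_modelDuality ha₂ hb]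
  simp only [modelDuality, modelDull, modelDorfman, dualForm_apply, Prod.fst_add, Prod.snd_add,
    Prod.fst_sub, Prod.snd_sub, add_apply, sub_apply, ContinuousLinearMap.comp_apply,
    ContinuousLinearMap.flip_apply, ContinuousLinearMap.coe_fst', ContinuousLinearMap.coe_snd',
    map_sub, add_zero]
  ring

theorem modelHor_zero : modelHor (0 : W × (G →L[ℝ] ℝ)) = 0 :=
  map_zero (modelHorL (W := W) (G := G))

theorem modelPairing_lift (ν₁ ν₂ : W × (G →L[ℝ] ℝ)) (τ₁ τ₂ : G × (W →L[ℝ] ℝ)) :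
    modelPairing (modelHor ν₁ + modelCore τ₁) (modelHor ν₂ + modelCore τ₂) =
      modelDuality ν₁ τ₂ + modelDuality ν₂ τ₁ := by
  simp [modelPairing, modelHor, modelCore, modelDuality]
  ring

theorem modelHor_add_modelCore (a : (W × G) × (W × G →L[ℝ] ℝ)) :
    modelHor (modelSide a) + modelCore (modelCorePart a) = a := by
  refine prod_dual_ext (by simp [modelHor, modelCore, modelSide, modelCorePart]) fun z => ?_
  have : z = (0, z.2) + (z.1, 0) := by simp
  conv_rhs => rw [this, map_add]
  simp [modelHor, modelCore, modelSide, modelCorePart]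

end ModelIso

section LiftStructure

variable {EM : Type*} [NormedAddCommGroup EM] [NormedSpace ℝ EM] [FiniteDimensional ℝ EM]
  {H : Type*} [TopologicalSpace H] {I : ModelWithCorners ℝ EM H} [I.Boundaryless]
  {M : Type*} [TopologicalSpace M] [T2Space M] [ChartedSpace H M] [IsManifold I ∞ M]
  {F : Type*} [NormedAddCommGroup F] [NormedSpace ℝ F] [FiniteDimensional ℝ F]
  {E : M → Type*} [TopologicalSpace (TotalSpace F E)]
  [∀ x, AddCommGroup (E x)] [∀ x, Module ℝ (E x)] [∀ x, TopologicalSpace (E x)]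
  [FiberBundle F E] [VectorBundle ℝ F E] [ContMDiffVectorBundle ∞ F E I]

theorem genCoord_self (p : TotalSpace F E) (a : GTE I F E p) : genCoord I F E p p a = a :=
  fibreCoord_gen_self a

theorem coreLift_eq_modelCore (p : TotalSpace F E) (τ : Core I E p.1) :
    coreLift p τ = modelCore (W := EM) (G := F) (coreCoord I F E p.1 p.1 τ) :=
  (genCoord_self p _).symm.trans (genCoord_coreLift (mem_coordSource_self (H := H) p.1) τ)

theorem modelSide_self (p : TotalSpace F E) (a : GTE I F E p) :
    modelSide (W := EM) (G := F) a = sideCoord I F E p.1 p.1 (sideProj p a) :=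
  (congrArg modelSide (genCoord_self p a)).symm.trans
    (sideCoord_sideProj (mem_coordSource_self (H := H) p.1) a).symm

/-- For fixed `ν` the horizontal part is constant along the fibre of `E` and the core part is linear
in `e`. This linearity is the compatibility of the lift with the side structure. -/
theorem hlift_eq_model (Δ : SkewDorfman I F E) (x : M) (ν : Side I E x) :
    ∃ K : F →L[ℝ] F × (EM →L[ℝ] ℝ), ∀ e : E x, hlift Δ ⟨x, e⟩ ν =
      modelHor (W := EM) (G := F) (sideCoord I F E x x ν) + modelCore (K (fibreCoord F E x x e)) := by
  obtain ⟨s, rfl⟩ := exists_section_eq (I := I) (F := EM × (F →L[ℝ] ℝ)) (V := Side I E) x ν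
  exact ⟨Δ.localForm s x (extChartAt I x x), fun e =>
    (genCoord_self (I := I) (⟨x, e⟩ : TotalSpace F E) _).symm.trans
      (genCoord_hlift_self Δ s ⟨x, e⟩)⟩

theorem sideProj_coreLift (p : TotalSpace F E) (τ : Core I E p.1) :
    sideProj p (coreLift p τ) = 0 := by
  apply sideCoord_injective (F := F) (mem_coordSource_self (H := H) p.1)
  rw [← modelSide_self, map_zero]
  refine (congrArg modelSide (coreLift_eq_modelCore p τ)).trans ?_
  refine prod_dual_ext rfl fun z => ?_
  simp [modelSide, modelCore]

theorem coreLift_injective (p : TotalSpace F E) :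
    Function.Injective (coreLift p : Core I E p.1 → GTE I F E p) := by
  intro τ τ' h
  apply coreCoord_injective (I := I) (F := F) (mem_coordSource_self (H := H) p.1)
  have h1 := (coreLift_eq_modelCore p τ).symm.trans (h.trans (coreLift_eq_modelCore p τ'))
  have h2 := modelCorePart_apply (W := EM) (G := F) 0
  have h3 := modelHor_zero (W := EM) (G := F)
  simp only [h3, zero_add] at h2
  rw [← h2 (coreCoord I F E p.1 p.1 τ), ← h2 (coreCoord I F E p.1 p.1 τ')]
  exact congrArg modelCorePart h1

theorem coreLift_zero (p : TotalSpace F E) : coreLift p (0 : Core I E p.1) = 0 := by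
  have h := coreLift_add (p := p) (0 : Core I E p.1) 0
  rw [add_zero] at h
  exact left_eq_add.1 h

theorem coreLift_neg (p : TotalSpace F E) (τ : Core I E p.1) :
    coreLift p (-τ) = -coreLift p τ := by
  rw [eq_neg_iff_add_eq_zero, ← coreLift_add, neg_add_cancel, coreLift_zero]

theorem coreLift_sub (p : TotalSpace F E) (τ τ' : Core I E p.1) :
    coreLift p (τ - τ') = coreLift p τ - coreLift p τ' := by
  rw [sub_eq_add_neg, coreLift_add, coreLift_neg, sub_eq_add_neg]

/-- The kernel of the side projection is the core. -/
theorem exists_coreLift_eq {p : TotalSpace F E} {a : GTE I F E p} (h : sideProj p a = 0) :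
    ∃ τ, a = coreLift p τ := by
  obtain ⟨τ, hτ⟩ := exists_coreCoord (I := I) (mem_coordSource_self (H := H) (F := F) (E := E) p.1)
    (modelCorePart (W := EM) (G := F) a)
  refine ⟨τ, ?_⟩
  have h1 := modelSide_self p a
  rw [h, map_zero] at h1
  have h2 := modelHor_add_modelCore (W := EM) (G := F) a
  have h3 := modelHor_zero (W := EM) (G := F)
  rw [h1, h3, zero_add, ← hτ] at h2
  exact h2.symm.trans (coreLift_eq_modelCore p τ).symm

/-- The lift is a section of the side projection, whose kernel is the core. -/
theorem exists_hlift_add_coreLift (Δ : SkewDorfman I F E) (p : TotalSpace F E) (a : GTE I F E p) :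
    ∃ τ, a = hlift Δ p (sideProj p a) + coreLift p τ := by
  obtain ⟨τ, h⟩ := exists_coreLift_eq (p := p) (a := a - hlift Δ p (sideProj p a))
    (by rw [map_sub, sideProj_hlift, sub_self])
  exact ⟨τ, by rw [← h]; abel⟩

theorem sideProj_lift (Δ : SkewDorfman I F E) (p : TotalSpace F E) (ν : Side I E p.1)
    (τ : Core I E p.1) : sideProj p (hlift Δ p ν + coreLift p τ) = ν := by
  rw [map_add, sideProj_hlift, sideProj_coreLift, add_zero]

theorem modelCorePart_lift (Δ : SkewDorfman I F E) (x : M) (ν : Side I E x) :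
    ∃ K : F →L[ℝ] F × (EM →L[ℝ] ℝ), ∀ (e : E x) (τ : Core I E x),
      modelCorePart (W := EM) (G := F) (hlift Δ ⟨x, e⟩ ν + coreLift ⟨x, e⟩ τ) =
        K (fibreCoord F E x x e) + coreCoord I F E x x τ := by
  obtain ⟨K, hK⟩ := hlift_eq_model Δ x ν
  refine ⟨K, fun e τ => ?_⟩
  have h := congrArg₂ (· + ·) (hK e) (coreLift_eq_modelCore (I := I) (⟨x, e⟩ : TotalSpace F E) τ)
  refine (congrArg modelCorePart h).trans ?_
  refine (congrArg modelCorePart (add_assoc (modelHor _) (modelCore (W := EM) (G := F) _)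
    (modelCore _))).trans ?_
  rw [← modelCore_add]
  exact modelCorePart_apply _ _

theorem modelSide_lift (Δ : SkewDorfman I F E) (x : M) (ν : Side I E x) (e : E x)
    (τ : Core I E x) :
    modelSide (W := EM) (G := F) (hlift Δ ⟨x, e⟩ ν + coreLift ⟨x, e⟩ τ) = sideCoord I F E x x ν :=
  (modelSide_self (⟨x, e⟩ : TotalSpace F E) _).trans
    (congrArg (sideCoord I F E x x) (sideProj_lift Δ ⟨x, e⟩ ν τ))

/-- Addition in the side structure, in terms of a splitting. -/
theorem isSideSum_lift (Δ : SkewDorfman I F E) (w : Whitney F E) (ν₁ ν₂ ν₃ : Side I E w.1)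
    (τ₁ τ₂ τ₃ : Core I E w.1) :
    IsSideSum w (hlift Δ (w.fst F E) ν₁ + coreLift (w.fst F E) τ₁)
      (hlift Δ (w.snd F E) ν₂ + coreLift (w.snd F E) τ₂)
      (hlift Δ (w.add F E) ν₃ + coreLift (w.add F E) τ₃) ↔ ν₁ = ν₃ ∧ ν₂ = ν₃ ∧ τ₃ = τ₁ + τ₂ := by
  have hw := mem_coordSource_self (H := H) (F := F) (E := E) w.1
  have hi : ∀ ν ν' : Side I E w.1,
      sideCoord I F E w.1 w.1 ν = sideCoord I F E w.1 w.1 ν' ↔ ν = ν' := fun ν ν' =>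
    (sideCoord_injective (I := I) (F := F) hw).eq_iff
  have s1 := modelSide_lift Δ w.1 ν₁ w.2.1 τ₁
  have s2 := modelSide_lift Δ w.1 ν₂ w.2.2 τ₂
  have s3 := modelSide_lift Δ w.1 ν₃ (w.2.1 + w.2.2) τ₃
  refine (isSideSum_iff w _ _ _).trans ((and_congr ((Eq.congr s1 s3).trans (hi _ _))
    (and_congr ((Eq.congr s2 s3).trans (hi _ _)) Iff.rfl)).trans ?_)
  refine and_congr_right fun h1 => and_congr_right fun h2 => ?_
  subst h1 h2
  -- The same linear `K` serves all three points, so the contributions of the lift cancel and the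
  -- core components add.
  obtain ⟨K, hK⟩ := modelCorePart_lift Δ w.1 ν₂
  refine (Eq.congr (hK (w.2.1 + w.2.2) τ₃)
    (congrArg₂ (· + ·) (hK w.2.1 τ₁) (hK w.2.2 τ₂))).trans ?_
  rw [map_add, map_add, add_add_add_comm, add_right_inj, ← map_add]
  exact (coreCoord_injective (I := I) (F := F) hw).eq_iff

/-- Multiplication in the side structure, in terms of a splitting. -/
theorem isSideSMul_lift (Δ : SkewDorfman I F E) (r : ℝ) (p : TotalSpace F E) (ν₁ ν₂ : Side I E p.1)
    (τ₁ τ₂ : Core I E p.1) :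
    IsSideSMul r p (hlift Δ p ν₁ + coreLift p τ₁)
      (hlift Δ (homothety F E r p) ν₂ + coreLift (homothety F E r p) τ₂) ↔
        ν₂ = ν₁ ∧ τ₂ = r • τ₁ := by
  have hw := mem_coordSource_self (H := H) (F := F) (E := E) p.1
  have s1 := modelSide_lift Δ p.1 ν₁ p.2 τ₁
  have s2 := modelSide_lift Δ p.1 ν₂ (r • p.2) τ₂
  refine (isSideSMul_iff r p _ _).trans ((and_congr ((Eq.congr s2 s1).trans
    (sideCoord_injective (I := I) (F := F) hw).eq_iff) Iff.rfl).trans ?_)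
  refine and_congr_right fun h1 => ?_
  subst h1
  obtain ⟨K, hK⟩ := modelCorePart_lift Δ p.1 ν₂
  refine (Eq.congr (hK (r • p.2) τ₂) (congrArg (r • ·) (hK p.2 τ₁))).trans ?_
  rw [map_smul, map_smul, smul_add, add_right_inj, ← map_smul]
  exact (coreCoord_injective (I := I) (F := F) hw).eq_iff

/-- The dull bracket, in coordinates. -/
theorem DorfmanConnection.sideReading_dullBracket (Δ : DorfmanConnection I F E)
    (ν₁ ν₂ : SideSection I F E) (x₀ : M) :
    sideReading x₀ (Δ.dullBracket ν₁ ν₂) =ᶠ[𝓝 (extChartAt I x₀ x₀)]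
      modelDull (sideReading x₀ ν₁) (sideReading x₀ ν₂) (Δ.localForm ν₁ x₀) := by
  filter_upwards [coordDomain_mem_nhds (I := I) (F := F) (V := E) x₀,
    Δ.coreReading_toFun ν₁ x₀] with y hy hΔ
  refine modelDuality_ext_left fun t => ?_
  have hx := symm_mem_coordSource I F E hy
  obtain ⟨v, hv⟩ := exists_coreCoord (I := I) hx t
  obtain ⟨τ, hτ⟩ := exists_section_eq (I := I) (F := F × (EM →L[ℝ] ℝ)) (V := Core I E) _ v
  have ht : coreReading x₀ τ y = t := (congrArg (coreCoord I F E x₀ _) hτ).trans hv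
  have hν := contDiffAt_of_coordDomain (contDiffOn_reading_side x₀ ν₂) hy
  have hc := contDiffAt_of_coordDomain (contDiffOn_reading_core x₀ τ) hy
  rw [← ht, modelDull_eq (hν.differentiableAt (by simp)) (hc.differentiableAt (by simp)), ← hΔ τ,
    modelDuality_reading hy, modelDuality_reading hy, Δ.pairing_dullBracket, derivMap_symm hy]
  refine congrArg (fun D : EM →L[ℝ] ℝ => D (sideReading x₀ ν₁ y).1 - _) ?_
  refine Filter.EventuallyEq.fderiv_eq ?_
  filter_upwards [(isOpen_coordDomain x₀).mem_nhds hy] with z hz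
  exact (modelDuality_reading hz ν₂ τ).symm

theorem genPairing_coreLift {p : TotalSpace F E} (a : GTE I F E p) (τ : Core I E p.1) :
    genPairing a (coreLift p τ) = pairing (sideProj p a) τ := by
  change a.2 (vlift I p τ.1) + τ.2 (Tproj I p a.1) = _
  rw [← sideProj_snd_apply]
  rfl

/-- The horizontal lift of a skew-symmetric Dorfman connection is isotropic. -/
theorem genPairing_hlift (Δ : SkewDorfman I F E) (p : TotalSpace F E) (ν₁ ν₂ : Side I E p.1) :
    genPairing (hlift Δ p ν₁) (hlift Δ p ν₂) = 0 := by
  obtain ⟨s₁, rfl⟩ := exists_section_eq (I := I) (F := EM × (F →L[ℝ] ℝ)) (V := Side I E) p.1 ν₁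
  obtain ⟨s₂, rfl⟩ := exists_section_eq (I := I) (F := EM × (F →L[ℝ] ℝ)) (V := Side I E) p.1 ν₂
  have hp := mem_coordSource_self (H := H) (F := F) (E := E) p.1
  have h1 := (genCoord_self p _).symm.trans (genCoord_hlift_self Δ s₁ p)
  have h2 := (genCoord_self p _).symm.trans (genCoord_hlift_self Δ s₂ p)
  refine (congrArg₂ (modelPairing (W := EM × F)) h1 h2).trans ?_
  rw [modelPairing_lift]
  have h3 := (Δ.sideReading_dullBracket s₁ s₂ p.1).self_of_nhds
  have h4 := (Δ.sideReading_dullBracket s₂ s₁ p.1).self_of_nhds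
  -- In the `E*`-component of the skew-symmetry the derivatives of `s₁` and `s₂` cancel. What
  -- remains, evaluated on the fibre coordinate of `p`, is the pairing of the two lifts.
  have h5 : sideReading p.1 (Δ.dullBracket s₁ s₂) (extChartAt I p.1 p.1) =
      -sideReading p.1 (Δ.dullBracket s₂ s₁) (extChartAt I p.1 p.1) := by
    rw [Δ.skew]; exact map_neg (sideCoord I F E p.1 _) _
  rw [h3, h4] at h5
  have h6 := congrArg (fun t => t.2 (fibreCoord F E p.1 p.1 p.2)) h5
  have e : ∀ s : SideSection I F E,
      sideReading p.1 s (extChartAt I p.1 p.1) = sideCoord I F E p.1 p.1 (s p.1) := fun s =>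
    reading_extChartAt (V := Side I E) (mem_extChartAt_source_of_coordSource hp) s
  simp only [modelDull, Prod.snd_add, Prod.snd_sub, add_apply, sub_apply,
    ContinuousLinearMap.comp_apply, ContinuousLinearMap.flip_apply, ContinuousLinearMap.coe_fst',
    ContinuousLinearMap.coe_snd', Prod.snd_neg, neg_apply, e] at h6
  simp only [modelDuality]
  linarith

end LiftStructure

/-! ### The symmetric part of the bracket and skewness of the Nijenhuis expression. -/

section ModelBracket

theorem modelBracket_congr {W : Type*} [NormedAddCommGroup W] [NormedSpace ℝ W]
    {a a' b b' : W → W × (W →L[ℝ] ℝ)} {y : W} (h : a =ᶠ[𝓝 y] a') (h' : b =ᶠ[𝓝 y] b') :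
    modelBracket a b y = modelBracket a' b' y := by
  simp only [modelBracket, h.fderiv_eq, h'.fderiv_eq, h.eq_of_nhds, h'.eq_of_nhds]

theorem modelBracket_symm {W : Type*} [NormedAddCommGroup W] [NormedSpace ℝ W]
    {a b : W → W × (W →L[ℝ] ℝ)} {y : W} (ha : DifferentiableAt ℝ a y)
    (hb : DifferentiableAt ℝ b y) :
    modelBracket a b y + modelBracket b a y =
      (0, fderiv ℝ (fun y => modelPairing (a y) (b y)) y) := by
  have h := ((ha.hasFDerivAt.snd.clm_apply hb.hasFDerivAt.fst).add
    (hb.hasFDerivAt.snd.clm_apply ha.hasFDerivAt.fst)).fderiv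
  refine prod_dual_ext ?_ fun z => ?_
  · simp [modelBracket]
  · refine Eq.trans ?_ (congrArg (fun L : W →L[ℝ] ℝ => L z) h).symm
    rw [Prod.snd_add, add_apply, modelBracket_snd_apply, modelBracket_snd_apply]
    simp only [add_apply, ContinuousLinearMap.comp_apply, ContinuousLinearMap.flip_apply,
      ContinuousLinearMap.coe_fst', ContinuousLinearMap.coe_snd']
    ring

theorem contDiffAt_liftField {W G : Type*} [NormedAddCommGroup W] [NormedSpace ℝ W]
    [NormedAddCommGroup G] [NormedSpace ℝ G] {a : W → W × (G →L[ℝ] ℝ)}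
    {K : W → G →L[ℝ] G × (W →L[ℝ] ℝ)} {z : W × G} (ha : ContDiffAt ℝ ∞ a z.1)
    (hK : ContDiffAt ℝ ∞ K z.1) : ContDiffAt ℝ ∞ (liftField a K) z := by
  have h1 : ContDiffAt ℝ ∞ (fun z : W × G => a z.1) z := ContDiffAt.comp z ha contDiffAt_fst
  have h2 : ContDiffAt ℝ ∞ (fun z : W × G => K z.1) z := ContDiffAt.comp z hK contDiffAt_fst
  exact ((modelHorL (W := W) (G := G)).contDiff.contDiffAt.comp z h1).add
    ((modelCoreL (W := W) (G := G)).contDiff.contDiffAt.comp z (h2.clm_apply contDiffAt_snd))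

end ModelBracket

section CourantSymm

variable {EN : Type*} [NormedAddCommGroup EN] [NormedSpace ℝ EN] [FiniteDimensional ℝ EN]
  {H : Type*} [TopologicalSpace H] {I : ModelWithCorners ℝ EN H} [I.Boundaryless]
  {N : Type*} [TopologicalSpace N] [ChartedSpace H N] [IsManifold I ∞ N]

theorem genPairing_comm {p : N} (a b : GenTangent I p) : genPairing a b = genPairing b a :=
  add_comm _ _

theorem genPairing_add_right {p : N} (a b c : GenTangent I p) :
    genPairing a (b + c) = genPairing a b + genPairing a c := by
  simp only [genPairing, Prod.fst_add, Prod.snd_add, map_add]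
  exact add_add_add_comm _ _ _ _

theorem genPairing_add_left {p : N} (a b c : GenTangent I p) :
    genPairing (a + b) c = genPairing a c + genPairing b c := by
  rw [genPairing_comm, genPairing_add_right, genPairing_comm c a, genPairing_comm c b]

theorem genPairing_zero_right {p : N} (a : GenTangent I p) : genPairing a 0 = 0 := by
  have h := genPairing_add_right a 0 0
  rw [add_zero] at h
  exact left_eq_add.1 h

theorem genPairing_neg_right {p : N} (a b : GenTangent I p) :
    genPairing a (-b) = -genPairing a b := by
  rw [eq_neg_iff_add_eq_zero, ← genPairing_add_right, neg_add_cancel, genPairing_zero_right]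

theorem genPairing_neg_left {p : N} (a b : GenTangent I p) :
    genPairing (-a) b = -genPairing a b := by
  rw [genPairing_comm, genPairing_neg_right, genPairing_comm]

theorem genPairing_app_left {J : BundleEnd I (EN × (EN →L[ℝ] ℝ)) (GenTangent I (N := N))}
    (hsq : ∀ p (a : GenTangent I p), J.app p (J.app p a) = -a)
    (horth : ∀ p (a b : GenTangent I p), genPairing (J.app p a) (J.app p b) = genPairing a b)
    {p : N} (a b : GenTangent I p) : genPairing (J.app p a) b = -genPairing a (J.app p b) := by
  rw [← horth p a (J.app p b), hsq, genPairing_neg_right, neg_neg]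

/-- The symmetric part of the Courant-Dorfman bracket. -/
theorem courantBracket_symm (e₁ e₂ : Cₛ^∞⟮I; EN × (EN →L[ℝ] ℝ), GenTangent I (N := N)⟯) (p : N) :
    courantBracket I e₁ e₂ p + courantBracket I e₂ e₁ p = ((0, fderiv ℝ
      (fun y => genPairing (e₁ ((extChartAt I p).symm y)) (e₂ ((extChartAt I p).symm y)))
      (extChartAt I p p)) : EN × (EN →L[ℝ] ℝ)) := by
  rw [courantBracket_section, courantBracket_section]
  refine (modelBracket_symm ((contDiffAt_reading_gen e₁ p).differentiableAt (by simp))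
    ((contDiffAt_reading_gen e₂ p).differentiableAt (by simp))).trans ?_
  refine congrArg (Prod.mk _) (Filter.EventuallyEq.fderiv_eq ?_)
  filter_upwards [extChartAt_target_mem_nhds (I := I) p] with y hy
  have hs : (extChartAt I p).symm y ∈ (chartAt H p).source := by
    rw [← extChartAt_source (I := I)]; exact (extChartAt I p).map_target hy
  exact genPairing_fibreCoord hs _ _

/-- The symmetric part of the bracket is `(0, d⟨e₁, e₂⟩)`. These exact terms drop out because `⟨J
e₁, J e₂⟩ = ⟨e₁, e₂⟩` and `⟨J e₁, e₂⟩ + ⟨e₁, J e₂⟩ = 0`. -/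
theorem nijenhuisExpr_skew (J : BundleEnd I (EN × (EN →L[ℝ] ℝ)) (GenTangent I (N := N)))
    (hsq : ∀ p (a : GenTangent I p), J.app p (J.app p a) = -a)
    (horth : ∀ p (a b : GenTangent I p), genPairing (J.app p a) (J.app p b) = genPairing a b)
    (e₁ e₂ : Cₛ^∞⟮I; EN × (EN →L[ℝ] ℝ), GenTangent I (N := N)⟯) (p : N) :
    nijenhuisExpr J e₁ e₂ p = -nijenhuisExpr J e₂ e₁ p := by
  have h1 := courantBracket_symm e₁ e₂ p
  have h2 := courantBracket_symm (J.onSections e₁) (J.onSections e₂) p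
  have h3 := courantBracket_symm (J.onSections e₁) e₂ p
  have h4 := courantBracket_symm e₁ (J.onSections e₂) p
  have h12 : courantBracket I (J.onSections e₁) (J.onSections e₂) p +
      courantBracket I (J.onSections e₂) (J.onSections e₁) p =
      courantBracket I e₁ e₂ p + courantBracket I e₂ e₁ p := by
    refine h2.trans (Eq.trans ?_ h1.symm)
    exact congrArg (fun f : EN → ℝ => ((0, fderiv ℝ f (extChartAt I p p)) : EN × (EN →L[ℝ] ℝ)))
      (funext fun y => horth _ _ _)
  have h34 : courantBracket I (J.onSections e₁) e₂ p + courantBracket I e₂ (J.onSections e₁) p =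
      -(courantBracket I e₁ (J.onSections e₂) p + courantBracket I (J.onSections e₂) e₁ p) := by
    refine h3.trans (Eq.trans ?_ (congrArg Neg.neg h4).symm)
    have : (fun y => genPairing (J.onSections e₁ ((extChartAt I p).symm y))
        (e₂ ((extChartAt I p).symm y))) = -fun y => genPairing (e₁ ((extChartAt I p).symm y))
        (J.onSections e₂ ((extChartAt I p).symm y)) := by
      exact funext fun y => genPairing_app_left hsq horth _ _
    rw [this, fderiv_neg]
    exact Prod.ext neg_zero.symm rfl
  rw [eq_neg_iff_add_eq_zero]
  simp only [nijenhuisExpr]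
  have h5 : courantBracket I (J.onSections e₁) e₂ p + courantBracket I e₁ (J.onSections e₂) p =
    -(courantBracket I (J.onSections e₂) e₁ p + courantBracket I e₂ (J.onSections e₁) p) := by
    rw [eq_sub_of_add_eq h34]; abel
  rw [h5, map_neg, eq_sub_of_add_eq h12]
  abel

end CourantSymm

/-! ### Courant-Dorfman brackets of lifted sections. -/

section LiftSections

variable {EM : Type*} [NormedAddCommGroup EM] [NormedSpace ℝ EM] [FiniteDimensional ℝ EM]
  {H : Type*} [TopologicalSpace H] {I : ModelWithCorners ℝ EM H} [I.Boundaryless]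
  {M : Type*} [TopologicalSpace M] [T2Space M] [ChartedSpace H M] [IsManifold I ∞ M]
  {F : Type*} [NormedAddCommGroup F] [NormedSpace ℝ F] [FiniteDimensional ℝ F]
  {E : M → Type*} [TopologicalSpace (TotalSpace F E)]
  [∀ x, AddCommGroup (E x)] [∀ x, Module ℝ (E x)] [∀ x, TopologicalSpace (E x)]
  [FiberBundle F E] [VectorBundle ℝ F E] [ContMDiffVectorBundle ∞ F E I]

variable (I F E) in
/-- Smooth sections of `TE ⊕ T*E → E`. -/
abbrev GTESection : Type _ :=
  Cₛ^∞⟮I.prod 𝓘(ℝ, F); (EM × F) × (EM × F →L[ℝ] ℝ), GTE I F E⟯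

theorem extChartAt_self (p : TotalSpace F E) : extChartAt (I.prod 𝓘(ℝ, F)) p p =
    (extChartAt I p.1 p.1, fibreCoord F E p.1 p.1 p.2) :=
  extChartAt_totalSpace (mem_coordSource_self (H := H) p.1)

/-- The core section of `TE ⊕ T*E` defined by a section of `E ⊕ T*M`. -/
def coreLiftSection (τ : CoreSection I F E) : GTESection I F E where
  toFun p := coreLift p (τ p.1)
  contMDiff_toFun p := by
    refine contMDiffAt_section_of_reading (V := GTE I F E) ?_
    refine ContDiffAt.congr_of_eventuallyEq ?_ (genReading_coreLift τ p)
    rw [extChartAt_self]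
    exact (modelCoreL (W := EM) (G := F)).contDiff.contDiffAt.comp _
      (ContDiffAt.comp (_, _) (contDiffAt_coreReading p.1 τ) contDiffAt_fst)

/-- The horizontal lift of a section of `TM ⊕ E*`. -/
def hliftSection (Δ : SkewDorfman I F E) (ν : SideSection I F E) : GTESection I F E where
  toFun p := hlift Δ p (ν p.1)
  contMDiff_toFun p := by
    refine contMDiffAt_section_of_reading (V := GTE I F E) ?_
    refine ContDiffAt.congr_of_eventuallyEq ?_ (genReading_hlift Δ ν p)
    rw [extChartAt_self]
    exact contDiffAt_liftField (contDiffAt_sideReading p.1 ν) (Δ.contDiffAt_localForm ν p.1)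

@[simp]
theorem coreLiftSection_apply (τ : CoreSection I F E) (p : TotalSpace F E) :
    coreLiftSection τ p = coreLift p (τ p.1) := rfl

@[simp]
theorem hliftSection_apply (Δ : SkewDorfman I F E) (ν : SideSection I F E) (p : TotalSpace F E) :
    hliftSection Δ ν p = hlift Δ p (ν p.1) := rfl

theorem courantBracket_core_core (τ τ' : CoreSection I F E) (p : TotalSpace F E) :
    courantBracket (I.prod 𝓘(ℝ, F)) (coreLiftSection τ) (coreLiftSection τ') p = 0 := by
  rw [courantBracket_section]
  refine (modelBracket_congr (genReading_coreLift τ p) (genReading_coreLift τ' p)).trans ?_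
  rw [extChartAt_self]
  exact modelBracket_core_core ((contDiffAt_coreReading p.1 τ).differentiableAt (by simp))
    ((contDiffAt_coreReading p.1 τ').differentiableAt (by simp))

theorem coreReading_self (x : M) (τ : CoreSection I F E) :
    coreReading x τ (extChartAt I x x) = coreCoord I F E x x (τ x) :=
  reading_extChartAt (V := Core I E) (mem_extChartAt_source x) τ

theorem sideReading_self (x : M) (ν : SideSection I F E) :
    sideReading x ν (extChartAt I x x) = sideCoord I F E x x (ν x) :=
  reading_extChartAt (V := Side I E) (mem_extChartAt_source x) ν

theorem courantBracket_hlift_core (Δ : SkewDorfman I F E) (ν : SideSection I F E)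
    (τ : CoreSection I F E) (p : TotalSpace F E) :
    courantBracket (I.prod 𝓘(ℝ, F)) (hliftSection Δ ν) (coreLiftSection τ) p =
      coreLift p (Δ.toFun ν τ p.1) := by
  rw [courantBracket_section]
  refine (modelBracket_congr (genReading_hlift Δ ν p) (genReading_coreLift τ p)).trans ?_
  rw [extChartAt_self]
  refine (modelBracket_liftField_core ((contDiffAt_sideReading p.1 ν).differentiableAt (by simp))
    ((Δ.contDiffAt_localForm ν p.1).differentiableAt (by simp))
    ((contDiffAt_coreReading p.1 τ).differentiableAt (by simp))).trans ?_
  rw [← (Δ.coreReading_toFun ν p.1).self_of_nhds τ, coreReading_self]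
  exact (coreLift_eq_modelCore p _).symm

/-- The curvature of a Dorfman connection. -/
def DorfmanConnection.curvature (Δ : DorfmanConnection I F E) (ν₁ ν₂ : SideSection I F E)
    (τ : CoreSection I F E) : CoreSection I F E :=
  Δ.toFun ν₁ (Δ.toFun ν₂ τ) - Δ.toFun ν₂ (Δ.toFun ν₁ τ) - Δ.toFun (Δ.dullBracket ν₁ ν₂) τ

/-- For a section with constant coordinates the term with its derivative disappears, which is the
form required by `modelDefect_eq`. -/
theorem DorfmanConnection.coreReading_toFun_const (Δ : DorfmanConnection I F E)
    (ν : SideSection I F E) (x₀ : M) {e : Cₛ^∞⟮I; F, E⟯} {f : F}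
    (he : reading I F x₀ e =ᶠ[𝓝 (extChartAt I x₀ x₀)] fun _ => f) :
    coreReading x₀ (Δ.toFun ν (coreInl e)) =ᶠ[𝓝 (extChartAt I x₀ x₀)] fun y =>
      (0, dualForm (fderiv ℝ (sideReading x₀ ν) y) (f, 0)) - Δ.localForm ν x₀ y f := by
  filter_upwards [coordDomain_mem_nhds (I := I) (F := F) (V := E) x₀, Δ.coreReading_toFun ν x₀,
    he.eventually_nhds] with y hy hΔ hey
  have hinl : coreReading x₀ (coreInl (I := I) e) =ᶠ[𝓝 y] fun _ => (f, 0) := by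
    filter_upwards [(isOpen_coordDomain x₀).mem_nhds hy, hey] with z hz hez
    rw [coreReading_coreInl hz e, hez]
  rw [hΔ, modelDorfman_inl (differentiableAt_const f) hinl, hinl.eq_of_nhds, fderiv_const_apply]
  rfl

/-- The curvature is evaluated on some section through `p`, chosen constant in coordinates; that
only its value at `p` matters is seen later from `pairing_curvature`. -/
theorem courantBracket_hlift_hlift (Δ : SkewDorfman I F E) (ν₁ ν₂ : SideSection I F E)
    (p : TotalSpace F E) : ∃ e : Cₛ^∞⟮I; F, E⟯, e p.1 = p.2 ∧
    courantBracket (I.prod 𝓘(ℝ, F)) (hliftSection Δ ν₁) (hliftSection Δ ν₂) p =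
      hlift Δ p (Δ.dullBracket ν₁ ν₂ p.1) -
        coreLift p (Δ.curvature ν₁ ν₂ (coreInl e) p.1) := by
  obtain ⟨c, hc⟩ := exists_constSection (I := I) (F := F) (V := E) p.1
  have hp := mem_coordSource_self (H := H) (F := F) (E := E) p.1
  set f := fibreCoord F E p.1 p.1 p.2 with hf
  have hep : c f p.1 = p.2 := by
    rw [hc.self_of_nhds.2 f]; exact symmL_fibreCoord (H := H) hp p.2
  refine ⟨c f, hep, ?_⟩
  have he : reading I F p.1 (c f) =ᶠ[𝓝 (extChartAt I p.1 p.1)] fun _ => f := by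
    filter_upwards [coordDomain_mem_nhds (I := I) (F := F) (V := E) p.1,
      eventually_symm (I := I) hc] with y hy hcy
    rw [reading, hcy.2]
    exact fibreCoord_symmL (H := H) (symm_mem_coordSource I F E hy) f
  set e := c f
  set y := extChartAt I p.1 p.1 with hy
  have hd : ∀ ν : SideSection I F E, DifferentiableAt ℝ (sideReading p.1 ν) y := fun ν =>
    (contDiffAt_sideReading p.1 ν).differentiableAt (by simp)
  have hK : ∀ ν : SideSection I F E, DifferentiableAt ℝ (Δ.localForm ν p.1) y := fun ν =>
    (Δ.contDiffAt_localForm ν p.1).differentiableAt (by simp)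
  have h12 := Δ.sideReading_dullBracket ν₁ ν₂ p.1
  have hdef := modelDefect_eq (g := f) (contDiffAt_sideReading p.1 ν₁) (contDiffAt_sideReading p.1 ν₂)
    (hK ν₁) (hK ν₂) (Δ.coreReading_toFun_const ν₁ p.1 he) (Δ.coreReading_toFun_const ν₂ p.1 he)
  rw [← (Δ.coreReading_toFun ν₁ p.1).self_of_nhds, ← (Δ.coreReading_toFun ν₂ p.1).self_of_nhds,
    ← h12.fderiv_eq] at hdef
  have h3 := (Δ.coreReading_toFun_const (Δ.dullBracket ν₁ ν₂) p.1 he).eq_of_nhds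
  -- The local form of `Δ` along the dull bracket is split off: it belongs to `σ(⟦ν₁, ν₂⟧)`, and the
  -- remainder is minus the curvature.
  have hS : modelDefect (sideReading p.1 ν₁) (sideReading p.1 ν₂) (Δ.localForm ν₁ p.1)
      (Δ.localForm ν₂ p.1) y f = Δ.localForm (Δ.dullBracket ν₁ ν₂) p.1 y f -
        coreCoord I F E p.1 p.1 (Δ.curvature ν₁ ν₂ (coreInl e) p.1) := by
    have hc1 : coreCoord I F E p.1 p.1 (Δ.curvature ν₁ ν₂ (coreInl e) p.1) =
        coreReading p.1 (Δ.toFun ν₁ (Δ.toFun ν₂ (coreInl e))) y -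
        coreReading p.1 (Δ.toFun ν₂ (Δ.toFun ν₁ (coreInl e))) y -
        coreReading p.1 (Δ.toFun (Δ.dullBracket ν₁ ν₂) (coreInl e)) y := by
      rw [coreReading_self, coreReading_self, coreReading_self, ← map_sub, ← map_sub]
      rfl
    rw [hc1, h3, hdef]
    abel
  rw [courantBracket_section]
  refine (modelBracket_congr (genReading_hlift Δ ν₁ p) (genReading_hlift Δ ν₂ p)).trans ?_
  rw [extChartAt_self]
  refine (modelBracket_liftField (hd ν₁) (hK ν₁) (hd ν₂) (hK ν₂)).trans ?_
  have h4 := (genCoord_self p _).symm.trans (genCoord_hlift_self Δ (Δ.dullBracket ν₁ ν₂) p)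
  have h5 := coreLift_eq_modelCore p (Δ.curvature ν₁ ν₂ (coreInl e) p.1)
  refine Eq.trans ?_ (congrArg₂ (fun a b : (EM × F) × (EM × F →L[ℝ] ℝ) => a - b) h4 h5).symm
  rw [← h12.eq_of_nhds, hS, modelCore_sub, ← add_sub_assoc, sideReading_self, hf]

end LiftSections

/-! ### Algebra of a skew bracket with a complex structure. -/

section AbstractBracket

variable {S : Type*} [AddCommGroup S] [Module ℝ S] {B : S →ₗ[ℝ] S →ₗ[ℝ] S} {J : S →ₗ[ℝ] S}

/-- The complex bracket defined by a bilinear bracket and a complex structure. -/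
def complexBracket (B : S →ₗ[ℝ] S →ₗ[ℝ] S) (J : S →ₗ[ℝ] S) (a b : S) : S :=
  (1 / 2 : ℝ) • (B a b - B (J a) (J b))

theorem complexBracket_apply_right (hJ : ∀ a, J (J a) = -a) (a b : S) :
    complexBracket B J a (J b) = (1 / 2 : ℝ) • (B (J a) b + B a (J b)) := by
  rw [complexBracket, hJ, map_neg, sub_neg_eq_add, add_comm]

/-- The Nijenhuis tensor vanishes if and only if the complex bracket is complex linear. -/
theorem nijenhuis_eq_zero_iff (hJ : ∀ a, J (J a) = -a) (a b : S) :
    B a b - B (J a) (J b) + J (B (J a) b + B a (J b)) = 0 ↔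
      complexBracket B J a (J b) = J (complexBracket B J a b) := by
  rw [complexBracket_apply_right hJ, complexBracket, map_smul,
    (smul_right_injective S (by norm_num : (1 / 2 : ℝ) ≠ 0)).eq_iff]
  constructor
  · intro h
    have h3 := congrArg J (eq_neg_of_add_eq_zero_left h)
    rw [map_neg, hJ, neg_neg] at h3
    exact h3.symm
  · intro h
    rw [h, hJ, add_neg_cancel]

/-- The Jacobiators of the complex bracket and of the bracket. -/
theorem complexBracket_jacobi (hJ : ∀ a, J (J a) = -a) (hB : ∀ a b, B a b = -B b a)
    (hc : ∀ a b, complexBracket B J a (J b) = J (complexBracket B J a b)) {jac : S → S → S → S}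
    (hjac : ∀ a b c, jac a b c = B (B a b) c + B b (B a c) - B a (B b c)) (a b c : S) :
    complexBracket B J a (complexBracket B J b c) + complexBracket B J b (complexBracket B J c a) +
      complexBracket B J c (complexBracket B J a b) =
    (-1 / 4 : ℝ) • (jac a b c - jac (J a) (J b) c - jac (J a) b (J c) - jac a (J b) (J c)) := by
  -- Complex linearity replaces `J` of the inner bracket by the inner bracket with `J c`, so the
  -- iterated bracket expands without any `J` outside `B`. The cyclic sum then regroups into four
  -- Jacobiators.
  have key : ∀ a b c : S, complexBracket B J a (complexBracket B J b c) = (1 / 4 : ℝ) •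
      (B a (B b c) - B a (B (J b) (J c)) - B (J a) (B (J b) c) - B (J a) (B b (J c))) := by
    intro a b c
    have h : complexBracket B J a (complexBracket B J b c) = (1 / 2 : ℝ) •
      (B a (complexBracket B J b c) - B (J a) (J (complexBracket B J b c))) := rfl
    rw [h, ← hc, complexBracket_apply_right hJ, complexBracket]
    simp only [map_smul, map_sub, map_add]
    module
  have jac' : ∀ a b c : S, jac a b c = -(B a (B b c) + B b (B c a) + B c (B a b)) := by
    intro a b c
    rw [hjac, hB (B a b) c, hB a c, map_neg]
    abel
  simp only [key, jac']
  module

/-- The first conditions on both sides are equivalent, and once they hold, the two second conditions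
differ by the factor `-1/4`. The Jacobi identity of `B` itself is not needed. -/
theorem complexBracket_integrable_iff (hJ : ∀ a, J (J a) = -a) (hB : ∀ a b, B a b = -B b a)
    {jac : S → S → S → S}
    (hjac : ∀ a b c, jac a b c = B (B a b) c + B b (B a c) - B a (B b c)) :
    ((∀ a b, B a b - B (J a) (J b) + J (B (J a) b + B a (J b)) = 0) ∧
      ∀ a b c, jac a b c - jac (J a) (J b) c - jac (J a) b (J c) - jac a (J b) (J c) = 0) ↔
    (∀ a b, complexBracket B J a (J b) = J (complexBracket B J a b)) ∧
      ∀ a b c, complexBracket B J a (complexBracket B J b c) +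
        complexBracket B J b (complexBracket B J c a) +
        complexBracket B J c (complexBracket B J a b) = 0 := by
  constructor
  · rintro ⟨h1, h2⟩
    have hc := fun a b => (nijenhuis_eq_zero_iff hJ a b).1 (h1 a b)
    exact ⟨hc, fun a b c => by rw [complexBracket_jacobi hJ hB hc hjac, h2, smul_zero]⟩
  · rintro ⟨hc, h⟩
    refine ⟨fun a b => (nijenhuis_eq_zero_iff hJ a b).2 (hc a b), fun a b c => ?_⟩
    have h3 := h a b c
    rw [complexBracket_jacobi hJ hB hc hjac] at h3
    exact (smul_eq_zero.1 h3).resolve_left (by norm_num)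

theorem complexBracket_self (hB : ∀ a b, B a b = -B b a) (a : S) : complexBracket B J a a = 0 := by
  have h : ∀ a, B a a = 0 := fun a => by
    have h2 : (2 : ℝ) • B a a = 0 := by
      rw [two_smul, ← eq_neg_iff_add_eq_zero]
      exact hB a a
    exact (smul_eq_zero.1 h2).resolve_left two_ne_zero
  rw [complexBracket, h, h, sub_zero, smul_zero]

theorem complexBracket_skew (hB : ∀ a b, B a b = -B b a) (a b : S) :
    complexBracket B J a b = -complexBracket B J b a := by
  rw [complexBracket, complexBracket, hB a b, hB (J a)]
  module

theorem complexBracket_add_right (a b c : S) :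
    complexBracket B J a (b + c) = complexBracket B J a b + complexBracket B J a c := by
  simp only [complexBracket, map_add]
  module

theorem complexBracket_add_left (a b c : S) :
    complexBracket B J (a + b) c = complexBracket B J a c + complexBracket B J b c := by
  simp only [complexBracket, map_add, LinearMap.add_apply]
  module

theorem complexBracket_smul_right (r : ℝ) (a b : S) :
    complexBracket B J a (r • b) = r • complexBracket B J a b := by
  simp only [complexBracket, map_smul]
  module

theorem complexBracket_complex_right
    (hc : ∀ a b, complexBracket B J a (J b) = J (complexBracket B J a b)) (r s : ℝ) (a b : S) :
    complexBracket B J a (r • b + s • J b) =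
      r • complexBracket B J a b + s • J (complexBracket B J a b) := by
  rw [complexBracket_add_right, complexBracket_smul_right, complexBracket_smul_right, hc]

theorem complexBracket_complex_left (hB : ∀ a b, B a b = -B b a)
    (hc : ∀ a b, complexBracket B J a (J b) = J (complexBracket B J a b)) (r s : ℝ) (a b : S) :
    complexBracket B J (r • a + s • J a) b =
      r • complexBracket B J a b + s • J (complexBracket B J a b) := by
  rw [complexBracket_skew hB, complexBracket_complex_right hc, complexBracket_skew hB a b, map_neg]
  module

end AbstractBracket

/-! ### Curvature and Jacobiator. -/

section Jacobiator

variable {EM : Type*} [NormedAddCommGroup EM] [NormedSpace ℝ EM] [FiniteDimensional ℝ EM]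
  {H : Type*} [TopologicalSpace H] {I : ModelWithCorners ℝ EM H} [I.Boundaryless]
  {M : Type*} [TopologicalSpace M] [T2Space M] [ChartedSpace H M] [IsManifold I ∞ M]
  {F : Type*} [NormedAddCommGroup F] [NormedSpace ℝ F] [FiniteDimensional ℝ F]
  {E : M → Type*} [TopologicalSpace (TotalSpace F E)]
  [∀ x, AddCommGroup (E x)] [∀ x, Module ℝ (E x)] [∀ x, TopologicalSpace (E x)]
  [FiberBundle F E] [VectorBundle ℝ F E] [ContMDiffVectorBundle ∞ F E I]

theorem exists_mvfderiv_eq (x : M) (θ : EM →L[ℝ] ℝ) :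
    ∃ f : C^∞⟮I, M; ℝ⟯, ∀ v : TangentSpace I x, mvfderiv I f x v = θ v := by
  obtain ⟨χ, hχ, hχ1⟩ := exists_bump (I := I) ((chartAt H x).open_source.mem_nhds
    (mem_chart_source H x))
  have hf : ContMDiff I 𝓘(ℝ, ℝ) ∞ (fun z => χ z * θ (extChartAt I x z)) := by
    refine contMDiff_of_tsupport fun z hz => ?_
    have hz' : z ∈ tsupport χ := closure_mono (Function.support_mul_subset_left _ _) hz
    exact (χ.contMDiff z).mul (θ.contDiff.contMDiff.contMDiffAt.comp z
      (contMDiffAt_extChartAt' (hχ hz')))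
  let f : C^∞⟮I, M; ℝ⟯ := ⟨_, hf⟩
  refine ⟨f, fun v => ?_⟩
  have h : (f ∘ (extChartAt I x).symm) =ᶠ[𝓝 (extChartAt I x x)] θ := by
    filter_upwards [eventually_symm (I := I) hχ1, extChartAt_target_mem_nhds (I := I) x]
      with y hy hy'
    change χ _ * θ _ = _
    rw [hy, one_mul, (extChartAt I x).right_inv hy']
  rw [mvfderiv_eq_fderiv (I := I) (mem_chart_source H x) (mdifferentiableAt_smooth f _), h.fderiv_eq,
    ContinuousLinearMap.fderiv, fibreCoord_tangent_self]

theorem tangent_ext {x : M} {v w : TangentSpace I x}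
    (h : ∀ f : C^∞⟮I, M; ℝ⟯, mvfderiv I f x v = mvfderiv I f x w) : v = w := by
  refine (SeparatingDual.eq_iff_forall_dual_eq (R := ℝ) (V := EM)).2 fun θ => ?_
  obtain ⟨f, hf⟩ := exists_mvfderiv_eq (I := I) x θ
  exact (hf v).symm.trans ((h f).trans (hf w))

theorem derivMap_const_smul (ν : SideSection I F E) (r : ℝ) (f : C^∞⟮I, M; ℝ⟯) (x : M) :
    derivMap ν (r • f) x = r * derivMap ν f x := by
  have h : r • f = ContMDiffMap.const r * f := rfl
  have h0 : derivMap ν (ContMDiffMap.const r) x = 0 := by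
    rw [derivMap_apply]
    exact congrArg (fun L => L (ν x).1) (mvfderiv_const (I := I) (c := r) (x := x))
  rw [h, derivMap_mul, h0, mul_zero, add_zero]
  rfl

namespace DorfmanConnection

variable (Δ : DorfmanConnection I F E)

theorem dullBracket_smul_right (r : ℝ) (ν₁ ν₂ : SideSection I F E) :
    Δ.dullBracket ν₁ (r • ν₂) = r • Δ.dullBracket ν₁ ν₂ := by
  refine sideSection_ext fun τ x => ?_
  have h : pairingMap (r • ν₂) τ = r • pairingMap ν₂ τ := by ext x; exact pairing_smul_left _ _ _
  rw [ContMDiffSection.coe_smul, Pi.smul_apply, pairing_smul_left]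
  simp only [pairing_dullBracket, h, derivMap_const_smul]
  rw [ContMDiffSection.coe_smul, Pi.smul_apply, pairing_smul_left]
  ring

/-- The defining duality as an identity of functions; repeated use moves all connections from `τ` to
brackets of side sections. -/
theorem pairingMap_toFun (ν₁ ν₂ : SideSection I F E) (τ : CoreSection I F E) :
    pairingMap ν₂ (Δ.toFun ν₁ τ) =
      derivMap ν₁ (pairingMap ν₂ τ) - pairingMap (Δ.dullBracket ν₁ ν₂) τ := by
  ext x
  rw [ContMDiffMap.coe_sub, Pi.sub_apply, pairingMap_apply (Δ.dullBracket ν₁ ν₂),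
    pairing_dullBracket, sub_sub_cancel]
  rfl

theorem pairingMap_coreD (ν : SideSection I F E) (f : C^∞⟮I, M; ℝ⟯) :
    pairingMap ν (coreD F E f) = derivMap ν f := by
  ext x
  rw [pairingMap_apply, pairing_coreD, derivMap_apply]

/-- Dual to the axiom on exact forms: the tangent part of the dull bracket is the Lie bracket of
vector fields. -/
theorem derivMap_dullBracket (ν₁ ν₂ : SideSection I F E) (f : C^∞⟮I, M; ℝ⟯) :
    derivMap (Δ.dullBracket ν₁ ν₂) f =
      derivMap ν₁ (derivMap ν₂ f) - derivMap ν₂ (derivMap ν₁ f) := by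
  have h := Δ.pairingMap_toFun ν₁ ν₂ (coreD F E f)
  rw [exact_form_eq, pairingMap_coreD, pairingMap_coreD, pairingMap_coreD] at h
  rw [h, sub_sub_cancel]

/-- The Jacobiator of the dull bracket, in Leibniz form. -/
def jacobiator (ν₁ ν₂ ν₃ : SideSection I F E) : SideSection I F E :=
  Δ.dullBracket (Δ.dullBracket ν₁ ν₂) ν₃ + Δ.dullBracket ν₂ (Δ.dullBracket ν₁ ν₃) -
    Δ.dullBracket ν₁ (Δ.dullBracket ν₂ ν₃)

/-- The second derivatives of `⟨ν₃, τ⟩` cancel, since the anchor carries the dull bracket to the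
commutator. In particular the curvature at `x` depends only on the value of `τ` there. -/
theorem pairing_curvature (ν₁ ν₂ ν₃ : SideSection I F E) (τ : CoreSection I F E) (x : M) :
    pairing (ν₃ x) (Δ.curvature ν₁ ν₂ τ x) = pairing (Δ.jacobiator ν₁ ν₂ ν₃ x) (τ x) := by
  have e : ∀ (ν : SideSection I F E) (τ : CoreSection I F E), pairing (ν x) (τ x) =
    pairingMap ν τ x := fun _ _ => rfl
  have s : ∀ (f g : C^∞⟮I, M; ℝ⟯), (f - g) x = f x - g x := fun _ _ => rfl
  simp only [curvature, jacobiator, ContMDiffSection.coe_sub, Pi.sub_apply, ContMDiffSection.coe_add,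
    Pi.add_apply, pairing_sub_left, pairing_sub_right, pairing_add_left, e, pairingMap_toFun, s,
    derivMap_sub, derivMap_dullBracket]
  ring

/-- Tangent vectors are tested on functions `f`, and the pairing of the curvature with `df` as its
argument vanishes. Only the `E*`-part of the Jacobiator carries information. -/
theorem jacobiator_fst (ν₁ ν₂ ν₃ : SideSection I F E) (x : M) :
    (Δ.jacobiator ν₁ ν₂ ν₃ x).1 = 0 := by
  refine tangent_ext fun f => ?_
  rw [← pairing_coreD, map_zero, ← pairing_curvature]
  have e : ∀ (ν : SideSection I F E) (τ : CoreSection I F E), pairing (ν x) (τ x) =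
    pairingMap ν τ x := fun _ _ => rfl
  have s : ∀ (f g : C^∞⟮I, M; ℝ⟯), (f - g) x = f x - g x := fun _ _ => rfl
  simp only [curvature, exact_form_eq, ContMDiffSection.coe_sub, Pi.sub_apply, pairing_sub_right, e,
    pairingMap_coreD, derivMap_dullBracket, derivMap_sub]
  ring

end DorfmanConnection

end Jacobiator

/-! ### Complex Lie algebroid axioms and integrability. -/

section ComplexAlgebroid

variable {EM : Type*} [NormedAddCommGroup EM] [NormedSpace ℝ EM] [FiniteDimensional ℝ EM]
  {H : Type*} [TopologicalSpace H] {I : ModelWithCorners ℝ EM H} [I.Boundaryless]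
  {M : Type*} [TopologicalSpace M] [T2Space M] [ChartedSpace H M] [IsManifold I ∞ M]
  {F : Type*} [NormedAddCommGroup F] [NormedSpace ℝ F] [FiniteDimensional ℝ F]
  {E : M → Type*} [TopologicalSpace (TotalSpace F E)]
  [∀ x, AddCommGroup (E x)] [∀ x, Module ℝ (E x)] [∀ x, TopologicalSpace (E x)]
  [FiberBundle F E] [VectorBundle ℝ F E] [ContMDiffVectorBundle ∞ F E I]

namespace SkewDorfman

variable (Δ : SkewDorfman I F E) (j : SideEnd I F E)

theorem dullBracket_smul_left (r : ℝ) (ν₁ ν₂ : SideSection I F E) :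
    Δ.dullBracket (r • ν₁) ν₂ = r • Δ.dullBracket ν₁ ν₂ := by
  have h : r • -Δ.dullBracket ν₂ ν₁ = -(r • Δ.dullBracket ν₂ ν₁) := by
    ext1 x; exact smul_neg r (Δ.dullBracket ν₂ ν₁ x)
  rw [Δ.skew, Δ.dullBracket_smul_right, Δ.skew ν₁, h]

/-- The dull bracket of a skew-symmetric Dorfman connection as a bilinear map. -/
def bracketL : SideSection I F E →ₗ[ℝ] SideSection I F E →ₗ[ℝ] SideSection I F E :=
  LinearMap.mk₂ ℝ Δ.dullBracket Δ.dullBracket_add_left Δ.dullBracket_smul_left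
    Δ.dullBracket_add_right Δ.dullBracket_smul_right

theorem bracketL_skew (ν₁ ν₂ : SideSection I F E) : Δ.bracketL ν₁ ν₂ = -Δ.bracketL ν₂ ν₁ :=
  Δ.skew ν₁ ν₂

/-- The vanishing of the Nijenhuis tensor of `j` for the dull bracket and of the part of the
Jacobiator that is seen by the bracket `𝔸`. -/
structure IsIntegrable : Prop where
  nijenhuis : ∀ ν₁ ν₂ : SideSection I F E, Δ.bracketL ν₁ ν₂ -
    Δ.bracketL (j.onSections ν₁) (j.onSections ν₂) + j.onSections
      (Δ.bracketL (j.onSections ν₁) ν₂ + Δ.bracketL ν₁ (j.onSections ν₂)) = 0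
  jacobi : ∀ ν₁ ν₂ ν₃ : SideSection I F E, Δ.jacobiator ν₁ ν₂ ν₃ -
    Δ.jacobiator (j.onSections ν₁) (j.onSections ν₂) ν₃ -
    Δ.jacobiator (j.onSections ν₁) ν₂ (j.onSections ν₃) -
    Δ.jacobiator ν₁ (j.onSections ν₂) (j.onSections ν₃) = 0

end SkewDorfman

theorem BundleEnd.onSections_sq {j : SideEnd I F E} (hj : ∀ x (ν : Side I E x),
    j.app x (j.app x ν) = -ν) (ν : SideSection I F E) :
    j.onSections (j.onSections ν) = -ν := by
  ext1 x; exact hj x _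

theorem csmul_const (j : SideEnd I F E) (c : ℂ) (ν : SideSection I F E) :
    csmul j (ContMDiffMap.const c) ν = c.re • ν + c.im • j.onSections ν := by
  ext1 x; rfl

/-- A bundle endomorphism as a linear map of the sections. -/
def BundleEnd.onSectionsL (j : SideEnd I F E) : SideSection I F E →ₗ[ℝ] SideSection I F E where
  toFun := j.onSections
  map_add' := j.onSections_add
  map_smul' := j.onSections_smul

theorem isIntegrable_iff {j : SideEnd I F E} (hj : ∀ x (ν : Side I E x),
    j.app x (j.app x ν) = -ν) (Δ : SkewDorfman I F E) :
    Δ.IsIntegrable j ↔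
      (∀ ν₁ ν₂, bracketA j Δ ν₁ (j.onSections ν₂) = j.onSections (bracketA j Δ ν₁ ν₂)) ∧
      ∀ ν₁ ν₂ ν₃, bracketA j Δ ν₁ (bracketA j Δ ν₂ ν₃) + bracketA j Δ ν₂ (bracketA j Δ ν₃ ν₁) +
        bracketA j Δ ν₃ (bracketA j Δ ν₁ ν₂) = 0 :=
  (Iff.intro (fun h => ⟨h.1, h.2⟩) fun h => ⟨h.1, h.2⟩).trans
    (complexBracket_integrable_iff (B := Δ.bracketL) (J := BundleEnd.onSectionsL j)
      (BundleEnd.onSections_sq hj) Δ.bracketL_skew (fun _ _ _ => rfl))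

end ComplexAlgebroid

section ComplexAlgebroid

variable {EM : Type*} [NormedAddCommGroup EM] [NormedSpace ℝ EM] [FiniteDimensional ℝ EM]
  {H : Type*} [TopologicalSpace H] {I : ModelWithCorners ℝ EM H} [I.Boundaryless]
  {M : Type*} [TopologicalSpace M] [T2Space M] [ChartedSpace H M] [IsManifold I ∞ M]
  {F : Type*} [NormedAddCommGroup F] [NormedSpace ℝ F] [FiniteDimensional ℝ F]
  {E : M → Type*} [TopologicalSpace (TotalSpace F E)]
  [∀ x, AddCommGroup (E x)] [∀ x, Module ℝ (E x)] [∀ x, TopologicalSpace (E x)]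
  [FiberBundle F E] [VectorBundle ℝ F E] [ContMDiffVectorBundle ∞ F E I]

theorem contMDiff_complexAnchor (j : SideEnd I F E) :
    ContMDiff (I.prod 𝓘(ℝ, EM × (F →L[ℝ] ℝ))) (I.prod 𝓘(ℝ, EM × EM)) ∞
      (fun v : TotalSpace (EM × (F →L[ℝ] ℝ)) (Side I E) =>
        (⟨v.1, complexAnchor j v.1 v.2⟩ : TotalSpace (EM × EM) (ComplexTangent I))) := by
  refine contMDiff_of_sections (V := Side I E) (V' := ComplexTangent I) (complexAnchor j)
    fun x₀ v => ?_
  obtain ⟨s, hs⟩ := exists_section_eq (I := I) (F := EM × (F →L[ℝ] ℝ)) (V := Side I E) x₀ v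
  refine ⟨s, hs, ?_⟩
  have hf : ∀ t : SideSection I F E, ContMDiffAt I (I.prod 𝓘(ℝ, EM)) ∞
      (fun x => (⟨x, (t x).1⟩ : TotalSpace EM (TangentSpace I : M → Type _))) x₀ := fun t => by
    have h := (contMDiffAt_section (E := Side I E) x₀).1 (t.contMDiff x₀)
    exact (contMDiffAt_section (E := (TangentSpace I : M → Type _)) x₀).2
      ((ContinuousLinearMap.fst ℝ EM (F →L[ℝ] ℝ)).contMDiff.contMDiffAt.comp x₀ h)
  have h1 := (contMDiffAt_section (E := (TangentSpace I : M → Type _)) x₀).1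
    (hf ((1 / 2 : ℝ) • s))
  have h2 := (contMDiffAt_section (E := (TangentSpace I : M → Type _)) x₀).1
    (hf (-((1 / 2 : ℝ) • j.onSections s)))
  exact (contMDiffAt_section (E := ComplexTangent I) x₀).2 (h1.prodMk_space h2)

/-- The derivative of a complex-valued function along the anchor. -/
theorem complexDeriv_anchor (j : SideEnd I F E) (f : C^∞⟮I, M; 𝓘(ℝ, ℂ), ℂ⟯)
    {a b : C^∞⟮I, M; ℝ⟯} (ha : ∀ x, a x = (f x).re) (hb : ∀ x, b x = (f x).im)
    (ν : SideSection I F E) (x : M) :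
    complexDeriv f x (complexAnchor j x (ν x)) =
      ⟨(1 / 2) * (derivMap ν a x + derivMap (j.onSections ν) b x),
        (1 / 2) * (derivMap ν b x - derivMap (j.onSections ν) a x)⟩ := by
  have hd := (mdifferentiableAt_smooth f x).hasMFDerivAt
  have hre : ∀ v : TangentSpace I x, mvfderiv I a x v = (mvfderiv I f x v).re := fun v => by
    have h := (Complex.reCLM.hasMFDerivAt (x := f x)).comp x hd
    have h2 := (h.congr_of_eventuallyEq (f₁ := a) (.of_forall ha)).mfderiv
    exact congrArg (fun L => L v) h2
  have him : ∀ v : TangentSpace I x, mvfderiv I b x v = (mvfderiv I f x v).im := fun v => by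
    have h := (Complex.imCLM.hasMFDerivAt (x := f x)).comp x hd
    have h2 := (h.congr_of_eventuallyEq (f₁ := b) (.of_forall hb)).mfderiv
    exact congrArg (fun L => L v) h2
  have e1 : (complexAnchor j x (ν x)).1 = (1 / 2 : ℝ) • (ν x).1 := rfl
  have e2 : (complexAnchor j x (ν x)).2 = -((1 / 2 : ℝ) • (j.app x (ν x)).1) := rfl
  simp only [derivMap_apply, hre, him]
  rw [complexDeriv, e1, e2, map_neg, map_smul, map_smul]
  apply Complex.ext <;> simp [BundleEnd.onSections_apply] <;> ring

/-- The derivatives along `½ ν₁` and `-½ j ν₁` are those along the real and imaginary parts of the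
anchor, and the second comes with `j` applied to `ν₂`. -/
theorem bracketA_fsmul {j : SideEnd I F E} (Δ : SkewDorfman I F E) (f : C^∞⟮I, M; ℝ⟯)
    (ν₁ ν₂ : SideSection I F E) (x : M) :
    bracketA j Δ ν₁ (fsmul f ν₂) x = f x • bracketA j Δ ν₁ ν₂ x +
      ((1 / 2 * derivMap ν₁ f x) • ν₂ x -
        (1 / 2 * derivMap (j.onSections ν₁) f x) • j.app x (ν₂ x)) := by
  have h : j.onSections (fsmul f ν₂) = fsmul f (j.onSections ν₂) := by
    ext1 x; exact map_smul (j.app x) (f x) (ν₂ x)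
  have h2 : ∀ ν : SideSection I F E, bracketA j Δ ν₁ ν x = (1 / 2 : ℝ) •
    (Δ.dullBracket ν₁ ν x - Δ.dullBracket (j.onSections ν₁) (j.onSections ν) x) := fun _ => rfl
  rw [h2, h2, h, Δ.dullBracket_fsmul_right, Δ.dullBracket_fsmul_right]
  simp only [ContMDiffSection.coe_add, Pi.add_apply, fsmul_apply, BundleEnd.onSections_apply]
  generalize Δ.dullBracket ν₁ ν₂ x = A
  generalize Δ.dullBracket (j.onSections ν₁) (j.onSections ν₂) x = B
  module

/-- `𝔸` defines a complex Lie algebroid if and only if `Δ` is integrable. -/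
theorem isComplexLieAlgebroid_iff {j : SideEnd I F E} (hj : ∀ x (ν : Side I E x),
    j.app x (j.app x ν) = -ν) (Δ : SkewDorfman I F E) :
    IsComplexLieAlgebroid j (complexAnchor j) (bracketA j Δ) ↔ Δ.IsIntegrable j := by
  have hJ := BundleEnd.onSections_sq hj
  rw [isIntegrable_iff hj]
  constructor
  · intro h
    refine ⟨fun ν₁ ν₂ => ?_, h.jacobi⟩
    -- Linearity over the imaginary unit is all that is needed of complex linearity.
    have h1 := h.smul_right Complex.I ν₁ ν₂
    rw [csmul_const, csmul_const, Complex.I_re, Complex.I_im] at h1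
    have h2 : ∀ ν : SideSection I F E, (0 : ℝ) • ν + (1 : ℝ) • j.onSections ν = j.onSections ν :=
      fun ν => by
        ext1 x
        change (0 : ℝ) • ν x + (1 : ℝ) • j.onSections ν x = j.onSections ν x
        rw [zero_smul, one_smul, zero_add]
    rwa [h2, h2] at h1
  · rintro ⟨hc, hjac⟩
    refine
      { complex_structure := hj
        anchor_smooth := contMDiff_complexAnchor j
        anchor_complex := fun x v => ?_
        add_left := complexBracket_add_left (B := Δ.bracketL) (J := BundleEnd.onSectionsL j)
        add_right := complexBracket_add_right (B := Δ.bracketL) (J := BundleEnd.onSectionsL j)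
        smul_left := fun c ν₁ ν₂ => ?_
        smul_right := fun c ν₁ ν₂ => ?_
        alternating := complexBracket_self (B := Δ.bracketL) (J := BundleEnd.onSectionsL j)
          Δ.bracketL_skew
        jacobi := hjac
        leibniz := fun f ν₁ ν₂ x => ?_ }
    · refine Prod.ext ?_ ?_
      · change (1 / 2 : ℝ) • (j.app x v).1 = - -((1 / 2 : ℝ) • (j.app x v).1)
        rw [neg_neg]
      · change -((1 / 2 : ℝ) • (j.app x (j.app x v)).1) = (1 / 2 : ℝ) • v.1
        rw [hj, Prod.fst_neg, smul_neg, neg_neg]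
    · rw [csmul_const, csmul_const]
      exact complexBracket_complex_left (B := Δ.bracketL) (J := BundleEnd.onSectionsL j)
        Δ.bracketL_skew hc c.re c.im ν₁ ν₂
    · rw [csmul_const, csmul_const]
      exact complexBracket_complex_right (B := Δ.bracketL) (J := BundleEnd.onSectionsL j)
        hc c.re c.im ν₁ ν₂
    -- With `f = a + i b` the complex Leibniz rule follows from the real one for `a` and `b` and
    -- from complex linearity of the bracket.
    · set a : C^∞⟮I, M; ℝ⟯ := ⟨fun x => (f x).re, Complex.reCLM.contMDiff.comp f.contMDiff⟩ with ha
      set b : C^∞⟮I, M; ℝ⟯ := ⟨fun x => (f x).im, Complex.imCLM.contMDiff.comp f.contMDiff⟩ with hb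
      have h1 : ∀ ν : SideSection I F E, csmul j f ν = fsmul a ν + fsmul b (j.onSections ν) :=
        fun _ => rfl
      have h2 : bracketA j Δ ν₁ (fsmul a ν₂ + fsmul b (j.onSections ν₂)) =
          bracketA j Δ ν₁ (fsmul a ν₂) + bracketA j Δ ν₁ (fsmul b (j.onSections ν₂)) :=
        complexBracket_add_right (B := Δ.bracketL) (J := BundleEnd.onSectionsL j) _ _ _
      rw [complexDeriv_anchor j f (a := a) (b := b) (fun _ => rfl) (fun _ => rfl), h1, h1, h2,
        ContMDiffSection.coe_add, Pi.add_apply, bracketA_fsmul, bracketA_fsmul, hc,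
        ContMDiffSection.coe_add, Pi.add_apply]
      simp only [fsmul_apply, BundleEnd.onSections_apply, hj]
      generalize bracketA j Δ ν₁ ν₂ x = A
      module

end ComplexAlgebroid

/-! ### The negative transpose and perturbations of Dorfman connections. -/

section GenPairingSmooth

variable {EN : Type*} [NormedAddCommGroup EN] [NormedSpace ℝ EN] [FiniteDimensional ℝ EN]
  {H : Type*} [TopologicalSpace H] {I : ModelWithCorners ℝ EN H} [I.Boundaryless]
  {N : Type*} [TopologicalSpace N] [ChartedSpace H N] [IsManifold I ∞ N]

theorem contMDiff_genPairing (e₁ e₂ : Cₛ^∞⟮I; EN × (EN →L[ℝ] ℝ), GenTangent I (N := N)⟯) :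
    ContMDiff I 𝓘(ℝ, ℝ) ∞ (fun p => genPairing (e₁ p) (e₂ p)) := by
  intro p
  have h1 := contDiffAt_reading_gen e₁ p
  have h2 := contDiffAt_reading_gen e₂ p
  have h3 : ContDiffAt ℝ ∞ (fun y => modelPairing (reading I (EN × (EN →L[ℝ] ℝ)) p e₁ y)
      (reading I (EN × (EN →L[ℝ] ℝ)) p e₂ y)) (extChartAt I p p) :=
    ((contDiffAt_snd.comp _ h1).clm_apply (contDiffAt_fst.comp _ h2)).add
      ((contDiffAt_snd.comp _ h2).clm_apply (contDiffAt_fst.comp _ h1))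
  have h4 : ContMDiffAt I 𝓘(ℝ, ℝ) ∞ _ p := h3.contMDiffAt.comp p contMDiffAt_extChartAt
  refine h4.congr_of_eventuallyEq ?_
  filter_upwards [extChartAt_source_mem_nhds (I := I) p] with q hq
  have hs : q ∈ (chartAt H p).source := by rwa [← extChartAt_source (I := I)]
  rw [Function.comp_apply, reading_extChartAt hq, reading_extChartAt hq]
  exact (genPairing_fibreCoord hs _ _).symm

end GenPairingSmooth

section Transpose

variable {EM : Type*} [NormedAddCommGroup EM] [NormedSpace ℝ EM] [FiniteDimensional ℝ EM]
  {H : Type*} [TopologicalSpace H] {I : ModelWithCorners ℝ EM H} [I.Boundaryless]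
  {M : Type*} [TopologicalSpace M] [T2Space M] [ChartedSpace H M] [IsManifold I ∞ M]
  {F : Type*} [NormedAddCommGroup F] [NormedSpace ℝ F] [FiniteDimensional ℝ F]
  {E : M → Type*} [TopologicalSpace (TotalSpace F E)]
  [∀ x, AddCommGroup (E x)] [∀ x, Module ℝ (E x)] [∀ x, TopologicalSpace (E x)]
  [FiberBundle F E] [VectorBundle ℝ F E] [ContMDiffVectorBundle ∞ F E I]

theorem exists_negTransposeSection (j : SideEnd I F E) (τ : CoreSection I F E) :
    ∃ τ' : CoreSection I F E, ∀ (x : M) (ν : Side I E x),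
      pairing ν (τ' x) = -pairing (j.app x ν) (τ x) := by
  obtain ⟨τ', h⟩ := exists_coreSection (I := I) (F := F) (E := E)
    (fun ν => -pairingMap (j.onSections ν) τ) (fun s t x => by
      change -pairing (j.app x (s x + t x)) (τ x) =
        -pairing (j.app x (s x)) (τ x) + -pairing (j.app x (t x)) (τ x)
      rw [map_add, pairing_add_left, neg_add]) (fun f s x => by
      change -pairing (j.app x (f x • s x)) (τ x) = f x * -pairing (j.app x (s x)) (τ x)
      rw [map_smul, pairing_smul_left, mul_neg])
  refine ⟨τ', fun x ν => ?_⟩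
  obtain ⟨s, rfl⟩ := exists_section_eq (I := I) (F := EM × (F →L[ℝ] ℝ)) (V := Side I E) x ν
  exact h s x

theorem exists_negTranspose (j : SideEnd I F E) (x : M) :
    ∃ T : Core I E x →ₗ[ℝ] Core I E x, ∀ ν τ, pairing ν (T τ) = -pairing (j.app x ν) τ := by
  have h : ∀ τ : Core I E x, ∃ τ', ∀ ν : Side I E x, pairing ν τ' = -pairing (j.app x ν) τ := by
    intro τ
    obtain ⟨s, rfl⟩ := exists_section_eq (I := I) (F := F × (EM →L[ℝ] ℝ)) (V := Core I E) x τ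
    obtain ⟨t, ht⟩ := exists_negTransposeSection j s
    exact ⟨t x, ht x⟩
  choose T hT using h
  refine ⟨⟨⟨T, fun a b => ?_⟩, fun r a => ?_⟩, fun ν τ => hT τ ν⟩
  · refine pairing_ext_right F fun ν => ?_
    rw [pairing_add_right, hT, hT, hT, pairing_add_right, neg_add]
  · refine pairing_ext_right F fun ν => ?_
    rw [pairing_smul_right, hT, hT, pairing_smul_right, RingHom.id_apply, mul_neg]

/-- The negative transpose of an endomorphism of `TM ⊕ E*`. -/
def negTranspose (j : SideEnd I F E) (x : M) : Core I E x →ₗ[ℝ] Core I E x :=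
  (exists_negTranspose j x).choose

theorem pairing_negTranspose (j : SideEnd I F E) {x : M} (ν : Side I E x) (τ : Core I E x) :
    pairing ν (negTranspose j x τ) = -pairing (j.app x ν) τ :=
  (exists_negTranspose j x).choose_spec ν τ

/-- The negative transpose on sections. -/
def negTransposeSection (j : SideEnd I F E) (τ : CoreSection I F E) : CoreSection I F E where
  toFun x := negTranspose j x (τ x)
  contMDiff_toFun := by
    obtain ⟨t, ht⟩ := exists_negTransposeSection j τ
    have h : ∀ x, negTranspose j x (τ x) = t x := fun x =>
      pairing_ext_right F fun ν => by rw [pairing_negTranspose, ht]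
    simpa only [h] using t.contMDiff

theorem negTranspose_sq {j : SideEnd I F E} (hj : ∀ x (ν : Side I E x), j.app x (j.app x ν) = -ν)
    {x : M} (τ : Core I E x) : negTranspose j x (negTranspose j x τ) = -τ := by
  refine pairing_ext_right F fun ν => ?_
  rw [pairing_negTranspose, pairing_negTranspose, hj, pairing_neg_left, pairing_neg_right, neg_neg]

theorem hasCoreNegTranspose_iff (J : GTEEnd I F E) (j : SideEnd I F E) :
    HasCoreNegTranspose J j ↔ ∀ (p : TotalSpace F E) (τ : Core I E p.1),
      J.app p (coreLift p τ) = coreLift p (negTranspose j p.1 τ) := by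
  constructor
  · exact fun h p τ => h p τ _ fun ν => pairing_negTranspose j ν τ
  · intro h p τ τ' hτ
    rw [h]
    refine congrArg _ (pairing_ext_right F fun ν => ?_)
    rw [hτ, pairing_negTranspose]

end Transpose

section Perturbation

variable {EM : Type*} [NormedAddCommGroup EM] [NormedSpace ℝ EM] [FiniteDimensional ℝ EM]
  {H : Type*} [TopologicalSpace H] {I : ModelWithCorners ℝ EM H} [I.Boundaryless]
  {M : Type*} [TopologicalSpace M] [T2Space M] [ChartedSpace H M] [IsManifold I ∞ M]
  {F : Type*} [NormedAddCommGroup F] [NormedSpace ℝ F] [FiniteDimensional ℝ F]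
  {E : M → Type*} [TopologicalSpace (TotalSpace F E)]
  [∀ x, AddCommGroup (E x)] [∀ x, Module ℝ (E x)] [∀ x, TopologicalSpace (E x)]
  [FiberBundle F E] [VectorBundle ℝ F E] [ContMDiffVectorBundle ∞ F E I]

/-- The sum of a Dorfman connection and a tensor. -/
def DorfmanConnection.perturb (Δ : DorfmanConnection I F E)
    (φ : ∀ x, Side I E x →ₗ[ℝ] E x →ₗ[ℝ] Core I E x)
    (hφ : ∀ (ν : SideSection I F E) (τ : CoreSection I F E),
      ContMDiff I (I.prod 𝓘(ℝ, F × (EM →L[ℝ] ℝ))) ∞ (fun x =>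
        (⟨x, φ x (ν x) (τ x).1⟩ : TotalSpace (F × (EM →L[ℝ] ℝ)) (Core I E)))) :
    DorfmanConnection I F E where
  toFun := LinearMap.mk₂ ℝ (fun ν τ => Δ.toFun ν τ + ⟨_, hφ ν τ⟩)
    (fun ν ν' τ => by
      ext1 x
      have h : Δ.toFun (ν + ν') τ x = Δ.toFun ν τ x + Δ.toFun ν' τ x := by rw [map_add]; rfl
      change Δ.toFun (ν + ν') τ x + φ x (ν x + ν' x) (τ x).1 =
        (Δ.toFun ν τ x + φ x (ν x) (τ x).1) + (Δ.toFun ν' τ x + φ x (ν' x) (τ x).1)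
      rw [h, map_add, LinearMap.add_apply, add_add_add_comm])
    (fun r ν τ => by
      ext1 x
      have h : Δ.toFun (r • ν) τ x = r • Δ.toFun ν τ x := by rw [map_smul]; rfl
      change Δ.toFun (r • ν) τ x + φ x (r • ν x) (τ x).1 =
        r • (Δ.toFun ν τ x + φ x (ν x) (τ x).1)
      rw [h, map_smul, LinearMap.smul_apply, smul_add])
    (fun ν τ τ' => by
      ext1 x
      have h : Δ.toFun ν (τ + τ') x = Δ.toFun ν τ x + Δ.toFun ν τ' x := by rw [map_add]; rfl
      change Δ.toFun ν (τ + τ') x + φ x (ν x) ((τ x).1 + (τ' x).1) =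
        (Δ.toFun ν τ x + φ x (ν x) (τ x).1) + (Δ.toFun ν τ' x + φ x (ν x) (τ' x).1)
      rw [h, map_add, add_add_add_comm])
    (fun r ν τ => by
      ext1 x
      have h : Δ.toFun ν (r • τ) x = r • Δ.toFun ν τ x := by rw [map_smul]; rfl
      change Δ.toFun ν (r • τ) x + φ x (ν x) (r • (τ x).1) =
        r • (Δ.toFun ν τ x + φ x (ν x) (τ x).1)
      rw [h, map_smul, smul_add])
  leibniz f ν τ x := by
    change Δ.toFun ν (fsmul f τ) x + φ x (ν x) (f x • (τ x).1) =
      f x • (Δ.toFun ν τ x + φ x (ν x) (τ x).1) + mvfderiv I f x (ν x).1 • τ x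
    rw [Δ.leibniz, map_smul, smul_add, add_right_comm]
  smul_left f ν τ x := by
    change Δ.toFun (fsmul f ν) τ x + φ x (f x • ν x) (τ x).1 =
      f x • (Δ.toFun ν τ x + φ x (ν x) (τ x).1) + pairing (ν x) (τ x) • coreD F E f x
    rw [Δ.smul_left, map_smul, LinearMap.smul_apply, smul_add, add_right_comm]
  -- `φ` sees only the `E`-component of its argument, and that of `(0, df)` is zero.
  exact_form f ν x := by
    change Δ.toFun ν (coreD F E f) x + φ x (ν x) (0 : E x) = _
    rw [Δ.exact_form, map_zero, add_zero]

theorem DorfmanConnection.perturb_toFun (Δ : DorfmanConnection I F E)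
    (φ : ∀ x, Side I E x →ₗ[ℝ] E x →ₗ[ℝ] Core I E x) (hφ) (ν : SideSection I F E)
    (τ : CoreSection I F E) (x : M) :
    (Δ.perturb φ hφ).toFun ν τ x = Δ.toFun ν τ x + φ x (ν x) (τ x).1 := rfl

/-- The sum of a skew-symmetric Dorfman connection and a skew-symmetric tensor. -/
def SkewDorfman.perturb (Δ : SkewDorfman I F E)
    (φ : ∀ x, Side I E x →ₗ[ℝ] E x →ₗ[ℝ] Core I E x)
    (hφ : ∀ (ν : SideSection I F E) (τ : CoreSection I F E),
      ContMDiff I (I.prod 𝓘(ℝ, F × (EM →L[ℝ] ℝ))) ∞ (fun x =>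
        (⟨x, φ x (ν x) (τ x).1⟩ : TotalSpace (F × (EM →L[ℝ] ℝ)) (Core I E))))
    (hskew : ∀ x (ν₁ ν₂ : Side I E x) (e : E x), pairing ν₂ (φ x ν₁ e) = -pairing ν₁ (φ x ν₂ e)) :
    SkewDorfman I F E where
  toDorfmanConnection := Δ.toDorfmanConnection.perturb φ hφ
  skew ν₁ ν₂ := by
    refine sideSection_ext fun τ x => ?_
    -- The perturbation changes the dull bracket by `-⟨ν₂, φ(ν₁, ·)⟩`, which is skew by `hskew`.
    have h1 := congrArg (fun s : SideSection I F E => pairing (s x) (τ x)) (Δ.skew ν₁ ν₂)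
    simp only [ContMDiffSection.coe_neg, Pi.neg_apply, pairing_neg_left,
      DorfmanConnection.pairing_dullBracket] at h1
    simp only [ContMDiffSection.coe_neg, Pi.neg_apply, pairing_neg_left,
      DorfmanConnection.pairing_dullBracket, DorfmanConnection.perturb_toFun, pairing_add_right]
    linarith [hskew x (ν₁ x) (ν₂ x) (τ x).1]

theorem hlift_eq_of_toFun {Δ Δ' : SkewDorfman I F E} {ν : SideSection I F E} {e : Cₛ^∞⟮I; F, E⟯}
    {x : M} {c : Core I E x}
    (h : Δ'.toFun ν (coreInl e) x = Δ.toFun ν (coreInl e) x + c) :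
    hlift Δ' ⟨x, e x⟩ (ν x) = hlift Δ ⟨x, e x⟩ (ν x) - coreLift ⟨x, e x⟩ c := by
  rw [hlift_section, hlift_section, horizontalLift, horizontalLift, h, coreLift_add, sub_sub]

theorem hlift_perturb (Δ : SkewDorfman I F E) (φ : ∀ x, Side I E x →ₗ[ℝ] E x →ₗ[ℝ] Core I E x)
    (hφ hskew) (p : TotalSpace F E) (ν : Side I E p.1) :
    hlift (Δ.perturb φ hφ hskew) p ν = hlift Δ p ν - coreLift p (φ p.1 ν p.2) := by
  obtain ⟨x, v⟩ := p
  obtain ⟨e, rfl⟩ := exists_section_eq (I := I) (F := F) (V := E) x v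
  obtain ⟨s, rfl⟩ := exists_section_eq (I := I) (F := EM × (F →L[ℝ] ℝ)) (V := Side I E) x ν
  exact hlift_eq_of_toFun rfl

end Perturbation

section Extensionality

variable {EN : Type*} [NormedAddCommGroup EN] [NormedSpace ℝ EN]
  {H : Type*} [TopologicalSpace H] {I : ModelWithCorners ℝ EN H}
  {N : Type*} [TopologicalSpace N] [ChartedSpace H N]
  {F : Type*} [NormedAddCommGroup F] [NormedSpace ℝ F]
  {V : N → Type*} [TopologicalSpace (TotalSpace F V)]
  [∀ x, AddCommGroup (V x)] [∀ x, Module ℝ (V x)] [∀ x, TopologicalSpace (V x)]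
  [FiberBundle F V] [VectorBundle ℝ F V]

theorem BundleEnd.ext_app {j j' : BundleEnd I F V} (h : ∀ x v, j.app x v = j'.app x v) :
    j = j' := by
  cases j; cases j'
  congr
  funext x
  exact LinearMap.ext (h x)

end Extensionality

/-! ### The side and core morphisms of `J`, and an adapted Dorfman connection. -/

section Adapted

variable {EM : Type*} [NormedAddCommGroup EM] [NormedSpace ℝ EM] [FiniteDimensional ℝ EM]
  {H : Type*} [TopologicalSpace H] {I : ModelWithCorners ℝ EM H} [I.Boundaryless]
  {M : Type*} [TopologicalSpace M] [T2Space M] [ChartedSpace H M] [IsManifold I ∞ M]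
  {F : Type*} [NormedAddCommGroup F] [NormedSpace ℝ F] [FiniteDimensional ℝ F]
  {E : M → Type*} [TopologicalSpace (TotalSpace F E)]
  [∀ x, AddCommGroup (E x)] [∀ x, Module ℝ (E x)] [∀ x, TopologicalSpace (E x)]
  [FiberBundle F E] [VectorBundle ℝ F E] [ContMDiffVectorBundle ∞ F E I]

theorem isAdapted_iff (J : GTEEnd I F E) (j : SideEnd I F E) (Δ : SkewDorfman I F E) :
    IsAdapted J j Δ ↔ ∀ (p : TotalSpace F E) (ν : Side I E p.1),
      J.app p (hlift Δ p ν) = hlift Δ p (j.app p.1 ν) := by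
  constructor
  · rintro h ⟨x, v⟩ ν
    obtain ⟨e, rfl⟩ := exists_section_eq (I := I) (F := F) (V := E) x v
    obtain ⟨s, rfl⟩ := exists_section_eq (I := I) (F := EM × (F →L[ℝ] ℝ)) (V := Side I E) x ν
    have h1 := h s e x
    rw [← hlift_section, ← hlift_section] at h1
    exact h1
  · intro h ν e m
    rw [← hlift_section, ← hlift_section]
    exact h ⟨m, e m⟩ (ν m)

section SideMorphism

variable {J : GTEEnd I F E} {j : SideEnd I F E}

theorem IsDoubleMorphism.sideProj_app (h : IsDoubleMorphism J j) (p : TotalSpace F E)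
    (a : GTE I F E p) : sideProj p (J.app p a) = j.app p.1 (sideProj p a) :=
  projectsTo_iff.1 (h.covers p a _ (projectsTo_iff.2 rfl))

/-- The splitting only serves to realise each `ν` as a side projection, and the zero vector of the
fibre is enough. -/
theorem IsDoubleMorphism.side_sq (h : IsDoubleMorphism J j) (Δ : SkewDorfman I F E)
    (hsq : ∀ p (a : GTE I F E p), J.app p (J.app p a) = -a) (x : M) (ν : Side I E x) :
    j.app x (j.app x ν) = -ν := by
  have h1 := congrArg (sideProj (⟨x, 0⟩ : TotalSpace F E)) (hsq ⟨x, 0⟩ (hlift Δ ⟨x, 0⟩ ν))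
  rw [h.sideProj_app, h.sideProj_app, sideProj_hlift, map_neg, sideProj_hlift] at h1
  exact h1

theorem IsDoubleMorphism.side_unique {j' : SideEnd I F E} (h : IsDoubleMorphism J j)
    (h' : IsDoubleMorphism J j') (Δ : SkewDorfman I F E) : j = j' := by
  refine BundleEnd.ext_app fun x ν => ?_
  have h1 := h.sideProj_app ⟨x, 0⟩ (hlift Δ ⟨x, 0⟩ ν)
  have h2 := h'.sideProj_app ⟨x, 0⟩ (hlift Δ ⟨x, 0⟩ ν)
  rw [sideProj_hlift] at h1 h2
  exact h1.symm.trans h2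

/-- `J` covers `j`, so it preserves the kernel of the side projection, the core. There it is
determined by pairing with lifts, where `J` is skew and acts by `j` on the side. -/
theorem app_coreLift (hsq : ∀ p (a : GTE I F E p), J.app p (J.app p a) = -a)
    (horth : ∀ p (a b : GTE I F E p), genPairing (J.app p a) (J.app p b) = genPairing a b) (Δ : SkewDorfman I F E)
    (hside : ∀ p (a : GTE I F E p), sideProj p (J.app p a) = j.app p.1 (sideProj p a))
    (p : TotalSpace F E) (τ : Core I E p.1) :
    J.app p (coreLift p τ) = coreLift p (negTranspose j p.1 τ) := by
  obtain ⟨τ', h⟩ := exists_coreLift_eq (p := p) (a := J.app p (coreLift p τ))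
    (by rw [hside, sideProj_coreLift, map_zero])
  rw [h]
  refine congrArg _ (pairing_ext_right F fun ν => ?_)
  have h1 := genPairing_app_left hsq horth (hlift Δ p ν) (coreLift p τ)
  rw [h, genPairing_coreLift, genPairing_coreLift, hside, sideProj_hlift] at h1
  rw [pairing_negTranspose, h1, neg_neg]

end SideMorphism

end Adapted

section Adapted

variable {EM : Type*} [NormedAddCommGroup EM] [NormedSpace ℝ EM] [FiniteDimensional ℝ EM]
  {H : Type*} [TopologicalSpace H] {I : ModelWithCorners ℝ EM H} [I.Boundaryless]
  {M : Type*} [TopologicalSpace M] [T2Space M] [ChartedSpace H M] [IsManifold I ∞ M]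
  {F : Type*} [NormedAddCommGroup F] [NormedSpace ℝ F] [FiniteDimensional ℝ F]
  {E : M → Type*} [TopologicalSpace (TotalSpace F E)]
  [∀ x, AddCommGroup (E x)] [∀ x, Module ℝ (E x)] [∀ x, TopologicalSpace (E x)]
  [FiberBundle F E] [VectorBundle ℝ F E] [ContMDiffVectorBundle ∞ F E I]

variable {J : GTEEnd I F E} {j : SideEnd I F E}

/-- The section `e` of `E` underlying a section `(e, θ)` of `E ⊕ T*M`. -/
def coreFst (τ : CoreSection I F E) : Cₛ^∞⟮I; F, E⟯ where
  toFun x := (τ x).1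
  contMDiff_toFun x :=
    (contMDiffAt_section (E := E) x).2 ((ContinuousLinearMap.fst ℝ F (EM →L[ℝ] ℝ)).contMDiff.contMDiffAt.comp x
      ((contMDiffAt_section x).1 (τ.contMDiff x)))

theorem isSideSum_hlift (Δ : SkewDorfman I F E) (w : Whitney F E) (ν : Side I E w.1) :
    IsSideSum w (hlift Δ (w.fst F E) ν) (hlift Δ (w.snd F E) ν) (hlift Δ (w.add F E) ν) := by
  have h := (isSideSum_lift Δ w ν ν ν 0 0 0).2 ⟨rfl, rfl, (add_zero _).symm⟩
  have z : ∀ (p : TotalSpace F E) (ν : Side I E p.1), hlift Δ p ν + coreLift p 0 = hlift Δ p ν :=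
    fun p ν => by rw [coreLift_zero, add_zero]
  exact Eq.mp (congr (congr (congrArg (IsSideSum w) (z (w.fst F E) ν)) (z (w.snd F E) ν))
    (z (w.add F E) ν)) h

theorem isSideSMul_hlift (Δ : SkewDorfman I F E) (r : ℝ) (p : TotalSpace F E) (ν : Side I E p.1) :
    IsSideSMul r p (hlift Δ p ν) (hlift Δ (homothety F E r p) ν) := by
  have h := (isSideSMul_lift Δ r p ν ν 0 0).2 ⟨rfl, (smul_zero _).symm⟩
  have z : ∀ (p : TotalSpace F E) (ν : Side I E p.1), hlift Δ p ν + coreLift p 0 = hlift Δ p ν :=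
    fun p ν => by rw [coreLift_zero, add_zero]
  exact Eq.mp (congr (congrArg (IsSideSMul r p) (z p ν)) (z (homothety F E r p) ν)) h

/-- The difference between `J ∘ σ` and `σ ∘ j` is a tensor. -/
theorem IsDoubleMorphism.exists_defect (hJ : IsDoubleMorphism J j) (Δ : SkewDorfman I F E) :
    ∃ φ : ∀ x, Side I E x →ₗ[ℝ] E x →ₗ[ℝ] Core I E x, ∀ (p : TotalSpace F E) ν,
      J.app p (hlift Δ p ν) = hlift Δ p (j.app p.1 ν) + coreLift p (φ p.1 ν p.2) := by
  have h : ∀ (p : TotalSpace F E) (ν : Side I E p.1), ∃ τ : Core I E p.1,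
      J.app p (hlift Δ p ν) = hlift Δ p (j.app p.1 ν) + coreLift p τ := by
    intro p ν
    obtain ⟨τ, hτ⟩ := exists_hlift_add_coreLift Δ p (J.app p (hlift Δ p ν))
    refine ⟨τ, ?_⟩
    rw [hJ.sideProj_app, sideProj_hlift] at hτ
    exact hτ
  choose T hT using h
  refine ⟨fun x => LinearMap.mk₂ ℝ (fun ν e => T ⟨x, e⟩ ν) ?_ ?_ ?_ ?_, hT⟩
  · intro ν ν' e
    apply coreLift_injective (⟨x, e⟩ : TotalSpace F E)
    have h1 := hT ⟨x, e⟩ (ν + ν')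
    rw [map_add, map_add, hT, hT, map_add, map_add, add_add_add_comm] at h1
    rw [coreLift_add]
    exact (add_left_cancel h1).symm
  · intro r ν e
    apply coreLift_injective (⟨x, e⟩ : TotalSpace F E)
    have h1 := hT ⟨x, e⟩ (r • ν)
    rw [map_smul, map_smul, hT, map_smul, map_smul, smul_add] at h1
    rw [coreLift_smul]
    exact (add_left_cancel h1).symm
  · intro ν e e'
    let w : Whitney F E := ⟨x, (e, e')⟩
    -- Linearity of the defect in the point `e` is the linearity of `J` for the second vector bundle
    -- structure: side sums of lifts are lifts, and side addition adds the core components.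
    have h1 := hJ.add w _ _ _ (isSideSum_hlift Δ w ν)
    have h2 := Eq.mp (congr (congr (congrArg (IsSideSum w) (hT (w.fst F E) ν))
      (hT (w.snd F E) ν)) (hT (w.add F E) ν)) h1
    exact ((isSideSum_lift Δ w _ _ _ _ _ _).1 h2).2.2
  · intro r ν e
    let p : TotalSpace F E := ⟨x, e⟩
    have h1 := hJ.smul r p _ _ (isSideSMul_hlift Δ r p ν)
    have h2 := Eq.mp (congr (congrArg (IsSideSMul r p) (hT p ν)) (hT (homothety F E r p) ν)) h1
    exact ((isSideSMul_lift Δ r p _ _ _ _).1 h2).2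

theorem pairing_defect {Δ : SkewDorfman I F E} {p : TotalSpace F E} {ν ν' : Side I E p.1}
    {τ : Core I E p.1} {a : GTE I F E p} (h : a = hlift Δ p ν + coreLift p τ) :
    pairing ν' τ = genPairing (hlift Δ p ν') a := by
  rw [h, genPairing_add_right, genPairing_hlift, genPairing_coreLift, sideProj_hlift, zero_add]

/-- A linear generalised complex structure has an adapted Dorfman connection. -/
theorem IsDoubleMorphism.exists_isAdapted (hJ : IsDoubleMorphism J j)
    (hsq : ∀ p (a : GTE I F E p), J.app p (J.app p a) = -a)
    (horth : ∀ p (a b : GTE I F E p), genPairing (J.app p a) (J.app p b) = genPairing a b)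
    (Δ : SkewDorfman I F E) : ∃ Δ' : SkewDorfman I F E, IsAdapted J j Δ' := by
  obtain ⟨φ, hφ⟩ := hJ.exists_defect Δ
  have hj := fun x ν => hJ.side_sq Δ hsq x ν
  have hcore := app_coreLift hsq horth Δ hJ.sideProj_app
  -- The core component of `J² = -1`.
  have hφj : ∀ x (ν : Side I E x) (e : E x), φ x (j.app x ν) e = -negTranspose j x (φ x ν e) := by
    intro x ν e
    apply coreLift_injective (⟨x, e⟩ : TotalSpace F E)
    have h1 := hsq ⟨x, e⟩ (hlift Δ ⟨x, e⟩ ν)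
    rw [hφ, map_add, hφ, hcore, hj, map_neg, add_assoc, ← coreLift_add] at h1
    have h2 := add_eq_left.1 h1
    rw [← coreLift_zero] at h2
    rw [eq_neg_of_add_eq_zero_left (coreLift_injective _ h2)]
  have hpair : ∀ (x : M) (ν ν' : Side I E x) (e : E x),
      pairing ν' (φ x ν e) = genPairing (hlift Δ ⟨x, e⟩ ν') (J.app ⟨x, e⟩ (hlift Δ ⟨x, e⟩ ν)) :=
    fun x ν ν' e => pairing_defect (hφ ⟨x, e⟩ ν)
  -- The lift `σ - ψ^↑` is adapted if `φ = -jᵗ ψ - ψ j`. By `hφj` and `j² = -1` both terms on the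
  -- right equal `½ φ` for this `ψ`.
  let ψ : ∀ x, Side I E x →ₗ[ℝ] E x →ₗ[ℝ] Core I E x := fun x => (1 / 2 : ℝ) • φ x ∘ₗ j.app x
  have hψ : ∀ x (ν : Side I E x) (e : E x), ψ x ν e = (1 / 2 : ℝ) • φ x (j.app x ν) e :=
    fun _ _ _ => rfl
  have hsmooth : ∀ (ν : SideSection I F E) (τ : CoreSection I F E),
      ContMDiff I (I.prod 𝓘(ℝ, F × (EM →L[ℝ] ℝ))) ∞ (fun x =>
        (⟨x, ψ x (ν x) (τ x).1⟩ : TotalSpace (F × (EM →L[ℝ] ℝ)) (Core I E))) := by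
    intro ν τ
    -- Smoothness of `φ` comes from writing its pairing with `ν'` as the pairing of `σ(ν')` with `J
    -- σ(j ν)`, pulled back along the section of `E`.
    obtain ⟨c, hc⟩ := exists_coreSection (I := I) (F := F) (E := E)
      (fun ν' => ⟨fun x => genPairing (hliftSection Δ ν' ⟨x, coreFst τ x⟩)
          (J.onSections (hliftSection Δ (j.onSections ν)) ⟨x, coreFst τ x⟩),
        (contMDiff_genPairing (hliftSection Δ ν')
          (J.onSections (hliftSection Δ (j.onSections ν)))).comp (coreFst τ).contMDiff⟩)
      (fun s t x => by
        change genPairing (hlift Δ ⟨x, coreFst τ x⟩ (s x + t x)) _ =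
          genPairing (hlift Δ ⟨x, coreFst τ x⟩ (s x)) _ + genPairing (hlift Δ ⟨x, coreFst τ x⟩ (t x)) _
        rw [map_add, genPairing_add_left])
      (fun f s x => by
        change genPairing (hlift Δ ⟨x, coreFst τ x⟩ (f x • s x)) _ =
          f x * genPairing (hlift Δ ⟨x, coreFst τ x⟩ (s x)) _
        rw [map_smul, genPairing_comm, genPairing_comm (hlift Δ ⟨x, coreFst τ x⟩ (s x))]
        simp [genPairing]
        ring)
    have h2 : ∀ x, ψ x (ν x) (τ x).1 = ((1 / 2 : ℝ) • c) x := by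
      intro x
      rw [hψ]
      refine congrArg _ (pairing_ext_right F fun ν' => ?_)
      obtain ⟨s, rfl⟩ := exists_section_eq (I := I) (F := EM × (F →L[ℝ] ℝ)) (V := Side I E) x ν'
      rw [hc, hpair]
      rfl
    simpa only [h2] using ((1 / 2 : ℝ) • c).contMDiff
  -- Moving `J` across the pairing and using isotropy of the lift turns the left side into `-½ ⟨j
  -- ν₁, φ(ν₂)⟩`; `hφj` gives the same for the right side.
  have hskew : ∀ x (ν₁ ν₂ : Side I E x) (e : E x),
      pairing ν₂ (ψ x ν₁ e) = -pairing ν₁ (ψ x ν₂ e) := by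
    intro x ν₁ ν₂ e
    rw [hψ, hψ, pairing_smul_right, pairing_smul_right, hpair,
      ← neg_eq_iff_eq_neg.2 (genPairing_app_left hsq horth (hlift Δ ⟨x, e⟩ ν₂) _), genPairing_comm,
      hφ, genPairing_add_right, genPairing_hlift, genPairing_coreLift, sideProj_hlift, hφj,
      pairing_neg_right, pairing_negTranspose]
    ring
  refine ⟨Δ.perturb ψ hsmooth hskew, (isAdapted_iff J j _).2 fun p ν => ?_⟩
  rw [hlift_perturb, hlift_perturb, map_sub, hφ, hcore, add_sub_assoc, sub_eq_add_neg (hlift Δ p _),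
    ← coreLift_sub, ← coreLift_neg, hψ, hψ, hj, map_smul, hφj, map_neg, negTranspose_sq hj, map_neg,
    LinearMap.neg_apply]
  congr 2
  module

end Adapted

/-! ### `j`-equivalence and adapted connections. -/

section Adapted

variable {EM : Type*} [NormedAddCommGroup EM] [NormedSpace ℝ EM] [FiniteDimensional ℝ EM]
  {H : Type*} [TopologicalSpace H] {I : ModelWithCorners ℝ EM H} [I.Boundaryless]
  {M : Type*} [TopologicalSpace M] [T2Space M] [ChartedSpace H M] [IsManifold I ∞ M]
  {F : Type*} [NormedAddCommGroup F] [NormedSpace ℝ F] [FiniteDimensional ℝ F]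
  {E : M → Type*} [TopologicalSpace (TotalSpace F E)]
  [∀ x, AddCommGroup (E x)] [∀ x, Module ℝ (E x)] [∀ x, TopologicalSpace (E x)]
  [FiberBundle F E] [VectorBundle ℝ F E] [ContMDiffVectorBundle ∞ F E I]

theorem dullBracket_fst (Δ₁ Δ₂ : DorfmanConnection I F E) (ν₁ ν₂ : SideSection I F E) (x : M) :
    (Δ₂.dullBracket ν₁ ν₂ x).1 = (Δ₁.dullBracket ν₁ ν₂ x).1 := by
  refine tangent_ext (I := I) fun f => ?_
  have h₁ := congrArg (fun g : C^∞⟮I, M; ℝ⟯ => g x) (Δ₁.derivMap_dullBracket ν₁ ν₂ f)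
  have h₂ := congrArg (fun g : C^∞⟮I, M; ℝ⟯ => g x) (Δ₂.derivMap_dullBracket ν₁ ν₂ f)
  rw [← derivMap_apply, ← derivMap_apply]
  exact h₂.trans h₁.symm

/-- The change of splittings is the pairing of the two lifts: they differ by the core lift of `Δ₁ -
Δ₂`, and lifts of the same connection are isotropic. This makes the relation between sections a
condition on vectors at each point. -/
theorem dullBracket_snd (Δ₁ Δ₂ : SkewDorfman I F E) (ν₁ ν₂ : SideSection I F E) (x : M) (v : E x) :
    (Δ₂.dullBracket ν₁ ν₂ x).2 v = (Δ₁.dullBracket ν₁ ν₂ x).2 v +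
      genPairing (hlift Δ₂ ⟨x, v⟩ (ν₁ x)) (hlift Δ₁ ⟨x, v⟩ (ν₂ x)) := by
  obtain ⟨e, rfl⟩ := exists_section_eq (I := I) (F := F) (V := E) x v
  have h : ∀ Δ : SkewDorfman I F E, (Δ.dullBracket ν₁ ν₂ x).2 (e x) =
      derivMap ν₁ (pairingMap ν₂ (coreInl e)) x - pairing (ν₂ x) (Δ.toFun ν₁ (coreInl e) x) := fun Δ => by
    rw [← Δ.pairing_dullBracket]
    change _ = (Δ.dullBracket ν₁ ν₂ x).2 (e x) + (0 : ℝ)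
    rw [add_zero]
  rw [h, h, hlift_eq_of_toFun (Δ := Δ₁) (Δ' := Δ₂) (ν := ν₁) (e := e) (x := x)
    (c := Δ₂.toFun ν₁ (coreInl e) x - Δ₁.toFun ν₁ (coreInl e) x) (by abel), sub_eq_add_neg (hlift _ _ _),
    genPairing_add_left, genPairing_hlift, genPairing_neg_left, genPairing_comm,
    genPairing_coreLift, sideProj_hlift, pairing_sub_right]
  ring

theorem jSetoid_iff (j : SideEnd I F E) (Δ₁ Δ₂ : SkewDorfman I F E) :
    jSetoid j Δ₁ Δ₂ ↔ ∀ (p : TotalSpace F E) (ν₁ ν₂ : Side I E p.1),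
      genPairing (hlift Δ₂ p ν₁) (hlift Δ₁ p ν₂) =
        genPairing (hlift Δ₂ p (j.app p.1 ν₁)) (hlift Δ₁ p (j.app p.1 ν₂)) := by
  constructor
  · rintro ⟨Ψ, h, hj⟩ ⟨x, v⟩ ν₁ ν₂
    obtain ⟨s₁, rfl⟩ := exists_section_eq (I := I) (F := EM × (F →L[ℝ] ℝ)) (V := Side I E) x ν₁
    obtain ⟨s₂, rfl⟩ := exists_section_eq (I := I) (F := EM × (F →L[ℝ] ℝ)) (V := Side I E) x ν₂
    have key : ∀ s₁ s₂ : SideSection I F E,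
        genPairing (hlift Δ₂ ⟨x, v⟩ (s₁ x)) (hlift Δ₁ ⟨x, v⟩ (s₂ x)) = Ψ s₁ s₂ x v := by
      intro s₁ s₂
      have h1 := dullBracket_snd Δ₁ Δ₂ s₁ s₂ x v
      rw [h s₁ s₂ x] at h1
      exact (add_left_cancel h1).symm
    exact (key s₁ s₂).trans ((congrArg (fun L : E x →L[ℝ] ℝ => L v) (hj s₁ s₂ x)).trans
      (key (j.onSections s₁) (j.onSections s₂)).symm)
  · intro h
    refine ⟨fun ν₁ ν₂ x => (Δ₂.dullBracket ν₁ ν₂ x).2 - (Δ₁.dullBracket ν₁ ν₂ x).2,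
      fun ν₁ ν₂ x => Prod.ext ?_ ?_, fun ν₁ ν₂ x => ?_⟩
    · exact (dullBracket_fst Δ₁.toDorfmanConnection Δ₂.toDorfmanConnection ν₁ ν₂ x).trans
        (add_zero _).symm
    · exact (add_sub_cancel _ _).symm
    · ext v
      change (Δ₂.dullBracket ν₁ ν₂ x).2 v - (Δ₁.dullBracket ν₁ ν₂ x).2 v = _ - _
      rw [dullBracket_snd Δ₁ Δ₂]
      have h1 := dullBracket_snd Δ₁ Δ₂ (j.onSections ν₁) (j.onSections ν₂) x v
      exact (add_sub_cancel_left _ _).trans ((h ⟨x, v⟩ (ν₁ x) (ν₂ x)).trans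
        (eq_sub_of_add_eq' h1.symm))

/-- The connections which are `j`-equivalent to an adapted one are the adapted ones. -/
theorem IsAdapted.jSetoid_iff {J : GTEEnd I F E} {j : SideEnd I F E} {Δ₁ : SkewDorfman I F E}
    (hsq : ∀ p (a : GTE I F E p), J.app p (J.app p a) = -a)
    (horth : ∀ p (a b : GTE I F E p), genPairing (J.app p a) (J.app p b) = genPairing a b)
    (hside : ∀ p (a : GTE I F E p), sideProj p (J.app p a) = j.app p.1 (sideProj p a))
    (hj : ∀ x (ν : Side I E x), j.app x (j.app x ν) = -ν)
    (h₁ : IsAdapted J j Δ₁) (Δ₂ : SkewDorfman I F E) :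
    jSetoid j Δ₁ Δ₂ ↔ IsAdapted J j Δ₂ := by
  rw [isAdapted_iff] at h₁ ⊢
  rw [LinGC.jSetoid_iff]
  constructor
  · intro h p ν
    have h1 : sideProj p (J.app p (hlift Δ₂ p ν) - hlift Δ₂ p (j.app p.1 ν)) = 0 := by
      rw [map_sub, hside, sideProj_hlift, sideProj_hlift, sub_self]
    obtain ⟨c, hc⟩ := exists_coreLift_eq h1
    -- The core element `c` is tested against `σ₁(ν')`. The hypothesis for `j ν` and `ν'`, with `j²
    -- = -1` and adaptedness of `Δ₁`, says that `J σ₂(ν)` and `σ₂(j ν)` pair equally with it.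
    have h0 : c = 0 := by
      refine pairing_ext_right F fun ν' => ?_
      have h2 : genPairing (hlift Δ₁ p ν') (coreLift p c) = pairing ν' c := by
        rw [genPairing_coreLift, sideProj_hlift]
      have h3 := h p (j.app p.1 ν) ν'
      rw [hj, map_neg, genPairing_neg_left, ← h₁, ← genPairing_app_left hsq horth] at h3
      rw [← h2, ← hc, sub_eq_add_neg, genPairing_add_right, genPairing_neg_right, genPairing_comm,
        genPairing_comm (hlift Δ₁ p ν'), h3, add_neg_cancel]
      simp [pairing]
    rw [h0, coreLift_zero] at hc
    exact sub_eq_zero.1 hc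
  · intro h p ν₁ ν₂
    rw [← h, ← h₁, horth]

end Adapted

/-! ### The Nijenhuis expression in an adapted splitting. -/

section Adapted

variable {EM : Type*} [NormedAddCommGroup EM] [NormedSpace ℝ EM] [FiniteDimensional ℝ EM]
  {H : Type*} [TopologicalSpace H] {I : ModelWithCorners ℝ EM H} [I.Boundaryless]
  {M : Type*} [TopologicalSpace M] [T2Space M] [ChartedSpace H M] [IsManifold I ∞ M]
  {F : Type*} [NormedAddCommGroup F] [NormedSpace ℝ F] [FiniteDimensional ℝ F]
  {E : M → Type*} [TopologicalSpace (TotalSpace F E)]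
  [∀ x, AddCommGroup (E x)] [∀ x, Module ℝ (E x)] [∀ x, TopologicalSpace (E x)]
  [FiberBundle F E] [VectorBundle ℝ F E] [ContMDiffVectorBundle ∞ F E I]

theorem hlift_add_coreLift_eq_zero_iff (Δ : SkewDorfman I F E) {p : TotalSpace F E}
    {ν : Side I E p.1} {τ : Core I E p.1} :
    hlift Δ p ν + coreLift p τ = 0 ↔ ν = 0 ∧ τ = 0 := by
  constructor
  · intro h
    have h1 : ν = 0 := by rw [← sideProj_lift Δ p ν τ, h, map_zero]
    rw [h1, map_zero, zero_add, ← coreLift_zero] at h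
    exact ⟨h1, coreLift_injective p h⟩
  · rintro ⟨rfl, rfl⟩
    rw [map_zero, coreLift_zero, add_zero]

theorem pairingMap_negTransposeSection (j : SideEnd I F E) (ν : SideSection I F E)
    (τ : CoreSection I F E) :
    pairingMap ν (negTransposeSection j τ) = -pairingMap (j.onSections ν) τ := by
  ext x
  exact pairing_negTranspose j (ν x) (τ x)

section Integrability

variable {J : GTEEnd I F E} {j : SideEnd I F E} {Δ : SkewDorfman I F E}

theorem onSections_hliftSection
    (hA : ∀ (p : TotalSpace F E) (ν : Side I E p.1), J.app p (hlift Δ p ν) = hlift Δ p (j.app p.1 ν))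
    (ν : SideSection I F E) :
    J.onSections (hliftSection Δ ν) = hliftSection Δ (j.onSections ν) := by
  ext1 p
  exact hA p (ν p.1)

theorem onSections_coreLiftSection
    (hC : ∀ (p : TotalSpace F E) (τ : Core I E p.1),
      J.app p (coreLift p τ) = coreLift p (negTranspose j p.1 τ))
    (τ : CoreSection I F E) :
    J.onSections (coreLiftSection τ) = coreLiftSection (negTransposeSection j τ) := by
  ext1 p
  exact hC p (τ p.1)

theorem nijenhuisExpr_core_core
    (hC : ∀ (p : TotalSpace F E) (τ : Core I E p.1),
      J.app p (coreLift p τ) = coreLift p (negTranspose j p.1 τ))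
    (τ τ' : CoreSection I F E) (p : TotalSpace F E) :
    nijenhuisExpr J (coreLiftSection τ) (coreLiftSection τ') p = 0 := by
  rw [nijenhuisExpr, onSections_coreLiftSection hC, onSections_coreLiftSection hC]
  simp only [courantBracket_core_core, sub_zero, add_zero, map_zero]

/-- The Nijenhuis expression of `j` for the dull bracket of `Δ`. -/
def SkewDorfman.sideNijenhuis (Δ : SkewDorfman I F E) (j : SideEnd I F E)
    (ν₁ ν₂ : SideSection I F E) : SideSection I F E :=
  Δ.bracketL ν₁ ν₂ - Δ.bracketL (j.onSections ν₁) (j.onSections ν₂) +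
    j.onSections (Δ.bracketL (j.onSections ν₁) ν₂ + Δ.bracketL ν₁ (j.onSections ν₂))

/-- The value is a core lift whose pairing with `ν₂` is `-⟨N_j(ν, ν₂), τ⟩`, where `N_j` is
`sideNijenhuis`: the derivatives of functions cancel in pairs once `Δ` is moved to the dull bracket.
-/
theorem nijenhuisExpr_hlift_core
    (hA : ∀ (p : TotalSpace F E) (ν : Side I E p.1), J.app p (hlift Δ p ν) = hlift Δ p (j.app p.1 ν))
    (hC : ∀ (p : TotalSpace F E) (τ : Core I E p.1),
      J.app p (coreLift p τ) = coreLift p (negTranspose j p.1 τ))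
    (hj : ∀ x (ν : Side I E x), j.app x (j.app x ν) = -ν)
    (ν : SideSection I F E) (τ : CoreSection I F E) (p : TotalSpace F E)
    (hN : ∀ ν', Δ.sideNijenhuis j ν ν' = 0) :
    nijenhuisExpr J (hliftSection Δ ν) (coreLiftSection τ) p = 0 := by
  rw [nijenhuisExpr, onSections_coreLiftSection hC, onSections_hliftSection hA]
  simp only [courantBracket_hlift_core]
  rw [← coreLift_add, hC, ← coreLift_sub, ← coreLift_add, ← coreLift_zero]
  refine congrArg _ (pairing_ext_right F fun ν₀ => ?_)
  obtain ⟨ν₂, rfl⟩ := exists_section_eq (I := I) (F := EM × (F →L[ℝ] ℝ)) (V := Side I E) p.1 ν₀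
  have h0 : pairing (Δ.sideNijenhuis j ν ν₂ p.1) (τ p.1) = 0 := by
    rw [hN]; simp [pairing]
  have hz : pairing (ν₂ p.1) (0 : Core I E p.1) = 0 := by simp [pairing]
  rw [hz]
  have e : ∀ (ν : SideSection I F E) (τ : CoreSection I F E), pairing (ν p.1) (τ p.1) =
    pairingMap ν τ p.1 := fun _ _ => rfl
  have s : ∀ (f g : C^∞⟮I, M; ℝ⟯), (f - g) p.1 = f p.1 - g p.1 := fun _ _ => rfl
  have n : ∀ (f : C^∞⟮I, M; ℝ⟯), (-f) p.1 = -f p.1 := fun _ => rfl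
  have jj : ∀ (a : SideSection I F E) (τ : CoreSection I F E), pairing (j.app p.1 (a p.1)) (τ p.1) =
    pairingMap (j.onSections a) τ p.1 := fun _ _ => rfl
  have h1 : pairing (Δ.sideNijenhuis j ν ν₂ p.1) (τ p.1) =
      pairing (Δ.dullBracket ν ν₂ p.1) (τ p.1) -
        pairing (Δ.dullBracket (j.onSections ν) (j.onSections ν₂) p.1) (τ p.1) +
        (pairing (j.app p.1 (Δ.dullBracket (j.onSections ν) ν₂ p.1)) (τ p.1) +
          pairing (j.app p.1 (Δ.dullBracket ν (j.onSections ν₂) p.1)) (τ p.1)) := by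
    rw [← pairing_sub_left, ← pairing_add_left, ← pairing_add_left, ← map_add]
    rfl
  rw [h0] at h1
  rw [pairing_add_right, pairing_sub_right, pairing_negTranspose, pairing_add_right]
  simp only [e, jj] at h1 ⊢
  simp only [DorfmanConnection.pairingMap_toFun, pairingMap_negTransposeSection, s, n, derivMap_neg,
    BundleEnd.onSections_sq hj]
  have hneg : pairingMap (-ν₂) τ = -pairingMap ν₂ τ := by
    ext x; exact pairing_neg_left (ν₂ x) (τ x)
  rw [hneg, derivMap_neg]
  linarith

/-- The four brackets bring four curvatures, two of them under `-jᵗ`, which becomes `j` on `ν₃`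
after pairing. Each curvature uses its own section of `E`, but all pass through `p`, and the pairing
sees nothing more. -/
theorem nijenhuisExpr_hlift_hlift
    (hA : ∀ (p : TotalSpace F E) (ν : Side I E p.1), J.app p (hlift Δ p ν) = hlift Δ p (j.app p.1 ν))
    (hC : ∀ (p : TotalSpace F E) (τ : Core I E p.1),
      J.app p (coreLift p τ) = coreLift p (negTranspose j p.1 τ))
    (ν₁ ν₂ : SideSection I F E) (p : TotalSpace F E) :
    ∃ κ : Core I E p.1, nijenhuisExpr J (hliftSection Δ ν₁) (hliftSection Δ ν₂) p =
        hlift Δ p (Δ.sideNijenhuis j ν₁ ν₂ p.1) + coreLift p κ ∧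
      ∀ ν₃ : SideSection I F E, pairing (ν₃ p.1) κ = -((Δ.jacobiator ν₁ ν₂ ν₃ -
        Δ.jacobiator (j.onSections ν₁) (j.onSections ν₂) ν₃ -
        Δ.jacobiator (j.onSections ν₁) ν₂ (j.onSections ν₃) -
        Δ.jacobiator ν₁ (j.onSections ν₂) (j.onSections ν₃) : SideSection I F E) p.1).2 p.2 := by
  obtain ⟨e₁, he₁, h₁⟩ := courantBracket_hlift_hlift Δ ν₁ ν₂ p
  obtain ⟨e₂, he₂, h₂⟩ := courantBracket_hlift_hlift Δ (j.onSections ν₁) (j.onSections ν₂) p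
  obtain ⟨e₃, he₃, h₃⟩ := courantBracket_hlift_hlift Δ (j.onSections ν₁) ν₂ p
  obtain ⟨e₄, he₄, h₄⟩ := courantBracket_hlift_hlift Δ ν₁ (j.onSections ν₂) p
  refine ⟨Δ.curvature (j.onSections ν₁) (j.onSections ν₂) (coreInl e₂) p.1 -
    Δ.curvature ν₁ ν₂ (coreInl e₁) p.1 - negTranspose j p.1
      (Δ.curvature (j.onSections ν₁) ν₂ (coreInl e₃) p.1 +
        Δ.curvature ν₁ (j.onSections ν₂) (coreInl e₄) p.1), ?_, fun ν₃ => ?_⟩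
  · rw [nijenhuisExpr, onSections_hliftSection hA, onSections_hliftSection hA, h₁, h₂, h₃, h₄]
    have h5 : Δ.sideNijenhuis j ν₁ ν₂ p.1 = Δ.dullBracket ν₁ ν₂ p.1 -
      Δ.dullBracket (j.onSections ν₁) (j.onSections ν₂) p.1 +
      j.app p.1 (Δ.dullBracket (j.onSections ν₁) ν₂ p.1 +
        Δ.dullBracket ν₁ (j.onSections ν₂) p.1) := rfl
    rw [h5]
    simp only [map_add, map_sub, hA, hC, coreLift_sub, coreLift_add]
    abel
  · have hp : ∀ (a b c : SideSection I F E) (e : Cₛ^∞⟮I; F, E⟯), e p.1 = p.2 →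
        pairing (c p.1) (Δ.curvature a b (coreInl e) p.1) = (Δ.jacobiator a b c p.1).2 p.2 := by
      intro a b c e he
      rw [DorfmanConnection.pairing_curvature]
      change (Δ.jacobiator a b c p.1).2 (e p.1) + (0 : ℝ) = _
      rw [he, add_zero]
    rw [pairing_sub_right, pairing_sub_right, pairing_negTranspose, pairing_add_right,
      hp _ _ _ _ he₁, hp _ _ _ _ he₂]
    have h6 := hp (j.onSections ν₁) ν₂ (j.onSections ν₃) e₃ he₃
    have h7 := hp ν₁ (j.onSections ν₂) (j.onSections ν₃) e₄ he₄
    refine (congrArg₂ (fun a b : ℝ => _ - _ - -(a + b)) h6 h7).trans ?_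
    change _ = -((Δ.jacobiator ν₁ ν₂ ν₃ p.1).2 p.2 -
        (Δ.jacobiator (j.onSections ν₁) (j.onSections ν₂) ν₃ p.1).2 p.2 -
        (Δ.jacobiator (j.onSections ν₁) ν₂ (j.onSections ν₃) p.1).2 p.2 -
        (Δ.jacobiator ν₁ (j.onSections ν₂) (j.onSections ν₃) p.1).2 p.2)
    ring

/-- An orthogonal almost complex structure with an adapted Dorfman connection is integrable if and
only if the dull bracket is. -/
theorem nijenhuisExpr_eq_zero_iff
    (hA : ∀ (p : TotalSpace F E) (ν : Side I E p.1), J.app p (hlift Δ p ν) = hlift Δ p (j.app p.1 ν))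
    (hC : ∀ (p : TotalSpace F E) (τ : Core I E p.1),
      J.app p (coreLift p τ) = coreLift p (negTranspose j p.1 τ))
    (hj : ∀ x (ν : Side I E x), j.app x (j.app x ν) = -ν)
    (hsq : ∀ p (a : GTE I F E p), J.app p (J.app p a) = -a)
    (horth : ∀ p (a b : GTE I F E p), genPairing (J.app p a) (J.app p b) = genPairing a b) :
    (∀ (e₁ e₂ : GTESection I F E) p, nijenhuisExpr J e₁ e₂ p = 0) ↔ Δ.IsIntegrable j := by
  constructor
  · intro h
    have h' := fun ν₁ ν₂ p => h (hliftSection Δ ν₁) (hliftSection Δ ν₂) p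
    constructor
    · intro ν₁ ν₂
      ext1 x
      obtain ⟨κ, hκ, -⟩ := nijenhuisExpr_hlift_hlift hA hC ν₁ ν₂ ⟨x, 0⟩
      rw [h'] at hκ
      exact ((hlift_add_coreLift_eq_zero_iff Δ).1 hκ.symm).1
    · intro ν₁ ν₂ ν₃
      ext1 x
      -- Jacobiators have no tangent part. The `E*`-part is evaluated on `v` by taking the Nijenhuis
      -- expression over the point `v` of `E`.
      refine Prod.ext ?_ (ContinuousLinearMap.ext fun v => ?_)
      · have hf := fun a b c => Δ.jacobiator_fst a b c x
        simp only [ContMDiffSection.coe_sub, Pi.sub_apply, Prod.fst_sub, hf, sub_zero]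
        rfl
      · obtain ⟨κ, hκ, hκ'⟩ := nijenhuisExpr_hlift_hlift hA hC ν₁ ν₂ ⟨x, v⟩
        rw [h'] at hκ
        have h1 := hκ' ν₃
        rw [((hlift_add_coreLift_eq_zero_iff Δ).1 hκ.symm).2] at h1
        have h2 : pairing (ν₃ x) (0 : Core I E x) = 0 := by simp [pairing]
        exact neg_eq_zero.1 (h1.symm.trans h2)
  · intro h
    have hN : ∀ ν₁ ν₂, Δ.sideNijenhuis j ν₁ ν₂ = 0 := h.nijenhuis
    have hss : ∀ ν₁ ν₂ p, nijenhuisExpr J (hliftSection Δ ν₁) (hliftSection Δ ν₂) p = 0 := by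
      intro ν₁ ν₂ p
      obtain ⟨κ, hκ, hκ'⟩ := nijenhuisExpr_hlift_hlift hA hC ν₁ ν₂ p
      refine hκ.trans ((hlift_add_coreLift_eq_zero_iff Δ).2 ⟨by rw [hN]; rfl, ?_⟩)
      refine pairing_ext_right F fun ν₀ => ?_
      obtain ⟨ν₃, rfl⟩ :=
        exists_section_eq (I := I) (F := EM × (F →L[ℝ] ℝ)) (V := Side I E) p.1 ν₀
      rw [hκ', h.jacobi]
      have h2 : pairing (ν₃ p.1) (0 : Core I E p.1) = 0 := by simp [pairing]
      rw [h2]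
      exact neg_zero
    intro e₁ e₂ p
    -- Additivity in the values at `p` reduces arbitrary sections to lifts and core sections;
    -- skewness reduces the pair core, lift to the pair lift, core.
    obtain ⟨T, hl, hr, hT⟩ := nijenhuisExpr_tensorial J hsq horth p
    have hd : ∀ a : GTE I F E p, ∃ (ν : SideSection I F E) (τ : CoreSection I F E),
        a = hliftSection Δ ν p + coreLiftSection τ p := by
      intro a
      obtain ⟨τ, hτ⟩ := exists_hlift_add_coreLift Δ p a
      obtain ⟨s, hs⟩ := exists_section_eq (I := I) (F := EM × (F →L[ℝ] ℝ)) (V := Side I E) p.1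
        (sideProj p a)
      obtain ⟨t, ht⟩ := exists_section_eq (I := I) (F := F × (EM →L[ℝ] ℝ)) (V := Core I E) p.1 τ
      refine ⟨s, t, ?_⟩
      rw [hliftSection_apply, coreLiftSection_apply, hs, ht]
      exact hτ
    obtain ⟨ν₁, τ₁, h1⟩ := hd (e₁ p)
    obtain ⟨ν₂, τ₂, h2⟩ := hd (e₂ p)
    rw [hT, h1, h2, hl, hr, hr, ← hT, ← hT, ← hT, ← hT, hss, nijenhuisExpr_core_core hC,
      nijenhuisExpr_hlift_core hA hC hj _ _ _ (hN ν₁),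
      nijenhuisExpr_skew J hsq horth, nijenhuisExpr_hlift_core hA hC hj _ _ _ (hN ν₂)]
    simp

end Integrability

end Adapted

/-! ### The endomorphism defined by `j` and a Dorfman connection. -/

section Adapted

variable {EM : Type*} [NormedAddCommGroup EM] [NormedSpace ℝ EM] [FiniteDimensional ℝ EM]
  {H : Type*} [TopologicalSpace H] {I : ModelWithCorners ℝ EM H} [I.Boundaryless]
  {M : Type*} [TopologicalSpace M] [T2Space M] [ChartedSpace H M] [IsManifold I ∞ M]
  {F : Type*} [NormedAddCommGroup F] [NormedSpace ℝ F] [FiniteDimensional ℝ F]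
  {E : M → Type*} [TopologicalSpace (TotalSpace F E)]
  [∀ x, AddCommGroup (E x)] [∀ x, Module ℝ (E x)] [∀ x, TopologicalSpace (E x)]
  [FiberBundle F E] [VectorBundle ℝ F E] [ContMDiffVectorBundle ∞ F E I]

/-- The cut-off arguments behind `contMDiff_of_sections` are applied to bundles over the manifold
`E`, which therefore has to be Hausdorff. -/
theorem t2Space_totalSpace (F : Type*) [NormedAddCommGroup F] (V : M → Type*)
    [TopologicalSpace (TotalSpace F V)] [∀ x, TopologicalSpace (V x)] [FiberBundle F V] :
    T2Space (TotalSpace F V) := by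
  refine ⟨fun v w hvw => ?_⟩
  by_cases h : v.1 = w.1
  · let e := trivializationAt F V v.1
    have hv : v ∈ e.source := FiberBundle.mem_trivializationAt_proj_source
    have hw : w ∈ e.source := by
      rw [Trivialization.mem_source, ← h]
      exact mem_baseSet_trivializationAt F V v.1
    have hne : e v ≠ e w := fun h' => hvw (e.injOn hv hw h')
    obtain ⟨U, W, hU, hW, hvU, hwW, hd⟩ := t2_separation hne
    exact ⟨_, _, e.continuousOn.isOpen_inter_preimage e.open_source hU,
      e.continuousOn.isOpen_inter_preimage e.open_source hW, ⟨hv, hvU⟩, ⟨hw, hwW⟩,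
      (hd.preimage e).mono Set.inter_subset_right Set.inter_subset_right⟩
  · exact separated_by_continuous (FiberBundle.continuous_proj F V) h

theorem exists_lift (Δ : SkewDorfman I F E) (p : TotalSpace F E) (a : GTE I F E p) :
    ∃ ν τ, a = hlift Δ p ν + coreLift p τ :=
  ⟨_, exists_hlift_add_coreLift Δ p a⟩

/-- The core component is unique since the core lift is injective, and uniqueness makes the choice
linear. -/
theorem exists_coreComponent (Δ : SkewDorfman I F E) (p : TotalSpace F E) :
    ∃ κ : GTE I F E p →ₗ[ℝ] Core I E p.1, ∀ ν τ, κ (hlift Δ p ν + coreLift p τ) = τ := by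
  choose T hT using exists_hlift_add_coreLift Δ p
  refine ⟨⟨⟨T, fun a b => ?_⟩, fun r a => ?_⟩, fun ν τ => ?_⟩
  · apply coreLift_injective p
    have h := hT (a + b)
    rw [map_add, map_add] at h
    rw [coreLift_add]
    have h1 : a + b = hlift Δ p (sideProj p a) + hlift Δ p (sideProj p b) +
        (coreLift p (T a) + coreLift p (T b)) := by
      conv_lhs => rw [hT a, hT b]
      abel
    exact add_left_cancel (h.symm.trans h1)
  · apply coreLift_injective p
    have h := hT (r • a)
    rw [map_smul, map_smul] at h
    rw [RingHom.id_apply, coreLift_smul]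
    have h1 : r • a = r • hlift Δ p (sideProj p a) + r • coreLift p (T a) := by
      conv_lhs => rw [hT a]
      exact smul_add _ _ _
    exact add_left_cancel (h.symm.trans h1)
  · apply coreLift_injective p
    have h := hT (hlift Δ p ν + coreLift p τ)
    rw [sideProj_lift] at h
    exact (add_left_cancel h).symm

/-- The endomorphism of `TE ⊕ T*E` which maps `σ(ν)` to `σ(j ν)` and `τ^↑` to `(-jᵗ τ)^↑`. -/
def liftApp (j : SideEnd I F E) (Δ : SkewDorfman I F E) (p : TotalSpace F E) :
    GTE I F E p →ₗ[ℝ] GTE I F E p where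
  toFun a := hlift Δ p (j.app p.1 (sideProj p a)) +
    coreLift p (negTranspose j p.1 ((exists_coreComponent Δ p).choose a))
  map_add' a b := by
    simp only [map_add, coreLift_add]
    abel
  map_smul' r a := by
    simp only [map_smul, coreLift_smul, RingHom.id_apply]
    exact (smul_add _ _ _).symm

theorem liftApp_lift (j : SideEnd I F E) (Δ : SkewDorfman I F E) (p : TotalSpace F E)
    (ν : Side I E p.1) (τ : Core I E p.1) :
    liftApp j Δ p (hlift Δ p ν + coreLift p τ) =
      hlift Δ p (j.app p.1 ν) + coreLift p (negTranspose j p.1 τ) := by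
  change hlift Δ p _ + coreLift p _ = _
  rw [(exists_coreComponent Δ p).choose_spec, sideProj_lift]

/-- The smooth endomorphism of `TE ⊕ T*E` defined by `j` and a Dorfman connection. -/
def liftEnd (j : SideEnd I F E) (Δ : SkewDorfman I F E) : GTEEnd I F E where
  app := liftApp j Δ
  contMDiff_app := by
    have := t2Space_totalSpace F E
    refine contMDiff_of_sections (V := GTE I F E) (V' := GTE I F E) (liftApp j Δ) fun p a => ?_
    obtain ⟨ν₀, τ₀, rfl⟩ := exists_lift Δ p a
    obtain ⟨ν, rfl⟩ := exists_section_eq (I := I) (F := EM × (F →L[ℝ] ℝ)) (V := Side I E) p.1 ν₀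
    obtain ⟨τ, rfl⟩ := exists_section_eq (I := I) (F := F × (EM →L[ℝ] ℝ)) (V := Core I E) p.1 τ₀
    -- Lifts and core sections reach every vector, and the endomorphism maps them to smooth sections
    -- of the same kind.
    refine ⟨hliftSection Δ ν + coreLiftSection τ, rfl, ?_⟩
    have h : ∀ q, liftApp j Δ q ((hliftSection Δ ν + coreLiftSection τ) q) =
        (hliftSection Δ (j.onSections ν) + coreLiftSection (negTransposeSection j τ)) q :=
      fun q => liftApp_lift j Δ q (ν q.1) (τ q.1)
    simp only [h]
    exact (hliftSection Δ (j.onSections ν) +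
      coreLiftSection (negTransposeSection j τ)).contMDiff p

section LiftEnd

variable (j : SideEnd I F E) (Δ : SkewDorfman I F E)

theorem liftEnd_lift (p : TotalSpace F E) (ν : Side I E p.1) (τ : Core I E p.1) :
    (liftEnd j Δ).app p (hlift Δ p ν + coreLift p τ) =
      hlift Δ p (j.app p.1 ν) + coreLift p (negTranspose j p.1 τ) := liftApp_lift j Δ p ν τ

theorem liftEnd_hlift (p : TotalSpace F E) (ν : Side I E p.1) :
    (liftEnd j Δ).app p (hlift Δ p ν) = hlift Δ p (j.app p.1 ν) := by
  simpa only [map_zero, coreLift_zero, add_zero] using liftEnd_lift j Δ p ν 0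

theorem liftEnd_coreLift (p : TotalSpace F E) (τ : Core I E p.1) :
    (liftEnd j Δ).app p (coreLift p τ) = coreLift p (negTranspose j p.1 τ) := by
  simpa only [map_zero, zero_add] using liftEnd_lift j Δ p 0 τ

theorem liftEnd_sq (hj : ∀ x (ν : Side I E x), j.app x (j.app x ν) = -ν) (p : TotalSpace F E)
    (a : GTE I F E p) : (liftEnd j Δ).app p ((liftEnd j Δ).app p a) = -a := by
  obtain ⟨ν, τ, rfl⟩ := exists_lift Δ p a
  rw [liftEnd_lift, liftEnd_lift, hj, negTranspose_sq hj, map_neg, coreLift_neg, neg_add]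

theorem genPairing_lift (p : TotalSpace F E) (ν ν' : Side I E p.1) (τ τ' : Core I E p.1) :
    genPairing (hlift Δ p ν + coreLift p τ) (hlift Δ p ν' + coreLift p τ') =
      pairing ν τ' + pairing ν' τ := by
  rw [genPairing_add_right, genPairing_coreLift, sideProj_lift, genPairing_comm,
    genPairing_add_right, genPairing_coreLift, sideProj_hlift, genPairing_hlift]
  ring

theorem liftEnd_orthogonal (hj : ∀ x (ν : Side I E x), j.app x (j.app x ν) = -ν)
    (p : TotalSpace F E) (a b : GTE I F E p) :
    genPairing ((liftEnd j Δ).app p a) ((liftEnd j Δ).app p b) = genPairing a b := by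
  obtain ⟨ν, τ, rfl⟩ := exists_lift Δ p a
  obtain ⟨ν', τ', rfl⟩ := exists_lift Δ p b
  rw [liftEnd_lift, liftEnd_lift, genPairing_lift, genPairing_lift, pairing_negTranspose,
    pairing_negTranspose, hj, hj, pairing_neg_left, pairing_neg_left, neg_neg, neg_neg]

theorem isDoubleMorphism_liftEnd : IsDoubleMorphism (liftEnd j Δ) j where
  covers p a ν h := by
    obtain ⟨ν', τ, rfl⟩ := exists_lift Δ p a
    rw [projectsTo_iff, sideProj_lift] at h
    rw [projectsTo_iff, liftEnd_lift, sideProj_lift, h]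
  add w a b c h := by
    obtain ⟨ν₁, τ₁, rfl⟩ := exists_lift Δ _ a
    obtain ⟨ν₂, τ₂, rfl⟩ := exists_lift Δ _ b
    obtain ⟨ν₃, τ₃, rfl⟩ := exists_lift Δ _ c
    obtain ⟨h1, h2, h3⟩ := (isSideSum_lift Δ w ν₁ ν₂ ν₃ τ₁ τ₂ τ₃).1 h
    refine Eq.mpr (congr (congr (congrArg (IsSideSum w) (liftEnd_lift j Δ (w.fst F E) ν₁ τ₁))
      (liftEnd_lift j Δ (w.snd F E) ν₂ τ₂)) (liftEnd_lift j Δ (w.add F E) ν₃ τ₃)) ?_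
    exact (isSideSum_lift Δ w _ _ _ _ _ _).2 ⟨congrArg (j.app w.1) h1, congrArg (j.app w.1) h2,
      (congrArg (negTranspose j w.1) h3).trans (map_add _ _ _)⟩
  smul r p a c h := by
    obtain ⟨ν₁, τ₁, rfl⟩ := exists_lift Δ _ a
    obtain ⟨ν₂, τ₂, rfl⟩ := exists_lift Δ _ c
    obtain ⟨h1, h2⟩ := (isSideSMul_lift Δ r p ν₁ ν₂ τ₁ τ₂).1 h
    refine Eq.mpr (congr (congrArg (IsSideSMul r p) (liftEnd_lift j Δ p ν₁ τ₁))
      (liftEnd_lift j Δ (homothety F E r p) ν₂ τ₂)) ?_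
    exact (isSideSMul_lift Δ r p _ _ _ _).2 ⟨congrArg (j.app p.1) h1,
      (congrArg (negTranspose j p.1) h2).trans (map_smul _ _ _)⟩

theorem isAdapted_liftEnd : IsAdapted (liftEnd j Δ) j Δ :=
  (isAdapted_iff _ j Δ).2 (liftEnd_hlift j Δ)

/-- An endomorphism with an adapted Dorfman connection is determined by its side morphism. -/
theorem eq_liftEnd {J : GTEEnd I F E} {j : SideEnd I F E} {Δ : SkewDorfman I F E}
    (hA : IsAdapted J j Δ)
    (hC : ∀ (p : TotalSpace F E) (τ : Core I E p.1),
      J.app p (coreLift p τ) = coreLift p (negTranspose j p.1 τ)) :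
    J = liftEnd j Δ := by
  refine BundleEnd.ext_app fun p a => ?_
  obtain ⟨ν, τ, rfl⟩ := exists_lift Δ p a
  rw [map_add, (isAdapted_iff _ _ _).1 hA, hC, liftEnd_lift]

end LiftEnd

end Adapted

/-! ### Existence of skew-symmetric Dorfman connections. -/

section FlatDorfman

variable {W G : Type*} [NormedAddCommGroup W] [NormedSpace ℝ W]
  [NormedAddCommGroup G] [NormedSpace ℝ G] {a a' : W → W × (G →L[ℝ] ℝ)}
  {b b' : W → G × (W →L[ℝ] ℝ)} {f : W → ℝ} {y : W}

theorem modelDorfman_add_left (ha : DifferentiableAt ℝ a y) (ha' : DifferentiableAt ℝ a' y) :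
    modelDorfman (a + a') b y = modelDorfman a b y + modelDorfman a' b y := by
  refine Prod.ext ?_ (ContinuousLinearMap.ext fun z => ?_) <;>
    simp [modelDorfman, modelDuality, fderiv_add ha ha']
  ring

theorem modelDorfman_add_right (hb : DifferentiableAt ℝ b y) (hb' : DifferentiableAt ℝ b' y) :
    modelDorfman a (b + b') y = modelDorfman a b y + modelDorfman a b' y := by
  refine Prod.ext ?_ (ContinuousLinearMap.ext fun z => ?_) <;>
    simp [modelDorfman, modelDuality, fderiv_add hb hb']
  ring

theorem modelDorfman_smul_right (hf : DifferentiableAt ℝ f y) (hb : DifferentiableAt ℝ b y) :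
    modelDorfman a (fun y => f y • b y) y =
      f y • modelDorfman a b y + fderiv ℝ f y (a y).1 • b y := by
  refine Prod.ext ?_ (ContinuousLinearMap.ext fun z => ?_) <;>
    simp [modelDorfman, modelDuality, fderiv_fun_smul hf hb]
  ring

theorem modelDorfman_smul_left (hf : DifferentiableAt ℝ f y) (ha : DifferentiableAt ℝ a y) :
    modelDorfman (fun y => f y • a y) b y =
      f y • modelDorfman a b y + modelDuality (a y) (b y) • ((0 : G), fderiv ℝ f y) := by
  refine Prod.ext ?_ (ContinuousLinearMap.ext fun z => ?_) <;>
    simp [modelDorfman, modelDuality, fderiv_fun_smul hf ha]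
  ring

/-- The axiom on exact forms for the flat connection is the symmetry of the second derivative of
`f`. -/
theorem modelDorfman_exact (hf : ContDiffAt ℝ ∞ f y) (ha : DifferentiableAt ℝ a y) :
    modelDorfman a (fun y => ((0 : G), fderiv ℝ f y)) y =
      (0, fderiv ℝ (fun y => fderiv ℝ f y (a y).1) y) := by
  have hf' : DifferentiableAt ℝ (fderiv ℝ f) y :=
    (hf.fderiv_right (m := ∞) (by simp)).differentiableAt (by simp)
  have h1 : HasFDerivAt (fun y => ((0 : G), fderiv ℝ f y))
      ((0 : W →L[ℝ] G).prod (fderiv ℝ (fderiv ℝ f) y)) y :=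
    (hasFDerivAt_const _ _).prodMk hf'.hasFDerivAt
  have h2 := (hf'.hasFDerivAt.clm_apply ha.hasFDerivAt.fst).fderiv
  have hs := fun v w => (hf.isSymmSndFDerivAt (by simpa using ENat.LEInfty.out)).eq v w
  rw [modelDorfman, h1.fderiv, h2]
  refine Prod.ext ?_ (ContinuousLinearMap.ext fun z => ?_)
  · simp
  · simp [modelDuality, hs z, add_comm]

/-- Equivalent, by duality, to the skew-symmetry of the dull bracket of the flat connection. -/
theorem modelDorfman_skew (ha : DifferentiableAt ℝ a y) (ha' : DifferentiableAt ℝ a' y)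
    (hb : DifferentiableAt ℝ b y) :
    modelDuality (a' y) (modelDorfman a b y) + modelDuality (a y) (modelDorfman a' b y) =
      fderiv ℝ (fun y => modelDuality (a' y) (b y)) y (a y).1 +
        fderiv ℝ (fun y => modelDuality (a y) (b y)) y (a' y).1 := by
  rw [fderiv_modelDuality ha' hb, fderiv_modelDuality ha hb]
  simp [modelDorfman, modelDuality]
  ring

theorem contDiffAt_modelDuality (ha : ContDiffAt ℝ ∞ a y) (hb : ContDiffAt ℝ ∞ b y) :
    ContDiffAt ℝ ∞ (fun y => modelDuality (a y) (b y)) y :=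
  (ha.snd.clm_apply hb.fst).add (hb.snd.clm_apply ha.fst)

theorem contDiffAt_clm {S T : Type*} [NormedAddCommGroup S] [NormedSpace ℝ S]
    [NormedAddCommGroup T] [NormedSpace ℝ T] (P : S →L[ℝ] T) {g : W → S}
    (hg : ContDiffAt ℝ ∞ g y) : ContDiffAt ℝ ∞ (fun y => P (g y)) y :=
  P.contDiff.contDiffAt.comp y hg

theorem contDiffAt_dualForm {D : W → W →L[ℝ] W × (G →L[ℝ] ℝ)} (hD : ContDiffAt ℝ ∞ D y)
    (hb : ContDiffAt ℝ ∞ b y) : ContDiffAt ℝ ∞ (fun y => dualForm (D y) (b y)) y := by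
  have h1 : ContDiffAt ℝ ∞ (fun y => (ContinuousLinearMap.fst ℝ W (G →L[ℝ] ℝ)).comp (D y)) y :=
    contDiffAt_const.clm_comp hD
  have h2 : ContDiffAt ℝ ∞ (fun y => coreForm (D y)) y :=
    contDiffAt_clm (S := W →L[ℝ] W × (G →L[ℝ] ℝ)) (T := G →L[ℝ] G × (W →L[ℝ] ℝ)) coreForm hD
  refine ((h2.clm_apply hb.fst).snd.add (hb.snd.clm_comp h1)).congr_of_eventuallyEq
    (.of_forall fun z => ContinuousLinearMap.ext fun w => ?_)
  simp [coreForm_apply, modelDuality]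

theorem contDiffAt_modelDorfman (ha : ContDiffAt ℝ ∞ a y) (hb : ContDiffAt ℝ ∞ b y) :
    ContDiffAt ℝ ∞ (modelDorfman a b) y := by
  have h1 := (hb.fderiv_right (m := ∞) (by simp)).clm_apply ha.fst
  have h2 := contDiffAt_dualForm (ha.fderiv_right (m := ∞) (by simp)) hb
  exact h1.add (contDiffAt_const.prodMk h2)

end FlatDorfman

section Adapted

variable {EM : Type*} [NormedAddCommGroup EM] [NormedSpace ℝ EM] [FiniteDimensional ℝ EM]
  {H : Type*} [TopologicalSpace H] {I : ModelWithCorners ℝ EM H} [I.Boundaryless]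
  {M : Type*} [TopologicalSpace M] [T2Space M] [ChartedSpace H M] [IsManifold I ∞ M]
  {F : Type*} [NormedAddCommGroup F] [NormedSpace ℝ F] [FiniteDimensional ℝ F]
  {E : M → Type*} [TopologicalSpace (TotalSpace F E)]
  [∀ x, AddCommGroup (E x)] [∀ x, Module ℝ (E x)] [∀ x, TopologicalSpace (E x)]
  [FiberBundle F E] [VectorBundle ℝ F E] [ContMDiffVectorBundle ∞ F E I]

/-- The flat Dorfman connection of a chart, paired with a section `ν'` of `TM ⊕ E*`. -/
def flatDorfman (x₀ : M) (ν : SideSection I F E) (τ : CoreSection I F E) (ν' : SideSection I F E)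
    (x : M) : ℝ :=
  modelDuality (sideReading x₀ ν' (extChartAt I x₀ x))
    (modelDorfman (sideReading x₀ ν) (coreReading x₀ τ) (extChartAt I x₀ x))

theorem coreReading_add (x₀ : M) (τ τ' : CoreSection I F E) :
    coreReading x₀ (τ + τ') = coreReading x₀ τ + coreReading x₀ τ' := reading_add x₀ τ τ'

theorem coreReading_fsmul (x₀ : M) (f : C^∞⟮I, M; ℝ⟯) (τ : CoreSection I F E) (y : EM) :
    coreReading x₀ (fsmul f τ) y = (f ∘ (extChartAt I x₀).symm) y • coreReading x₀ τ y :=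
  map_smul (coreCoord I F E x₀ _) _ _

section FlatDorfman

variable {x₀ x : M}

theorem modelDuality_reading_extChartAt (hx : x ∈ coordSource (H := H) F E x₀)
    (ν : SideSection I F E) (τ : CoreSection I F E) :
    modelDuality (sideReading x₀ ν (extChartAt I x₀ x)) (coreReading x₀ τ (extChartAt I x₀ x)) =
      pairing (ν x) (τ x) := by
  have h := modelDuality_reading (extChartAt_mem_coordDomain hx) ν τ
  rwa [(extChartAt I x₀).left_inv (mem_extChartAt_source_of_coordSource hx)] at h

theorem derivMap_extChartAt (hx : x ∈ coordSource (H := H) F E x₀) (ν : SideSection I F E)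
    (f : C^∞⟮I, M; ℝ⟯) : derivMap ν f x =
      fderiv ℝ (f ∘ (extChartAt I x₀).symm) (extChartAt I x₀ x)
        (sideReading x₀ ν (extChartAt I x₀ x)).1 := by
  have h := derivMap_symm (extChartAt_mem_coordDomain hx) ν f
  rwa [(extChartAt I x₀).left_inv (mem_extChartAt_source_of_coordSource hx)] at h

theorem contDiffAt_comp_extChartAt_symm (hx : x ∈ coordSource (H := H) F E x₀) (f : C^∞⟮I, M; ℝ⟯) :
    ContDiffAt ℝ ∞ (f ∘ (extChartAt I x₀).symm) (extChartAt I x₀ x) := by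
  have h := (contMDiffOn_extChartAt_symm (I := I) (n := ∞) x₀).contMDiffAt
    ((isOpen_extChartAt_target x₀).mem_nhds (extChartAt_mem_coordDomain hx).1)
  exact (f.contMDiff.contMDiffAt.comp _ h).contDiffAt

theorem flatDorfman_add_left (hx : x ∈ coordSource (H := H) F E x₀)
    (ν₁ ν₂ : SideSection I F E) (τ : CoreSection I F E) (ν' : SideSection I F E) :
    flatDorfman x₀ (ν₁ + ν₂) τ ν' x = flatDorfman x₀ ν₁ τ ν' x + flatDorfman x₀ ν₂ τ ν' x := by
  rw [flatDorfman, sideReading_add, modelDorfman_add_left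
    ((contDiffAt_reading_side hx ν₁).differentiableAt (by simp))
    ((contDiffAt_reading_side hx ν₂).differentiableAt (by simp))]
  simp only [flatDorfman, modelDuality, Prod.fst_add, Prod.snd_add, map_add, add_apply]
  ring

theorem flatDorfman_add_right (hx : x ∈ coordSource (H := H) F E x₀)
    (ν : SideSection I F E) (τ₁ τ₂ : CoreSection I F E) (ν' : SideSection I F E) :
    flatDorfman x₀ ν (τ₁ + τ₂) ν' x = flatDorfman x₀ ν τ₁ ν' x + flatDorfman x₀ ν τ₂ ν' x := by
  rw [flatDorfman, coreReading_add, modelDorfman_add_right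
    ((contDiffAt_reading_core hx τ₁).differentiableAt (by simp))
    ((contDiffAt_reading_core hx τ₂).differentiableAt (by simp))]
  simp only [flatDorfman, modelDuality, Prod.fst_add, Prod.snd_add, map_add, add_apply]
  ring

theorem flatDorfman_fsmul_right (hx : x ∈ coordSource (H := H) F E x₀) (f : C^∞⟮I, M; ℝ⟯)
    (ν : SideSection I F E) (τ : CoreSection I F E) (ν' : SideSection I F E) :
    flatDorfman x₀ ν (fsmul f τ) ν' x =
      f x * flatDorfman x₀ ν τ ν' x + derivMap ν f x * pairing (ν' x) (τ x) := by
  have h : coreReading x₀ (fsmul f τ) =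
      fun y => (f ∘ (extChartAt I x₀).symm) y • coreReading x₀ τ y :=
    funext (coreReading_fsmul x₀ f τ)
  rw [flatDorfman, h, modelDorfman_smul_right
    ((contDiffAt_comp_extChartAt_symm hx f).differentiableAt (by simp))
    ((contDiffAt_reading_core hx τ).differentiableAt (by simp)), derivMap_extChartAt hx,
    ← modelDuality_reading_extChartAt hx, Function.comp_apply,
    (extChartAt I x₀).left_inv (mem_extChartAt_source_of_coordSource hx)]
  simp only [flatDorfman, modelDuality, Prod.fst_add, Prod.snd_add, map_add, add_apply,
    Prod.smul_fst, Prod.smul_snd, map_smul, smul_apply, smul_eq_mul]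
  ring

theorem flatDorfman_fsmul_left (hx : x ∈ coordSource (H := H) F E x₀) (f : C^∞⟮I, M; ℝ⟯)
    (ν : SideSection I F E) (τ : CoreSection I F E) (ν' : SideSection I F E) :
    flatDorfman x₀ (fsmul f ν) τ ν' x =
      f x * flatDorfman x₀ ν τ ν' x + pairing (ν x) (τ x) * derivMap ν' f x := by
  have h : sideReading x₀ (fsmul f ν) =
      fun y => (f ∘ (extChartAt I x₀).symm) y • sideReading x₀ ν y :=
    funext (sideReading_fsmul x₀ f ν)
  rw [flatDorfman, h, modelDorfman_smul_left
    ((contDiffAt_comp_extChartAt_symm hx f).differentiableAt (by simp))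
    ((contDiffAt_reading_side hx ν).differentiableAt (by simp)), derivMap_extChartAt hx,
    ← modelDuality_reading_extChartAt hx, Function.comp_apply,
    (extChartAt I x₀).left_inv (mem_extChartAt_source_of_coordSource hx)]
  simp only [flatDorfman, modelDuality, Prod.fst_add, Prod.snd_add, map_add, add_apply,
    Prod.smul_fst, Prod.smul_snd, map_smul, smul_apply, smul_eq_mul, map_zero]
  ring

theorem flatDorfman_coreD (hx : x ∈ coordSource (H := H) F E x₀) (f : C^∞⟮I, M; ℝ⟯)
    (ν ν' : SideSection I F E) :
    flatDorfman x₀ ν (coreD F E f) ν' x = derivMap ν' (derivMap ν f) x := by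
  have hn := (isOpen_coordDomain (I := I) (F := F) (V := E) x₀).mem_nhds
    (extChartAt_mem_coordDomain hx)
  have h : coreReading x₀ (coreD F E f) =ᶠ[𝓝 (extChartAt I x₀ x)]
      fun y => (0, fderiv ℝ (f ∘ (extChartAt I x₀).symm) y) := by
    filter_upwards [hn] with y hy using coreReading_coreD hy f
  have h' : (derivMap ν f ∘ (extChartAt I x₀).symm) =ᶠ[𝓝 (extChartAt I x₀ x)]
      fun y => fderiv ℝ (f ∘ (extChartAt I x₀).symm) y (sideReading x₀ ν y).1 := by
    filter_upwards [hn] with y hy using derivMap_symm hy ν f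
  have h2 := modelDorfman_exact (G := F) (contDiffAt_comp_extChartAt_symm hx f)
    ((contDiffAt_reading_side hx ν).differentiableAt (by simp))
  rw [flatDorfman, modelDorfman, h.fderiv_eq, h.eq_of_nhds]
  rw [modelDorfman] at h2
  rw [h2, derivMap_extChartAt hx, h'.fderiv_eq]
  simp only [modelDuality, map_zero, zero_add]

theorem flatDorfman_skew (hx : x ∈ coordSource (H := H) F E x₀) (ν ν' : SideSection I F E)
    (τ : CoreSection I F E) : flatDorfman x₀ ν τ ν' x + flatDorfman x₀ ν' τ ν x =
      derivMap ν (pairingMap ν' τ) x + derivMap ν' (pairingMap ν τ) x := by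
  have hn := (isOpen_coordDomain (I := I) (F := F) (V := E) x₀).mem_nhds
    (extChartAt_mem_coordDomain hx)
  have h : ∀ ν : SideSection I F E, (pairingMap ν τ ∘ (extChartAt I x₀).symm) =ᶠ[𝓝 (extChartAt I x₀ x)]
      fun y => modelDuality (sideReading x₀ ν y) (coreReading x₀ τ y) := fun ν => by
    filter_upwards [hn] with y hy using (modelDuality_reading hy ν τ).symm
  rw [derivMap_extChartAt hx, derivMap_extChartAt hx, (h ν).fderiv_eq, (h ν').fderiv_eq]
  exact modelDorfman_skew ((contDiffAt_reading_side hx ν).differentiableAt (by simp))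
    ((contDiffAt_reading_side hx ν').differentiableAt (by simp))
    ((contDiffAt_reading_core hx τ).differentiableAt (by simp))

theorem flatDorfman_section_add (ν : SideSection I F E) (τ : CoreSection I F E)
    (s t : SideSection I F E) :
    flatDorfman x₀ ν τ (s + t) x = flatDorfman x₀ ν τ s x + flatDorfman x₀ ν τ t x := by
  rw [flatDorfman, sideReading_add]
  simp only [flatDorfman, modelDuality, Pi.add_apply, Prod.fst_add, Prod.snd_add, map_add, add_apply]
  ring

theorem flatDorfman_section_fsmul (hx : x ∈ coordSource (H := H) F E x₀) (f : C^∞⟮I, M; ℝ⟯)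
    (ν : SideSection I F E) (τ : CoreSection I F E) (s : SideSection I F E) :
    flatDorfman x₀ ν τ (fsmul f s) x = f x * flatDorfman x₀ ν τ s x := by
  rw [flatDorfman, sideReading_fsmul, Function.comp_apply,
    (extChartAt I x₀).left_inv (mem_extChartAt_source_of_coordSource hx)]
  simp only [flatDorfman, modelDuality, Prod.smul_fst, Prod.smul_snd, map_smul, smul_apply,
    smul_eq_mul]
  ring

theorem contMDiffAt_flatDorfman (hx : x ∈ coordSource (H := H) F E x₀) (ν : SideSection I F E)
    (τ : CoreSection I F E) (ν' : SideSection I F E) :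
    ContMDiffAt I 𝓘(ℝ, ℝ) ∞ (flatDorfman x₀ ν τ ν') x := by
  have h := contDiffAt_modelDuality (contDiffAt_reading_side hx ν')
    (contDiffAt_modelDorfman (contDiffAt_reading_side hx ν) (contDiffAt_reading_core hx τ))
  exact h.contMDiffAt.comp x (contMDiffAt_extChartAt' hx.1)

end FlatDorfman

end Adapted

section Adapted

variable {EM : Type*} [NormedAddCommGroup EM] [NormedSpace ℝ EM] [FiniteDimensional ℝ EM]
  {H : Type*} [TopologicalSpace H] {I : ModelWithCorners ℝ EM H} [I.Boundaryless]
  {M : Type*} [TopologicalSpace M] [T2Space M] [ChartedSpace H M] [IsManifold I ∞ M]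
  {F : Type*} [NormedAddCommGroup F] [NormedSpace ℝ F] [FiniteDimensional ℝ F]
  {E : M → Type*} [TopologicalSpace (TotalSpace F E)]
  [∀ x, AddCommGroup (E x)] [∀ x, Module ℝ (E x)] [∀ x, TopologicalSpace (E x)]
  [FiberBundle F E] [VectorBundle ℝ F E] [ContMDiffVectorBundle ∞ F E I]

/-- `A x` is the weighted mean at `x` of numbers indexed by charts, with weights from a partition of
unity. Only three properties are retained: linearity, total weight one, and blindness to charts
whose coordinates do not cover `x`. They suffice to carry every affine identity over to `D`. -/
theorem exists_averagedDorfman [SecondCountableTopology M] :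
    ∃ (D : SideSection I F E → CoreSection I F E → CoreSection I F E)
      (A : M → (M → ℝ) →ₗ[ℝ] ℝ), (∀ x c, A x (fun _ => c) = c) ∧
      (∀ x φ ψ, (∀ i, x ∈ coordSource (H := H) F E i → φ i = ψ i) → A x φ = A x ψ) ∧
      ∀ ν τ (ν' : SideSection I F E) x,
        pairing (ν' x) (D ν τ x) = A x (fun i => flatDorfman i ν τ ν' x) := by
  have : LocallyCompactSpace H := I.locallyCompactSpace
  have : LocallyCompactSpace M := ChartedSpace.locallyCompactSpace H M
  obtain ⟨ρ, hρ⟩ := SmoothPartitionOfUnity.exists_isSubordinate I (s := (Set.univ : Set M))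
    isClosed_univ (coordSource (H := H) F E) (isOpen_coordSource (H := H) (F := F) (E := E))
    (fun x _ => Set.mem_iUnion_of_mem x (mem_coordSource_self x))
  let A : M → (M → ℝ) →ₗ[ℝ] ℝ := fun x => ∑ i ∈ ρ.finsupport x, ρ i x • LinearMap.proj i
  have hA : ∀ x φ, A x φ = ∑ i ∈ ρ.finsupport x, ρ i x • φ i := fun x φ => by simp [A]
  have hmem : ∀ {x i}, i ∈ ρ.finsupport x → x ∈ coordSource (H := H) F E i := fun {x i} hi =>
    hρ i (subset_tsupport _ ((ρ.mem_finsupport x).1 hi))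
  let L : SideSection I F E → CoreSection I F E → SideSection I F E → C^∞⟮I, M; ℝ⟯ :=
    fun ν τ ν' => ⟨fun x => ∑ᶠ i, ρ i x • flatDorfman i ν τ ν' x,
      ρ.contMDiff_finsum_smul fun i x hx => contMDiffAt_flatDorfman (hρ i hx) ν τ ν'⟩
  have hL : ∀ ν τ ν' x, L ν τ ν' x = A x (fun i => flatDorfman i ν τ ν' x) := fun ν τ ν' x =>
    (ρ.sum_finsupport_smul_eq_finsum x (fun i x => flatDorfman i ν τ ν' x)).symm.trans (hA x _).symm
  -- The mean is formed of the functions paired with `ν'`; it stays tensorial in `ν'` and is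
  -- represented by a core section.
  have hD : ∀ ν τ, ∃ σ : CoreSection I F E, ∀ ν' x, pairing (ν' x) (σ x) = L ν τ ν' x := by
    intro ν τ
    refine exists_coreSection (L ν τ) (fun s t x => ?_) (fun f s x => ?_)
    · rw [hL, hL, hL, ← map_add]
      exact congrArg _ (funext fun i => flatDorfman_section_add ν τ s t)
    · rw [hL, hL, hA, hA, Finset.mul_sum]
      refine Finset.sum_congr rfl fun i hi => ?_
      rw [flatDorfman_section_fsmul (hmem hi), smul_eq_mul, smul_eq_mul]
      ring
  choose D hD using hD
  refine ⟨D, A, fun x c => ?_, fun x φ ψ h => ?_, fun ν τ ν' x => (hD ν τ ν' x).trans (hL ν τ ν' x)⟩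
  · rw [hA, ← Finset.sum_smul, ρ.sum_finsupport x (Set.mem_univ x), one_smul]
  · rw [hA, hA]
    exact Finset.sum_congr rfl fun i hi => by rw [h i (hmem hi)]

theorem derivMap_const (ν : SideSection I F E) (r : ℝ) (x : M) :
    derivMap ν (ContMDiffMap.const r) x = 0 := by
  rw [derivMap_apply]
  exact congrArg (fun L => L (ν x).1) (mvfderiv_const (I := I) (c := r) (x := x))

/-- Every vector bundle over a paracompact manifold has a skew-symmetric Dorfman connection. -/
theorem nonempty_skewDorfman [SecondCountableTopology M] : Nonempty (SkewDorfman I F E) := by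
  obtain ⟨D, A, hconst, hcongr, hD⟩ := exists_averagedDorfman (I := I) (F := F) (E := E)
  have ext : ∀ {x} {τ τ' : Core I E x},
      (∀ ν : SideSection I F E, pairing (ν x) τ = pairing (ν x) τ') → τ = τ' := by
    intro x τ τ' h
    refine pairing_ext_right F fun ν => ?_
    obtain ⟨s, rfl⟩ := exists_section_eq (I := I) (F := EM × (F →L[ℝ] ℝ)) (V := Side I E) x ν
    exact h s
  -- The inhomogeneous term `c` does not depend on the chart, so a mean of total weight one
  -- reproduces it.
  have haff : ∀ (x : M) (φ ψ : M → ℝ) (r c : ℝ),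
      (∀ i, x ∈ coordSource (H := H) F E i → φ i = r * ψ i + c) → A x φ = r * A x ψ + c := by
    intro x φ ψ r c h
    have h1 := map_add (A x) (r • ψ) (fun _ => c)
    rw [map_smul, hconst] at h1
    exact (hcongr x _ _ h).trans h1
  have hadd : ∀ (x : M) (φ ψ χ : M → ℝ),
      (∀ i, x ∈ coordSource (H := H) F E i → φ i = ψ i + χ i) → A x φ = A x ψ + A x χ :=
    fun x φ ψ χ h => (hcongr x _ _ h).trans (map_add (A x) ψ χ)
  have hleib : ∀ (f : C^∞⟮I, M; ℝ⟯) ν τ x,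
      D ν (fsmul f τ) x = f x • D ν τ x + derivMap ν f x • τ x := by
    intro f ν τ x
    refine ext fun ν' => ?_
    rw [pairing_add_right, pairing_smul_right, pairing_smul_right, hD, hD]
    exact haff x _ _ _ _ fun i hi => flatDorfman_fsmul_right hi f ν τ ν'
  have hsmul : ∀ (f : C^∞⟮I, M; ℝ⟯) ν τ x,
      D (fsmul f ν) τ x = f x • D ν τ x + pairing (ν x) (τ x) • coreD F E f x := by
    intro f ν τ x
    refine ext fun ν' => ?_
    rw [pairing_add_right, pairing_smul_right, pairing_smul_right, hD, hD]
    exact haff x _ _ _ _ fun i hi => flatDorfman_fsmul_left hi f ν τ ν'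
  have hcoreD : ∀ (f : C^∞⟮I, M; ℝ⟯) ν x, D ν (coreD F E f) x = coreD F E (derivMap ν f) x := by
    intro f ν x
    refine ext fun ν' => ?_
    rw [hD]
    refine (hcongr x _ _ fun i hi => flatDorfman_coreD hi f ν ν').trans ((hconst x _).trans ?_)
    exact (derivMap_apply ν' _ x).trans (pairing_coreD ν' _ x).symm
  let Δ : DorfmanConnection I F E :=
    { toFun := LinearMap.mk₂ ℝ D
        (fun ν₁ ν₂ τ => by
          ext1 x
          refine ext fun ν' => ?_
          rw [ContMDiffSection.coe_add, Pi.add_apply, pairing_add_right, hD, hD, hD]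
          exact hadd x _ _ _ fun i hi => flatDorfman_add_left hi ν₁ ν₂ τ ν')
        (fun r ν τ => by
          ext1 x
          refine (hsmul (ContMDiffMap.const r) ν τ x).trans ?_
          have h0 : coreD F E (ContMDiffMap.const r : C^∞⟮I, M; ℝ⟯) x = 0 := ext fun ν' =>
            (pairing_coreD ν' _ x).trans (((derivMap_apply ν' _ x).symm.trans
              (derivMap_const ν' r x)).trans (by simp [pairing]))
          rw [h0, smul_zero, add_zero]
          rfl)
        (fun ν τ₁ τ₂ => by
          ext1 x
          refine ext fun ν' => ?_
          rw [ContMDiffSection.coe_add, Pi.add_apply, pairing_add_right, hD, hD, hD]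
          exact hadd x _ _ _ fun i hi => flatDorfman_add_right hi ν τ₁ τ₂ ν')
        (fun r ν τ => by
          ext1 x
          refine (hleib (ContMDiffMap.const r) ν τ x).trans ?_
          rw [derivMap_const, zero_smul, add_zero]
          rfl)
      leibniz := fun f ν τ x => by
        rw [← derivMap_apply]
        exact hleib f ν τ x
      smul_left := hsmul
      exact_form := fun f ν x => by
        refine (hcoreD f ν x).trans ?_
        have : (fun y => mvfderiv I f y (ν y).1) = derivMap ν f :=
          funext fun y => (derivMap_apply ν f y).symm
        rw [this]
        rfl }
  refine ⟨⟨Δ, fun ν₁ ν₂ => sideSection_ext fun τ x => ?_⟩⟩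
  rw [ContMDiffSection.coe_neg, Pi.neg_apply, pairing_neg_left, Δ.pairing_dullBracket,
    Δ.pairing_dullBracket]
  have h1 : pairing (ν₂ x) (D ν₁ τ x) + pairing (ν₁ x) (D ν₂ τ x) =
      derivMap ν₁ (pairingMap ν₂ τ) x + derivMap ν₂ (pairingMap ν₁ τ) x := by
    rw [hD, hD, ← map_add]
    exact (hcongr x _ _ fun i hi => flatDorfman_skew hi ν₁ ν₂ τ).trans (hconst x _)
  change _ - pairing (ν₂ x) (D ν₁ τ x) = -(_ - pairing (ν₁ x) (D ν₂ τ x))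
  linarith

end Adapted

/-! ### The correspondence. -/

section Adapted

variable {EM : Type*} [NormedAddCommGroup EM] [NormedSpace ℝ EM] [FiniteDimensional ℝ EM]
  {H : Type*} [TopologicalSpace H] {I : ModelWithCorners ℝ EM H} [I.Boundaryless]
  {M : Type*} [TopologicalSpace M] [T2Space M] [ChartedSpace H M] [IsManifold I ∞ M]
  {F : Type*} [NormedAddCommGroup F] [NormedSpace ℝ F] [FiniteDimensional ℝ F]
  {E : M → Type*} [TopologicalSpace (TotalSpace F E)]
  [∀ x, AddCommGroup (E x)] [∀ x, Module ℝ (E x)] [∀ x, TopologicalSpace (E x)]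
  [FiberBundle F E] [VectorBundle ℝ F E] [ContMDiffVectorBundle ∞ F E I]

/-- The datum `d` corresponds to the linear generalised complex structure `𝒥`. -/
def Corresponds (𝒥 : LinearGCS I F E) (d : DorfmanDatum I F E) : Prop :=
  IsDoubleMorphism 𝒥.J d.j ∧
    ∀ Δ : SkewDorfman I F E, Quotient.mk (jSetoid d.j) Δ = d.cls ↔ IsAdapted 𝒥.J d.j Δ

theorem Corresponds.coreLift {𝒥 : LinearGCS I F E} {d : DorfmanDatum I F E}
    (h : Corresponds 𝒥 d) (p : TotalSpace F E) (τ : Core I E p.1) :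
    𝒥.J.app p (coreLift p τ) = coreLift p (negTranspose d.j p.1 τ) := by
  obtain ⟨Δ, -⟩ := Quotient.exists_rep d.cls
  exact app_coreLift 𝒥.isGeneralizedComplex.sq 𝒥.isGeneralizedComplex.orthogonal Δ
    h.1.sideProj_app p τ

/-- One adapted representative suffices, because its `j`-class consists of all adapted connections.
-/
theorem corresponds_mk {𝒥 : LinearGCS I F E} {d : DorfmanDatum I F E} {Δ : SkewDorfman I F E}
    (h : IsDoubleMorphism 𝒥.J d.j) (hΔ : IsAdapted 𝒥.J d.j Δ)
    (hd : Quotient.mk (jSetoid d.j) Δ = d.cls) : Corresponds 𝒥 d := by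
  refine ⟨h, fun Δ' => ?_⟩
  rw [← hd, eq_comm, Quotient.eq]
  exact hΔ.jSetoid_iff 𝒥.isGeneralizedComplex.sq 𝒥.isGeneralizedComplex.orthogonal h.sideProj_app
    d.sq Δ'

theorem exists_corresponds_right [SecondCountableTopology M] (𝒥 : LinearGCS I F E) :
    ∃ d, Corresponds 𝒥 d := by
  obtain ⟨j, hJ⟩ := 𝒥.isLinear
  have hsq := 𝒥.isGeneralizedComplex.sq
  have horth := 𝒥.isGeneralizedComplex.orthogonal
  obtain ⟨Δ₀⟩ := nonempty_skewDorfman (I := I) (F := F) (E := E)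
  obtain ⟨Δ, hΔ⟩ := hJ.exists_isAdapted hsq horth Δ₀
  have hj := fun x ν => hJ.side_sq Δ hsq x ν
  have hint := (nijenhuisExpr_eq_zero_iff ((isAdapted_iff _ _ _).1 hΔ)
    (app_coreLift hsq horth Δ hJ.sideProj_app) hj hsq horth).1 𝒥.isGeneralizedComplex.nijenhuis
  exact ⟨⟨j, hj, Quotient.mk (jSetoid j) Δ, (isComplexLieAlgebroid_iff hj Δ).2 hint⟩,
    corresponds_mk hJ hΔ rfl⟩

theorem exists_corresponds_left (d : DorfmanDatum I F E) :
    ∃ 𝒥 : LinearGCS I F E, Corresponds 𝒥 d := by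
  obtain ⟨Δ, hΔ⟩ := Quotient.exists_rep d.cls
  have hsq := liftEnd_sq d.j Δ d.sq
  have horth := liftEnd_orthogonal d.j Δ d.sq
  have halg := d.isComplexLieAlgebroid
  rw [← hΔ] at halg
  have hN := (nijenhuisExpr_eq_zero_iff (liftEnd_hlift d.j Δ) (liftEnd_coreLift d.j Δ) d.sq hsq
    horth).2 ((isComplexLieAlgebroid_iff d.sq Δ).1 halg)
  have hJ := isDoubleMorphism_liftEnd d.j Δ
  exact ⟨⟨liftEnd d.j Δ, ⟨hsq, horth, hN⟩, ⟨d.j, hJ⟩⟩,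
    corresponds_mk hJ (isAdapted_liftEnd d.j Δ) hΔ⟩

/-- The side morphism is determined by `𝒥`, and a representative of one class is adapted, hence lies
in the other. -/
theorem Corresponds.right_unique {𝒥 : LinearGCS I F E} {d d' : DorfmanDatum I F E}
    (h : Corresponds 𝒥 d) (h' : Corresponds 𝒥 d') : d = d' := by
  obtain ⟨j, hj, c, hc⟩ := d
  obtain ⟨j', hj', c', hc'⟩ := d'
  obtain ⟨Δ, rfl⟩ := Quotient.exists_rep c
  obtain rfl : j = j' := h.1.side_unique h'.1 Δ
  obtain rfl : Quotient.mk (jSetoid j) Δ = c' := (h'.2 Δ).2 ((h.2 Δ).1 rfl)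
  rfl

/-- A representative of the class is adapted to both structures, and each is then the endomorphism
`liftEnd` of it and `j`. -/
theorem Corresponds.left_unique {𝒥 𝒥' : LinearGCS I F E} {d : DorfmanDatum I F E}
    (h : Corresponds 𝒥 d) (h' : Corresponds 𝒥' d) : 𝒥 = 𝒥' := by
  obtain ⟨Δ, hΔ⟩ := Quotient.exists_rep d.cls
  have e : 𝒥.J = 𝒥'.J := (eq_liftEnd ((h.2 Δ).1 hΔ) h.coreLift).trans
    (eq_liftEnd ((h'.2 Δ).1 hΔ) h'.coreLift).symm
  cases 𝒥
  cases 𝒥'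
  congr

end Adapted
end LinGC

theorem mainTheorem3
    {EM : Type*} [NormedAddCommGroup EM] [NormedSpace ℝ EM] [FiniteDimensional ℝ EM]
    {H : Type*} [TopologicalSpace H] (I : ModelWithCorners ℝ EM H) [I.Boundaryless]
    {M : Type*} [TopologicalSpace M] [T2Space M] [SecondCountableTopology M]
    [ChartedSpace H M] [IsManifold I ∞ M]
    (F : Type*) [NormedAddCommGroup F] [NormedSpace ℝ F] [FiniteDimensional ℝ F]
    (E : M → Type*) [TopologicalSpace (TotalSpace F E)]
    [∀ x, AddCommGroup (E x)] [∀ x, Module ℝ (E x)] [∀ x, TopologicalSpace (E x)]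
    [FiberBundle F E] [VectorBundle ℝ F E] [ContMDiffVectorBundle ∞ F E I] :
    ∃ Θ : LinGC.LinearGCS I F E ≃ LinGC.DorfmanDatum I F E,
      ∀ 𝒥 : LinGC.LinearGCS I F E,
        LinGC.IsDoubleMorphism 𝒥.J (Θ 𝒥).j ∧
        LinGC.HasCoreNegTranspose 𝒥.J (Θ 𝒥).j ∧
        ∀ Δ : LinGC.SkewDorfman I F E,
          (Quotient.mk (LinGC.jSetoid (Θ 𝒥).j) Δ = (Θ 𝒥).cls ↔
            LinGC.IsAdapted 𝒥.J (Θ 𝒥).j Δ) := by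
  choose θ hθ using LinGC.exists_corresponds_right (I := I) (F := F) (E := E)
  have hinj : Function.Injective θ := fun 𝒥 𝒥' h => (hθ 𝒥).left_unique (h ▸ hθ 𝒥')
  have hsurj : Function.Surjective θ := fun d => by
    obtain ⟨𝒥, h⟩ := LinGC.exists_corresponds_left d
    exact ⟨𝒥, (hθ 𝒥).right_unique h⟩
  exact ⟨Equiv.ofBijective θ ⟨hinj, hsurj⟩, fun 𝒥 => ⟨(hθ 𝒥).1,
    (LinGC.hasCoreNegTranspose_iff _ _).2 (hθ 𝒥).coreLift, (hθ 𝒥).2⟩⟩
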